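/- **Renormalized energy inequality.** Functions on $\mathbb T^d$ ($d\ge1$) are identified with $1$-periodic functions on $\mathbb R^d$; space-time points are $\mathbf x=(t,x)$, $\mathbf y=(s,y)$, $\mathbf z=(r,z)$, and $\|\mathbf x\|_{\mathfrak s}=(|t|+|x|^2)^{1/2}$. Let $\alpha\in(2/3,1)$, $\beta\in(2-\alpha,2\alpha]$, $1<M<1+\frac{3\alpha-2}{\alpha(2-\alpha)}$, $N\ge M+1$, $p>1$, $\epsilon\in(0,1]$, $C,L,\kappa>0$. There is a constant $K$, depending only on $d,\alpha,\beta,M,N,p,\epsilon,C,L,\kappa$, such that the following holds for all $0<T\le1$ and all $R\ge\kappa\sqrt T$. *Nonlinearities.* Let $a\in C^2(\mathbb R)$ be bounded below by some positive number, with $|v|^{M-1}\le Ca(v)$ for all $v$ and $|a'(v)|\le C|v|^{M-2}$, $|a''(v)|\le C|v|^{M-3}$ for $v\ne0$. Let $\sigma\in C^2(\mathbb R)$ be supported in $[-C,C]$, with $|\sigma(v)|\le C|v|^N$, $|\sigma'(v)|\le C|v|^{N-1}$, $|\sigma''(v)|\le C|v|^{N-2}$. Let $\Theta$ be smooth, increasing,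 bounded by $L$, equal to the identity on $\operatorname{supp}\sigma$, with $\Theta'$ compactly supported. Put $g(v)=\int_0^v|w|^{p-2}\,dw$. *Noise and model.* Let $\xi:\mathbb R\times\mathbb T^d\to\mathbb R$ be smooth. Let $\bar a\mapsto C^{\bar a}$ be continuous on $(0,\infty)$. Let $c_1^{\bar a}(s),c_2^{\bar a}(s)$ be counterterms that are measurable in $s$, $C^1$ in $\bar a>0$ and, locally uniformly in $\bar a$, dominated together with their $\bar a$-derivatives by a locally integrable function of $s$. Let $\Psi(\bar a,(t,x))=(4\pi\bar at)^{-d/2}e^{-|x|^2/(4\bar at)}\mathbf 1_{t>0}$ and $$\Pi_{\mathbf x}[\mathsf I;\bar a](\mathbf y)=\int_{(0,\infty)\times\mathbb R^d}\big(\Psi(\bar a,\mathbf y-\mathbf z)-\Psi(\bar a,\mathbf x-\mathbf z)\big)\xi(\mathbf z)\,d\mathbf z,$$ $\Pi_{\mathbf x}[\xi](\mathbf y)=\xi(\mathbf y)$, $\Pi_{\mathbf x}[\mathsf D;\bar a](\mathbf y)=\Pi_{\mathbf x}[\mathsf I;\bar a](\mathbf y)\xi(\mathbf y)-c_1^{\bar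 a}(s)$, $\Pi_{\mathbf x}[\mathsf V;\bar a](\mathbf y)=|\nabla_y\Pi_{\mathbf x}[\mathsf I;\bar a](\mathbf y)|^2-c_2^{\bar a}(s)$, $\Pi_{\mathbf x}[\mathsf X](\mathbf y)=(y-x)\xi(\mathbf y)$. Assign to $\tau=\xi,\mathsf I,\mathsf D,\mathsf V,\mathsf X$ the homogeneities $|\tau|=\alpha-2,\ \alpha,\ 2\alpha-2,\ 2\alpha-2,\ \alpha-1$ and the exponents $\mathfrak e(\tau)=0,\ 1+\epsilon,\ 1+\epsilon,\ 2+2\epsilon,\ 0$. Let $[\tau]\ge0$ be constants with $$\Big|\int_{\mathbb R\times\mathbb R^d}\partial_{\bar a}^m\Pi_{\mathbf x}[\tau;\bar a](\mathbf y)\,\lambda^{-d-2}\varphi\big(\tfrac{s-t}{\lambda^2},\tfrac{y-x}{\lambda}\big)\,d\mathbf y\Big|\le[\tau]\,\lambda^{|\tau|}\,\bar a^{-\mathfrak e(\tau)-m},$$ $$|\partial_{\bar a}^m\Pi_{\mathbf x}[\mathsf I;\bar a](\mathbf y)|\le[\mathsf I]\,\|\mathbf x-\mathbf y\|_{\mathfrak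 s}^\alpha\,\bar a^{-1-\epsilon-m}$$ for all $\mathbf x,\mathbf y\in[-4,4]\times[-4,4]^d$, $\lambda\in(0,1)$, $\bar a\in a(\operatorname{supp}\sigma)$, $m\in\{0,1\}$ and all smooth $\varphi$ supported in the parabolic unit ball whose derivatives of order at most $2$ are bounded by $1$. Assume finally $$\int_0^T\sup_v\big|\sigma'(v)\sigma(v)\big(C^{a(v)}-c_1^{a(v)}(t)\big)\big|dt\le C,\qquad \int_0^T\sup_v\big|\tfrac{\sigma(v)^2}{v}\big(c_1^{a(v)}(t)-a(v)c_2^{a(v)}(t)\big)\big|dt\le C.$$ *Solution.* Let $u_0$ be smooth on $\mathbb T^d$ and let $u$ be a classical solution on $[0,T]\times\mathbb T^d$ of $$\partial_tu-\nabla\cdot(a(u)\nabla u)=\sigma(u)\xi-\sigma'(u)\sigma(u)C^{a(u)},\qquad u(0,\cdot)=u_0,$$ and let $\nu(\mathbf x)=\nabla_z\big(u(\mathbf z)-u(\mathbf x)-\sigma(u(\mathbf x))\Pi_{\mathbf x}[\mathsf I;a(u(\mathbf x))](\mathbf z)\big)\big|_{\mathbf z=\mathbf x}$. *Seminorms.*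 For $\mathbf y\in\mathbb R\times\mathbb R^d$ let $D_{\mathbf y}=\{\mathbf x\in[0,T]\times\mathbb T^d:\mathbf x+\mathbf y\in[0,T]\times\mathbb T^d\}$. Let $[f]_\gamma$ be the supremum over $0<\|\mathbf y\|_{\mathfrak s}\le R$ of $\|\mathbf y\|_{\mathfrak s}^{-\gamma}\int_{D_{\mathbf y}}|f(\mathbf x+\mathbf y)-f(\mathbf x)|d\mathbf x$, and let $[f(\mathcal U)]_\beta$ be the supremum over the same $\mathbf y$ of $$\|\mathbf y\|_{\mathfrak s}^{-\beta}\int_{D_{\mathbf y}}\big|f(u(\mathbf x+\mathbf y))-f(u(\mathbf x))-f'(u(\mathbf x))\big(\sigma(u(\mathbf x))\Pi_{\mathbf x}[\mathsf I;a(u(\mathbf x))](\mathbf x+\mathbf y)+\nu(\mathbf x)\cdot y\big)\big|d\mathbf x .$$ *Conclusion.* With $L^1,L^2$ norms taken over $[0,T]\times\mathbb T^d$, $$\int_{(0,T)\times\mathbb T^d}|g'(u)|\,a(u)\,|\nu|^2\,d\mathbf z\le K\big(\|u_0\|_{L^p(\mathbb T^d)}^p+E+1\big),$$ $$\begin{aligned}E={}&[\xi]\big([(g\sigma)(\mathcal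 U)]_\beta+(\sqrt T)^\alpha\big)+\big([\mathsf D]+[\mathsf I][\xi]+[\mathsf V]\big)\big([\Theta(u)]_\alpha+(\sqrt T)^{2\alpha}\big)\\&+\big([\mathsf X]+[\mathsf I]\big)\Big([\Theta'(u)\nu]_{\beta-1}+[\Theta(u)]_\alpha^{1/2}\|\Theta'(u)\nu\|_{L^2}+\|\Theta'(u)\nu\|_{L^1}(\sqrt T)^{\alpha-1}\Big).\end{aligned}$$ (Different constants may be used in place of $C$ for the nonlinearities and for the noise.) -/

import Mathlib

open MeasureTheory Set
open scoped NNReal ENNReal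

noncomputable section

namespace SPM

/-! ### Space-time and periodic functions

Functions on the torus are identified with functions on `ℝ^d` that are `1`-periodic in every
coordinate direction; integrals over the torus are integrals over the unit cube. -/

/-- Euclidean space `ℝ^d`. -/
abbrev Space (d : ℕ) : Type := EuclideanSpace ℝ (Fin d)

/-- Space-time points `(t, x)`. -/
abbrev SpaceTime (d : ℕ) : Type := ℝ × Space d

/-- The parabolic norm `(|t| + |x|^2)^{1/2}`. -/
def pnorm {d : ℕ} (z : SpaceTime d) : ℝ := √(|z.1| + ‖z.2‖ ^ 2)

/-- The unit cube `[0,1)^d`, a fundamental domain of the torus. -/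
def cube (d : ℕ) : Set (Space d) := {x | ∀ i, x i ∈ Ico (0 : ℝ) 1}

/-- `1`-periodicity in all coordinate directions. -/
def IsPeriodic {d : ℕ} (f : Space d → ℝ) : Prop :=
  ∀ (k : Fin d → ℤ) (x : Space d), f (x + WithLp.toLp 2 (fun i => (k i : ℝ))) = f x

/-- The divergence of a vector field on `ℝ^d`. -/
def divergence {d : ℕ} (F : Space d → Space d) (x : Space d) : ℝ :=
  ∑ i, fderiv ℝ (fun w => F w i) x (EuclideanSpace.single i 1)

/-! ### The nonlinearities -/

/-- The assumptions on the nonlinearities `a` and `σ`. -/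
structure Nonlinearities (M N C : ℝ) (a σ : ℝ → ℝ) : Prop where
  a_contDiff : ContDiff ℝ 2 a
  a_pos : ∃ a₀ : ℝ, 0 < a₀ ∧ ∀ v, a₀ ≤ a v
  a_lower : ∀ v, |v| ^ (M - 1) ≤ C * a v
  a_deriv : ∀ v, v ≠ 0 → |deriv a v| ≤ C * |v| ^ (M - 2)
  a_deriv_two : ∀ v, v ≠ 0 → |iteratedDeriv 2 a v| ≤ C * |v| ^ (M - 3)
  sigma_contDiff : ContDiff ℝ 2 σ
  sigma_support : tsupport σ ⊆ Icc (-C) C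
  sigma_bound : ∀ v, |σ v| ≤ C * |v| ^ N
  sigma_deriv : ∀ v, |deriv σ v| ≤ C * |v| ^ (N - 1)
  sigma_deriv_two : ∀ v, |iteratedDeriv 2 σ v| ≤ C * |v| ^ (N - 2)

/-! ### The model -/

/-- The heat kernel of `ℝ^d`, extended by zero to nonpositive times. -/
def heatKernel {d : ℕ} (t : ℝ) (x : Space d) : ℝ :=
  if 0 < t then (4 * Real.pi * t) ^ (-(d : ℝ) / 2) * Real.exp (-‖x‖ ^ 2 / (4 * t)) else 0

/-- The heat kernel with diffusivity `b`. -/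
def dilatedKernel {d : ℕ} (b : ℝ) (z : SpaceTime d) : ℝ := heatKernel (b * z.1) z.2

/-- The solution of the heat equation with diffusivity `b`, forcing `ξ` and zero initial datum,
centered at `x` and evaluated at `y`. -/
def lolly {d : ℕ} (ξ : SpaceTime d → ℝ) (b : ℝ) (x y : SpaceTime d) : ℝ :=
  ∫ z in {z : SpaceTime d | 0 < z.1}, (dilatedKernel b (y - z) - dilatedKernel b (x - z)) * ξ z

/-- The spatial gradient of `lolly ξ b x` at `y`. -/
def gradLolly {d : ℕ} (ξ : SpaceTime d → ℝ) (b : ℝ) (x y : SpaceTime d) : Space d :=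
  gradient (fun w : Space d => lolly ξ b x (y.1, w)) y.2

/-- The renormalized product of `lolly` and the noise; `cd b s` is the counterterm. -/
def dumb {d : ℕ} (ξ : SpaceTime d → ℝ) (cd : ℝ → ℝ → ℝ) (b : ℝ) (x y : SpaceTime d) : ℝ :=
  lolly ξ b x y * ξ y - cd b y.1

/-- The renormalized square of the gradient of `lolly`; `cc b s` is the counterterm. -/
def cherry {d : ℕ} (ξ : SpaceTime d → ℝ) (cc : ℝ → ℝ → ℝ) (b : ℝ) (x y : SpaceTime d) : ℝ :=
  ‖gradLolly ξ b x y‖ ^ 2 - cc b y.1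

/-- The product of the centered spatial monomials with the noise. -/
def xnoise {d : ℕ} (ξ : SpaceTime d → ℝ) (x y : SpaceTime d) : Space d :=
  ξ y • (y.2 - x.2)

/-- Qualitative regularity of a time dependent counterterm `c b s` (`b` the diffusivity, `s` the
time): measurable in time, continuously differentiable in the diffusivity, and, locally uniformly
in the diffusivity, dominated together with its derivative by a locally integrable function of
time. It makes all pairings with test functions meaningful. -/
structure CountertermRegular (c : ℝ → ℝ → ℝ) : Prop where
  measurable : ∀ b, 0 < b → Measurable (c b)
  contDiffOn : ∀ s, ContDiffOn ℝ 1 (fun b => c b s) (Ioi 0)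
  dominated : ∀ K : Set ℝ, IsCompact K → K ⊆ Ioi 0 →
    ∃ B : ℝ → ℝ, LocallyIntegrable B volume ∧
      ∀ b ∈ K, ∀ s, |c b s| ≤ B s ∧ |deriv (fun b' => c b' s) b| ≤ B s

/-- Smooth functions supported in the parabolic unit ball with all derivatives up to order two
bounded by one. -/
def TestFunctions (d : ℕ) : Set (SpaceTime d → ℝ) :=
  {φ | ContDiff ℝ (((⊤ : ℕ∞) : WithTop ℕ∞)) φ ∧ (∀ z, φ z ≠ 0 → pnorm z ≤ 1) ∧
    ∀ k : ℕ, k ≤ 2 → ∀ z, ‖iteratedFDeriv ℝ k φ z‖ ≤ 1}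

/-- The test function `φ` recentered at `x` and rescaled to the parabolic scale `lam`. -/
def rescale {d : ℕ} (φ : SpaceTime d → ℝ) (lam : ℝ) (x y : SpaceTime d) : ℝ :=
  lam ^ (-(d : ℝ) - 2) * φ ((y.1 - x.1) / lam ^ 2, lam⁻¹ • (y.2 - x.2))

/-- The compact set of space-time points on which the model is measured. By periodicity it
represents all points with times in `[-4,4]`. -/
def box (d : ℕ) : Set (SpaceTime d) :=
  {z | z.1 ∈ Icc (-4 : ℝ) 4 ∧ ∀ i, z.2 i ∈ Icc (-4 : ℝ) 4}

/-- The bound with constant `n`, homogeneity `h` and exponent `e` on a family `P b x y` of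
functions of `y`, depending on a base point `x` and a diffusivity `b`, and on its first derivative
in `b`. -/
def ModelBound {d : ℕ} {V : Type} [NormedAddCommGroup V] [NormedSpace ℝ V] (a σ : ℝ → ℝ)
    (P : ℝ → SpaceTime d → SpaceTime d → V) (h e : ℝ) (n : ℝ≥0) : Prop :=
  ∀ x ∈ box d, ∀ lam ∈ Ioo (0 : ℝ) 1, ∀ b ∈ (a '' tsupport σ) \ {0}, ∀ m : ℕ, m ≤ 1 →
    ∀ φ ∈ TestFunctions d,
      ‖∫ y, rescale φ lam x y • iteratedDeriv m (fun b' => P b' x y) b‖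
        ≤ n * lam ^ h * b ^ (-e - m)

/-- Constants bounding the five components of the model. -/
structure ModelConstants where
  noise : ℝ≥0
  lolly : ℝ≥0
  dumb : ℝ≥0
  cherry : ℝ≥0
  xnoise : ℝ≥0

/-- The quantitative assumption on the model: `n` collects admissible constants. -/
structure ModelBounds {d : ℕ} (α ε : ℝ) (a σ : ℝ → ℝ) (ξ : SpaceTime d → ℝ)
    (cd cc : ℝ → ℝ → ℝ) (n : ModelConstants) : Prop where
  noise : ModelBound a σ (fun _ _ y => ξ y) (α - 2) 0 n.noise
  lolly : ModelBound a σ (fun b x y => lolly ξ b x y) α (1 + ε) n.lolly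
  dumb : ModelBound a σ (fun b x y => dumb ξ cd b x y) (2 * α - 2) (1 + ε) n.dumb
  cherry : ModelBound a σ (fun b x y => cherry ξ cc b x y) (2 * α - 2) (2 + 2 * ε) n.cherry
  xnoise : ModelBound a σ (fun _ x y => xnoise ξ x y) (α - 1) 0 n.xnoise
  lolly_pointwise : ∀ x ∈ box d, ∀ y ∈ box d, ∀ b ∈ (a '' tsupport σ) \ {0}, ∀ m : ℕ, m ≤ 1 →
    |iteratedDeriv m (fun b' => SPM.lolly ξ b' x y) b|
      ≤ n.lolly * pnorm (x - y) ^ α * b ^ (-(1 + ε) - m)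

/-- The assumptions on the noise `ξ`, on the counterterm `Cct` of the equation and on the
counterterms `cd`, `cc` of the model, up to the final time `T`. -/
structure NoiseAssumption {d : ℕ} (α ε C T : ℝ) (a σ : ℝ → ℝ) (ξ : SpaceTime d → ℝ)
    (Cct : ℝ → ℝ) (cd cc : ℝ → ℝ → ℝ) (n : ModelConstants) : Prop where
  smooth : ContDiff ℝ (((⊤ : ℕ∞) : WithTop ℕ∞)) ξ
  periodic : ∀ t, IsPeriodic (fun x => ξ (t, x))
  Cct_continuousOn : ContinuousOn Cct (Ioi 0)
  cd_regular : CountertermRegular cd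
  cc_regular : CountertermRegular cc
  model : ModelBounds α ε a σ ξ cd cc n
  counterterm_time_independent :
    ∫⁻ t in Ioo 0 T, ⨆ v : ℝ,
      ENNReal.ofReal |deriv σ v * σ v * (Cct (a v) - cd (a v) t)| ≤ ENNReal.ofReal C
  counterterm_dumb_cherry :
    ∫⁻ t in Ioo 0 T, ⨆ v : ℝ,
      ENNReal.ofReal |σ v ^ 2 / v * (cd (a v) t - a v * cc (a v) t)| ≤ ENNReal.ofReal C

/-! ### The equation -/

/-- `u` is a classical solution on `[0,T]` of
`∂_t u - ∇·(a(u)∇u) = σ(u) ξ - σ'(u) σ(u) C^{a(u)}` with initial datum `u₀`: it is periodic and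
twice differentiable in space with derivatives up to order two continuous on `[0,T] × ℝ^d`, and it
solves the equation pointwise (so that `∂_t u` extends continuously to `[0,T] × ℝ^d`, too). -/
structure IsClassicalSolution {d : ℕ} (T : ℝ) (a σ : ℝ → ℝ) (ξ : SpaceTime d → ℝ)
    (Cct : ℝ → ℝ) (u₀ : Space d → ℝ) (u : SpaceTime d → ℝ) : Prop where
  periodic : ∀ t ∈ Icc 0 T, IsPeriodic (fun x => u (t, x))
  initial : ∀ x, u (0, x) = u₀ x
  contDiff : ∀ t ∈ Icc 0 T, ContDiff ℝ 2 (fun x => u (t, x))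
  continuousOn : ∀ k : ℕ, k ≤ 2 →
    ContinuousOn (fun z : SpaceTime d => iteratedFDeriv ℝ k (fun x => u (z.1, x)) z.2)
      (Icc 0 T ×ˢ univ)
  equation : ∀ t ∈ Ioo 0 T, ∀ x,
    HasDerivAt (fun s => u (s, x))
      (divergence (fun w => a (u (t, w)) • gradient (fun w' => u (t, w')) w) x
        + σ (u (t, x)) * ξ (t, x)
        - deriv σ (u (t, x)) * σ (u (t, x)) * Cct (a (u (t, x)))) t

/-- The modelledness derivative: the spatial gradient at the base point `z` of
`u - u(z) - σ(u(z)) Π_z[lolly; a(u(z))]`. -/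
def nu {d : ℕ} (a σ : ℝ → ℝ) (ξ : SpaceTime d → ℝ) (u : SpaceTime d → ℝ) (z : SpaceTime d) :
    Space d :=
  gradient (fun w : Space d =>
    u (z.1, w) - u z - σ (u z) * lolly ξ (a (u z)) z (z.1, w)) z.2

/-! ### Seminorms -/

/-- The points `x` of `[0,T] × 𝕋^d` for which `x + y` lies in `[0,T] × 𝕋^d`. -/
def shiftDomain {d : ℕ} (T : ℝ) (y : SpaceTime d) : Set (SpaceTime d) :=
  {x | x.1 ∈ Icc 0 T ∧ x.1 + y.1 ∈ Icc 0 T ∧ x.2 ∈ cube d}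

/-- The seminorm of order `γ` based on increments of size at most `R`, measured in `L^1`. -/
def besov {d : ℕ} {V : Type} [NormedAddCommGroup V] (T R γ : ℝ) (f : SpaceTime d → V) : ℝ≥0∞ :=
  ⨆ (y : SpaceTime d) (_ : 0 < pnorm y ∧ pnorm y ≤ R),
    ENNReal.ofReal (pnorm y ^ (-γ)) * ∫⁻ x in shiftDomain T y, ‖f (x + y) - f x‖ₑ

/-- The modelledness seminorm of order `γ` of `f(u)`. -/
def modelled {d : ℕ} (T R γ : ℝ) (a σ : ℝ → ℝ) (ξ : SpaceTime d → ℝ) (u : SpaceTime d → ℝ)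
    (f : ℝ → ℝ) : ℝ≥0∞ :=
  ⨆ (y : SpaceTime d) (_ : 0 < pnorm y ∧ pnorm y ≤ R),
    ENNReal.ofReal (pnorm y ^ (-γ)) * ∫⁻ x in shiftDomain T y,
      ‖f (u (x + y)) - f (u x)
        - deriv f (u x) *
          (σ (u x) * lolly ξ (a (u x)) x (x + y) + inner ℝ (nu a σ ξ u x) y.2)‖ₑ

/-- Lebesgue measure on `[0,T] × 𝕋^d`. -/
def torusMeasure (d : ℕ) (T : ℝ) : Measure (SpaceTime d) :=
  volume.restrict (Icc 0 T ×ˢ cube d)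

/-! ### Auxiliary functions -/

/-- `g'(v) = |v|^{p-2}`. -/
def gPrime (p v : ℝ) : ℝ := |v| ^ (p - 2)

/-- `g(v) = ∫_0^v |w|^{p-2} dw`. -/
def g (p v : ℝ) : ℝ := ∫ w in (0 : ℝ)..v, gPrime p w

/-- A smooth increasing truncation of the identity, bounded by `L`, which is the identity on the
support of `σ` and constant near `-∞` and near `+∞`. -/
structure IsTruncation (L : ℝ) (σ Θ : ℝ → ℝ) : Prop where
  smooth : ContDiff ℝ (((⊤ : ℕ∞) : WithTop ℕ∞)) Θ
  monotone : Monotone Θ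
  eq_id : ∀ v ∈ tsupport σ, Θ v = v
  eventually_const : HasCompactSupport (deriv Θ)
  bounded : ∀ v, |Θ v| ≤ L

/-- The explicit constant of the energy inequality. -/
def energyConstant {d : ℕ} (T R α β p : ℝ) (a σ Θ : ℝ → ℝ) (ξ : SpaceTime d → ℝ)
    (u : SpaceTime d → ℝ) (n : ModelConstants) : ℝ≥0∞ :=
  (n.noise : ℝ≥0∞) *
      (modelled T R β a σ ξ u (fun v => g p v * σ v) + ENNReal.ofReal (√T ^ α))
  + ((n.dumb : ℝ≥0∞) + n.lolly * n.noise + n.cherry) *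
      (besov T R α (fun x => Θ (u x)) + ENNReal.ofReal (√T ^ (2 * α)))
  + ((n.xnoise : ℝ≥0∞) + n.lolly) *
      (besov T R (β - 1) (fun x => deriv Θ (u x) • nu a σ ξ u x)
        + besov T R α (fun x => Θ (u x)) ^ (1 / 2 : ℝ)
            * eLpNorm (fun x => deriv Θ (u x) • nu a σ ξ u x) 2 (torusMeasure d T)
        + eLpNorm (fun x => deriv Θ (u x) • nu a σ ξ u x) 1 (torusMeasure d T)
            * ENNReal.ofReal (√T ^ (α - 1)))

end SPM

end

/-!
Testing the equation with `g(u)` gives an energy inequality whose dissipation is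
`∫ g'(u) a(u) |∇u|²`. As `g'` is singular at the origin for `p < 2`, one tests with
smooth regularizations of `g` and lets the regularization tend to zero, by dominated convergence on the
right and Fatou's lemma on the left. Inserting `∇u = ν + σ(u) ∇Π[I]` produces the dissipation of
`ν` and products of the noise (`IsClassicalSolution.energy_inequality`): the reaction term
`g(u) σ(u) ξ`, the term `g'(u) a(u) σ(u)² |∇Π[I]|²` and the cross term
`2 g'(u) a(u) σ(u) ν · ∇Π[I]`. None of them is bounded by the model separately.

Together these products are, up to differences of counterterms that are bounded by assumption
(`IsClassicalSolution.enorm_integral_energy_le`), the diagonal `F x x` of a germ `F x y`, namely of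
the local expansion around `x` of all the products in terms of the model (`germ`,
`energy_integrand_eq`). On the diagonal the terms of the expansion of `g(u) σ(u) ξ` which involve
`Π_x[D]` and `Π_x[X]` contribute only counterterms, but they are what makes the germ coherent. The
integral over the diagonal is estimated by a reconstruction argument on the torus
(`exists_reconstruction_bound`). The function `h ↦ ∫ F x (x + h) dx` over `[0,T] × 𝕋^d` is continuous
at `0`. Averaged with two mollifiers at consecutive dyadic scales it changes, from one scale to the
next, by increments of a single mollification (`enorm_le_of_mollified_increments`); and such an
increment consists of a change of base point in the averaged germ and of boundary layers
(`GermRegular.enorm_integral_diagonal_le`).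

*Coherence.* Re-expanding the model around the evaluation point writes an average of the germ with
base point `x` as the averaged noise times the local expansion of `g(u) σ(u)`, plus functions of
`u(x)` that are Lipschitz continuous with respect to the truncation `Θ`, plus a term linear in `ν(x)`
with coefficients of the same kind (`germAverage_eq`, `exists_germAverage_decomposition`). Hence a
change of base point costs the seminorms of the statement (`exists_germAverage_bounds`,
`exists_coherentGerm`). The Lipschitz bounds have to absorb the factors `a(u)^(-e)` with which the
model degenerates for small diffusivities. This is where `|v|^(M-1) ≤ C a(v)` and `N ≥ M + 1` enter:
the prefactors vanish fast enough at the origin (`exists_weightBound`, `WeightBound.mul_comp`), and a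
Lipschitz function that vanishes off `supp σ` is controlled by `Θ` (`abs_sub_le_of_eq_id`). As
`∇Π[I]` alone is not part of the model, its averages are integrated by parts onto the mollifier.

*The product of `ν` and an increment of `Θ(u)`* is estimated by the Cauchy-Schwarz inequality, the
increment being controlled in `L²` by interpolation between `L¹` and `L^∞`
(`CoherentGerm.lintegral_field_mul_le`). This is the origin of the term
`[Θ(u)]_α^(1/2) ‖Θ'(u) ν‖_{L²}`.

*Boundary layers.* Translations move points out of `[0,T]`, so that layers of width `l²` at the
initial and final times remain at scale `l`. There only the size of the germ is available, and
`l^(α-1) ∫_layer |Θ'(u) ν|` has to be summed over scales although `α < 1`. Comparing a layer with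
its translate by its own width halves the mass up to an increment of `Θ'(u) ν`
(`two_mul_layerMass_le`), which makes the weighted masses a geometric sequence with ratio `2^(-α)`
up to a summable perturbation (`CoherentGerm.tsum_layerMass_le`).

The sums over scales converge because `α + β - 2 > 0` and `3 α - 2 > 0`. Starting from a largest
scale proportional to `√T`, they produce the powers of `√T` in the statement.

The model is accessed through a representation of the heat potential in self-similar variables
(`potential`, `lolly_eq`), in which the kernel is a fixed Gaussian weight and regularity in the
diffusivity and in space-time follows by differentiation under the integral.
-/


namespace SPM

open Filter Topology

variable {d : ℕ}

/-! ### Integration over the torus -/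

/-- The integer point `k`, as a vector. -/
noncomputable def latticeVec (k : Fin d → ℤ) : Space d := WithLp.toLp 2 (fun i => (k i : ℝ))

@[simp] lemma latticeVec_apply (k : Fin d → ℤ) (i : Fin d) : latticeVec k i = k i := rfl

/-- Spatial periodicity of a function of space-time. -/
def SpacePeriodic {E : Type*} (f : SpaceTime d → E) : Prop :=
  ∀ (k : Fin d → ℤ) (z : SpaceTime d), f (z + (0, latticeVec k)) = f z

/-- The spatial lattice `{0} × ℤ^d` of translations of space-time. -/
noncomputable def lattice (d : ℕ) : AddSubgroup (SpaceTime d) :=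
  AddMonoidHom.range
    { toFun := fun k : Fin d → ℤ => ((0, latticeVec k) : SpaceTime d)
      map_zero' := by ext <;> simp
      map_add' := by intro a b; ext <;> simp }

instance : Countable (lattice d) := by
  have : (lattice d : Set (SpaceTime d)).Countable := Set.countable_range _
  exact this.to_subtype

instance isAddHaarMeasure_volume_spaceTime :
    (volume : Measure (SpaceTime d)).IsAddHaarMeasure := by
  rw [Measure.volume_eq_prod]; infer_instance

lemma measurableSet_cube : MeasurableSet (cube d) := by
  have : cube d = ⋂ i, (fun x : Space d => x i) ⁻¹' Ico (0 : ℝ) 1 := by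
    ext x; simp [cube]
  rw [this]
  refine MeasurableSet.iInter fun i => ?_
  exact (by fun_prop : Continuous fun x : Space d => x i).measurable measurableSet_Ico

lemma volume_cube : volume (cube d) = 1 := by
  have h := (EuclideanSpace.volume_preserving_symm_measurableEquiv_toLp (Fin d))
  have e : cube d = (MeasurableEquiv.toLp 2 (Fin d → ℝ)).symm ⁻¹' (Set.pi univ fun _ => Ico 0 1) := by
    ext x; simp [cube]
  rw [e, h.measure_preimage (MeasurableSet.univ_pi fun _ => measurableSet_Ico).nullMeasurableSet,
    volume_pi_pi]
  simp

lemma existsUnique_vadd_mem_strip (z : SpaceTime d) :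
    ∃! g : lattice d, g +ᵥ z ∈ (univ : Set ℝ) ×ˢ cube d := by
  have key : ∀ k : Fin d → ℤ, ((0, latticeVec k) + z : SpaceTime d) ∈ (univ : Set ℝ) ×ˢ cube d ↔
      ∀ i, k i = -⌊z.2 i⌋ := by
    intro k
    simp only [cube, mem_prod, mem_univ, true_and, mem_ofPred_eq, Prod.snd_add, PiLp.add_apply,
      latticeVec_apply, mem_Ico]
    refine forall_congr' fun i => ?_
    rw [eq_neg_iff_add_eq_zero, add_comm (k i), ← Int.floor_add_intCast, Int.floor_eq_zero_iff,
      add_comm (z.2 i), mem_Ico]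
  refine ⟨⟨(0, latticeVec fun i => -⌊z.2 i⌋), _, rfl⟩, (key _).2 fun i => rfl, ?_⟩
  rintro ⟨_, k, rfl⟩ hk
  have := (key k).1 hk
  obtain rfl : k = fun i => -⌊z.2 i⌋ := funext this
  rfl

lemma isAddFundamentalDomain_strip :
    IsAddFundamentalDomain (lattice d) ((univ : Set ℝ) ×ˢ cube d) :=
  IsAddFundamentalDomain.mk' (MeasurableSet.univ.prod measurableSet_cube).nullMeasurableSet
    existsUnique_vadd_mem_strip

lemma isAddFundamentalDomain_strip_shift (h : SpaceTime d) :
    IsAddFundamentalDomain (lattice d) ((fun z => z + h) ⁻¹' ((univ : Set ℝ) ×ˢ cube d)) := by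
  refine IsAddFundamentalDomain.mk' ((MeasurableSet.univ.prod measurableSet_cube).preimage
    (measurable_add_const h)).nullMeasurableSet fun z => ?_
  obtain ⟨k, hk, hu⟩ := existsUnique_vadd_mem_strip (z + h)
  refine ⟨k, ?_, fun g hg => hu g ?_⟩
  · simpa [AddSubgroup.vadd_def, add_assoc] using hk
  · simpa [AddSubgroup.vadd_def, add_assoc] using hg

lemma SpacePeriodic.vadd_eq {E : Type*} {f : SpaceTime d → E} (hf : SpacePeriodic f)
    (g : lattice d) (z : SpaceTime d) : f (g +ᵥ z) = f z := by
  obtain ⟨_, k, rfl⟩ := g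
  rw [AddSubgroup.vadd_def, vadd_eq_add, add_comm]
  exact hf k z

/-- Integrals over the torus are invariant under translations of space-time. -/
lemma lintegral_strip_add {f : SpaceTime d → ℝ≥0∞} (hf : SpacePeriodic f) (h : SpaceTime d) :
    ∫⁻ z in univ ×ˢ cube d, f (z + h) = ∫⁻ z in univ ×ˢ cube d, f z := by
  have hmp : MeasurePreserving (fun z : SpaceTime d => z + h) := measurePreserving_add_right _ h
  have he : MeasurableEmbedding (fun z : SpaceTime d => z + h) := measurableEmbedding_addRight h
  have h1 := hmp.setLIntegral_comp_preimage_emb he f (univ ×ˢ cube d)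
  rw [← h1]
  refine IsAddFundamentalDomain.setLIntegral_eq isAddFundamentalDomain_strip
    (isAddFundamentalDomain_strip_shift h) _ fun g z => ?_
  have := hf.vadd_eq g (z + h)
  simpa [AddSubgroup.vadd_def, add_assoc] using this

lemma integral_strip_add {E : Type*} [NormedAddCommGroup E] [NormedSpace ℝ E]
    {f : SpaceTime d → E} (hf : SpacePeriodic f) (h : SpaceTime d) :
    ∫ z in univ ×ˢ cube d, f (z + h) = ∫ z in univ ×ˢ cube d, f z := by
  have hmp : MeasurePreserving (fun z : SpaceTime d => z + h) := measurePreserving_add_right _ h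
  have he : MeasurableEmbedding (fun z : SpaceTime d => z + h) := measurableEmbedding_addRight h
  have h1 := hmp.setIntegral_preimage_emb he f (univ ×ˢ cube d)
  rw [← h1]
  refine IsAddFundamentalDomain.setIntegral_eq isAddFundamentalDomain_strip
    (isAddFundamentalDomain_strip_shift h) fun g z => ?_
  have := hf.vadd_eq g (z + h)
  simpa [AddSubgroup.vadd_def, add_assoc] using this

lemma prod_cube_eq (A : Set ℝ) :
    A ×ˢ cube d = (Prod.fst ⁻¹' A) ∩ ((univ : Set ℝ) ×ˢ cube d) := by
  ext z; simp

lemma lintegral_prod_cube (A : Set ℝ) (hA : MeasurableSet A) (f : SpaceTime d → ℝ≥0∞) :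
    ∫⁻ z in A ×ˢ cube d, f z = ∫⁻ z in univ ×ˢ cube d, (Prod.fst ⁻¹' A).indicator f z := by
  rw [lintegral_indicator (measurable_fst hA), Measure.restrict_restrict (measurable_fst hA),
    ← prod_cube_eq]

lemma integral_prod_cube {E : Type*} [NormedAddCommGroup E] [NormedSpace ℝ E]
    (A : Set ℝ) (hA : MeasurableSet A) (f : SpaceTime d → E) :
    ∫ z in A ×ˢ cube d, f z = ∫ z in univ ×ˢ cube d, (Prod.fst ⁻¹' A).indicator f z := by
  rw [integral_indicator (measurable_fst hA), Measure.restrict_restrict (measurable_fst hA),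
    ← prod_cube_eq]

lemma SpacePeriodic.indicator {E : Type*} [Zero E] {f : SpaceTime d → E} (hf : SpacePeriodic f)
    (A : Set ℝ) : SpacePeriodic ((Prod.fst ⁻¹' A).indicator f) := by
  intro k z
  have : z + (0, latticeVec k) ∈ (Prod.fst ⁻¹' A : Set (SpaceTime d)) ↔
      z ∈ (Prod.fst ⁻¹' A : Set (SpaceTime d)) := by simp
  by_cases hz : z ∈ (Prod.fst ⁻¹' A : Set (SpaceTime d))
  · rw [indicator_of_mem hz, indicator_of_mem (this.2 hz), hf k z]
  · rw [indicator_of_notMem hz, indicator_of_notMem (fun h => hz (this.1 h))]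

/-- Translating a periodic function translates the time interval of integration only. -/
lemma lintegral_prod_cube_add {f : SpaceTime d → ℝ≥0∞} (hf : SpacePeriodic f) {A : Set ℝ}
    (hA : MeasurableSet A) (h : SpaceTime d) :
    ∫⁻ z in ((fun t => t + h.1) ⁻¹' A) ×ˢ cube d, f (z + h) = ∫⁻ z in A ×ˢ cube d, f z := by
  rw [lintegral_prod_cube A hA, ← lintegral_strip_add (hf.indicator A) h,
    lintegral_prod_cube _ (measurable_add_const _ hA)]
  rfl

lemma integral_prod_cube_add {E : Type*} [NormedAddCommGroup E] [NormedSpace ℝ E]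
    {f : SpaceTime d → E} (hf : SpacePeriodic f) {A : Set ℝ}
    (hA : MeasurableSet A) (h : SpaceTime d) :
    ∫ z in ((fun t => t + h.1) ⁻¹' A) ×ˢ cube d, f (z + h) = ∫ z in A ×ˢ cube d, f z := by
  rw [integral_prod_cube A hA, ← integral_strip_add (hf.indicator A) h,
    integral_prod_cube _ (measurable_add_const _ hA)]
  rfl

lemma volume_prod_cube (A : Set ℝ) : volume (A ×ˢ cube d) = volume A := by
  rw [Measure.volume_eq_prod, Measure.prod_prod, volume_cube, mul_one]

/-- The closed unit cube. -/
def closedCube (d : ℕ) : Set (Space d) := {x | ∀ i, x i ∈ Icc (0 : ℝ) 1}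

lemma cube_subset_closedCube : cube d ⊆ closedCube d := fun _ hx i => Ico_subset_Icc_self (hx i)

lemma isCompact_pi_Icc (l u : ℝ) : IsCompact {x : Space d | ∀ i, x i ∈ Icc l u} := by
  have e : {x : Space d | ∀ i, x i ∈ Icc l u} =
      (EuclideanSpace.equiv (Fin d) ℝ).symm '' (Set.pi univ fun _ => Icc l u) := by
    ext x
    constructor
    · intro hx
      exact ⟨fun i => x i, fun i _ => hx i, rfl⟩
    · rintro ⟨y, hy, rfl⟩ i
      exact hy i (mem_univ i)
  rw [e]
  exact (isCompact_univ_pi fun _ => isCompact_Icc).image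
    (EuclideanSpace.equiv (Fin d) ℝ).symm.continuous

lemma isCompact_closedCube : IsCompact (closedCube d) := isCompact_pi_Icc 0 1

/-- Every point of space is a lattice translate of a point of the unit cube. -/
lemma exists_add_latticeVec_mem_cube (x : Space d) :
    ∃ k : Fin d → ℤ, x + latticeVec k ∈ cube d := by
  refine ⟨fun i => -⌊x i⌋, fun i => ?_⟩
  simp only [PiLp.add_apply, latticeVec_apply, Int.cast_neg]
  exact ⟨by linarith [Int.floor_le (x i)], by linarith [Int.lt_floor_add_one (x i)]⟩

/-- A continuous periodic function is bounded on bounded time intervals. -/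
lemma SpacePeriodic.exists_bound {E : Type*} [NormedAddCommGroup E] {f : SpaceTime d → E}
    (hf : SpacePeriodic f) (hc : Continuous f) (l u : ℝ) :
    ∃ B : ℝ, 0 ≤ B ∧ ∀ z : SpaceTime d, z.1 ∈ Icc l u → ‖f z‖ ≤ B := by
  obtain ⟨B, hB⟩ := ((isCompact_Icc (a := l) (b := u)).prod
    (isCompact_closedCube (d := d))).exists_bound_of_continuousOn hc.continuousOn
  refine ⟨max B 0, le_max_right _ _, fun z hz => ?_⟩
  obtain ⟨k, hk⟩ := exists_add_latticeVec_mem_cube z.2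
  rw [← hf k z]
  exact (hB _ ⟨by simpa using hz, cube_subset_closedCube (by simpa using hk)⟩).trans
    (le_max_left _ _)

lemma integrableOn_prod_cube {E : Type*} [NormedAddCommGroup E] {f : SpaceTime d → E}
    (hc : Continuous f) (l u : ℝ) : IntegrableOn f (Icc l u ×ˢ cube d) :=
  (hc.continuousOn.integrableOn_compact
    ((isCompact_Icc (a := l) (b := u)).prod (isCompact_closedCube (d := d)))).mono_set
    (prod_mono_right cube_subset_closedCube)

/-- The integral over the torus of a spatial derivative of a periodic function vanishes. -/
lemma integral_prod_cube_deriv_eq_zero {f f' : SpaceTime d → ℝ} (hf : SpacePeriodic f)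
    (hf' : SpacePeriodic f') (hc : Continuous f) (hc' : Continuous f') (v : Space d)
    (hd : ∀ (t : ℝ) (x : Space d) (s : ℝ), HasDerivAt (fun s : ℝ => f (t, x + s • v)) (f' (t, x + s • v)) s) (l u : ℝ) :
    ∫ z in Icc l u ×ˢ cube d, f' z = 0 := by
  set A := Icc l u with hA
  have hAm : MeasurableSet A := measurableSet_Icc
  have shift : ∀ (φ : SpaceTime d → ℝ), SpacePeriodic φ → ∀ s : ℝ,
      ∫ z in A ×ˢ cube d, φ (z + (0, s • v)) = ∫ z in A ×ˢ cube d, φ z := by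
    intro φ hφ s
    have := integral_prod_cube_add hφ hAm (0, s • v)
    simpa using this
  have e1 : ∫ s in (0:ℝ)..1, ∫ z in A ×ˢ cube d, f' (z + (0, s • v)) =
      ∫ z in A ×ˢ cube d, f' z := by
    simp_rw [shift f' hf']
    simp
  rw [← e1]
  have hcont : Continuous fun q : ℝ × SpaceTime d => f' (q.2 + (0, q.1 • v)) := by fun_prop
  rw [intervalIntegral_integral_swap]
  · have : ∀ z : SpaceTime d, ∫ s in (0:ℝ)..1, f' (z + (0, s • v)) =
        f (z + (0, (1:ℝ) • v)) - f z := by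
      intro z
      have e : ∀ s : ℝ, z + (0, s • v) = (z.1, z.2 + s • v) := fun s => Prod.ext (add_zero _) rfl
      have e0 : z + (0, (0 : ℝ) • v) = z := by
        rw [e, zero_smul, add_zero]
      have := intervalIntegral.integral_eq_sub_of_hasDerivAt (a := 0) (b := 1)
        (f := fun s => f (z + (0, s • v))) (f' := fun s => f' (z + (0, s • v)))
        (fun s _ => by simpa only [e] using hd z.1 z.2 s)
        (Continuous.intervalIntegrable (by fun_prop) _ _)
      rw [this, e0]
    simp_rw [this]
    rw [integral_sub, shift f hf, sub_self]
    · exact integrableOn_prod_cube (f := fun z => f (z + (0, (1:ℝ) • v))) (by fun_prop) l u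
    · exact integrableOn_prod_cube hc l u
  · have hk : IntegrableOn (fun q : ℝ × SpaceTime d => f' (q.2 + (0, q.1 • v)))
        (Icc 0 1 ×ˢ (A ×ˢ closedCube d)) :=
      hcont.continuousOn.integrableOn_compact
        (isCompact_Icc.prod (isCompact_Icc.prod isCompact_closedCube))
    have := hk.mono_set (t := Icc 0 1 ×ˢ (A ×ˢ closedCube d)) (s := uIoc 0 1 ×ˢ (A ×ˢ cube d))
      (prod_mono (by rw [uIoc_of_le zero_le_one]; exact Ioc_subset_Icc_self)
        (prod_mono_right cube_subset_closedCube))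
    rw [IntegrableOn, Measure.volume_eq_prod, ← Measure.prod_restrict] at this
    exact this

/-! ### The heat potential of a smooth periodic function -/

section Potential

variable {E : Type*} [NormedAddCommGroup E] [NormedSpace ℝ E]

/-- The spatial derivative of a function on space-time. -/
noncomputable def sderiv (η : SpaceTime d → E) (z : SpaceTime d) : Space d →L[ℝ] E :=
  (fderiv ℝ η z).comp (ContinuousLinearMap.inr ℝ ℝ (Space d))

lemma hasFDerivAt_sderiv {η : SpaceTime d → E} (hη : Differentiable ℝ η) (t : ℝ) (x : Space d) :
    HasFDerivAt (fun x => η (t, x)) (sderiv η (t, x)) x :=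
  (hη (t, x)).hasFDerivAt.comp x (hasFDerivAt_prodMk_right t x)

lemma contDiff_sderiv {η : SpaceTime d → E} (hη : ContDiff ℝ ((⊤ : ℕ∞) : WithTop ℕ∞) η) :
    ContDiff ℝ ((⊤ : ℕ∞) : WithTop ℕ∞) (sderiv η) :=
  (hη.fderiv_right (m := ((⊤ : ℕ∞) : WithTop ℕ∞)) (by norm_cast)).clm_comp contDiff_const

lemma SpacePeriodic.sderiv {η : SpaceTime d → E} (hp : SpacePeriodic η) :
    SpacePeriodic (sderiv η) := by
  intro k z
  have : (fun z => η (z + (0, latticeVec k))) = η := funext fun z => hp k z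
  rw [SPM.sderiv, SPM.sderiv, ← fderiv_comp_add_right, this]

/-- The Gaussian kernel at time one. -/
noncomputable def gauss (w : Space d) : ℝ := heatKernel 1 w

lemma gauss_eq (w : Space d) :
    gauss w = (4 * Real.pi) ^ (-(d : ℝ) / 2) * Real.exp (-(1 / 4) * ‖w‖ ^ 2) := by
  rw [gauss, heatKernel, if_pos one_pos]
  congr 2 <;> ring

lemma gauss_nonneg (w : Space d) : 0 ≤ gauss w := by
  rw [gauss_eq]; positivity

lemma continuous_gauss : Continuous (gauss (d := d)) := by
  have : gauss (d := d) = fun w => (4 * Real.pi) ^ (-(d : ℝ) / 2) *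
      Real.exp (-(1 / 4) * ‖w‖ ^ 2) := funext gauss_eq
  rw [this]; fun_prop

lemma integrable_exp_neg_mul_norm_sq {b : ℝ} (hb : 0 < b) :
    Integrable (fun w : Space d => Real.exp (-b * ‖w‖ ^ 2)) := by
  have h := GaussianFourier.integrable_cexp_neg_mul_sq_norm_add (V := Space d) (b := (b : ℂ))
    (by simpa using hb) 0 0
  have h2 := h.norm
  refine h2.congr (Eventually.of_forall fun w => ?_)
  simp only [zero_mul, add_zero, Complex.norm_exp]
  norm_cast

lemma integrable_gauss : Integrable (gauss (d := d)) := by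
  have : gauss (d := d) = fun w => (4 * Real.pi) ^ (-(d : ℝ) / 2) *
      Real.exp (-(1 / 4) * ‖w‖ ^ 2) := funext gauss_eq
  rw [this]
  exact (integrable_exp_neg_mul_norm_sq (by norm_num)).const_mul _

lemma integrable_gauss_mul_norm : Integrable (fun w : Space d => gauss w * ‖w‖) := by
  refine ((integrable_exp_neg_mul_norm_sq (d := d) (b := 1 / 8) (by norm_num)).const_mul
    ((4 * Real.pi) ^ (-(d : ℝ) / 2) * 3)).mono'
    (continuous_gauss.mul continuous_norm).aestronglyMeasurable (Eventually.of_forall fun w => ?_)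
  rw [Real.norm_of_nonneg (mul_nonneg (gauss_nonneg w) (norm_nonneg w)), gauss_eq]
  -- half of the Gaussian absorbs the factor `‖w‖`
  have h1 : Real.exp (-(1 / 4) * ‖w‖ ^ 2) =
      Real.exp (-(1 / 8) * ‖w‖ ^ 2) * Real.exp (-(1 / 8 * ‖w‖ ^ 2)) := by
    rw [← Real.exp_add]; congr 1; ring
  have h2 : Real.exp (-(1 / 8 * ‖w‖ ^ 2)) * ‖w‖ ≤ 3 := by
    rw [Real.exp_neg, inv_mul_le_iff₀ (Real.exp_pos _)]
    nlinarith [Real.add_one_le_exp (1 / 8 * ‖w‖ ^ 2), sq_nonneg (‖w‖ - 4 / 3)]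
  rw [h1]
  have h3 : 0 ≤ (4 * Real.pi) ^ (-(d : ℝ) / 2) * Real.exp (-(1 / 8) * ‖w‖ ^ 2) := by positivity
  calc _ = (4 * Real.pi) ^ (-(d : ℝ) / 2) * Real.exp (-(1 / 8) * ‖w‖ ^ 2) *
        (Real.exp (-(1 / 8 * ‖w‖ ^ 2)) * ‖w‖) := by ring
    _ ≤ (4 * Real.pi) ^ (-(d : ℝ) / 2) * Real.exp (-(1 / 8) * ‖w‖ ^ 2) * 3 := by gcongr
    _ = _ := by ring

/-- The measure on pairs of a relative time in `[0,1]` and a rescaled position. -/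
noncomputable def selfSimilarMeasure (d : ℕ) : Measure (ℝ × Space d) :=
  (volume.restrict (Icc (0 : ℝ) 1)).prod volume

/-- The point of space-time with relative time `q.1` and rescaled position `q.2` seen from `y`. -/
noncomputable def selfSimilarPoint (b : ℝ) (y : SpaceTime d) (q : ℝ × Space d) : SpaceTime d :=
  (max y.1 0 * q.1, y.2 - (√b * √(max y.1 0 * (1 - q.1))) • q.2)

/-- The solution of the heat equation with diffusivity `b`, forcing `η` and zero initial datum, in
self-similar variables. In these variables the kernel has become an integrable weight which does
not depend on any parameter. -/
noncomputable def potential (η : SpaceTime d → E) (b : ℝ) (y : SpaceTime d) : E :=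
  max y.1 0 • ∫ q, gauss q.2 • η (selfSimilarPoint b y q) ∂(selfSimilarMeasure d)

/-- The derivative of `potential η b y` in `b`. -/
noncomputable def potentialDeriv (η : SpaceTime d → E) (b : ℝ) (y : SpaceTime d) : E :=
  max y.1 0 • ∫ q, (-(1 / (2 * √b)) * √(max y.1 0 * (1 - q.1))) •
    (gauss q.2 • sderiv η (selfSimilarPoint b y q) q.2) ∂(selfSimilarMeasure d)

lemma continuous_selfSimilarPoint :
    Continuous fun p : (ℝ × SpaceTime d) × (ℝ × Space d) => selfSimilarPoint p.1.1 p.1.2 p.2 := by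
  unfold selfSimilarPoint
  fun_prop

lemma integrable_weight {f : Space d → ℝ} (hf : Integrable f) :
    Integrable (fun q : ℝ × Space d => f q.2) (selfSimilarMeasure d) := by
  have : Integrable (fun q : ℝ × Space d => (1 : ℝ) * f q.2) (selfSimilarMeasure d) :=
    Integrable.mul_prod (f := fun _ : ℝ => (1:ℝ)) (integrable_const _) hf
  simpa using this

lemma ae_selfSimilarMeasure : ∀ᵐ q ∂(selfSimilarMeasure d), q.1 ∈ Icc (0 : ℝ) 1 := by
  have h : (selfSimilarMeasure d) = volume.restrict (Icc (0:ℝ) 1 ×ˢ (univ : Set (Space d))) := by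
    rw [selfSimilarMeasure, Measure.volume_eq_prod, ← Measure.prod_restrict, Measure.restrict_univ]
  rw [h]
  filter_upwards [ae_restrict_mem (measurableSet_Icc.prod MeasurableSet.univ)] with q hq
  exact hq.1

lemma selfSimilarPoint_time {b : ℝ} {y : SpaceTime d} {q : ℝ × Space d} (hq : q.1 ∈ Icc (0 : ℝ) 1)
    {S : ℝ} (hS : max y.1 0 ≤ S) : (selfSimilarPoint b y q).1 ∈ Icc 0 S := by
  have h0 : (0 : ℝ) ≤ max y.1 0 := le_max_right _ _
  refine ⟨mul_nonneg h0 hq.1, le_trans ?_ hS⟩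
  exact mul_le_of_le_one_right h0 hq.2

/-- Near a point of space-time the times before it stay bounded. -/
lemma eventually_time_le (p₀ : ℝ × SpaceTime d) :
    ∀ᶠ p : ℝ × SpaceTime d in 𝓝 p₀, max p.2.1 0 ≤ max p₀.2.1 0 + 1 := by
  have : Continuous fun p : ℝ × SpaceTime d => max p.2.1 0 := by fun_prop
  exact this.continuousAt.eventually_le_const (by linarith)

lemma continuous_potential {η : SpaceTime d → E} (hc : Continuous η) (hp : SpacePeriodic η) :
    Continuous fun p : ℝ × SpaceTime d => potential η p.1 p.2 := by
  unfold potential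
  refine Continuous.smul (by fun_prop) (continuous_iff_continuousAt.2 fun p₀ => ?_)
  obtain ⟨B, hB0, hB⟩ := hp.exists_bound hc 0 (max p₀.2.1 0 + 1)
  have hk : Continuous fun p : (ℝ × SpaceTime d) × (ℝ × Space d) =>
      gauss p.2.2 • η (selfSimilarPoint p.1.1 p.1.2 p.2) :=
    (continuous_gauss.comp (by fun_prop)).smul (hc.comp continuous_selfSimilarPoint)
  refine continuousAt_of_dominated (bound := fun q => gauss q.2 * B) ?_ ?_ ?_ ?_
  · exact Eventually.of_forall fun p =>
      (hk.comp (Continuous.prodMk_right p)).aestronglyMeasurable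
  · filter_upwards [eventually_time_le p₀] with p hpt
    filter_upwards [ae_selfSimilarMeasure] with q hq
    rw [norm_smul, Real.norm_of_nonneg (gauss_nonneg _)]
    exact mul_le_mul_of_nonneg_left (hB _ (selfSimilarPoint_time hq hpt)) (gauss_nonneg _)
  · exact (integrable_weight integrable_gauss).mul_const B
  · exact Eventually.of_forall fun q => (hk.comp (Continuous.prodMk_left q)).continuousAt

/-- A majorant for the integrand of `potentialDeriv` which is uniform for diffusivities above `b₀`
and times below `S`. -/
lemma norm_dpotential_integrand_le {η : SpaceTime d → E} {b S B b₀ : ℝ} {y : SpaceTime d}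
    {q : ℝ × Space d} (hq : q.1 ∈ Icc (0 : ℝ) 1) (hS : max y.1 0 ≤ S) (hb₀ : 0 < b₀) (hb : b₀ ≤ b)
    (hB : ∀ z : SpaceTime d, z.1 ∈ Icc 0 S → ‖sderiv η z‖ ≤ B) :
    ‖(-(1 / (2 * √b)) * √(max y.1 0 * (1 - q.1))) •
      (gauss q.2 • sderiv η (selfSimilarPoint b y q) q.2)‖ ≤
      (1 / (2 * √b₀) * √S * B) * (gauss q.2 * ‖q.2‖) := by
  have h0 : (0 : ℝ) ≤ max y.1 0 := le_max_right _ _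
  rw [norm_smul, norm_smul, norm_mul, norm_neg, Real.norm_of_nonneg (gauss_nonneg _),
    Real.norm_of_nonneg (by positivity : 0 ≤ 1 / (2 * √b)), Real.norm_of_nonneg (Real.sqrt_nonneg _)]
  have h1 : 1 / (2 * √b) ≤ 1 / (2 * √b₀) := by
    have := Real.sqrt_pos.2 hb₀
    gcongr
  have h2 : √(max y.1 0 * (1 - q.1)) ≤ √S := by
    apply Real.sqrt_le_sqrt
    exact (mul_le_of_le_one_right h0 (by linarith [hq.1])).trans hS
  have h3 : ‖sderiv η (selfSimilarPoint b y q) q.2‖ ≤ B * ‖q.2‖ :=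
    ((sderiv η _).le_opNorm _).trans
      (mul_le_mul_of_nonneg_right (hB _ (selfSimilarPoint_time hq hS)) (norm_nonneg _))
  calc _ ≤ (1 / (2 * √b₀) * √S) * (gauss q.2 * (B * ‖q.2‖)) := by
        have := gauss_nonneg q.2
        gcongr
    _ = _ := by ring

lemma continuousAt_potentialDeriv {η : SpaceTime d → E}
    (hη : ContDiff ℝ ((⊤ : ℕ∞) : WithTop ℕ∞) η) (hp : SpacePeriodic η) {p₀ : ℝ × SpaceTime d}
    (hb : 0 < p₀.1) :
    ContinuousAt (fun p : ℝ × SpaceTime d => potentialDeriv η p.1 p.2) p₀ := by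
  unfold potentialDeriv
  have hc : Continuous (sderiv η) := (contDiff_sderiv hη).continuous
  refine ContinuousAt.smul (by fun_prop) ?_
  obtain ⟨B, hB0, hB⟩ := hp.sderiv.exists_bound hc 0 (max p₀.2.1 0 + 1)
  have hb2 : 0 < p₀.1 / 2 := by linarith
  have hlow : ∀ᶠ p : ℝ × SpaceTime d in 𝓝 p₀, p₀.1 / 2 ≤ p.1 :=
    (continuous_fst.tendsto p₀).eventually (eventually_ge_nhds (by linarith))
  refine continuousAt_of_dominated
    (F := fun (p : ℝ × SpaceTime d) q => (-(1 / (2 * √p.1)) * √(max p.2.1 0 * (1 - q.1))) •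
      (gauss q.2 • sderiv η (selfSimilarPoint p.1 p.2 q) q.2))
    (bound := fun q => (1 / (2 * √(p₀.1 / 2)) * √(max p₀.2.1 0 + 1) * B) * (gauss q.2 * ‖q.2‖))
    ?_ ?_ ?_ ?_
  · refine Eventually.of_forall fun p => Continuous.aestronglyMeasurable ?_
    have h1 : Continuous fun q : ℝ × Space d => -(1 / (2 * √p.1)) * √(max p.2.1 0 * (1 - q.1)) := by
      fun_prop
    have h2 : Continuous fun q : ℝ × Space d =>
        gauss q.2 • sderiv η (selfSimilarPoint p.1 p.2 q) q.2 :=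
      (continuous_gauss.comp (by fun_prop)).smul
        ((hc.comp (continuous_selfSimilarPoint.comp (Continuous.prodMk_right p))).clm_apply
          (by fun_prop))
    exact h1.smul h2
  · refine ((eventually_time_le p₀).and hlow).mono fun p hp' => ?_
    obtain ⟨hpt, hpb⟩ := hp'
    refine ae_selfSimilarMeasure.mono fun q hq => ?_
    exact norm_dpotential_integrand_le hq hpt hb2 hpb hB
  · exact (integrable_weight integrable_gauss_mul_norm).const_mul _
  · refine Eventually.of_forall fun q => ?_
    have h2 : ContinuousAt (fun p : ℝ × SpaceTime d =>
      gauss q.2 • sderiv η (selfSimilarPoint p.1 p.2 q) q.2) p₀ :=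
      (Continuous.const_smul ((hc.comp (continuous_selfSimilarPoint.comp
        (Continuous.prodMk_left q))).clm_apply continuous_const) _).continuousAt
    have h1 : ContinuousAt (fun p : ℝ × SpaceTime d => 1 / (2 * √p.1)) p₀ := by
      refine ContinuousAt.div (by fun_prop) (by fun_prop) ?_
      have := Real.sqrt_pos.2 hb
      positivity
    have h3 : ContinuousAt (fun p : ℝ × SpaceTime d => √(max p.2.1 0 * (1 - q.1))) p₀ := by
      fun_prop
    exact (h1.neg.mul h3).smul h2

lemma potential_add_latticeVec {η : SpaceTime d → E} (hp : SpacePeriodic η) (b : ℝ) :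
    SpacePeriodic (potential η b) := by
  intro k y
  have : ∀ q, η (selfSimilarPoint b (y + (0, latticeVec k)) q) = η (selfSimilarPoint b y q) := by
    intro q
    rw [← hp k (selfSimilarPoint b y q)]
    congr 1
    refine Prod.ext (by simp [selfSimilarPoint]) ?_
    simp only [selfSimilarPoint, Prod.snd_add, Prod.fst_add, add_zero]
    abel
  simp only [potential, this, Prod.fst_add, add_zero]

lemma hasDerivAt_potential {η : SpaceTime d → E}
    (hη : ContDiff ℝ ((⊤ : ℕ∞) : WithTop ℕ∞) η) (hp : SpacePeriodic η) {b : ℝ} (hb : 0 < b)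
    (y : SpaceTime d) :
    HasDerivAt (fun b => potential η b y) (potentialDeriv η b y) b := by
  unfold potential potentialDeriv
  have hc : Continuous (sderiv η) := (contDiff_sderiv hη).continuous
  obtain ⟨B, hB0, hB⟩ := hp.sderiv.exists_bound hc 0 (max y.1 0)
  obtain ⟨B', hB0', hB'⟩ := hp.exists_bound hη.continuous 0 (max y.1 0)
  have hk (b' : ℝ) : Continuous fun q : ℝ × Space d =>
      gauss q.2 • sderiv η (selfSimilarPoint b' y q) q.2 :=
    (continuous_gauss.comp (by fun_prop)).smul
      ((hc.comp (continuous_selfSimilarPoint.comp (Continuous.prodMk_right (b', y)))).clm_apply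
        (by fun_prop))
  have hk' (b' : ℝ) : Continuous fun q : ℝ × Space d => gauss q.2 • η (selfSimilarPoint b' y q) :=
    (continuous_gauss.comp (by fun_prop)).smul
      (hη.continuous.comp (continuous_selfSimilarPoint.comp (Continuous.prodMk_right (b', y))))
  refine HasDerivAt.const_smul _ (hasDerivAt_integral_of_dominated_loc_of_deriv_le
    (s := Ioi (b / 2))
    (bound := fun q => (1 / (2 * √(b / 2)) * √(max y.1 0) * B) * (gauss q.2 * ‖q.2‖))
    (F := fun b q => gauss q.2 • η (selfSimilarPoint b y q))
    (F' := fun b q => (-(1 / (2 * √b)) * √(max y.1 0 * (1 - q.1))) •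
      (gauss q.2 • sderiv η (selfSimilarPoint b y q) q.2))
    (Ioi_mem_nhds (by linarith)) ?_ ?_ ?_ ?_ ?_ ?_).2
  · exact Eventually.of_forall fun b' => (hk' b').aestronglyMeasurable
  · refine ((integrable_weight integrable_gauss).mul_const B').mono'
      (hk' b).aestronglyMeasurable ?_
    filter_upwards [ae_selfSimilarMeasure] with q hq
    rw [norm_smul, Real.norm_of_nonneg (gauss_nonneg _)]
    exact mul_le_mul_of_nonneg_left (hB' _ (selfSimilarPoint_time hq le_rfl)) (gauss_nonneg _)
  · exact (Continuous.smul (by fun_prop) (hk b)).aestronglyMeasurable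
  · filter_upwards [ae_selfSimilarMeasure] with q hq b' hb'
    exact norm_dpotential_integrand_le hq le_rfl (by linarith) (le_of_lt hb') hB
  · exact (integrable_weight integrable_gauss_mul_norm).const_mul _
  · refine Eventually.of_forall fun q b' hb' => ?_
    have hb'0 : 0 < b' := lt_trans (by linarith) hb'
    have h1 : HasDerivAt (fun b : ℝ => y.2 - (√b * √(max y.1 0 * (1 - q.1))) • q.2)
        (-((1 / (2 * √b') * √(max y.1 0 * (1 - q.1))) • q.2)) b' :=
      (((Real.hasDerivAt_sqrt hb'0.ne').mul_const _).smul_const q.2).const_sub y.2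
    have h2 := (hasFDerivAt_sderiv (hη.differentiable (by simp)) (max y.1 0 * q.1)
      (y.2 - (√b' * √(max y.1 0 * (1 - q.1))) • q.2)).comp_hasDerivAt b' h1
    have h3 := h2.const_smul (gauss q.2)
    refine h3.congr_deriv ?_
    rw [map_neg, map_smul, smul_neg, smul_comm, neg_mul, neg_smul]
    rfl

lemma hasFDerivAt_potential {η : SpaceTime d → E}
    (hη : ContDiff ℝ ((⊤ : ℕ∞) : WithTop ℕ∞) η) (hp : SpacePeriodic η) (b s : ℝ) (x : Space d) :
    HasFDerivAt (fun x => potential η b (s, x)) (potential (sderiv η) b (s, x)) x := by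
  unfold potential
  have hc : Continuous (sderiv η) := (contDiff_sderiv hη).continuous
  obtain ⟨B, hB0, hB⟩ := hp.sderiv.exists_bound hc 0 (max s 0)
  obtain ⟨B', hB0', hB'⟩ := hp.exists_bound hη.continuous 0 (max s 0)
  have hk (x' : Space d) : Continuous fun q : ℝ × Space d =>
      gauss q.2 • sderiv η (selfSimilarPoint b (s, x') q) :=
    (continuous_gauss.comp (by fun_prop)).smul
      (hc.comp (continuous_selfSimilarPoint.comp (Continuous.prodMk_right (b, (s, x')))))
  have hk' (x' : Space d) : Continuous fun q : ℝ × Space d =>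
      gauss q.2 • η (selfSimilarPoint b (s, x') q) :=
    (continuous_gauss.comp (by fun_prop)).smul
      (hη.continuous.comp (continuous_selfSimilarPoint.comp (Continuous.prodMk_right (b, (s, x')))))
  refine HasFDerivAt.const_smul (c := max s 0) (hasFDerivAt_integral_of_dominated_of_fderiv_le
    (s := univ) (bound := fun q => gauss q.2 * B)
    (F := fun x q => gauss q.2 • η (selfSimilarPoint b (s, x) q))
    (F' := fun x q => gauss q.2 • sderiv η (selfSimilarPoint b (s, x) q))
    univ_mem ?_ ?_ ?_ ?_ ?_ ?_)
  · exact Eventually.of_forall fun b' => (hk' b').aestronglyMeasurable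
  · refine ((integrable_weight integrable_gauss).mul_const B').mono'
      (hk' x).aestronglyMeasurable ?_
    filter_upwards [ae_selfSimilarMeasure] with q hq
    rw [norm_smul, Real.norm_of_nonneg (gauss_nonneg _)]
    exact mul_le_mul_of_nonneg_left (hB' _ (selfSimilarPoint_time hq le_rfl)) (gauss_nonneg _)
  · exact (hk x).aestronglyMeasurable
  · filter_upwards [ae_selfSimilarMeasure] with q hq x' _
    rw [norm_smul, Real.norm_of_nonneg (gauss_nonneg _)]
    exact mul_le_mul_of_nonneg_left (hB _ (selfSimilarPoint_time hq le_rfl)) (gauss_nonneg _)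
  · exact (integrable_weight integrable_gauss).mul_const B
  · refine Eventually.of_forall fun q x' _ => HasFDerivAt.const_smul ?_ _
    have h1 : HasFDerivAt (fun x : Space d => x - (√b * √(max s 0 * (1 - q.1))) • q.2)
        (ContinuousLinearMap.id ℝ (Space d)) x' := (hasFDerivAt_id x').sub_const _
    have h2 := (hasFDerivAt_sderiv (hη.differentiable (by simp)) (max s 0 * q.1)
      (x' - (√b * √(max s 0 * (1 - q.1))) • q.2)).comp x' h1
    rwa [ContinuousLinearMap.comp_id] at h2

end Potential

/-! ### The model in terms of the heat potential -/

/-- Parabolic rescaling turns the heat kernel at time `θ ^ 2` into the fixed Gaussian `gauss`. -/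
lemma heatKernel_scale {θ : ℝ} (hθ : 0 < θ) (w : Space d) :
    θ ^ d * heatKernel (θ ^ 2) (θ • w) = gauss w := by
  rw [gauss_eq, heatKernel, if_pos (by positivity), norm_smul, Real.norm_of_nonneg hθ.le,
    Real.mul_rpow (by positivity) (by positivity)]
  have h1 : (θ ^ 2) ^ (-(d : ℝ) / 2) = (θ ^ d)⁻¹ := by
    rw [← Real.rpow_natCast θ 2, ← Real.rpow_mul hθ.le, ← Real.rpow_natCast θ d,
      ← Real.rpow_neg hθ.le]
    congr 1; push_cast; ring
  have h2 : -(θ * ‖w‖) ^ 2 / (4 * θ ^ 2) = -(1 / 4) * ‖w‖ ^ 2 := by field_simp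
  rw [h1, h2]
  field_simp

lemma measurable_dilatedKernel (b : ℝ) : Measurable (dilatedKernel (d := d) b) := by
  unfold dilatedKernel heatKernel
  refine Measurable.ite (measurableSet_lt measurable_const (by fun_prop)) ?_ measurable_const
  fun_prop

/-- Convolution with the heat kernel in rescaled position. -/
lemma dilatedKernel_scale {b s : ℝ} (hb : 0 < b) (hs : 0 < s) (η : Space d → ℝ) (x : Space d) :
    ∫ v, dilatedKernel b (s, x - v) * η v = ∫ w, gauss w * η (x - (√b * √s) • w) := by
  have hθ : 0 < √b * √s := by have := Real.sqrt_pos.2 hb; have := Real.sqrt_pos.2 hs; positivity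
  have hθ2 : (√b * √s) ^ 2 = b * s := by rw [mul_pow, Real.sq_sqrt hb.le, Real.sq_sqrt hs.le]
  have e1 := integral_sub_left_eq_self (fun v => dilatedKernel b (s, v) * η (x - v)) volume x
  simp only [sub_sub_cancel] at e1
  have e2 := Measure.integral_comp_smul volume
    (fun v : Space d => dilatedKernel b (s, v) * η (x - v)) (√b * √s)
  rw [finrank_euclideanSpace_fin, abs_of_pos (by positivity), smul_eq_mul] at e2
  rw [e1, ← mul_inv_cancel_left₀ (pow_pos hθ d).ne' (∫ v, dilatedKernel b (s, v) * η (x - v)), ← e2,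
    ← integral_const_mul]
  refine integral_congr_ae (Eventually.of_forall fun w => ?_)
  simp only
  rw [← mul_assoc, dilatedKernel, ← hθ2, heatKernel_scale hθ]

lemma integrable_dilatedKernel {b s : ℝ} (hb : 0 < b) (hs : 0 < s) (x : Space d) :
    Integrable (fun v => dilatedKernel b (s, x - v)) := by
  have hθ : 0 < √b * √s := by have := Real.sqrt_pos.2 hb; have := Real.sqrt_pos.2 hs; positivity
  have hθ2 : (√b * √s) ^ 2 = b * s := by rw [mul_pow, Real.sq_sqrt hb.le, Real.sq_sqrt hs.le]
  refine Integrable.comp_sub_left (f := fun v => dilatedKernel b (s, v)) ?_ x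
  rw [← integrable_comp_smul_iff volume _ hθ.ne']
  have : (fun w : Space d => dilatedKernel b (s, (√b * √s) • w)) =
      fun w => ((√b * √s) ^ d)⁻¹ * gauss w := by
    ext w
    rw [dilatedKernel, ← hθ2, ← heatKernel_scale hθ, inv_mul_cancel_left₀ (pow_pos hθ d).ne']
  rw [this]
  exact integrable_gauss.const_mul _

lemma dilatedKernel_nonneg (b : ℝ) (z : SpaceTime d) : 0 ≤ dilatedKernel b z := by
  unfold dilatedKernel heatKernel
  split_ifs with h
  · positivity
  · exact le_rfl

lemma dilatedKernel_of_nonpos {b : ℝ} (hb : 0 < b) {z : SpaceTime d} (hz : z.1 ≤ 0) :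
    dilatedKernel b z = 0 := by
  unfold dilatedKernel heatKernel
  rw [if_neg]
  exact not_lt.2 (mul_nonpos_of_nonneg_of_nonpos hb.le hz)

lemma restrict_pos_time : (volume : Measure (SpaceTime d)).restrict {z | 0 < z.1} =
    (volume.restrict (Ioi (0 : ℝ))).prod volume := by
  have h : {z : SpaceTime d | 0 < z.1} = Ioi (0 : ℝ) ×ˢ univ := by ext z; simp
  rw [h, Measure.volume_eq_prod, ← Measure.prod_restrict, Measure.restrict_univ]

section

variable {ξ : SpaceTime d → ℝ}

lemma integrable_kernel_mul (hc : Continuous ξ) (hp : SpacePeriodic ξ) {b : ℝ} (hb : 0 < b)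
    (y : SpaceTime d) :
    Integrable (fun z : SpaceTime d => dilatedKernel b (y - z) * ξ z)
      ((volume.restrict (Ioi (0 : ℝ))).prod volume) := by
  obtain ⟨B, hB0, hB⟩ := hp.exists_bound hc 0 y.1
  have hm : Measurable fun z : SpaceTime d => dilatedKernel b (y - z) * ξ z :=
    ((measurable_dilatedKernel b).comp (measurable_const.sub measurable_id)).mul hc.measurable
  -- earlier times contribute at most the kernel times a bound on `ξ`, later ones nothing
  have hbound : ∀ r, 0 < r → r < y.1 → ∀ v : Space d,
      ‖dilatedKernel b (y - (r, v)) * ξ (r, v)‖ ≤ dilatedKernel b (y.1 - r, y.2 - v) * B := by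
    intro r h0 h1 v
    rw [norm_mul, Real.norm_of_nonneg (dilatedKernel_nonneg _ _)]
    exact mul_le_mul_of_nonneg_left (hB (r, v) ⟨h0.le, h1.le⟩) (dilatedKernel_nonneg _ _)
  have hzero : ∀ r, y.1 ≤ r → ∀ v : Space d, dilatedKernel b (y - (r, v)) * ξ (r, v) = 0 := by
    intro r h v
    rw [dilatedKernel_of_nonpos hb, zero_mul]
    simpa using h
  rw [integrable_prod_iff hm.aestronglyMeasurable]
  constructor
  · filter_upwards [ae_restrict_mem measurableSet_Ioi] with r hr
    rcases lt_or_ge r y.1 with h | h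
    · exact ((integrable_dilatedKernel hb (sub_pos.2 h) y.2).mul_const B).mono'
        (hm.comp measurable_prodMk_left).aestronglyMeasurable
        (Eventually.of_forall (hbound r hr h))
    · simp only [hzero r h]
      exact integrable_zero _ _ _
  · have hi : Integrable (fun r => (Iio y.1).indicator (fun _ => (∫ w : Space d, gauss w) * B) r)
        (volume.restrict (Ioi (0 : ℝ))) := by
      rw [integrable_indicator_iff measurableSet_Iio, IntegrableOn,
        Measure.restrict_restrict measurableSet_Iio, Iio_inter_Ioi]
      exact integrable_const _
    refine hi.mono' (hm.norm.aestronglyMeasurable.integral_prod_right') ?_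
    filter_upwards [ae_restrict_mem measurableSet_Ioi] with r hr
    rw [Real.norm_of_nonneg (integral_nonneg fun _ => norm_nonneg _)]
    rcases lt_or_ge r y.1 with h | h
    · rw [indicator_of_mem (by exact h)]
      have e := dilatedKernel_scale hb (sub_pos.2 h) (fun _ => B) y.2
      rw [integral_mul_const, integral_mul_const] at e
      rw [← e, ← integral_mul_const]
      exact integral_mono_of_nonneg (Eventually.of_forall fun _ => norm_nonneg _)
        ((integrable_dilatedKernel hb (sub_pos.2 h) y.2).mul_const B)
        (Eventually.of_forall (hbound r hr h))
    · rw [indicator_of_notMem (by simpa using h)]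
      simp [hzero r h]

/-- The space-time convolution of the heat kernel with `ξ`, restricted to positive times, is the
heat potential of `ξ`: the position is rescaled by the standard deviation of the kernel, and the
time by the time `y.1` elapsed. -/
lemma integral_kernel_mul (hc : Continuous ξ) (hp : SpacePeriodic ξ) {b : ℝ} (hb : 0 < b)
    (y : SpaceTime d) :
    ∫ z in {z : SpaceTime d | 0 < z.1}, dilatedKernel b (y - z) * ξ z = potential ξ b y := by
  rw [restrict_pos_time, integral_prod _ (integrable_kernel_mul hc hp hb y)]
  have hin : ∀ r, ∫ v, dilatedKernel b (y - (r, v)) * ξ (r, v) =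
      (Iio y.1).indicator (fun r => ∫ w, gauss w * ξ (r, y.2 - (√b * √(y.1 - r)) • w)) r := by
    intro r
    rcases lt_or_ge r y.1 with h | h
    · rw [indicator_of_mem (by exact h)]
      exact dilatedKernel_scale hb (sub_pos.2 h) (fun v => ξ (r, v)) y.2
    · rw [indicator_of_notMem (by simpa using h), ← integral_zero (Space d) ℝ]
      refine integral_congr_ae (Eventually.of_forall fun v => ?_)
      simp only
      rw [dilatedKernel_of_nonpos hb (by simpa using h), zero_mul]
  simp_rw [hin]
  rw [integral_indicator measurableSet_Iio, Measure.restrict_restrict measurableSet_Iio,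
    Iio_inter_Ioi, potential]
  rcases le_or_gt y.1 0 with h | h
  · rw [Ioo_eq_empty (not_lt.2 h), max_eq_right h]
    simp
  · obtain ⟨B, hB0, hB⟩ := hp.exists_bound hc 0 (max y.1 0)
    rw [max_eq_left h.le, selfSimilarMeasure, integral_prod, ← integral_Ioc_eq_integral_Ioo,
      ← intervalIntegral.integral_of_le h.le, integral_Icc_eq_integral_Ioc,
      ← intervalIntegral.integral_of_le zero_le_one]
    · have e := intervalIntegral.mul_integral_comp_mul_left (a := 0) (b := 1)
        (f := fun r => ∫ w, gauss w * ξ (r, y.2 - (√b * √(y.1 - r)) • w)) y.1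
      rw [mul_zero, mul_one] at e
      rw [← e, smul_eq_mul]
      congr 1
      refine intervalIntegral.integral_congr fun q _ => ?_
      simp only [selfSimilarPoint, max_eq_left h.le, smul_eq_mul]
      rw [mul_sub, mul_one]
    · refine ((integrable_weight (d := d) integrable_gauss).mul_const B).mono' ?_ ?_
      · refine Continuous.aestronglyMeasurable ?_
        exact (continuous_gauss.comp (by fun_prop)).smul
          (hc.comp (continuous_selfSimilarPoint.comp (Continuous.prodMk_right (b, y))))
      · filter_upwards [ae_selfSimilarMeasure] with q hq
        rw [norm_smul, Real.norm_of_nonneg (gauss_nonneg _)]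
        exact mul_le_mul_of_nonneg_left (hB _ (selfSimilarPoint_time hq le_rfl)) (gauss_nonneg _)

/-- The model of the integrated noise is an increment of the heat potential. Its two kernels can be
integrated separately because only positive times contribute. -/
lemma lolly_eq (hc : Continuous ξ) (hp : SpacePeriodic ξ) {b : ℝ} (hb : 0 < b)
    (x y : SpaceTime d) : lolly ξ b x y = potential ξ b y - potential ξ b x := by
  have h (y : SpaceTime d) : Integrable (fun z : SpaceTime d => dilatedKernel b (y - z) * ξ z)
      ((volume : Measure (SpaceTime d)).restrict {z | 0 < z.1}) := by
    rw [restrict_pos_time]; exact integrable_kernel_mul hc hp hb y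
  unfold lolly
  simp_rw [sub_mul]
  rw [integral_sub (h y) (h x), integral_kernel_mul hc hp hb, integral_kernel_mul hc hp hb]

/-- The spatial gradient of the heat potential. -/
noncomputable def gradPotential (ξ : SpaceTime d → ℝ) (b : ℝ) (y : SpaceTime d) : Space d :=
  (InnerProductSpace.toDual ℝ (Space d)).symm (potential (sderiv ξ) b y)

lemma hasGradientAt_potential (hξ : ContDiff ℝ ((⊤ : ℕ∞) : WithTop ℕ∞) ξ) (hp : SpacePeriodic ξ)
    (b s : ℝ) (x : Space d) :
    HasGradientAt (fun x => potential ξ b (s, x)) (gradPotential ξ b (s, x)) x := by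
  rw [hasGradientAt_iff_hasFDerivAt, gradPotential, LinearIsometryEquiv.apply_symm_apply]
  exact hasFDerivAt_potential hξ hp b s x

lemma gradLolly_eq (hξ : ContDiff ℝ ((⊤ : ℕ∞) : WithTop ℕ∞) ξ) (hp : SpacePeriodic ξ)
    {b : ℝ} (hb : 0 < b) (x y : SpaceTime d) : gradLolly ξ b x y = gradPotential ξ b y := by
  unfold gradLolly
  simp_rw [lolly_eq hξ.continuous hp hb]
  refine HasGradientAt.gradient ?_
  rw [hasGradientAt_iff_hasFDerivAt]
  exact (hasGradientAt_iff_hasFDerivAt.1 (hasGradientAt_potential hξ hp b y.1 y.2)).sub_const _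

lemma continuous_gradPotential (hξ : ContDiff ℝ ((⊤ : ℕ∞) : WithTop ℕ∞) ξ) (hp : SpacePeriodic ξ) :
    Continuous fun p : ℝ × SpaceTime d => gradPotential ξ p.1 p.2 :=
  (InnerProductSpace.toDual ℝ (Space d)).symm.continuous.comp
    (continuous_potential (contDiff_sderiv hξ).continuous hp.sderiv)

lemma gradPotential_periodic (hp : SpacePeriodic ξ) (b : ℝ) :
    SpacePeriodic (gradPotential ξ b) := by
  intro k y
  rw [gradPotential, gradPotential, potential_add_latticeVec hp.sderiv b k y]

/-- The derivative of `gradPotential ξ b y` in `b`. -/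
noncomputable def gradPotentialDeriv (ξ : SpaceTime d → ℝ) (b : ℝ) (y : SpaceTime d) : Space d :=
  (InnerProductSpace.toDual ℝ (Space d)).symm (potentialDeriv (sderiv ξ) b y)

lemma hasDerivAt_gradPotential (hξ : ContDiff ℝ ((⊤ : ℕ∞) : WithTop ℕ∞) ξ) (hp : SpacePeriodic ξ)
    {b : ℝ} (hb : 0 < b) (y : SpaceTime d) :
    HasDerivAt (fun b => gradPotential ξ b y) (gradPotentialDeriv ξ b y) b := by
  have h := hasDerivAt_potential (contDiff_sderiv hξ) hp.sderiv hb y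
  exact ((InnerProductSpace.toDual ℝ (Space d)).symm.toContinuousLinearEquiv.hasFDerivAt
    (x := potential (sderiv ξ) b y)).comp_hasDerivAt b h

lemma continuousAt_gradPotentialDeriv (hξ : ContDiff ℝ ((⊤ : ℕ∞) : WithTop ℕ∞) ξ)
    (hp : SpacePeriodic ξ) {p₀ : ℝ × SpaceTime d} (hb : 0 < p₀.1) :
    ContinuousAt (fun p : ℝ × SpaceTime d => gradPotentialDeriv ξ p.1 p.2) p₀ :=
  (InnerProductSpace.toDual ℝ (Space d)).symm.continuous.continuousAt.comp
    (continuousAt_potentialDeriv (contDiff_sderiv hξ) hp.sderiv hb)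

end

/-! ### Classical solutions, extended to all times -/

/-- The projection of a time to `[0,T]`. -/
noncomputable def clampTime (T t : ℝ) : ℝ := max 0 (min T t)

lemma clampTime_mem {T : ℝ} (hT : 0 ≤ T) (t : ℝ) : clampTime T t ∈ Icc 0 T :=
  ⟨le_max_left _ _, max_le hT (min_le_left _ _)⟩

lemma clampTime_of_mem {T t : ℝ} (ht : t ∈ Icc 0 T) : clampTime T t = t := by
  rw [clampTime, min_eq_right ht.2, max_eq_right ht.1]

lemma continuous_clampTime (T : ℝ) : Continuous (clampTime T) := by
  unfold clampTime; fun_prop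

/-- The function `u`, made constant in time outside of `[0,T]`. -/
noncomputable def extend (T : ℝ) (u : SpaceTime d → ℝ) (z : SpaceTime d) : ℝ :=
  u (clampTime T z.1, z.2)

lemma extend_of_mem {T : ℝ} {u : SpaceTime d → ℝ} {z : SpaceTime d} (hz : z.1 ∈ Icc 0 T) :
    extend T u z = u z := by
  rw [extend, clampTime_of_mem hz]

/-- The spatial derivative of `extend T u`. -/
noncomputable def extendD (T : ℝ) (u : SpaceTime d → ℝ) (z : SpaceTime d) : Space d →L[ℝ] ℝ :=
  fderiv ℝ (fun x => u (clampTime T z.1, x)) z.2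

/-- The second spatial derivative of `extend T u`. -/
noncomputable def extendDD (T : ℝ) (u : SpaceTime d → ℝ) (z : SpaceTime d) :
    Space d →L[ℝ] Space d →L[ℝ] ℝ :=
  fderiv ℝ (fderiv ℝ fun x => u (clampTime T z.1, x)) z.2

/-- The spatial gradient of `extend T u`. -/
noncomputable def extendGrad (T : ℝ) (u : SpaceTime d → ℝ) (z : SpaceTime d) : Space d :=
  (InnerProductSpace.toDual ℝ (Space d)).symm (extendD T u z)

lemma extendGrad_apply (T : ℝ) (u : SpaceTime d → ℝ) (z : SpaceTime d) (i : Fin d) :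
    extendGrad T u z i = extendD T u z (EuclideanSpace.single i 1) := by
  have h := InnerProductSpace.toDual_symm_apply (𝕜 := ℝ) (x := EuclideanSpace.single i (1 : ℝ))
    (y := extendD T u z)
  rw [← h, EuclideanSpace.inner_single_right]
  simp [extendGrad]

lemma norm_extendGrad_sq (T : ℝ) (u : SpaceTime d → ℝ) (z : SpaceTime d) :
    ‖extendGrad T u z‖ ^ 2 = ∑ i, extendD T u z (EuclideanSpace.single i 1) ^ 2 := by
  simp [EuclideanSpace.norm_sq_eq, extendGrad_apply]

namespace IsClassicalSolution

variable {T : ℝ} {a σ : ℝ → ℝ} {ξ : SpaceTime d → ℝ} {Cct : ℝ → ℝ} {u₀ : Space d → ℝ}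
  {u : SpaceTime d → ℝ}

lemma continuous_iteratedFDeriv (hu : IsClassicalSolution T a σ ξ Cct u₀ u) (hT : 0 ≤ T) {k : ℕ}
    (hk : k ≤ 2) : Continuous fun z : SpaceTime d =>
      iteratedFDeriv ℝ k (fun x => u (clampTime T z.1, x)) z.2 := by
  have h := (hu.continuousOn k hk).comp_continuous
    (f := fun z : SpaceTime d => (clampTime T z.1, z.2))
    (((continuous_clampTime T).comp continuous_fst).prodMk continuous_snd)
    (fun z => ⟨clampTime_mem hT _, mem_univ _⟩)
  exact h

lemma continuous_extend (hu : IsClassicalSolution T a σ ξ Cct u₀ u) (hT : 0 ≤ T) :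
    Continuous (extend T u) := by
  have h := hu.continuous_iteratedFDeriv hT (k := 0) (by norm_num)
  have h2 : Continuous fun z : SpaceTime d =>
      iteratedFDeriv ℝ 0 (fun x => u (clampTime T z.1, x)) z.2 0 :=
    (ContinuousMultilinearMap.apply ℝ (fun _ : Fin 0 => Space d) ℝ 0).continuous.comp h
  simp only [iteratedFDeriv_zero_apply] at h2
  exact h2

lemma continuous_extendD (hu : IsClassicalSolution T a σ ξ Cct u₀ u) (hT : 0 ≤ T) :
    Continuous (extendD T u) := by
  have h := hu.continuous_iteratedFDeriv hT (k := 1) (by norm_num)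
  refine continuous_clm_apply.2 fun v => ?_
  have h2 : Continuous fun z : SpaceTime d =>
      iteratedFDeriv ℝ 1 (fun x => u (clampTime T z.1, x)) z.2 (fun _ => v) :=
    (ContinuousMultilinearMap.apply ℝ (fun _ : Fin 1 => Space d) ℝ (fun _ => v)).continuous.comp h
  simp only [iteratedFDeriv_one_apply] at h2
  exact h2

lemma continuous_extendDD (hu : IsClassicalSolution T a σ ξ Cct u₀ u) (hT : 0 ≤ T) :
    Continuous (extendDD T u) := by
  have h := hu.continuous_iteratedFDeriv hT (k := 2) le_rfl
  refine continuous_clm_apply.2 fun v => continuous_clm_apply.2 fun w => ?_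
  have h2 : Continuous fun z : SpaceTime d =>
      iteratedFDeriv ℝ 2 (fun x => u (clampTime T z.1, x)) z.2 ![v, w] :=
    (ContinuousMultilinearMap.apply ℝ (fun _ : Fin 2 => Space d) ℝ ![v, w]).continuous.comp h
  simp only [iteratedFDeriv_two_apply] at h2
  exact h2

lemma continuous_extendGrad (hu : IsClassicalSolution T a σ ξ Cct u₀ u) (hT : 0 ≤ T) :
    Continuous (extendGrad T u) :=
  (InnerProductSpace.toDual ℝ (Space d)).symm.continuous.comp (hu.continuous_extendD hT)

lemma extend_periodic (hu : IsClassicalSolution T a σ ξ Cct u₀ u) (hT : 0 ≤ T) :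
    SpacePeriodic (extend T u) := by
  intro k z
  have := hu.periodic _ (clampTime_mem hT z.1) k z.2
  simpa [extend, latticeVec] using this

lemma slice_add (hu : IsClassicalSolution T a σ ξ Cct u₀ u) (hT : 0 ≤ T) (k : Fin d → ℤ) (t : ℝ) :
    (fun x => u (clampTime T t, x + latticeVec k)) = fun x => u (clampTime T t, x) :=
  funext fun x => hu.periodic _ (clampTime_mem hT t) k x

lemma extendD_periodic (hu : IsClassicalSolution T a σ ξ Cct u₀ u) (hT : 0 ≤ T) :
    SpacePeriodic (extendD T u) := by
  intro k z
  unfold extendD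
  rw [Prod.snd_add, ← fderiv_comp_add_right, Prod.fst_add, add_zero, hu.slice_add hT]

lemma extendDD_periodic (hu : IsClassicalSolution T a σ ξ Cct u₀ u) (hT : 0 ≤ T) :
    SpacePeriodic (extendDD T u) := by
  intro k z
  unfold extendDD
  rw [Prod.snd_add, ← fderiv_comp_add_right, Prod.fst_add, add_zero]
  simp_rw [← fderiv_comp_add_right]
  rw [hu.slice_add hT]

lemma extendGrad_periodic (hu : IsClassicalSolution T a σ ξ Cct u₀ u) (hT : 0 ≤ T) :
    SpacePeriodic (extendGrad T u) := by
  intro k z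
  rw [extendGrad, extendGrad, hu.extendD_periodic hT k z]

lemma hasFDerivAt_extend (hu : IsClassicalSolution T a σ ξ Cct u₀ u) (hT : 0 ≤ T) (t : ℝ)
    (x : Space d) : HasFDerivAt (fun x => extend T u (t, x)) (extendD T u (t, x)) x :=
  ((hu.contDiff _ (clampTime_mem hT t)).differentiable (by norm_num) x).hasFDerivAt

lemma hasFDerivAt_extendD (hu : IsClassicalSolution T a σ ξ Cct u₀ u) (hT : 0 ≤ T) (t : ℝ)
    (x : Space d) : HasFDerivAt (fun x => extendD T u (t, x)) (extendDD T u (t, x)) x := by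
  have h : ContDiff ℝ 1 (fderiv ℝ fun x => u (clampTime T t, x)) :=
    (hu.contDiff _ (clampTime_mem hT t)).fderiv_right (by norm_num)
  exact (h.differentiable (by norm_num) x).hasFDerivAt

/-- The modelledness derivative in terms of the gradients of the solution and of the heat
potential. -/
lemma nu_eq (hu : IsClassicalSolution T a σ ξ Cct u₀ u) (ha : ∀ v, 0 < a v)
    (hξ : ContDiff ℝ ((⊤ : ℕ∞) : WithTop ℕ∞) ξ) (hp : SpacePeriodic ξ) {z : SpaceTime d}
    (hz : z.1 ∈ Icc 0 T) :
    nu a σ ξ u z = extendGrad T u z -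
      σ (extend T u z) • gradPotential ξ (a (extend T u z)) z := by
  have hT : 0 ≤ T := hz.1.trans hz.2
  unfold nu
  refine HasGradientAt.gradient ?_
  rw [hasGradientAt_iff_hasFDerivAt, extend_of_mem hz]
  simp_rw [lolly_eq hξ.continuous hp (ha _)]
  have h1 := hu.hasFDerivAt_extend hT z.1 z.2
  have h2 := hasGradientAt_iff_hasFDerivAt.1 (hasGradientAt_potential hξ hp (a (u z)) z.1 z.2)
  have e : (fun x => extend T u (z.1, x)) = fun x => u (z.1, x) :=
    funext fun x => extend_of_mem (z := (z.1, x)) hz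
  rw [e] at h1
  have h3 := (h1.sub_const (u z)).sub ((h2.sub_const (potential ξ (a (u z)) z)).const_mul (σ (u z)))
  refine h3.congr_fderiv ?_
  rw [map_sub, map_smul, extendGrad, LinearIsometryEquiv.apply_symm_apply]

/-- The diffusion term of the equation in terms of the derivatives of the solution. -/
noncomputable def _root_.SPM.diffusion (T : ℝ) (a : ℝ → ℝ) (u : SpaceTime d → ℝ)
    (z : SpaceTime d) : ℝ :=
  ∑ i, (deriv a (extend T u z) * extendD T u z (EuclideanSpace.single i 1) ^ 2 +
    a (extend T u z) *
      extendDD T u z (EuclideanSpace.single i 1) (EuclideanSpace.single i 1))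

/-- The divergence in the equation, by the product rule. -/
lemma divergence_eq (hu : IsClassicalSolution T a σ ξ Cct u₀ u) (haC : ContDiff ℝ 2 a)
    {z : SpaceTime d} (hz : z.1 ∈ Icc 0 T) :
    divergence (fun w => a (u (z.1, w)) • gradient (fun w' => u (z.1, w')) w) z.2 =
      diffusion T a u z := by
  have hT : 0 ≤ T := hz.1.trans hz.2
  have e : ∀ x, u (z.1, x) = extend T u (z.1, x) :=
    fun x => (extend_of_mem (z := (z.1, x)) hz).symm
  unfold divergence diffusion
  refine Finset.sum_congr rfl fun i _ => ?_
  have e2 : (fun w => (a (u (z.1, w)) • gradient (fun w' => u (z.1, w')) w) i) =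
      fun w => a (extend T u (z.1, w)) * extendD T u (z.1, w) (EuclideanSpace.single i 1) := by
    ext w
    rw [← extendGrad_apply, PiLp.smul_apply, smul_eq_mul, e w, extendGrad, extendD, gradient]
    simp only [clampTime_of_mem hz]
  have h1 := hu.hasFDerivAt_extend hT z.1 z.2
  have h2 := (hu.hasFDerivAt_extendD hT z.1 z.2).clm_apply
    (hasFDerivAt_const (EuclideanSpace.single i (1 : ℝ)) z.2)
  have h3 := ((haC.differentiable (by norm_num)) (extend T u z)).hasDerivAt.comp_hasFDerivAt z.2 h1
  have h4 := h3.mul h2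
  rw [e2]
  have := h4.fderiv
  erw [this]
  simp only [Function.comp, add_apply, smul_apply,
    ContinuousLinearMap.comp_apply, ContinuousLinearMap.flip_apply, smul_eq_mul,
    zero_apply, map_zero, zero_add, Prod.mk.eta]
  ring

lemma continuous_diffusion (hu : IsClassicalSolution T a σ ξ Cct u₀ u) (hT : 0 ≤ T)
    (haC : ContDiff ℝ 2 a) : Continuous (diffusion T a u) := by
  have h0 := hu.continuous_extend hT
  have h1 := hu.continuous_extendD hT
  have h2 := hu.continuous_extendDD hT
  have ha := haC.continuous
  have ha' : Continuous (deriv a) := haC.continuous_deriv (by norm_num)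
  unfold diffusion
  refine continuous_finsetSum _ fun i _ => ?_
  exact ((ha'.comp h0).mul ((h1.clm_apply continuous_const).pow 2)).add
    ((ha.comp h0).mul ((h2.clm_apply continuous_const).clm_apply continuous_const))

/-- Integration by parts of the diffusion term against a function of the solution. -/
lemma integral_mul_diffusion (hu : IsClassicalSolution T a σ ξ Cct u₀ u) (hT : 0 ≤ T)
    (haC : ContDiff ℝ 2 a) {γ γ' : ℝ → ℝ} (hγ : ∀ v, HasDerivAt γ (γ' v) v)
    (hγ' : Continuous γ') :
    ∫ z in Icc 0 T ×ˢ cube d, γ (extend T u z) * diffusion T a u z =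
      -∫ z in Icc 0 T ×ˢ cube d,
        γ' (extend T u z) * a (extend T u z) * ‖extendGrad T u z‖ ^ 2 := by
  have h0 := hu.continuous_extend hT
  have h1 := hu.continuous_extendD hT
  have h2 := hu.continuous_extendDD hT
  have p0 := hu.extend_periodic hT
  have p1 := hu.extendD_periodic hT
  have p2 := hu.extendDD_periodic hT
  have ha := haC.continuous
  have ha' : Continuous (deriv a) := haC.continuous_deriv (by norm_num)
  have hγc : Continuous γ := continuous_iff_continuousAt.2 fun v => (hγ v).continuousAt
  -- each integrand is the `i`-th derivative of the periodic function `γ(u) a(u) ∂ᵢu`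
  have key : ∀ i : Fin d, ∫ z in Icc 0 T ×ˢ cube d,
      (γ' (extend T u z) * a (extend T u z) * extendD T u z (EuclideanSpace.single i 1) ^ 2 +
        γ (extend T u z) * (deriv a (extend T u z) *
          extendD T u z (EuclideanSpace.single i 1) ^ 2 + a (extend T u z) *
          extendDD T u z (EuclideanSpace.single i 1) (EuclideanSpace.single i 1))) = 0 := by
    intro i
    refine integral_prod_cube_deriv_eq_zero
      (f := fun z => γ (extend T u z) * (a (extend T u z) *
        extendD T u z (EuclideanSpace.single i 1)))
      (fun k z => ?_) (fun k z => ?_) ?_ ?_ (EuclideanSpace.single i 1) (fun t x s => ?_) 0 T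
    · simp only [p0 k z, p1 k z]
    · simp only [p0 k z, p1 k z, p2 k z]
    · exact (hγc.comp h0).mul ((ha.comp h0).mul (h1.clm_apply continuous_const))
    · exact (((hγ'.comp h0).mul (ha.comp h0)).mul ((h1.clm_apply continuous_const).pow 2)).add
        ((hγc.comp h0).mul (((ha'.comp h0).mul ((h1.clm_apply continuous_const).pow 2)).add
          ((ha.comp h0).mul ((h2.clm_apply continuous_const).clm_apply continuous_const))))
    · generalize EuclideanSpace.single i (1 : ℝ) = e
      have hl : HasDerivAt (fun s : ℝ => x + s • e) e s := by
        simpa using ((hasDerivAt_id s).smul_const e).const_add x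
      have d0 : HasDerivAt (fun s : ℝ => extend T u (t, x + s • e))
          (extendD T u (t, x + s • e) e) s :=
        HasFDerivAt.comp_hasDerivAt (f := fun s : ℝ => x + s • e) s
          (hu.hasFDerivAt_extend hT t (x + s • e)) hl
      have d1 : HasDerivAt (fun s : ℝ => extendD T u (t, x + s • e) e)
          (extendDD T u (t, x + s • e) e e) s := by
        have h := (hu.hasFDerivAt_extendD hT t (x + s • e)).comp_hasDerivAt s hl
        have h' := h.clm_apply (hasDerivAt_const s e)
        simpa using h'
      have d2 : HasDerivAt (fun s : ℝ => a (extend T u (t, x + s • e)))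
          (deriv a (extend T u (t, x + s • e)) * extendD T u (t, x + s • e) e) s :=
        (haC.differentiable (by norm_num) _).hasDerivAt.comp s d0
      have d3 : HasDerivAt (fun s : ℝ => γ (extend T u (t, x + s • e)))
          (γ' (extend T u (t, x + s • e)) * extendD T u (t, x + s • e) e) s :=
        (hγ _).comp s d0
      exact (d3.mul (d2.mul d1)).congr_deriv (by simp only [Pi.mul_apply]; ring)
  have hint : ∀ i : Fin d, IntegrableOn (fun z =>
      (γ' (extend T u z) * a (extend T u z) * extendD T u z (EuclideanSpace.single i 1) ^ 2 +
        γ (extend T u z) * (deriv a (extend T u z) *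
          extendD T u z (EuclideanSpace.single i 1) ^ 2 + a (extend T u z) *
          extendDD T u z (EuclideanSpace.single i 1) (EuclideanSpace.single i 1))))
      (Icc 0 T ×ˢ cube d) := fun i => integrableOn_prod_cube
    ((((hγ'.comp h0).mul (ha.comp h0)).mul ((h1.clm_apply continuous_const).pow 2)).add
        ((hγc.comp h0).mul (((ha'.comp h0).mul ((h1.clm_apply continuous_const).pow 2)).add
          ((ha.comp h0).mul ((h2.clm_apply continuous_const).clm_apply continuous_const))))) 0 T
  have hsum := integral_finsetSum Finset.univ fun i _ => hint i
  rw [Finset.sum_eq_zero fun i _ => key i] at hsum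
  rw [eq_neg_iff_add_eq_zero, ← integral_add]
  · refine Eq.trans ?_ hsum
    refine integral_congr_ae (Eventually.of_forall fun z => ?_)
    simp only [diffusion, norm_extendGrad_sq, Finset.mul_sum, ← Finset.sum_add_distrib]
    exact Finset.sum_congr rfl fun i _ => by ring
  · exact integrableOn_prod_cube ((hγc.comp h0).mul (hu.continuous_diffusion hT haC)) 0 T
  · exact integrableOn_prod_cube (((hγ'.comp h0).mul (ha.comp h0)).mul
      ((hu.continuous_extendGrad hT).norm.pow 2)) 0 T

/-- The right hand side of the equation. -/
noncomputable def _root_.SPM.reaction (T : ℝ) (a σ : ℝ → ℝ) (ξ : SpaceTime d → ℝ) (Cct : ℝ → ℝ)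
    (u : SpaceTime d → ℝ) (z : SpaceTime d) : ℝ :=
  σ (extend T u z) * ξ z - deriv σ (extend T u z) * σ (extend T u z) * Cct (a (extend T u z))

lemma continuous_reaction (hu : IsClassicalSolution T a σ ξ Cct u₀ u) (hT : 0 ≤ T)
    (haC : ContDiff ℝ 2 a) (ha : ∀ v, 0 < a v) (hσ : ContDiff ℝ 2 σ) (hξ : Continuous ξ)
    (hC : ContinuousOn Cct (Ioi 0)) : Continuous (reaction T a σ ξ Cct u) := by
  have h0 := hu.continuous_extend hT
  have hσ' : Continuous (deriv σ) := hσ.continuous_deriv (by norm_num)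
  exact ((hσ.continuous.comp h0).mul hξ).sub (((hσ'.comp h0).mul (hσ.continuous.comp h0)).mul
    (hC.comp_continuous (haC.continuous.comp h0) fun z => ha _))

/-- The energy identity, with the energy at the final time dropped. -/
lemma energy_le (hu : IsClassicalSolution T a σ ξ Cct u₀ u) (hT : 0 < T)
    (haC : ContDiff ℝ 2 a) (ha : ∀ v, 0 < a v) (hσ : ContDiff ℝ 2 σ) (hξ : Continuous ξ)
    (hC : ContinuousOn Cct (Ioi 0)) {Γ γ γ' : ℝ → ℝ} (hΓ : ∀ v, HasDerivAt Γ (γ v) v)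
    (hγ : ∀ v, HasDerivAt γ (γ' v) v) (hγ' : Continuous γ') (hΓ0 : ∀ v, 0 ≤ Γ v) :
    ∫ z in Icc 0 T ×ˢ cube d, γ' (extend T u z) * a (extend T u z) * ‖extendGrad T u z‖ ^ 2 ≤
      (∫ x in cube d, Γ (u₀ x)) +
        ∫ z in Icc 0 T ×ˢ cube d, γ (extend T u z) * reaction T a σ ξ Cct u z := by
  have h0 := hu.continuous_extend hT.le
  have hγc : Continuous γ := continuous_iff_continuousAt.2 fun v => (hγ v).continuousAt
  have hΓc : Continuous Γ := continuous_iff_continuousAt.2 fun v => (hΓ v).continuousAt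
  have hr := hu.continuous_reaction hT.le haC ha hσ hξ hC
  have hdf := hu.continuous_diffusion hT.le haC
  have hcont : Continuous fun z => γ (extend T u z) *
      (diffusion T a u z + reaction T a σ ξ Cct u z) := (hγc.comp h0).mul (hdf.add hr)
  -- the equation says that `γ(u)` times its right hand side is the time derivative of
  -- `Γ(u)`; for fixed `x` this is integrated in time
  have htime : ∀ x, ∫ t in Icc 0 T, γ (extend T u (t, x)) *
      (diffusion T a u (t, x) + reaction T a σ ξ Cct u (t, x)) =
      Γ (extend T u (T, x)) - Γ (u₀ x) := by
    intro x
    have e0 : u₀ x = extend T u (0, x) := by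
      rw [extend_of_mem (z := (0, x)) ⟨le_rfl, hT.le⟩, hu.initial]
    rw [integral_Icc_eq_integral_Ioc, ← intervalIntegral.integral_of_le hT.le, e0]
    refine intervalIntegral.integral_eq_sub_of_hasDerivAt_of_le hT.le
      (f := fun t => Γ (extend T u (t, x))) ?_ (fun t ht => ?_) ?_
    · exact (hΓc.comp (h0.comp (Continuous.prodMk_left x))).continuousOn
    · have h1 := hu.equation t ht x
      have htI : t ∈ Icc 0 T := Ioo_subset_Icc_self ht
      have e1 := hu.divergence_eq haC (z := (t, x)) htI
      rw [e1] at h1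
      have h2 : HasDerivAt (fun s => extend T u (s, x))
          (diffusion T a u (t, x) + reaction T a σ ξ Cct u (t, x)) t := by
        refine (h1.congr_of_eventuallyEq ?_).congr_deriv ?_
        · filter_upwards [Ioo_mem_nhds ht.1 ht.2] with s hs
          exact extend_of_mem (z := (s, x)) (Ioo_subset_Icc_self hs)
        · rw [reaction, extend_of_mem (z := (t, x)) htI]
          ring
      exact (hΓ _).comp t h2
    · exact Continuous.intervalIntegrable (hcont.comp (Continuous.prodMk_left x)) _ _
  have hint := integrableOn_prod_cube hcont 0 T
  have htot : ∫ z in Icc 0 T ×ˢ cube d, γ (extend T u z) *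
      (diffusion T a u z + reaction T a σ ξ Cct u z) =
      ∫ x in cube d, (Γ (extend T u (T, x)) - Γ (u₀ x)) := by
    rw [IntegrableOn, Measure.volume_eq_prod, ← Measure.prod_restrict] at hint
    rw [Measure.volume_eq_prod, ← Measure.prod_restrict, integral_prod_symm _ hint]
    exact integral_congr_ae (Eventually.of_forall fun x => htime x)
  have hsplit : ∫ z in Icc 0 T ×ˢ cube d, γ (extend T u z) *
      (diffusion T a u z + reaction T a σ ξ Cct u z) =
      (∫ z in Icc 0 T ×ˢ cube d, γ (extend T u z) * diffusion T a u z) +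
      ∫ z in Icc 0 T ×ˢ cube d, γ (extend T u z) * reaction T a σ ξ Cct u z := by
    simp only [mul_add]
    exact integral_add (integrableOn_prod_cube ((hγc.comp h0).mul hdf) 0 T)
      (integrableOn_prod_cube ((hγc.comp h0).mul hr) 0 T)
  rw [hu.integral_mul_diffusion hT.le haC hγ hγ'] at hsplit
  have hu₀c : Continuous u₀ := by
    have : u₀ = fun x => extend T u (0, x) := by
      ext x
      rw [extend_of_mem (z := (0, x)) ⟨le_rfl, hT.le⟩, hu.initial]
    rw [this]
    exact h0.comp (Continuous.prodMk_right 0)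
  have hI : ∀ {φ : Space d → ℝ}, Continuous φ → IntegrableOn φ (cube d) := fun hφ =>
    (hφ.continuousOn.integrableOn_compact isCompact_closedCube).mono_set cube_subset_closedCube
  have hdiff : ∫ x in cube d, (Γ (extend T u (T, x)) - Γ (u₀ x)) =
      (∫ x in cube d, Γ (extend T u (T, x))) - ∫ x in cube d, Γ (u₀ x) :=
    integral_sub (hI (hΓc.comp (h0.comp (Continuous.prodMk_right T)))) (hI (hΓc.comp hu₀c))
  have hpos : 0 ≤ ∫ x in cube d, Γ (extend T u (T, x)) := integral_nonneg fun x => hΓ0 _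
  linarith

end IsClassicalSolution

/-! ### The test function of the energy estimate and its regularization -/

lemma gPrime_nonneg (p v : ℝ) : 0 ≤ gPrime p v := Real.rpow_nonneg (abs_nonneg v) _

lemma g_of_nonneg {p : ℝ} (hp : 1 < p) {v : ℝ} (hv : 0 ≤ v) : g p v = v ^ (p - 1) / (p - 1) := by
  have h1 : g p v = ∫ w in (0 : ℝ)..v, w ^ (p - 2) := by
    refine intervalIntegral.integral_congr fun w hw => ?_
    rw [uIcc_of_le hv] at hw
    simp only [gPrime, abs_of_nonneg hw.1]
  rw [h1, integral_rpow (Or.inl (by linarith)), Real.zero_rpow (by linarith)]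
  rw [show p - 2 + 1 = p - 1 by ring, sub_zero]

lemma g_neg (p v : ℝ) : g p (-v) = -g p v := by
  have h := intervalIntegral.integral_comp_neg (a := 0) (b := v) (gPrime p)
  simp only [gPrime, abs_neg, neg_zero] at h
  unfold g
  simp only [gPrime]
  rw [intervalIntegral.integral_symm, ← h]

lemma g_eq {p : ℝ} (hp : 1 < p) (v : ℝ) :
    g p v = (max v 0) ^ (p - 1) / (p - 1) - (max (-v) 0) ^ (p - 1) / (p - 1) := by
  have h0 : (0 : ℝ) ^ (p - 1) = 0 := Real.zero_rpow (by linarith)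
  rcases le_total 0 v with h | h
  · rw [g_of_nonneg hp h, max_eq_left h, max_eq_right (by linarith), h0]; simp
  · rw [← neg_neg v, g_neg, g_of_nonneg hp (by linarith : 0 ≤ -v), max_eq_right (by linarith),
      neg_neg, max_eq_left (by linarith), h0]; simp

lemma abs_g {p : ℝ} (hp : 1 < p) (v : ℝ) : |g p v| = |v| ^ (p - 1) / (p - 1) := by
  have hp' : 0 < p - 1 := by linarith
  rcases le_total 0 v with h | h
  · rw [g_of_nonneg hp h, abs_of_nonneg h, abs_of_nonneg]
    positivity
  · rw [← neg_neg v, g_neg, abs_neg, abs_neg, g_of_nonneg hp (by linarith : 0 ≤ -v),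
      abs_of_nonneg (by linarith : 0 ≤ -v), abs_of_nonneg]
    have : 0 ≤ -v := by linarith
    positivity

lemma g_zero (p : ℝ) : g p 0 = 0 := by simp [g]

lemma continuous_g {p : ℝ} (hp : 1 < p) : Continuous (g p) := by
  rw [funext (g_eq hp)]
  have hp' : 0 ≤ p - 1 := by linarith
  exact (((continuous_id.max continuous_const).rpow_const fun _ => Or.inr hp').div_const _).sub
    (((continuous_id.neg.max continuous_const).rpow_const fun _ => Or.inr hp').div_const _)

lemma hasDerivAt_g {p : ℝ} (hp : 1 < p) {v : ℝ} (hv : v ≠ 0) : HasDerivAt (g p) (gPrime p v) v := by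
  have hp' : p - 1 ≠ 0 := by linarith
  have pos : ∀ {v : ℝ}, 0 < v → HasDerivAt (g p) (gPrime p v) v := by
    intro v hv
    have h := (Real.hasDerivAt_rpow_const (x := v) (p := p - 1) (Or.inl hv.ne')).div_const (p - 1)
    refine (h.congr_of_eventuallyEq ?_).congr_deriv ?_
    · filter_upwards [lt_mem_nhds hv] with w hw
      exact g_of_nonneg hp hw.le
    · rw [gPrime, abs_of_pos hv, show p - 1 - 1 = p - 2 by ring]
      field_simp
  rcases lt_or_gt_of_ne hv with h | h
  · have h1 : HasDerivAt (fun v => -g p (-v)) (gPrime p v) v := by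
      have := ((pos (neg_pos.2 h)).comp v (hasDerivAt_neg v)).neg
      refine this.congr_deriv ?_
      simp [gPrime]
    have : (fun v => -g p (-v)) = g p := by ext v; rw [g_neg, neg_neg]
    rwa [this] at h1
  · exact pos h

lemma intervalIntegrable_gPrime {p : ℝ} (hp : 1 < p) (v : ℝ) :
    IntervalIntegrable (gPrime p) volume 0 v := by
  have pos : ∀ {v : ℝ}, 0 ≤ v → IntervalIntegrable (gPrime p) volume 0 v := by
    intro v hv
    refine (intervalIntegral.intervalIntegrable_rpow' (r := p - 2) (by linarith)).congr
      fun w hw => ?_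
    rw [uIoc_of_le hv] at hw
    simp only [gPrime, abs_of_pos hw.1]
  rcases le_total 0 v with h | h
  · exact pos h
  · rw [IntervalIntegrable.iff_comp_neg]
    have e : (fun w => gPrime p (-w)) = gPrime p := by ext w; simp [gPrime]
    rw [neg_zero, e]
    exact pos (neg_nonneg.2 h)

/-- A smooth regularization of `|v|^{p-2}`. -/
noncomputable def gPrimeReg (p δ v : ℝ) : ℝ := (v ^ 2 + δ) ^ ((p - 2) / 2)

/-- The primitive of `gPrimeReg`. -/
noncomputable def gReg (p δ v : ℝ) : ℝ := ∫ w in (0 : ℝ)..v, gPrimeReg p δ w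

/-- The primitive of `gReg`, a regularization of a multiple of `|v|^p`. -/
noncomputable def energyReg (p δ v : ℝ) : ℝ := ∫ w in (0 : ℝ)..v, gReg p δ w

section Reg

variable {p δ : ℝ}

lemma continuous_gPrimeReg (hδ : 0 < δ) : Continuous (gPrimeReg p δ) := by
  unfold gPrimeReg
  exact Continuous.rpow_const (by fun_prop) fun v => Or.inl (by positivity)

lemma gPrimeReg_nonneg (hδ : 0 < δ) (v : ℝ) : 0 ≤ gPrimeReg p δ v := by
  unfold gPrimeReg; positivity

lemma hasDerivAt_gReg (hδ : 0 < δ) (v : ℝ) : HasDerivAt (gReg p δ) (gPrimeReg p δ v) v :=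
  intervalIntegral.integral_hasDerivAt_right ((continuous_gPrimeReg hδ).intervalIntegrable _ _)
    ((continuous_gPrimeReg hδ).stronglyMeasurableAtFilter _ _) (continuous_gPrimeReg hδ).continuousAt

lemma continuous_gReg (hδ : 0 < δ) : Continuous (gReg p δ) :=
  continuous_iff_continuousAt.2 fun v => (hasDerivAt_gReg hδ v).continuousAt

lemma hasDerivAt_energyReg (hδ : 0 < δ) (v : ℝ) : HasDerivAt (energyReg p δ) (gReg p δ v) v :=
  intervalIntegral.integral_hasDerivAt_right ((continuous_gReg hδ).intervalIntegrable _ _)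
    ((continuous_gReg hδ).stronglyMeasurableAtFilter _ _) (continuous_gReg hδ).continuousAt

lemma sq_rpow_half (p v : ℝ) : (v ^ 2) ^ ((p - 2) / 2) = |v| ^ (p - 2) := by
  rw [← sq_abs, ← Real.rpow_natCast, ← Real.rpow_mul (abs_nonneg v)]
  congr 1; push_cast; ring

lemma gPrimeReg_le_of_lt (hp : p < 2) (hδ : 0 < δ) {v : ℝ} (hv : v ≠ 0) :
    gPrimeReg p δ v ≤ gPrime p v := by
  rw [gPrimeReg, gPrime, ← sq_rpow_half]
  exact Real.rpow_le_rpow_of_nonpos (by positivity) (by linarith) (by linarith)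

lemma gPrimeReg_le_of_ge (hp : 2 ≤ p) (hδ : 0 < δ) (hδ' : δ ≤ 1) (v : ℝ) :
    gPrimeReg p δ v ≤ (v ^ 2 + 1) ^ ((p - 2) / 2) :=
  Real.rpow_le_rpow (by positivity) (by linarith) (by linarith)

/-- A bound uniform in the regularization: for `p < 2` the regularization lies below `gPrime p`, for
`2 ≤ p` below its value at `δ = 1`. -/
lemma gPrimeReg_le (hδ : 0 < δ) (hδ' : δ ≤ 1) {v : ℝ} (hv : v ≠ 0) :
    gPrimeReg p δ v ≤ gPrime p v + (v ^ 2 + 1) ^ ((p - 2) / 2) := by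
  rcases lt_or_ge p 2 with h | h
  · have := gPrimeReg_le_of_lt h hδ hv
    have : 0 ≤ (v ^ 2 + 1) ^ ((p - 2) / 2) := by positivity
    linarith
  · have := gPrimeReg_le_of_ge h hδ hδ' v
    linarith [gPrime_nonneg p v]

/-- The constant in the growth bounds for `gReg` and `energyReg`. -/
noncomputable def growthConst (p : ℝ) : ℝ := 1 / (p - 1) + 2 ^ ((p - 1) / 2)

lemma growthConst_pos (hp : 1 < p) : 0 < growthConst p := by
  have : 0 < p - 1 := by linarith
  unfold growthConst; positivity

lemma abs_gReg_le (hp : 1 < p) (hδ : 0 < δ) (hδ' : δ ≤ 1) (v : ℝ) :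
    |gReg p δ v| ≤ growthConst p * (|v| ^ (p - 1) + 1) := by
  have hp1 : 0 < p - 1 := by linarith
  have hv1 : 0 ≤ |v| ^ (p - 1) := by positivity
  rcases lt_or_ge p 2 with h | h
  -- for `p < 2` the regularization decreases the integrand
  · have h1 : |gReg p δ v| ≤ |g p v| := by
      refine intervalIntegral.norm_integral_le_abs_of_norm_le (f := gPrimeReg p δ) ?_
        (intervalIntegrable_gPrime hp v)
      filter_upwards [ae_restrict_of_ae (compl_mem_ae_iff.2 (measure_singleton (0 : ℝ)))] with w hw
      rw [Real.norm_of_nonneg (gPrimeReg_nonneg hδ w)]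
      exact gPrimeReg_le_of_lt h hδ hw
    rw [abs_g hp] at h1
    have h2 : 0 ≤ (2 : ℝ) ^ ((p - 1) / 2) := by positivity
    have h3 : 0 ≤ 1 / (p - 1) := by positivity
    calc _ ≤ |v| ^ (p - 1) / (p - 1) := h1
      _ = 1 / (p - 1) * |v| ^ (p - 1) := by ring
      _ ≤ growthConst p * (|v| ^ (p - 1) + 1) := by unfold growthConst; gcongr <;> linarith
  -- for `2 ≤ p` the integrand increases in `|w|` and in `δ`
  · have h1 : |gReg p δ v| ≤ (v ^ 2 + 1) ^ ((p - 2) / 2) * |v - 0| := by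
      refine intervalIntegral.norm_integral_le_of_norm_le_const (f := gPrimeReg p δ)
        fun w hw => ?_
      rw [Real.norm_of_nonneg (gPrimeReg_nonneg hδ w)]
      refine (gPrimeReg_le_of_ge h hδ hδ' w).trans
        (Real.rpow_le_rpow (by positivity) ?_ (by linarith))
      have : |w| ≤ |v| := by
        rcases le_total 0 v with h0 | h0
        · rw [uIoc_of_le h0] at hw
          rw [abs_of_pos hw.1, abs_of_nonneg h0]; exact hw.2
        · rw [uIoc_of_ge h0] at hw
          rw [abs_of_nonpos hw.2, abs_of_nonpos h0]; linarith [hw.1]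
      have := sq_le_sq.2 this
      linarith
    have h2 : |v| ≤ (v ^ 2 + 1) ^ ((1 : ℝ) / 2) := by
      rw [← Real.sqrt_eq_rpow]
      exact Real.abs_le_sqrt (by linarith)
    have h3 : (v ^ 2 + 1) ^ ((p - 2) / 2) * |v| ≤ (v ^ 2 + 1) ^ ((p - 1) / 2) := by
      calc _ ≤ (v ^ 2 + 1) ^ ((p - 2) / 2) * (v ^ 2 + 1) ^ ((1 : ℝ) / 2) := by gcongr
        _ = _ := by rw [← Real.rpow_add (by positivity)]; congr 1; ring
    have h4 : (v ^ 2 + 1) ^ ((p - 1) / 2) ≤ 2 ^ ((p - 1) / 2) * (|v| ^ (p - 1) + 1) := by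
      have e : |v| ^ (p - 1) = (v ^ 2) ^ ((p - 1) / 2) := by
        rw [← sq_abs, ← Real.rpow_natCast, ← Real.rpow_mul (abs_nonneg v)]
        congr 1; push_cast; ring
      rcases le_total (v ^ 2) 1 with hv | hv
      · calc (v ^ 2 + 1) ^ ((p - 1) / 2) ≤ 2 ^ ((p - 1) / 2) :=
              Real.rpow_le_rpow (by positivity) (by linarith) (by linarith)
          _ ≤ _ := by nlinarith [Real.rpow_nonneg zero_le_two ((p - 1) / 2)]
      · calc (v ^ 2 + 1) ^ ((p - 1) / 2) ≤ (2 * v ^ 2) ^ ((p - 1) / 2) :=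
              Real.rpow_le_rpow (by positivity) (by linarith) (by linarith)
          _ = 2 ^ ((p - 1) / 2) * |v| ^ (p - 1) := by
              rw [Real.mul_rpow (by norm_num) (by positivity), e]
          _ ≤ _ := by nlinarith [Real.rpow_nonneg zero_le_two ((p - 1) / 2)]
    rw [sub_zero] at h1
    refine (h1.trans (h3.trans h4)).trans ?_
    unfold growthConst
    gcongr
    linarith [show 0 < 1 / (p - 1) by positivity]

lemma gReg_sign (hδ : 0 < δ) (v : ℝ) : (0 ≤ v → 0 ≤ gReg p δ v) ∧ (v ≤ 0 → gReg p δ v ≤ 0) := by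
  refine ⟨fun h => intervalIntegral.integral_nonneg h fun w _ => gPrimeReg_nonneg hδ w,
    fun h => ?_⟩
  rw [gReg, intervalIntegral.integral_symm, neg_nonpos]
  exact intervalIntegral.integral_nonneg h fun w _ => gPrimeReg_nonneg hδ w

lemma energyReg_nonneg (hδ : 0 < δ) (v : ℝ) : 0 ≤ energyReg p δ v := by
  rcases le_total 0 v with h | h
  · exact intervalIntegral.integral_nonneg h fun w hw => (gReg_sign hδ w).1 hw.1
  · rw [energyReg, intervalIntegral.integral_symm, ← intervalIntegral.integral_neg]
    exact intervalIntegral.integral_nonneg h fun w hw =>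
      neg_nonneg.2 ((gReg_sign hδ w).2 hw.2)

lemma energyReg_le (hp : 1 < p) (hδ : 0 < δ) (hδ' : δ ≤ 1) (v : ℝ) :
    energyReg p δ v ≤ growthConst p * (2 * |v| ^ p + 1) := by
  have hp1 : 0 < p - 1 := by linarith
  have h1 : |energyReg p δ v| ≤ growthConst p * (|v| ^ (p - 1) + 1) * |v - 0| := by
    refine intervalIntegral.norm_integral_le_of_norm_le_const (f := gReg p δ) fun w hw => ?_
    refine (abs_gReg_le hp hδ hδ' w).trans ?_
    have : |w| ≤ |v| := by
      rcases le_total 0 v with h0 | h0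
      · rw [uIoc_of_le h0] at hw
        rw [abs_of_pos hw.1, abs_of_nonneg h0]; exact hw.2
      · rw [uIoc_of_ge h0] at hw
        rw [abs_of_nonpos hw.2, abs_of_nonpos h0]; linarith [hw.1]
    have := growthConst_pos hp
    gcongr
  have h2 : |v| ^ (p - 1) * |v| = |v| ^ p := by
    rcases eq_or_ne v 0 with rfl | hv
    · rw [abs_zero, mul_zero, Real.zero_rpow (by linarith)]
    · have := Real.rpow_add_one (abs_ne_zero.2 hv) (p - 1)
      rw [← this]; congr 1; ring
  have h3 : |v| ≤ |v| ^ p + 1 := by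
    rcases le_total |v| 1 with h | h
    · have : 0 ≤ |v| ^ p := by positivity
      linarith
    · have := Real.self_le_rpow_of_one_le h hp.le
      linarith
  rw [sub_zero] at h1
  have := growthConst_pos hp
  calc _ ≤ |energyReg p δ v| := le_abs_self _
    _ ≤ _ := h1
    _ = growthConst p * (|v| ^ p + |v|) := by rw [← h2]; ring
    _ ≤ _ := mul_le_mul_of_nonneg_left (by linarith) this.le

end Reg

/-- The sequence of regularization parameters. -/
noncomputable def regSeq (n : ℕ) : ℝ := 1 / ((n : ℝ) + 1)

lemma regSeq_pos (n : ℕ) : 0 < regSeq n := by unfold regSeq; positivity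

lemma regSeq_le (n : ℕ) : regSeq n ≤ 1 := by
  unfold regSeq
  rw [div_le_one (by positivity)]
  linarith [(Nat.cast_nonneg n : (0 : ℝ) ≤ n)]

lemma tendsto_regSeq : Tendsto regSeq atTop (𝓝 0) := tendsto_one_div_add_atTop_nhds_zero_nat

lemma tendsto_gPrimeReg {p v : ℝ} (h : v ≠ 0 ∨ 2 ≤ p) :
    Tendsto (fun n => gPrimeReg p (regSeq n) v) atTop (𝓝 (gPrime p v)) := by
  rw [gPrime, ← sq_rpow_half]
  have h1 : Tendsto (fun n => v ^ 2 + regSeq n) atTop (𝓝 (v ^ 2)) := by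
    simpa using tendsto_regSeq.const_add (v ^ 2)
  refine h1.rpow_const ?_
  rcases h with h | h
  · exact Or.inl (by positivity)
  · exact Or.inr (by linarith)

lemma tendsto_gReg {p : ℝ} (hp : 1 < p) (v : ℝ) :
    Tendsto (fun n => gReg p (regSeq n) v) atTop (𝓝 (g p v)) := by
  refine intervalIntegral.tendsto_integral_filter_of_dominated_convergence
    (fun w => gPrime p w + (w ^ 2 + 1) ^ ((p - 2) / 2)) ?_ ?_ ?_ ?_
  · exact Eventually.of_forall fun n =>
      (continuous_gPrimeReg (regSeq_pos n)).aestronglyMeasurable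
  · refine Eventually.of_forall fun n => ?_
    filter_upwards [compl_mem_ae_iff.2 (measure_singleton (0 : ℝ))] with w hw _
    rw [Real.norm_of_nonneg (gPrimeReg_nonneg (regSeq_pos n) w)]
    exact gPrimeReg_le (regSeq_pos n) (regSeq_le n) hw
  · exact (intervalIntegrable_gPrime hp v).add
      (Continuous.intervalIntegrable (continuous_gPrimeReg (p := p) one_pos) _ _)
  · filter_upwards [compl_mem_ae_iff.2 (measure_singleton (0 : ℝ))] with w hw _
    exact tendsto_gPrimeReg (Or.inl hw)

/-! ### The energy inequality before renormalization -/

/-- The continuous extension of the modelledness derivative. -/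
noncomputable def extendNu (T : ℝ) (a σ : ℝ → ℝ) (ξ u : SpaceTime d → ℝ) (z : SpaceTime d) :
    Space d :=
  extendGrad T u z - σ (extend T u z) • gradPotential ξ (a (extend T u z)) z

/-- The products of the modelledness derivative and of the gradient of the heat potential that
remain when the gradient of the solution is replaced by the modelledness derivative. -/
noncomputable def crossTerm (T : ℝ) (a σ : ℝ → ℝ) (ξ u : SpaceTime d → ℝ) (z : SpaceTime d) : ℝ :=
  a (extend T u z) * (2 * inner ℝ (extendNu T a σ ξ u z) (gradPotential ξ (a (extend T u z)) z) +
    σ (extend T u z) * ‖gradPotential ξ (a (extend T u z)) z‖ ^ 2)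

lemma integrableOn_closedCube_of_continuous {φ : Space d → ℝ} (hφ : Continuous φ) :
    IntegrableOn φ (cube d) :=
  (hφ.continuousOn.integrableOn_compact isCompact_closedCube).mono_set cube_subset_closedCube

lemma ofReal_integral_growth_le {p : ℝ} (hp : 1 < p) {u₀ : Space d → ℝ} (hu₀ : Continuous u₀) :
    ENNReal.ofReal (∫ x in cube d, growthConst p * (2 * |u₀ x| ^ p + 1)) ≤
      ENNReal.ofReal (2 * growthConst p) * ((∫⁻ x in cube d, ‖u₀ x‖ₑ ^ p) + 1) := by
  have hg := growthConst_pos hp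
  have hc : Continuous fun x => growthConst p * (2 * |u₀ x| ^ p + 1) :=
    continuous_const.mul ((continuous_const.mul (hu₀.abs.rpow_const
      fun x => Or.inr (by linarith))).add continuous_const)
  rw [ofReal_integral_eq_lintegral_ofReal (integrableOn_closedCube_of_continuous hc)
    (Eventually.of_forall fun x => by positivity)]
  have h1 : ∀ x, ENNReal.ofReal (growthConst p * (2 * |u₀ x| ^ p + 1)) ≤
      ENNReal.ofReal (2 * growthConst p) * (‖u₀ x‖ₑ ^ p + 1) := by
    intro x
    have e : ‖u₀ x‖ₑ ^ p = ENNReal.ofReal (|u₀ x| ^ p) := by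
      rw [← ofReal_norm, Real.norm_eq_abs, ENNReal.ofReal_rpow_of_nonneg (abs_nonneg _) (by linarith)]
    rw [e, ← ENNReal.ofReal_one, ← ENNReal.ofReal_add (by positivity) zero_le_one,
      ← ENNReal.ofReal_mul (by positivity)]
    refine ENNReal.ofReal_le_ofReal ?_
    nlinarith [show 0 ≤ |u₀ x| ^ p by positivity]
  calc _ ≤ ∫⁻ x in cube d, ENNReal.ofReal (2 * growthConst p) * (‖u₀ x‖ₑ ^ p + 1) :=
        lintegral_mono h1
    _ = ENNReal.ofReal (2 * growthConst p) * ∫⁻ x in cube d, (‖u₀ x‖ₑ ^ p + 1) :=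
        lintegral_const_mul' _ _ ENNReal.ofReal_ne_top
    _ = _ := by
        rw [lintegral_add_right _ measurable_const, lintegral_const, Measure.restrict_apply_univ,
          volume_cube, one_mul]

section

variable {T : ℝ} {a σ : ℝ → ℝ} {ξ : SpaceTime d → ℝ} {Cct : ℝ → ℝ} {u₀ : Space d → ℝ}
  {u : SpaceTime d → ℝ}

lemma continuous_gradPotential_comp (hξ : ContDiff ℝ ((⊤ : ℕ∞) : WithTop ℕ∞) ξ)
    (hp : SpacePeriodic ξ) (ha : Continuous a) {U : SpaceTime d → ℝ} (hU : Continuous U) :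
    Continuous fun z => gradPotential ξ (a (U z)) z :=
  (continuous_gradPotential hξ hp).comp ((ha.comp hU).prodMk continuous_id)

lemma IsClassicalSolution.continuous_extendNu (hu : IsClassicalSolution T a σ ξ Cct u₀ u)
    (hT : 0 ≤ T) (ha : Continuous a) (hσ : Continuous σ)
    (hξ : ContDiff ℝ ((⊤ : ℕ∞) : WithTop ℕ∞) ξ) (hp : SpacePeriodic ξ) :
    Continuous (extendNu T a σ ξ u) :=
  (hu.continuous_extendGrad hT).sub ((hσ.comp (hu.continuous_extend hT)).smul
    (continuous_gradPotential_comp hξ hp ha (hu.continuous_extend hT)))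

lemma IsClassicalSolution.extendNu_periodic (hu : IsClassicalSolution T a σ ξ Cct u₀ u)
    (hT : 0 ≤ T) (hp : SpacePeriodic ξ) : SpacePeriodic (extendNu T a σ ξ u) := by
  intro k z
  simp only [extendNu, hu.extendGrad_periodic hT k z, hu.extend_periodic hT k z,
    gradPotential_periodic hp _ k z]

lemma IsClassicalSolution.continuous_crossTerm (hu : IsClassicalSolution T a σ ξ Cct u₀ u)
    (hT : 0 ≤ T) (ha : Continuous a) (hσ : Continuous σ)
    (hξ : ContDiff ℝ ((⊤ : ℕ∞) : WithTop ℕ∞) ξ) (hp : SpacePeriodic ξ) :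
    Continuous (crossTerm T a σ ξ u) := by
  have h0 := hu.continuous_extend hT
  have h1 := continuous_gradPotential_comp hξ hp ha h0
  exact (ha.comp h0).mul ((continuous_const.mul
    ((hu.continuous_extendNu hT ha hσ hξ hp).inner h1)).add ((hσ.comp h0).mul (h1.norm.pow 2)))

/-- The energy inequality, with all products of the noise on the right hand side. The regularity
of the test function at the origin is dealt with by approximation. -/
theorem IsClassicalSolution.energy_inequality {p : ℝ} (hp1 : 1 < p)
    (hu : IsClassicalSolution T a σ ξ Cct u₀ u) (hT : 0 < T)
    (haC : ContDiff ℝ 2 a) (ha : ∀ v, 0 < a v) (hσ : ContDiff ℝ 2 σ)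
    (hξ : ContDiff ℝ ((⊤ : ℕ∞) : WithTop ℕ∞) ξ) (hp : SpacePeriodic ξ)
    (hC : ContinuousOn Cct (Ioi 0)) (hσ0 : σ 0 = 0) {B : ℝ}
    (hB : ∀ v, gPrime p v * |σ v| ≤ B) :
    ∫⁻ z in Ioo 0 T ×ˢ cube d,
        ENNReal.ofReal (|gPrime p (u z)| * a (u z) * ‖nu a σ ξ u z‖ ^ 2) ≤
      ENNReal.ofReal (2 * growthConst p) * ((∫⁻ x in cube d, ‖u₀ x‖ₑ ^ p) + 1) +
      ENNReal.ofReal (∫ z in Icc 0 T ×ˢ cube d, (g p (extend T u z) * reaction T a σ ξ Cct u z -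
        gPrime p (extend T u z) * σ (extend T u z) * crossTerm T a σ ξ u z)) := by
  have h0 := hu.continuous_extend hT.le
  have hr := hu.continuous_reaction hT.le haC ha hσ hξ.continuous hC
  have hN := hu.continuous_extendNu hT.le haC.continuous hσ.continuous hξ hp
  have hX := hu.continuous_crossTerm hT.le haC.continuous hσ.continuous hξ hp
  have hG := hu.continuous_extendGrad hT.le
  have hu₀c : Continuous u₀ := by
    have : u₀ = fun x => extend T u (0, x) := by
      ext x
      rw [extend_of_mem (z := (0, x)) ⟨le_rfl, hT.le⟩, hu.initial]
    rw [this]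
    exact h0.comp (Continuous.prodMk_right 0)
  have hB0 : 0 ≤ B := (mul_nonneg (gPrime_nonneg p 0) (abs_nonneg _)).trans (hB 0)
  set U := extend T u with hU
  set D : Set (SpaceTime d) := Icc 0 T ×ˢ cube d with hD
  set A : ℝ := ∫ x in cube d, growthConst p * (2 * |u₀ x| ^ p + 1) with hA
  set I : ℕ → ℝ := fun n => ∫ z in D, (gReg p (regSeq n) (U z) * reaction T a σ ξ Cct u z -
    gPrimeReg p (regSeq n) (U z) * σ (U z) * crossTerm T a σ ξ u z) with hI
  -- the regularized inequality
  have hreg : ∀ n, ∫⁻ z in D, ENNReal.ofReal (gPrimeReg p (regSeq n) (U z) * a (U z) *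
      ‖extendNu T a σ ξ u z‖ ^ 2) ≤ ENNReal.ofReal (A + I n) := by
    intro n
    have hδ := regSeq_pos n
    have c1 : Continuous fun z => gPrimeReg p (regSeq n) (U z) * a (U z) *
        ‖extendNu T a σ ξ u z‖ ^ 2 :=
      (((continuous_gPrimeReg hδ).comp h0).mul (haC.continuous.comp h0)).mul (hN.norm.pow 2)
    rw [← ofReal_integral_eq_lintegral_ofReal (integrableOn_prod_cube c1 0 T)
      (Eventually.of_forall fun z => mul_nonneg (mul_nonneg (gPrimeReg_nonneg hδ _) (ha _).le)
        (sq_nonneg _))]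
    refine ENNReal.ofReal_le_ofReal ?_
    have hE := hu.energy_le hT haC ha hσ hξ.continuous hC
      (fun v => hasDerivAt_energyReg (p := p) hδ v) (fun v => hasDerivAt_gReg hδ v)
      (continuous_gPrimeReg hδ) (energyReg_nonneg hδ)
    have hinit : ∫ x in cube d, energyReg p (regSeq n) (u₀ x) ≤ A := by
      have cE : Continuous (energyReg p (regSeq n)) :=
        continuous_iff_continuousAt.2 fun v => (hasDerivAt_energyReg hδ v).continuousAt
      refine integral_mono (integrableOn_closedCube_of_continuous (cE.comp hu₀c))
        (integrableOn_closedCube_of_continuous ?_)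
        (fun x => energyReg_le hp1 hδ (regSeq_le n) (u₀ x))
      exact continuous_const.mul ((continuous_const.mul (hu₀c.abs.rpow_const
        fun x => Or.inr (by linarith))).add continuous_const)
    have cr : Continuous fun z => gReg p (regSeq n) (U z) * reaction T a σ ξ Cct u z :=
      ((continuous_gReg hδ).comp h0).mul hr
    have cX : Continuous fun z => gPrimeReg p (regSeq n) (U z) * σ (U z) *
        crossTerm T a σ ξ u z :=
      (((continuous_gPrimeReg hδ).comp h0).mul (hσ.continuous.comp h0)).mul hX
    have e1 : I n = (∫ z in D, gReg p (regSeq n) (U z) * reaction T a σ ξ Cct u z) -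
        ∫ z in D, gPrimeReg p (regSeq n) (U z) * σ (U z) * crossTerm T a σ ξ u z :=
      integral_sub (integrableOn_prod_cube cr 0 T) (integrableOn_prod_cube cX 0 T)
    have e2 : ∫ z in D, gPrimeReg p (regSeq n) (U z) * a (U z) * ‖extendGrad T u z‖ ^ 2 =
        (∫ z in D, gPrimeReg p (regSeq n) (U z) * a (U z) * ‖extendNu T a σ ξ u z‖ ^ 2) +
        ∫ z in D, gPrimeReg p (regSeq n) (U z) * σ (U z) * crossTerm T a σ ξ u z := by
      rw [← integral_add (integrableOn_prod_cube c1 0 T) (integrableOn_prod_cube cX 0 T)]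
      refine integral_congr_ae (Eventually.of_forall fun z => ?_)
      simp only
      have e3 : extendGrad T u z = extendNu T a σ ξ u z +
          σ (U z) • gradPotential ξ (a (U z)) z := by rw [extendNu]; abel
      rw [e3, norm_add_sq_real, norm_smul, mul_pow, Real.norm_eq_abs, sq_abs, inner_smul_right,
        crossTerm]
      ring
    linarith
  -- convergence of the right hand side
  have hlim : Tendsto I atTop (𝓝 (∫ z in D, (g p (U z) * reaction T a σ ξ Cct u z -
      gPrime p (U z) * σ (U z) * crossTerm T a σ ξ u z))) := by
    refine tendsto_integral_of_dominated_convergence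
      (fun z => growthConst p * (|U z| ^ (p - 1) + 1) * |reaction T a σ ξ Cct u z| +
        (B + (U z ^ 2 + 1) ^ ((p - 2) / 2) * |σ (U z)|) * |crossTerm T a σ ξ u z|) ?_ ?_ ?_ ?_
    · intro n
      exact ((((continuous_gReg (regSeq_pos n)).comp h0).mul hr).sub
        ((((continuous_gPrimeReg (regSeq_pos n)).comp h0).mul
          (hσ.continuous.comp h0)).mul hX)).aestronglyMeasurable
    · refine integrableOn_prod_cube ?_ 0 T
      have c1 : Continuous fun z => |U z| ^ (p - 1) :=
        h0.abs.rpow_const fun x => Or.inr (by linarith)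
      have c2 : Continuous fun z => (U z ^ 2 + 1) ^ ((p - 2) / 2) :=
        (continuous_gPrimeReg (p := p) one_pos).comp h0
      have c3 : Continuous fun z => σ (U z) := hσ.continuous.comp h0
      fun_prop
    · intro n
      refine Eventually.of_forall fun z => ?_
      have hδ := regSeq_pos n
      refine (norm_sub_le _ _).trans (add_le_add ?_ ?_)
      · rw [norm_mul]
        exact mul_le_mul_of_nonneg_right (abs_gReg_le hp1 hδ (regSeq_le n) _) (norm_nonneg _)
      · rw [norm_mul]
        refine mul_le_mul_of_nonneg_right ?_ (norm_nonneg _)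
        rw [norm_mul, Real.norm_of_nonneg (gPrimeReg_nonneg hδ _), Real.norm_eq_abs]
        rcases eq_or_ne (U z) 0 with h | h
        · rw [h, hσ0, abs_zero, mul_zero, mul_zero]; linarith
        · calc _ ≤ (gPrime p (U z) + (U z ^ 2 + 1) ^ ((p - 2) / 2)) * |σ (U z)| := by
                have := gPrimeReg_le (p := p) hδ (regSeq_le n) h
                gcongr
            _ ≤ _ := by rw [add_mul]; linarith [hB (U z)]
    · refine Eventually.of_forall fun z => ?_
      refine ((tendsto_gReg hp1 _).mul_const _).sub (Tendsto.mul_const _ ?_)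
      -- at the origin `gPrimeReg` may diverge, but `σ` vanishes there
      rcases eq_or_ne (U z) 0 with h | h
      · rw [h, hσ0]; simp
      · exact (tendsto_gPrimeReg (Or.inl h)).mul_const _
  -- Fatou's lemma
  have hmeas : ∀ n, Measurable fun z => ENNReal.ofReal (gPrimeReg p (regSeq n) (U z) * a (U z) *
      ‖extendNu T a σ ξ u z‖ ^ 2) := fun n =>
    ENNReal.measurable_ofReal.comp ((((continuous_gPrimeReg (regSeq_pos n)).comp h0).mul
      (haC.continuous.comp h0)).mul (hN.norm.pow 2)).measurable
  calc ∫⁻ z in Ioo 0 T ×ˢ cube d,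
        ENNReal.ofReal (|gPrime p (u z)| * a (u z) * ‖nu a σ ξ u z‖ ^ 2)
      = ∫⁻ z in Ioo 0 T ×ˢ cube d,
        ENNReal.ofReal (gPrime p (U z) * a (U z) * ‖extendNu T a σ ξ u z‖ ^ 2) := by
        refine setLIntegral_congr_fun (measurableSet_Ioo.prod measurableSet_cube) fun z hz => ?_
        have hz1 : z.1 ∈ Icc 0 T := Ioo_subset_Icc_self hz.1
        rw [hu.nu_eq ha hξ hp hz1, hU, extend_of_mem hz1, abs_of_nonneg (gPrime_nonneg _ _),
          extendNu, extend_of_mem hz1]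
    _ ≤ ∫⁻ z in D, ENNReal.ofReal (gPrime p (U z) * a (U z) * ‖extendNu T a σ ξ u z‖ ^ 2) :=
        lintegral_mono_set (prod_mono_left Ioo_subset_Icc_self)
    _ ≤ ∫⁻ z in D, liminf (fun n => ENNReal.ofReal (gPrimeReg p (regSeq n) (U z) * a (U z) *
          ‖extendNu T a σ ξ u z‖ ^ 2)) atTop := by
        refine lintegral_mono fun z => ?_
        by_cases h : U z ≠ 0 ∨ 2 ≤ p
        · have ht : Tendsto (fun n => ENNReal.ofReal (gPrimeReg p (regSeq n) (U z) * a (U z) *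
              ‖extendNu T a σ ξ u z‖ ^ 2)) atTop (𝓝 (ENNReal.ofReal (gPrime p (U z) * a (U z) *
              ‖extendNu T a σ ξ u z‖ ^ 2))) :=
            ENNReal.tendsto_ofReal (((tendsto_gPrimeReg h).mul_const _).mul_const _)
          exact ht.liminf_eq.ge
        -- for `p < 2` the value of `|v| ^ (p - 2)` at the origin is `0`
        · rw [not_or, not_not, not_le] at h
          have : gPrime p (U z) = 0 := by
            rw [h.1, gPrime, abs_zero, Real.zero_rpow (by linarith [h.2])]
          simp only
          rw [this]; simp
    _ ≤ liminf (fun n => ∫⁻ z in D, ENNReal.ofReal (gPrimeReg p (regSeq n) (U z) * a (U z) *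
          ‖extendNu T a σ ξ u z‖ ^ 2)) atTop := lintegral_liminf_le hmeas
    _ ≤ liminf (fun n => ENNReal.ofReal (A + I n)) atTop :=
        liminf_le_liminf (Eventually.of_forall hreg)
    _ = ENNReal.ofReal (A + ∫ z in D, (g p (U z) * reaction T a σ ξ Cct u z -
          gPrime p (U z) * σ (U z) * crossTerm T a σ ξ u z)) :=
        (ENNReal.tendsto_ofReal (hlim.const_add A)).liminf_eq
    _ ≤ _ := ENNReal.ofReal_add_le.trans (add_le_add (ofReal_integral_growth_le hp1 hu₀c) le_rfl)

end

/-! ### Parabolic scaling and mollification -/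

lemma pnorm_nonneg (z : SpaceTime d) : 0 ≤ pnorm z := Real.sqrt_nonneg _

lemma pnorm_sq (z : SpaceTime d) : pnorm z ^ 2 = |z.1| + ‖z.2‖ ^ 2 :=
  Real.sq_sqrt (by positivity)

lemma abs_fst_le_pnorm_sq (z : SpaceTime d) : |z.1| ≤ pnorm z ^ 2 := by
  rw [pnorm_sq]; linarith [sq_nonneg ‖z.2‖]

lemma norm_snd_le_pnorm (z : SpaceTime d) : ‖z.2‖ ≤ pnorm z := by
  refine abs_le_of_sq_le_sq' ?_ (pnorm_nonneg z) |>.2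
  rw [pnorm_sq]; linarith [abs_nonneg z.1]

lemma pnorm_le_of_sq_le {z : SpaceTime d} {r : ℝ} (hr : 0 ≤ r) (h : |z.1| + ‖z.2‖ ^ 2 ≤ r ^ 2) :
    pnorm z ≤ r := by
  rw [pnorm]; exact (Real.sqrt_le_left hr).2 h

lemma pnorm_neg (z : SpaceTime d) : pnorm (-z) = pnorm z := by simp [pnorm]

@[simp] lemma pnorm_zero : pnorm (0 : SpaceTime d) = 0 := by simp [pnorm]

lemma eq_zero_of_pnorm_nonpos {z : SpaceTime d} (h : pnorm z ≤ 0) : z = 0 := by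
  have h0 : pnorm z = 0 := le_antisymm h (pnorm_nonneg z)
  have h1 := abs_fst_le_pnorm_sq z
  have h2 := norm_snd_le_pnorm z
  rw [h0] at h1 h2
  refine Prod.ext ?_ (norm_le_zero_iff.1 h2)
  exact abs_eq_zero.1 (le_antisymm (by simpa using h1) (abs_nonneg _))

lemma continuous_pnorm : Continuous (pnorm (d := d)) := by unfold pnorm; fun_prop

lemma pnorm_add_le_one {h k : SpaceTime d} (hh : pnorm h ≤ 1 / 4) (hk : pnorm k ≤ 1 / 4) :
    pnorm (h + k) ≤ 1 := by
  have h1 := abs_fst_le_pnorm_sq h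
  have h2 := norm_snd_le_pnorm h
  have k1 := abs_fst_le_pnorm_sq k
  have k2 := norm_snd_le_pnorm k
  have a1 := abs_add_le h.1 k.1
  have a2 := norm_add_le h.2 k.2
  have h0 := pnorm_nonneg h
  have k0 := pnorm_nonneg k
  have a3 : ‖(h + k).2‖ ≤ 1 / 2 := by rw [Prod.snd_add]; linarith
  refine pnorm_le_of_sq_le zero_le_one ?_
  rw [Prod.fst_add]
  nlinarith [norm_nonneg (h + k).2]

/-- The parabolic dilation by `lam⁻¹`. -/
noncomputable def dilate (lam : ℝ) (k : SpaceTime d) : SpaceTime d := (k.1 / lam ^ 2, lam⁻¹ • k.2)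

lemma pnorm_dilate {lam : ℝ} (hl : 0 < lam) (k : SpaceTime d) :
    pnorm (dilate lam k) = pnorm k / lam := by
  have h : |(dilate lam k).1| + ‖(dilate lam k).2‖ ^ 2 = (|k.1| + ‖k.2‖ ^ 2) / lam ^ 2 := by
    simp only [dilate, abs_div, abs_of_pos (pow_pos hl 2), norm_smul, norm_inv,
      Real.norm_of_nonneg hl.le]
    field_simp
  rw [pnorm, h, Real.sqrt_div (by positivity), Real.sqrt_sq hl.le]; rfl

lemma rescale_eq (φ : SpaceTime d → ℝ) (lam : ℝ) (x y : SpaceTime d) :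
    rescale φ lam x y = lam ^ (-(d : ℝ) - 2) * φ (dilate lam (y - x)) := rfl

lemma rescale_add (φ : SpaceTime d → ℝ) (lam : ℝ) (x k : SpaceTime d) :
    rescale φ lam x (x + k) = rescale φ lam 0 k := by
  rw [rescale_eq, rescale_eq, add_sub_cancel_left, sub_zero]

lemma continuous_rescale {φ : SpaceTime d → ℝ} (hφ : Continuous φ) (lam : ℝ) (x : SpaceTime d) :
    Continuous (rescale φ lam x) := by
  unfold rescale
  fun_prop

lemma hasCompactSupport_comp_dilate {φ : SpaceTime d → ℝ} (hs : HasCompactSupport φ) {lam : ℝ}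
    (hl : 0 < lam) : HasCompactSupport fun k : SpaceTime d => φ (dilate lam k) := by
  have h := hs.comp_homeomorph ((Homeomorph.mulRight₀ ((lam ^ 2)⁻¹) (by positivity)).prodCongr
    (Homeomorph.smulOfNeZero (α := Space d) (lam⁻¹) (by positivity)))
  exact h

lemma integral_dilate {φ : SpaceTime d → ℝ} (hφ : Continuous φ) (hs : HasCompactSupport φ)
    {lam : ℝ} (hl : 0 < lam) : ∫ k, rescale φ lam 0 k = ∫ k, φ k := by
  have hint : Integrable (fun k : SpaceTime d => φ (dilate lam k)) :=
    Continuous.integrable_of_hasCompactSupport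
      (hφ.comp (by unfold dilate; fun_prop)) (hasCompactSupport_comp_dilate hs hl)
  have e1 : ∫ k, rescale φ lam 0 k = lam ^ (-(d : ℝ) - 2) * ∫ k : SpaceTime d, φ (dilate lam k) := by
    rw [← integral_const_mul]
    simp only [rescale_eq, sub_zero]
  rw [e1, Measure.volume_eq_prod, integral_prod _ hint,
    integral_prod _ (hφ.integrable_of_hasCompactSupport hs)]
  have e2 : ∀ t : ℝ, ∫ x : Space d, φ (dilate lam (t, x)) =
      lam ^ d * ∫ x : Space d, φ (t / lam ^ 2, x) := by
    intro t
    have := Measure.integral_comp_inv_smul volume (fun x : Space d => φ (t / lam ^ 2, x)) lam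
    rw [finrank_euclideanSpace_fin, abs_of_pos (by positivity), smul_eq_mul] at this
    exact this
  simp_rw [e2]
  rw [integral_const_mul, Measure.integral_comp_div (fun t => ∫ x : Space d, φ (t, x)) (lam ^ 2),
    abs_of_pos (by positivity), smul_eq_mul, ← mul_assoc, ← mul_assoc]
  have e3 : lam ^ (-(d : ℝ) - 2) * lam ^ d * lam ^ 2 = 1 := by
    rw [← Real.rpow_natCast lam d, ← Real.rpow_natCast lam 2, ← Real.rpow_add hl,
      ← Real.rpow_add hl, show -(d : ℝ) - 2 + d + (2 : ℕ) = 0 by push_cast; ring, Real.rpow_zero]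
  rw [e3, one_mul]

/-- A normalized smooth bump function on space-time, supported in the parabolic unit ball. -/
noncomputable def bump (d : ℕ) : SpaceTime d → ℝ :=
  ContDiffBump.normed (⟨1 / 4, 1 / 2, by norm_num, by norm_num⟩ : ContDiffBump (0 : SpaceTime d))
    volume

lemma contDiff_bump : ContDiff ℝ ((⊤ : ℕ∞) : WithTop ℕ∞) (bump d) := ContDiffBump.contDiff_normed _

lemma bump_nonneg (z : SpaceTime d) : 0 ≤ bump d z := ContDiffBump.nonneg_normed _ _

lemma integral_bump : ∫ z, bump d z = 1 := ContDiffBump.integral_normed _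

lemma hasCompactSupport_bump : HasCompactSupport (bump d) :=
  ContDiffBump.hasCompactSupport_normed _

lemma tsupport_bump_subset : tsupport (bump d) ⊆ Metric.closedBall 0 (1 / 2) := by
  rw [bump, ContDiffBump.tsupport_normed_eq]

lemma pnorm_le_of_mem_tsupport_bump {z : SpaceTime d} (hz : z ∈ tsupport (bump d)) :
    |z.1| ≤ 1 / 2 ∧ ‖z.2‖ ≤ 1 / 2 ∧ pnorm z ≤ 1 := by
  have h := tsupport_bump_subset hz
  rw [mem_closedBall_zero_iff, Prod.norm_def, max_le_iff, Real.norm_eq_abs] at h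
  refine ⟨h.1, h.2, pnorm_le_of_sq_le zero_le_one ?_⟩
  nlinarith [norm_nonneg z.2, h.1, h.2]

/-- The bump function at scale `lam`. -/
noncomputable def mollifier (lam : ℝ) (k : SpaceTime d) : ℝ := rescale (bump d) lam 0 k

lemma continuous_mollifier (lam : ℝ) : Continuous (mollifier (d := d) lam) :=
  continuous_rescale contDiff_bump.continuous _ _

lemma mollifier_nonneg {lam : ℝ} (hl : 0 < lam) (k : SpaceTime d) : 0 ≤ mollifier lam k :=
  mul_nonneg (by positivity) (bump_nonneg _)

lemma integral_mollifier {lam : ℝ} (hl : 0 < lam) : ∫ k : SpaceTime d, mollifier lam k = 1 := by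
  unfold mollifier
  rw [integral_dilate contDiff_bump.continuous hasCompactSupport_bump hl, integral_bump]

lemma pnorm_le_of_mollifier_ne_zero {lam : ℝ} (hl : 0 < lam) {k : SpaceTime d}
    (hk : mollifier lam k ≠ 0) : pnorm k ≤ lam := by
  have h1 : bump d (dilate lam k) ≠ 0 := by
    intro h
    apply hk
    rw [mollifier, rescale_eq, sub_zero, h, mul_zero]
  have h2 := (pnorm_le_of_mem_tsupport_bump (subset_tsupport _ h1)).2.2
  rwa [pnorm_dilate hl, div_le_one hl] at h2

lemma integrable_mollifier {lam : ℝ} (hl : 0 < lam) : Integrable (mollifier (d := d) lam) := by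
  by_contra h
  have := integral_mollifier (d := d) hl
  rw [integral_undef h] at this
  exact zero_ne_one this

lemma lintegral_mollifier {lam : ℝ} (hl : 0 < lam) :
    ∫⁻ k : SpaceTime d, ‖mollifier lam k‖ₑ = 1 := by
  have h1 : ∀ k : SpaceTime d, ‖mollifier lam k‖ₑ = ENNReal.ofReal (mollifier lam k) :=
    fun k => Real.enorm_of_nonneg (mollifier_nonneg hl k)
  simp_rw [h1]
  rw [← ofReal_integral_eq_lintegral_ofReal (integrable_mollifier hl)
    (Eventually.of_forall (mollifier_nonneg hl)), integral_mollifier hl, ENNReal.ofReal_one]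

/-- Averages against a mollifier of a function that is close to a constant. -/
lemma enorm_integral_mollifier_mul_sub_le {lam : ℝ} (hl : 0 < lam) {V : SpaceTime d → ℝ} {c : ℝ}
    {E : ℝ≥0∞} (hint : Integrable fun h => mollifier lam h * V h)
    (hE : ∀ h, pnorm h ≤ lam → ‖V h - c‖ₑ ≤ E) :
    ‖(∫ h, mollifier lam h * V h) - c‖ₑ ≤ E := by
  have e : (∫ h, mollifier lam h * V h) - c = ∫ h, mollifier lam h * (V h - c) := by
    have : ∫ h : SpaceTime d, mollifier lam h * c = c := by
      rw [integral_mul_const, integral_mollifier hl, one_mul]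
    rw [← this, ← integral_sub hint ((integrable_mollifier hl).mul_const c), this]
    simp only [mul_sub]
  rw [e]
  refine (enorm_integral_le_lintegral_enorm _).trans ?_
  calc ∫⁻ h, ‖mollifier lam h * (V h - c)‖ₑ ≤ ∫⁻ h : SpaceTime d, ‖mollifier lam h‖ₑ * E := by
        refine lintegral_mono fun h => ?_
        rw [enorm_mul]
        rcases eq_or_ne (mollifier lam h) 0 with h0 | h0
        · simp [h0]
        · exact mul_le_mul_right (hE h (pnorm_le_of_mollifier_ne_zero hl h0)) _
    _ = E := by
        rw [lintegral_mul_const _ (continuous_mollifier lam).enorm.measurable,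
          lintegral_mollifier hl, one_mul]

/-! ### Reconstruction of germs over the torus -/

lemma norm_le_pnorm {z : SpaceTime d} (hz : pnorm z ≤ 1) : ‖z‖ ≤ pnorm z := by
  rw [Prod.norm_def, max_le_iff]
  refine ⟨?_, norm_snd_le_pnorm z⟩
  rw [Real.norm_eq_abs]
  exact (abs_fst_le_pnorm_sq z).trans (by nlinarith [pnorm_nonneg z])

lemma integrable_mollifier_mul_mollifier_mul {J : SpaceTime d → ℝ} (hJm : StronglyMeasurable J)
    {B : ℝ} (hJb : ∀ h, pnorm h ≤ 1 → |J h| ≤ B) {l l' : ℝ} (hl : 0 < l) (hl4 : l ≤ 1 / 4)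
    (hl' : 0 < l') (hl4' : l' ≤ 1 / 4) :
    Integrable (fun q : SpaceTime d × SpaceTime d =>
      mollifier l q.1 * (mollifier l' q.2 * J (q.1 + q.2))) (volume.prod volume) := by
  have hm : Integrable (fun q : SpaceTime d × SpaceTime d => mollifier l q.1 * mollifier l' q.2)
      (volume.prod volume) :=
    Integrable.mul_prod (integrable_mollifier hl) (integrable_mollifier hl')
  refine (hm.mul_const B).mono' ?_ (Eventually.of_forall fun q => ?_)
  · refine StronglyMeasurable.aestronglyMeasurable ?_
    exact ((continuous_mollifier l).comp continuous_fst).stronglyMeasurable.mul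
      (((continuous_mollifier l').comp continuous_snd).stronglyMeasurable.mul
        (hJm.comp_measurable (measurable_fst.add measurable_snd)))
  · rw [norm_mul, norm_mul, Real.norm_of_nonneg (mollifier_nonneg hl _),
      Real.norm_of_nonneg (mollifier_nonneg hl' _), ← mul_assoc]
    rcases eq_or_ne (mollifier l q.1) 0 with h1 | h1
    · simp [h1]
    rcases eq_or_ne (mollifier l' q.2) 0 with h2 | h2
    · simp [h2]
    refine mul_le_mul_of_nonneg_left (hJb _ (pnorm_add_le_one
      ((pnorm_le_of_mollifier_ne_zero hl h1).trans hl4)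
      ((pnorm_le_of_mollifier_ne_zero hl' h2).trans hl4'))) ?_
    exact mul_nonneg (mollifier_nonneg hl _) (mollifier_nonneg hl' _)

lemma integrable_mollifier_mul {J : SpaceTime d → ℝ} (hJm : StronglyMeasurable J)
    {B : ℝ} (hJb : ∀ h, pnorm h ≤ 1 → |J h| ≤ B) {l : ℝ} (hl : 0 < l) (hl4 : l ≤ 1 / 4)
    {h : SpaceTime d} (hh : pnorm h ≤ 1 / 4) :
    Integrable (fun k => mollifier l k * J (h + k)) := by
  refine ((integrable_mollifier hl).mul_const B).mono' ?_ (Eventually.of_forall fun k => ?_)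
  · exact ((continuous_mollifier l).stronglyMeasurable.mul
      (hJm.comp_measurable (measurable_const_add h))).aestronglyMeasurable
  · rw [norm_mul, Real.norm_of_nonneg (mollifier_nonneg hl _)]
    rcases eq_or_ne (mollifier l k) 0 with h1 | h1
    · simp [h1]
    · exact mul_le_mul_of_nonneg_left (hJb _ (pnorm_add_le_one hh
        ((pnorm_le_of_mollifier_ne_zero hl h1).trans hl4))) (mollifier_nonneg hl _)

/-- The dyadic scales below `μ`. -/
noncomputable def scale (μ : ℝ) (n : ℕ) : ℝ := μ / 2 ^ n

lemma scale_pos {μ : ℝ} (hμ : 0 < μ) (n : ℕ) : 0 < scale μ n := by unfold scale; positivity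

lemma scale_le {μ : ℝ} (hμ : 0 < μ) (n : ℕ) : scale μ n ≤ μ :=
  div_le_self hμ.le (one_le_pow₀ one_le_two)

lemma scale_succ (μ : ℝ) (n : ℕ) : scale μ (n + 1) = scale μ n / 2 := by
  rw [scale, scale, pow_succ, div_mul_eq_div_div]

lemma scale_succ_le {μ : ℝ} (hμ : 0 < μ) (n : ℕ) : scale μ (n + 1) ≤ scale μ n := by
  rw [scale_succ]; linarith [scale_pos hμ n]

lemma tendsto_scale (μ : ℝ) : Tendsto (scale μ) atTop (𝓝 0) := by
  have := (tendsto_pow_atTop_nhds_zero_of_lt_one (r := (1 / 2 : ℝ)) (by norm_num)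
    (by norm_num)).const_mul μ
  rw [mul_zero] at this
  refine this.congr fun n => ?_
  rw [scale, one_div, inv_pow]; rfl

/-- A multiscale bound for the value of a function at the origin. Averaging with two mollifiers at
consecutive scales makes the difference between consecutive scales a single mollification, tested
against an increment. -/
lemma enorm_le_of_mollified_increments {J : SpaceTime d → ℝ} (hJm : StronglyMeasurable J)
    {B : ℝ} (hJb : ∀ h, pnorm h ≤ 1 → |J h| ≤ B) (hJc : ContinuousAt J 0) {μ : ℝ} (hμ : 0 < μ)
    (hμ' : μ ≤ 1 / 4) (E : ℕ → ℝ≥0∞)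
    (hE : ∀ n h, pnorm h ≤ scale μ n →
      ‖(∫ k, mollifier (scale μ (n + 1)) k * J (h + k)) -
        ∫ k, mollifier (scale μ (n + 1)) k * J (0 + k)‖ₑ ≤ E n) :
    ‖J 0‖ₑ ≤ ‖∫ k, mollifier (scale μ 1) k * J (0 + k)‖ₑ + 3 * ∑' n, E n := by
  have hs0 : ∀ n, 0 < scale μ n := scale_pos hμ
  have hs4 : ∀ n, scale μ n ≤ 1 / 4 := fun n => (scale_le hμ n).trans hμ'
  set V : ℕ → SpaceTime d → ℝ := fun m h => ∫ k, mollifier (scale μ m) k * J (h + k) with hV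
  set u : ℕ → ℝ := fun n => ∫ h, mollifier (scale μ n) h * V (n + 1) h with hu
  have hprod : ∀ n m, Integrable (fun q : SpaceTime d × SpaceTime d =>
      mollifier (scale μ n) q.1 * (mollifier (scale μ m) q.2 * J (q.1 + q.2)))
      (volume.prod volume) := fun n m =>
    integrable_mollifier_mul_mollifier_mul hJm hJb (hs0 n) (hs4 n) (hs0 m) (hs4 m)
  have hVint : ∀ n m, Integrable fun h => mollifier (scale μ n) h * V m h := by
    intro n m
    have := (hprod n m).integral_prod_left
    simpa only [integral_const_mul] using this
  -- the roles of the two mollifiers can be exchanged, so `u n` and `u (n + 1)` are both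
  -- averages of `V (n + 1)`
  have hu1 : ∀ n, u (n + 1) = ∫ h, mollifier (scale μ (n + 2)) h * V (n + 1) h := by
    intro n
    have h1 := integral_integral_swap (f := fun h k : SpaceTime d => mollifier (scale μ (n + 1)) h *
      (mollifier (scale μ (n + 2)) k * J (h + k))) (hprod (n + 1) (n + 2))
    simp only [integral_const_mul] at h1
    rw [hu]
    simp only [hV]
    rw [h1]
    refine integral_congr_ae (Eventually.of_forall fun k => ?_)
    simp only
    rw [← integral_const_mul]
    refine integral_congr_ae (Eventually.of_forall fun h => ?_)
    simp only [add_comm h k]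
    ring
  have b1 : ∀ n, edist (u n) (V (n + 1) 0) ≤ E n := fun n => by
    rw [edist_eq_enorm_sub]
    exact enorm_integral_mollifier_mul_sub_le (hs0 n) (hVint n (n + 1)) (hE n)
  have b2 : ∀ n, edist (u (n + 1)) (V (n + 1) 0) ≤ E n := fun n => by
    rw [edist_eq_enorm_sub, hu1]
    refine enorm_integral_mollifier_mul_sub_le (hs0 (n + 2)) (hVint (n + 2) (n + 1))
      fun h hh => hE n h (hh.trans ((scale_succ_le hμ (n + 1)).trans (scale_succ_le hμ n)))
  have b3 : ∀ n, edist (u n) (u n.succ) ≤ 2 * E n := fun n => by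
    refine (edist_triangle_right _ _ (V (n + 1) 0)).trans ?_
    rw [two_mul]
    exact add_le_add (b1 n) (b2 n)
  -- `u n` averages `J` over shrinking neighbourhoods of the origin
  have hlim : Tendsto u atTop (𝓝 (J 0)) := by
    rw [EMetric.tendsto_atTop]
    intro ε hε
    obtain ⟨ε', hε'0, hε'⟩ := exists_between hε
    have hev : ∀ᶠ z in 𝓝 (0 : SpaceTime d), edist (J z) (J 0) ≤ ε' :=
      hJc.eventually (Metric.closedEBall_mem_nhds _ hε'0)
    obtain ⟨δ, hδ, hball⟩ := Metric.eventually_nhds_iff.1 hev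
    obtain ⟨n₀, hn₀⟩ := eventually_atTop.1
      ((tendsto_scale μ).eventually (gt_mem_nhds (show 0 < δ / 2 by linarith)))
    refine ⟨n₀, fun n hn => lt_of_le_of_lt ?_ hε'⟩
    rw [edist_eq_enorm_sub]
    refine enorm_integral_mollifier_mul_sub_le (hs0 n) (hVint n (n + 1)) fun h hh => ?_
    refine enorm_integral_mollifier_mul_sub_le (hs0 (n + 1)) (integrable_mollifier_mul hJm hJb
      (hs0 (n + 1)) (hs4 (n + 1)) (hh.trans (hs4 n))) fun k hk => ?_
    rw [← edist_eq_enorm_sub]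
    apply hball
    rw [dist_zero_right]
    have h1 := norm_le_pnorm (hh.trans ((hs4 n).trans (by norm_num)))
    have h2 := norm_le_pnorm (hk.trans ((hs4 (n + 1)).trans (by norm_num)))
    have h3 := hn₀ n hn
    have h4 := hn₀ (n + 1) (by omega)
    calc ‖h + k‖ ≤ ‖h‖ + ‖k‖ := norm_add_le _ _
      _ < δ := by linarith
  have hsum := edist_le_tsum_of_edist_le_of_tendsto₀ (fun n => 2 * E n) b3 hlim
  rw [ENNReal.tsum_mul_left] at hsum
  have hE0 : E 0 ≤ ∑' n, E n := ENNReal.le_tsum 0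
  calc ‖J 0‖ₑ = edist (J 0) 0 := by rw [edist_zero_right]
    _ ≤ edist (J 0) (u 0) + edist (u 0) (V 1 0) + edist (V 1 0) 0 := edist_triangle4 _ _ _ _
    _ ≤ 2 * (∑' n, E n) + (∑' n, E n) + ‖V 1 0‖ₑ := by
        refine add_le_add (add_le_add ?_ ((b1 0).trans hE0)) (by rw [edist_zero_right])
        rw [edist_comm]; exact hsum
    _ = _ := by ring

/-- Qualitative regularity of a germ, that is, of a family `F x` of functions indexed by base points
`x`; `B` dominates the germ near the diagonal. -/
structure GermRegular (F : SpaceTime d → SpaceTime d → ℝ) (B : ℝ → ℝ) : Prop where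
  measurable : Measurable (Function.uncurry F)
  periodic : ∀ (k : Fin d → ℤ) x y, F (x + (0, latticeVec k)) (y + (0, latticeVec k)) = F x y
  integrableOn : IntegrableOn B (Icc (-2) 3)
  bound : ∀ x h, x.1 ∈ Icc (-1 : ℝ) 2 → pnorm h ≤ 1 → |F x (x + h)| ≤ B (x.1 + h.1)
  continuous : ∀ y, Continuous fun x => F x y

lemma integrableOn_time {φ : ℝ → ℝ} {A : Set ℝ} (hφ : IntegrableOn φ A) :
    IntegrableOn (fun z : SpaceTime d => φ z.1) (A ×ˢ cube d) := by
  rw [IntegrableOn, Measure.volume_eq_prod, ← Measure.prod_restrict]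
  have : IsFiniteMeasure ((volume : Measure (Space d)).restrict (cube d)) :=
    ⟨by rw [Measure.restrict_apply_univ, volume_cube]; exact ENNReal.one_lt_top⟩
  have h : Integrable (fun z : SpaceTime d => φ z.1 * (1 : ℝ))
      ((volume.restrict A).prod (volume.restrict (cube d))) :=
    Integrable.mul_prod (g := fun _ : Space d => (1 : ℝ)) hφ (integrable_const _)
  simpa using h

lemma integral_time (φ : ℝ → ℝ) (A : Set ℝ) :
    ∫ z in A ×ˢ cube d, φ z.1 = ∫ t in A, φ t := by
  have h := setIntegral_prod_mul (μ := (volume : Measure ℝ)) (ν := (volume : Measure (Space d)))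
    φ (fun _ => (1 : ℝ)) A (cube d)
  rw [← Measure.volume_eq_prod] at h
  simpa [Measure.real, volume_cube] using h

lemma integrableOn_comp_add {φ : ℝ → ℝ} {A : Set ℝ} (hφ : IntegrableOn φ A) (c : ℝ) :
    IntegrableOn (fun t => φ (t + c)) ((fun t => t + c) ⁻¹' A) :=
  ((measurePreserving_add_right volume c).integrableOn_comp_preimage
    (measurableEmbedding_addRight c)).2 hφ

lemma setIntegral_comp_add (φ : ℝ → ℝ) (A : Set ℝ) (c : ℝ) :
    ∫ t in (fun t => t + c) ⁻¹' A, φ (t + c) = ∫ t in A, φ t :=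
  (measurePreserving_add_right volume c).setIntegral_preimage_emb
    (measurableEmbedding_addRight c) φ A

namespace GermRegular

variable {F : SpaceTime d → SpaceTime d → ℝ} {B : ℝ → ℝ}

lemma abs_fst_le_one {h : SpaceTime d} (hh : pnorm h ≤ 1) : |h.1| ≤ 1 :=
  (abs_fst_le_pnorm_sq h).trans (by nlinarith [pnorm_nonneg h])

lemma measurable_shift (hF : GermRegular F B) (h : SpaceTime d) :
    Measurable fun x => F x (x + h) :=
  hF.measurable.comp (measurable_id.prodMk (measurable_add_const h))

lemma integrableOn_shift_bound (hF : GermRegular F B) {T : ℝ} (hT : T ≤ 1) {h : SpaceTime d}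
    (hh : pnorm h ≤ 1) : IntegrableOn (fun t => |B (t + h.1)|) (Icc 0 T) := by
  have h1 := abs_le.1 (abs_fst_le_one hh)
  have h2 : IntegrableOn (fun t => |B (t + h.1)|) ((fun t => t + h.1) ⁻¹' Icc (-2) 3) :=
    (integrableOn_comp_add hF.integrableOn h.1).abs
  refine h2.mono_set fun t ht => ?_
  exact ⟨by linarith [ht.1], by linarith [ht.2]⟩

lemma integrableOn_shift (hF : GermRegular F B) {T : ℝ} (hT : T ≤ 1) {h : SpaceTime d}
    (hh : pnorm h ≤ 1) : IntegrableOn (fun x => F x (x + h)) (Icc 0 T ×ˢ cube d) := by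
  refine (integrableOn_time (hF.integrableOn_shift_bound hT hh)).mono'
    (hF.measurable_shift h).aestronglyMeasurable ?_
  filter_upwards [ae_restrict_mem (measurableSet_Icc.prod measurableSet_cube)] with x hx
  exact (hF.bound x h ⟨by linarith [hx.1.1], by linarith [hx.1.2]⟩ hh).trans (le_abs_self _)

lemma integral_norm_shift_le (hF : GermRegular F B) {T : ℝ} (hT : T ≤ 1) {h : SpaceTime d}
    (hh : pnorm h ≤ 1) :
    ∫ x in Icc 0 T ×ˢ cube d, ‖F x (x + h)‖ ≤ ∫ t in Icc (-2) 3, |B t| := by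
  have h1 := abs_le.1 (abs_fst_le_one hh)
  calc _ ≤ ∫ x in Icc 0 T ×ˢ cube d, |B (x.1 + h.1)| := by
        refine setIntegral_mono_on (hF.integrableOn_shift hT hh).norm
          (integrableOn_time (hF.integrableOn_shift_bound hT hh))
          (measurableSet_Icc.prod measurableSet_cube) fun x hx => ?_
        exact (hF.bound x h ⟨by linarith [hx.1.1], by linarith [hx.1.2]⟩ hh).trans (le_abs_self _)
    _ = ∫ t in Icc 0 T, |B (t + h.1)| := integral_time (fun t => |B (t + h.1)|) _
    _ ≤ ∫ t in (fun t => t + h.1) ⁻¹' Icc (-2) 3, |B (t + h.1)| := by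
        refine setIntegral_mono_set (integrableOn_comp_add hF.integrableOn h.1).abs
          (Eventually.of_forall fun _ => abs_nonneg _) (LE.le.eventuallyLE fun t ht => ?_)
        exact ⟨by linarith [ht.1], by linarith [ht.2]⟩
    _ = _ := setIntegral_comp_add (fun t => |B t|) _ _

/-- The integral of a germ at a fixed distance from the diagonal. -/
noncomputable def _root_.SPM.offDiagonal (F : SpaceTime d → SpaceTime d → ℝ) (T : ℝ)
    (h : SpaceTime d) : ℝ := ∫ x in Icc 0 T ×ˢ cube d, F x (x + h)

/-- A germ averaged at scale `lam` around `w`. -/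
noncomputable def _root_.SPM.germAverage (F : SpaceTime d → SpaceTime d → ℝ) (lam : ℝ)
    (x w : SpaceTime d) : ℝ := ∫ k, mollifier lam k * F x (w + k)

lemma stronglyMeasurable_offDiagonal (hF : GermRegular F B) (T : ℝ) :
    StronglyMeasurable (offDiagonal F T) := by
  have h : Measurable fun q : SpaceTime d × SpaceTime d => F q.2 (q.2 + q.1) :=
    hF.measurable.comp (measurable_snd.prodMk (measurable_snd.add measurable_fst))
  exact h.stronglyMeasurable.integral_prod_right (ν := volume.restrict (Icc 0 T ×ˢ cube d))

lemma abs_offDiagonal_le (hF : GermRegular F B) {T : ℝ} (hT : T ≤ 1) (h : SpaceTime d)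
    (hh : pnorm h ≤ 1) : |offDiagonal F T h| ≤ ∫ t in Icc (-2) 3, |B t| :=
  (norm_integral_le_integral_norm _).trans (hF.integral_norm_shift_le hT hh)

/-- Integrals of a germ close to the diagonal converge to the integral over the diagonal. Shifting
the base point instead of the evaluation point, only continuity in the base point is needed. -/
lemma continuousAt_offDiagonal (hF : GermRegular F B) {T : ℝ} (hT : T ≤ 1) :
    ContinuousAt (offDiagonal F T) 0 := by
  set S : Set (SpaceTime d) := Icc (-1 : ℝ) 2 ×ˢ cube d with hS
  have hSm : MeasurableSet S := measurableSet_Icc.prod measurableSet_cube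
  set Φ : SpaceTime d → SpaceTime d → ℝ := fun h z =>
    {z : SpaceTime d | z.1 ∈ Icc h.1 (T + h.1)}.indicator (fun z => F (z - h) z) z with hΦ
  have hmeas : ∀ h : SpaceTime d, Measurable fun z => F (z - h) z := fun h =>
    hF.measurable.comp ((measurable_sub_const h).prodMk measurable_id)
  have hsm : ∀ h : SpaceTime d, MeasurableSet {z : SpaceTime d | z.1 ∈ Icc h.1 (T + h.1)} :=
    fun h => measurable_fst measurableSet_Icc
  -- with the evaluation point as variable, the domain of integration moves with `h` and is
  -- encoded in an indicator function on a fixed domain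
  have hrep : ∀ h : SpaceTime d, pnorm h ≤ 1 → offDiagonal F T h = ∫ z in S, Φ h z := by
    intro h hh
    have h1 := abs_le.1 (abs_fst_le_one hh)
    have hper : SpacePeriodic fun z => F (z - h) z := by
      intro k z
      simp only
      rw [add_sub_right_comm, hF.periodic]
    have e1 := integral_prod_cube_add hper (A := Icc h.1 (T + h.1)) measurableSet_Icc h
    have e2 : (fun t => t + h.1) ⁻¹' Icc h.1 (T + h.1) = Icc 0 T := by
      ext t; simp
    rw [e2] at e1
    simp only [add_sub_cancel_right] at e1
    rw [offDiagonal, e1, hΦ, setIntegral_indicator (hsm h)]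
    congr 2
    ext z
    simp only [hS, mem_prod, mem_inter_iff, mem_ofPred_eq]
    constructor
    · rintro ⟨h2, h3⟩
      exact ⟨⟨⟨by linarith [h2.1], by linarith [h2.2]⟩, h3⟩, h2⟩
    · rintro ⟨⟨_, h3⟩, h2⟩
      exact ⟨h2, h3⟩
  have hev : ∀ᶠ h in 𝓝 (0 : SpaceTime d), pnorm h ≤ 1 :=
    continuous_pnorm.continuousAt.eventually_le_const (by simp)
  have hlim : Tendsto (fun h => ∫ z in S, Φ h z) (𝓝 0) (𝓝 (∫ z in S, Φ 0 z)) := by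
    refine tendsto_integral_filter_of_dominated_convergence (fun z => |B z.1|) ?_ ?_ ?_ ?_
    · exact Eventually.of_forall fun h => ((hmeas h).indicator (hsm h)).aestronglyMeasurable
    · filter_upwards [hev] with h hh
      refine Eventually.of_forall fun z => ?_
      have h1 := abs_le.1 (abs_fst_le_one hh)
      by_cases hz : z ∈ {z : SpaceTime d | z.1 ∈ Icc h.1 (T + h.1)}
      · have hz' : z.1 ∈ Icc h.1 (T + h.1) := hz
        simp only [hΦ, indicator_of_mem hz]
        have := hF.bound (z - h) h ⟨by simp only [Prod.fst_sub]; linarith [hz'.1],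
          by simp only [Prod.fst_sub]; linarith [hz'.2]⟩ hh
        rw [sub_add_cancel, Prod.fst_sub, sub_add_cancel] at this
        exact this.trans (le_abs_self _)
      · simp only [hΦ, indicator_of_notMem hz, norm_zero]
        exact abs_nonneg _
    · exact integrableOn_time ((hF.integrableOn.mono_set
        (Icc_subset_Icc (by norm_num) (by norm_num))).abs)
    -- the indicator is continuous in `h` except at the initial and the final time
    · have hne : ∀ᵐ z ∂((volume : Measure (SpaceTime d)).restrict S), z.1 ≠ 0 ∧ z.1 ≠ T := by
        refine ae_restrict_of_ae ?_
        have hnull : ∀ c : ℝ, ∀ᵐ z : SpaceTime d, z.1 ≠ c := fun c => by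
          rw [Measure.volume_eq_prod]
          exact Measure.quasiMeasurePreserving_fst.ae (p := fun t => t ≠ c)
            (compl_mem_ae_iff.2 (measure_singleton c))
        filter_upwards [hnull 0, hnull T] with z h1 h2 using ⟨h1, h2⟩
      filter_upwards [hne] with z hz
      have hcont : Tendsto (fun h => F (z - h) z) (𝓝 0) (𝓝 (F (z - 0) z)) :=
        ((hF.continuous z).comp (continuous_const.sub continuous_id)).tendsto 0
      have hfst : Tendsto (fun h : SpaceTime d => h.1) (𝓝 0) (𝓝 0) := continuous_fst.tendsto 0
      by_cases hz0 : z.1 ∈ Icc 0 T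
      · have h0 : 0 < z.1 := lt_of_le_of_ne hz0.1 (Ne.symm hz.1)
        have hTz : z.1 < T := lt_of_le_of_ne hz0.2 hz.2
        have e0 : Φ 0 z = F (z - 0) z := by
          simp only [hΦ]; rw [indicator_of_mem]; simpa using hz0
        rw [e0]
        refine hcont.congr' ?_
        filter_upwards [hfst.eventually (gt_mem_nhds h0),
          hfst.eventually (lt_mem_nhds (show z.1 - T < 0 by linarith))] with h ha hb
        simp only [hΦ]
        rw [indicator_of_mem]
        exact ⟨ha.le, by linarith⟩
      · have e0 : Φ 0 z = 0 := by
          simp only [hΦ]; rw [indicator_of_notMem]; simpa using hz0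
        rw [e0]
        refine tendsto_const_nhds.congr' ?_
        rw [mem_Icc, not_and_or, not_le, not_le] at hz0
        rcases hz0 with hz0 | hz0
        · filter_upwards [hfst.eventually (lt_mem_nhds hz0)] with h ha
          simp only [hΦ]
          rw [indicator_of_notMem]
          exact fun hc => by linarith [hc.1]
        · filter_upwards [hfst.eventually (gt_mem_nhds (show 0 < z.1 - T by linarith))] with h ha
          simp only [hΦ]
          rw [indicator_of_notMem]
          exact fun hc => by linarith [hc.2]
  rw [ContinuousAt, hrep 0 (by simp)]
  refine hlim.congr' ?_
  filter_upwards [hev] with h hh using (hrep h hh).symm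

end GermRegular

namespace GermRegular

variable {F : SpaceTime d → SpaceTime d → ℝ} {B : ℝ → ℝ}

lemma integrable_mollifier_mul_germ (hF : GermRegular F B) {T : ℝ} (hT : T ≤ 1) {l : ℝ}
    (hl : 0 < l) (hl4 : l ≤ 1 / 4) {h : SpaceTime d} (hh : pnorm h ≤ 1 / 4) :
    Integrable (fun q : SpaceTime d × SpaceTime d => mollifier l q.2 * F q.1 (q.1 + h + q.2))
      ((volume.restrict (Icc 0 T ×ˢ cube d)).prod volume) := by
  have hm : Measurable fun q : SpaceTime d × SpaceTime d =>
      mollifier l q.2 * F q.1 (q.1 + h + q.2) :=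
    ((continuous_mollifier l).measurable.comp measurable_snd).mul
      (hF.measurable.comp (measurable_fst.prodMk
        ((measurable_fst.add measurable_const).add measurable_snd)))
  rw [integrable_prod_iff' hm.aestronglyMeasurable]
  constructor
  · refine Eventually.of_forall fun k => ?_
    rcases eq_or_ne (mollifier l k) 0 with h1 | h1
    · simp [h1]
    · have h2 := pnorm_add_le_one hh ((pnorm_le_of_mollifier_ne_zero hl h1).trans hl4)
      have h3 : Integrable _ (volume.restrict (Icc 0 T ×ˢ cube d)) := hF.integrableOn_shift hT h2
      simpa only [add_assoc] using h3.const_mul (mollifier l k)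
  · refine ((integrable_mollifier hl).mul_const (∫ t in Icc (-2) 3, |B t|)).mono'
      (hm.norm.stronglyMeasurable.integral_prod_left'
        (μ := volume.restrict (Icc 0 T ×ˢ cube d))).aestronglyMeasurable
      (Eventually.of_forall fun k => ?_)
    rw [Real.norm_of_nonneg (integral_nonneg fun _ => norm_nonneg _)]
    simp only [norm_mul, Real.norm_of_nonneg (mollifier_nonneg hl k)]
    rw [integral_const_mul]
    rcases eq_or_ne (mollifier l k) 0 with h1 | h1
    · simp [h1]
    · have h2 := pnorm_add_le_one hh ((pnorm_le_of_mollifier_ne_zero hl h1).trans hl4)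
      have h3 := hF.integral_norm_shift_le hT h2
      simp only [← add_assoc] at h3
      exact mul_le_mul_of_nonneg_left h3 (mollifier_nonneg hl k)

lemma integrableOn_germAverage (hF : GermRegular F B) {T : ℝ} (hT : T ≤ 1) {l : ℝ}
    (hl : 0 < l) (hl4 : l ≤ 1 / 4) {h : SpaceTime d} (hh : pnorm h ≤ 1 / 4) :
    IntegrableOn (fun x => germAverage F l x (x + h)) (Icc 0 T ×ˢ cube d) :=
  (hF.integrable_mollifier_mul_germ hT hl hl4 hh).integral_prod_left

lemma integral_mollifier_mul_offDiagonal (hF : GermRegular F B) {T : ℝ} (hT : T ≤ 1) {l : ℝ}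
    (hl : 0 < l) (hl4 : l ≤ 1 / 4) {h : SpaceTime d} (hh : pnorm h ≤ 1 / 4) :
    ∫ k, mollifier l k * offDiagonal F T (h + k) =
      ∫ x in Icc 0 T ×ˢ cube d, germAverage F l x (x + h) := by
  have e := integral_integral_swap (f := fun x k : SpaceTime d => mollifier l k * F x (x + h + k))
    (hF.integrable_mollifier_mul_germ hT hl hl4 hh)
  unfold germAverage
  rw [e]
  refine integral_congr_ae (Eventually.of_forall fun k => ?_)
  simp only [offDiagonal, ← add_assoc]
  rw [integral_const_mul]

lemma germAverage_periodic (hF : GermRegular F B) (l : ℝ) (k : Fin d → ℤ) (x w : SpaceTime d) :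
    germAverage F l (x + (0, latticeVec k)) (w + (0, latticeVec k)) = germAverage F l x w := by
  unfold germAverage
  congr 1
  ext q
  rw [add_right_comm, hF.periodic]

lemma _root_.SPM.shiftDomain_eq (T : ℝ) (h : SpaceTime d) :
    shiftDomain T h = (Icc 0 T ∩ (fun t => t + h.1) ⁻¹' Icc 0 T) ×ˢ cube d := by
  ext x
  simp only [shiftDomain, mem_ofPred_eq, mem_prod, mem_inter_iff, mem_preimage, and_assoc]

lemma _root_.SPM.measurableSet_shiftDomain (T : ℝ) (h : SpaceTime d) :
    MeasurableSet (shiftDomain T h) := by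
  rw [shiftDomain_eq]
  exact (measurableSet_Icc.inter (measurable_add_const _ measurableSet_Icc)).prod measurableSet_cube

lemma _root_.SPM.shiftDomain_subset (T : ℝ) (h : SpaceTime d) :
    shiftDomain T h ⊆ Icc 0 T ×ˢ cube d := by
  rw [shiftDomain_eq]; exact prod_mono_left inter_subset_left

/-- The increments of averages of a germ split into an increment of the base point and two
contributions from the boundary layers in time. -/
lemma enorm_increment_le (hF : GermRegular F B) {T : ℝ} (hT : T ≤ 1) {l : ℝ}
    (hl : 0 < l) (hl4 : l ≤ 1 / 4) {h : SpaceTime d} (hh : pnorm h ≤ 1 / 4) :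
    ‖(∫ k, mollifier l k * offDiagonal F T (h + k)) -
        ∫ k, mollifier l k * offDiagonal F T (0 + k)‖ₑ ≤
      (∫⁻ x in shiftDomain T h, ‖germAverage F l x (x + h) - germAverage F l (x + h) (x + h)‖ₑ) +
      ((∫⁻ x in (Icc 0 T ×ˢ cube d) \ shiftDomain T h, ‖germAverage F l x (x + h)‖ₑ) +
      ∫⁻ x in (Icc 0 T ×ˢ cube d) \ shiftDomain T (-h), ‖germAverage F l x (x + 0)‖ₑ) := by
  have h00 : pnorm (0 : SpaceTime d) ≤ 1 / 4 := by rw [pnorm_zero]; norm_num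
  rw [hF.integral_mollifier_mul_offDiagonal hT hl hl4 hh,
    hF.integral_mollifier_mul_offDiagonal hT hl hl4 h00]
  set D : Set (SpaceTime d) := Icc 0 T ×ˢ cube d
  have i1 := hF.integrableOn_germAverage hT hl hl4 hh
  have i0 := hF.integrableOn_germAverage hT hl hl4 h00
  have e1 := setIntegral_sdiff (measurableSet_shiftDomain T h) i1 (shiftDomain_subset T h)
  have e0 := setIntegral_sdiff (measurableSet_shiftDomain T (-h)) i0 (shiftDomain_subset T (-h))
  have hper : SpacePeriodic fun x => germAverage F l x (x + 0) := by
    intro k x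
    simp only [add_zero]
    exact hF.germAverage_periodic l k x x
  have hA : MeasurableSet (Icc 0 T ∩ (fun t => t + (-h).1) ⁻¹' Icc 0 T) :=
    measurableSet_Icc.inter (measurable_add_const _ measurableSet_Icc)
  have hset : (fun t => t + h.1) ⁻¹' (Icc 0 T ∩ (fun t => t + (-h).1) ⁻¹' Icc 0 T) =
      Icc 0 T ∩ (fun t => t + h.1) ⁻¹' Icc 0 T := by
    ext t
    simp only [mem_preimage, mem_inter_iff, Prod.fst_neg, add_neg_cancel_right]
    exact and_comm
  -- translation by `h` maps `shiftDomain T h` onto `shiftDomain T (-h)`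
  have e2 : ∫ x in shiftDomain T h, germAverage F l (x + h) (x + h) =
      ∫ x in shiftDomain T (-h), germAverage F l x (x + 0) := by
    have := integral_prod_cube_add hper hA h
    rw [hset] at this
    rw [shiftDomain_eq, shiftDomain_eq, ← this]
    simp only [add_zero]
  have i2 : IntegrableOn (fun x => germAverage F l (x + h) (x + h)) (shiftDomain T h) := by
    have i0' : IntegrableOn (fun x => germAverage F l x (x + 0)) (shiftDomain T (-h)) :=
      i0.mono_set (shiftDomain_subset T (-h))
    have hmeas : Measurable fun x => germAverage F l x (x + 0) := by
      have hm : Measurable fun q : SpaceTime d × SpaceTime d =>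
          mollifier l q.2 * F q.1 (q.1 + 0 + q.2) :=
        ((continuous_mollifier l).measurable.comp measurable_snd).mul
          (hF.measurable.comp (measurable_fst.prodMk
            ((measurable_fst.add measurable_const).add measurable_snd)))
      exact hm.stronglyMeasurable.integral_prod_right.measurable
    refine ⟨?_, ?_⟩
    · have := hmeas.comp (measurable_add_const h)
      simpa only [Function.comp_def, add_zero] using this.aestronglyMeasurable
    · have hfin := i0'.2
      rw [HasFiniteIntegral] at hfin ⊢
      have hper' : SpacePeriodic fun x => ‖germAverage F l x (x + 0)‖ₑ := fun k x => by
        have := hper k x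
        simp only at this
        simp only [this]
      have := lintegral_prod_cube_add hper' hA h
      rw [hset, ← shiftDomain_eq, ← shiftDomain_eq] at this
      simp only [add_zero] at this hfin ⊢
      rw [this]
      exact hfin
  have key : (∫ x in D, germAverage F l x (x + h)) - ∫ x in D, germAverage F l x (x + 0) =
      (∫ x in shiftDomain T h, (germAverage F l x (x + h) - germAverage F l (x + h) (x + h))) +
      ((∫ x in D \ shiftDomain T h, germAverage F l x (x + h)) -
        ∫ x in D \ shiftDomain T (-h), germAverage F l x (x + 0)) := by
    rw [integral_sub (i1.mono_set (shiftDomain_subset T h)) i2, e1, e0, e2]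
    ring
  rw [key]
  refine (enorm_add_le _ _).trans (add_le_add (enorm_integral_le_lintegral_enorm _) ?_)
  exact (enorm_sub_le).trans (add_le_add (enorm_integral_le_lintegral_enorm _)
    (enorm_integral_le_lintegral_enorm _))

/-- Reconstruction on the torus: the integral of a germ over the diagonal is bounded by its average
at the largest scale, by the increments in the base point, and by boundary layers. -/
theorem enorm_integral_diagonal_le (hF : GermRegular F B) {T : ℝ} (hT : T ≤ 1) {μ : ℝ}
    (hμ : 0 < μ) (hμ' : μ ≤ 1 / 4) (E : ℕ → ℝ≥0∞)
    (hE : ∀ n h, pnorm h ≤ scale μ n →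
      (∫⁻ x in shiftDomain T h, ‖germAverage F (scale μ (n + 1)) x (x + h) -
        germAverage F (scale μ (n + 1)) (x + h) (x + h)‖ₑ) +
      ((∫⁻ x in (Icc 0 T ×ˢ cube d) \ shiftDomain T h,
        ‖germAverage F (scale μ (n + 1)) x (x + h)‖ₑ) +
      ∫⁻ x in (Icc 0 T ×ˢ cube d) \ shiftDomain T (-h),
        ‖germAverage F (scale μ (n + 1)) x (x + 0)‖ₑ) ≤ E n) :
    ‖∫ x in Icc 0 T ×ˢ cube d, F x x‖ₑ ≤
      (∫⁻ x in Icc 0 T ×ˢ cube d, ‖germAverage F (scale μ 1) x (x + 0)‖ₑ) + 3 * ∑' n, E n := by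
  have h00 : pnorm (0 : SpaceTime d) ≤ 1 / 4 := by rw [pnorm_zero]; norm_num
  have hs4 : ∀ n, scale μ n ≤ 1 / 4 := fun n => (scale_le hμ n).trans hμ'
  have h := enorm_le_of_mollified_increments (hF.stronglyMeasurable_offDiagonal T)
    (hF.abs_offDiagonal_le hT) (hF.continuousAt_offDiagonal hT) hμ hμ' E fun n h hh =>
      (hF.enorm_increment_le hT (scale_pos hμ _) (hs4 _) (hh.trans (hs4 n))).trans (hE n h hh)
  rw [hF.integral_mollifier_mul_offDiagonal hT (scale_pos hμ _) (hs4 _) h00] at h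
  have e : offDiagonal F T 0 = ∫ x in Icc 0 T ×ˢ cube d, F x x := by
    simp only [offDiagonal, add_zero]
  rw [e] at h
  exact h.trans (add_le_add (enorm_integral_le_lintegral_enorm _) le_rfl)

end GermRegular

/-! ### Testing the model off center -/

/-- The profiles against which germs are tested: smooth functions supported in the ball of radius
`1/2` around the origin. -/
structure IsProfile (ψ : SpaceTime d → ℝ) : Prop where
  contDiff : ContDiff ℝ ((⊤ : ℕ∞) : WithTop ℕ∞) ψ
  tsupport_subset : tsupport ψ ⊆ Metric.closedBall 0 (1 / 2)

lemma isProfile_bump : IsProfile (bump d) := ⟨contDiff_bump, tsupport_bump_subset⟩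

/-- The `i`-th spatial derivative of the bump function. -/
noncomputable def bumpDeriv (i : Fin d) (z : SpaceTime d) : ℝ :=
  sderiv (bump d) z (EuclideanSpace.single i 1)

lemma isProfile_bumpDeriv (i : Fin d) : IsProfile (bumpDeriv (d := d) i) := by
  refine ⟨(contDiff_sderiv contDiff_bump).clm_apply contDiff_const, ?_⟩
  refine (closure_mono ?_).trans ((tsupport_fderiv_subset ℝ).trans tsupport_bump_subset)
  intro z hz h0
  apply hz
  simp only [bumpDeriv, sderiv]
  rw [h0]
  rfl

namespace IsProfile

variable {ψ : SpaceTime d → ℝ}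

lemma hasCompactSupport (hψ : IsProfile ψ) : HasCompactSupport ψ :=
  (isCompact_closedBall (0 : SpaceTime d) (1 / 2)).of_isClosed_subset (isClosed_tsupport _)
    hψ.tsupport_subset

lemma le_of_ne_zero (hψ : IsProfile ψ) {z : SpaceTime d} (hz : ψ z ≠ 0) :
    |z.1| ≤ 1 / 2 ∧ ‖z.2‖ ≤ 1 / 2 := by
  have h := hψ.tsupport_subset (subset_tsupport _ hz)
  rwa [mem_closedBall_zero_iff, Prod.norm_def, max_le_iff, Real.norm_eq_abs] at h

lemma pnorm_le_of_rescale_ne_zero (hψ : IsProfile ψ) {l : ℝ} (hl : 0 < l) {k : SpaceTime d}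
    (hk : rescale ψ l 0 k ≠ 0) : pnorm k ≤ l := by
  have h1 : ψ (dilate l k) ≠ 0 := by
    intro h
    apply hk
    rw [rescale_eq, sub_zero, h, mul_zero]
  have h2 := hψ.le_of_ne_zero h1
  have h3 : pnorm (dilate l k) ≤ 1 :=
    pnorm_le_of_sq_le zero_le_one (by nlinarith [norm_nonneg (dilate l k).2, h2.1, h2.2])
  rwa [pnorm_dilate hl, div_le_one hl] at h3

lemma exists_bound (hψ : IsProfile ψ) :
    ∃ M : ℝ, 1 ≤ M ∧ ∀ k : ℕ, k ≤ 2 → ∀ z, ‖iteratedFDeriv ℝ k ψ z‖ ≤ M := by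
  have h (k : ℕ) : ∃ M : ℝ, ∀ z, ‖iteratedFDeriv ℝ k ψ z‖ ≤ M := by
    have hc : Continuous (iteratedFDeriv ℝ k ψ) :=
      hψ.contDiff.continuous_iteratedFDeriv (by exact_mod_cast le_top)
    exact (hψ.hasCompactSupport.iteratedFDeriv (𝕜 := ℝ) k).exists_bound_of_continuous hc
  choose M hM using h
  refine ⟨max 1 (max (M 0) (max (M 1) (M 2))), le_max_left _ _, fun k hk z => (hM k z).trans ?_⟩
  interval_cases k <;> simp

end IsProfile

/-- The linear part of the change of variables between parabolic scales `lam` and `4 * lam`. -/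
noncomputable def zoom (d : ℕ) : SpaceTime d →L[ℝ] SpaceTime d :=
  ((16 : ℝ) • ContinuousLinearMap.fst ℝ ℝ (Space d)).prod
    ((4 : ℝ) • ContinuousLinearMap.snd ℝ ℝ (Space d))

lemma zoom_apply (z : SpaceTime d) : zoom d z = (16 * z.1, (4 : ℝ) • z.2) := rfl

lemma norm_zoom_le : ‖zoom d‖ ≤ 16 := by
  refine ContinuousLinearMap.opNorm_le_bound _ (by norm_num) fun z => ?_
  rw [zoom_apply, Prod.norm_def, max_le_iff]
  constructor
  · rw [norm_mul, Real.norm_of_nonneg (by norm_num : (0 : ℝ) ≤ 16)]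
    exact mul_le_mul_of_nonneg_left (norm_fst_le z) (by norm_num)
  · rw [norm_smul, Real.norm_of_nonneg (by norm_num : (0 : ℝ) ≤ 4)]
    have := norm_snd_le z
    nlinarith [norm_nonneg z]

/-- A profile centered at a point `q` of the parabolic ball of radius `2` becomes, viewed from a
scale four times as large, a multiple of an admissible test function. At most two derivatives are
taken, each of which costs a factor `‖zoom‖ ≤ 16`. -/
lemma zoom_mem_testFunctions {ψ : SpaceTime d → ℝ} (hψ : IsProfile ψ) {M : ℝ} (hM1 : 1 ≤ M)
    (hM : ∀ k : ℕ, k ≤ 2 → ∀ z, ‖iteratedFDeriv ℝ k ψ z‖ ≤ M) {q : SpaceTime d}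
    (hq1 : |q.1| ≤ 4) (hq2 : ‖q.2‖ ≤ 2) :
    (fun z => (256 * M)⁻¹ • ψ (zoom d z - q)) ∈ TestFunctions d := by
  have hM0 : 0 < M := by linarith
  have hsub : ContDiff ℝ ((⊤ : ℕ∞) : WithTop ℕ∞) fun z => ψ (z - q) :=
    hψ.contDiff.comp (contDiff_id.sub contDiff_const)
  have hcomp : ContDiff ℝ ((⊤ : ℕ∞) : WithTop ℕ∞) fun z => ψ (zoom d z - q) :=
    hsub.comp (zoom d).contDiff
  refine ⟨hcomp.const_smul _, fun z hz => ?_, fun k hk z => ?_⟩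
  · have hne : ψ (zoom d z - q) ≠ 0 := fun h => hz (by simp only [h, smul_zero])
    have h := hψ.le_of_ne_zero hne
    rw [zoom_apply] at h
    simp only [Prod.fst_sub, Prod.snd_sub] at h
    have h1 : |z.1| ≤ 9 / 32 := by
      have h3 : |16 * z.1| ≤ 1 / 2 + 4 := by
        calc |16 * z.1| = |(16 * z.1 - q.1) + q.1| := by rw [sub_add_cancel]
          _ ≤ |16 * z.1 - q.1| + |q.1| := abs_add_le _ _
          _ ≤ _ := add_le_add h.1 hq1
      rw [abs_mul, abs_of_pos (by norm_num : (0 : ℝ) < 16)] at h3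
      linarith
    have h2 : ‖z.2‖ ≤ 5 / 8 := by
      have h3 : ‖(4 : ℝ) • z.2‖ ≤ 1 / 2 + 2 := by
        calc ‖(4 : ℝ) • z.2‖ = ‖((4 : ℝ) • z.2 - q.2) + q.2‖ := by rw [sub_add_cancel]
          _ ≤ ‖(4 : ℝ) • z.2 - q.2‖ + ‖q.2‖ := norm_add_le _ _
          _ ≤ _ := add_le_add h.2 hq2
      rw [norm_smul, Real.norm_of_nonneg (by norm_num : (0 : ℝ) ≤ 4)] at h3
      linarith
    refine pnorm_le_of_sq_le zero_le_one ?_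
    nlinarith [norm_nonneg z.2]
  · have hk' : ((k : ℕ∞) : WithTop ℕ∞) ≤ ((⊤ : ℕ∞) : WithTop ℕ∞) := by exact_mod_cast le_top
    have e1 : iteratedFDeriv ℝ k (fun z => (256 * M)⁻¹ • ψ (zoom d z - q)) z =
        (256 * M)⁻¹ • iteratedFDeriv ℝ k (fun z => ψ (zoom d z - q)) z :=
      iteratedFDeriv_const_smul_apply (a := (256 * M)⁻¹) (f := fun z => ψ (zoom d z - q))
        ((hcomp.of_le hk').contDiffAt)
    have e2 : iteratedFDeriv ℝ k (fun z => ψ (zoom d z - q)) z =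
        (iteratedFDeriv ℝ k ψ (zoom d z - q)).compContinuousLinearMap fun _ => zoom d := by
      have := (zoom d).iteratedFDeriv_comp_right (f := fun z => ψ (z - q)) hsub z hk'
      rw [iteratedFDeriv_comp_sub] at this
      exact this
    rw [e1, e2, norm_smul, Real.norm_of_nonneg (by positivity), inv_mul_le_iff₀ (by positivity),
      mul_one]
    refine (ContinuousMultilinearMap.norm_compContinuousLinearMap_le _ _).trans ?_
    rw [Finset.prod_const, Finset.card_univ, Fintype.card_fin, mul_comm 256 M]
    refine mul_le_mul (hM k hk _) ?_ (by positivity) hM0.le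
    calc ‖zoom d‖ ^ k ≤ 16 ^ k := pow_le_pow_left₀ (norm_nonneg _) norm_zoom_le k
      _ ≤ 16 ^ 2 := pow_le_pow_right₀ (by norm_num) hk
      _ = 256 := by norm_num

/-- The model bounds also control test functions that are centered at a point `w` close to the base
point `x`. -/
lemma exists_pairing_le {ψ : SpaceTime d → ℝ} (hψ : IsProfile ψ) (h : ℝ) :
    ∃ K : ℝ, 0 < K ∧ ∀ (V : Type) [NormedAddCommGroup V] [NormedSpace ℝ V] (a σ : ℝ → ℝ)
      (P : ℝ → SpaceTime d → SpaceTime d → V) (e : ℝ) (n : ℝ≥0), ModelBound a σ P h e n →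
      ∀ x ∈ box d, ∀ lam, 0 < lam → 4 * lam < 1 → ∀ w, pnorm (w - x) ≤ 2 * lam →
      ∀ b ∈ (a '' tsupport σ) \ {0}, ∀ m : ℕ, m ≤ 1 →
      ‖∫ k, rescale ψ lam 0 k • iteratedDeriv m (fun b' => P b' x (w + k)) b‖ ≤
        K * n * lam ^ h * b ^ (-e - m) := by
  obtain ⟨M, hM1, hM⟩ := hψ.exists_bound
  have hM0 : 0 < M := by linarith
  refine ⟨4 ^ ((d : ℝ) + 2) * (256 * M) * 4 ^ h, by positivity, ?_⟩
  intro V _ _ a σ P e n hP x hx lam hl hl1 w hw b hb m hm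
  set q : SpaceTime d := dilate lam (w - x) with hq
  have hqn : pnorm q ≤ 2 := by
    rw [hq, pnorm_dilate hl, div_le_iff₀ hl]; exact hw
  have hq1 : |q.1| ≤ 4 := (abs_fst_le_pnorm_sq q).trans (by nlinarith [pnorm_nonneg q])
  have hq2 : ‖q.2‖ ≤ 2 := (norm_snd_le_pnorm q).trans hqn
  have hφ := zoom_mem_testFunctions hψ hM1 hM hq1 hq2
  -- the ball of radius `lam` around `w` lies in the ball of radius `4 * lam` around `x`
  have key := hP x hx (4 * lam) ⟨by positivity, hl1⟩ b hb m hm _ hφ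
  have e1 : ∀ y, rescale ψ lam w y = (4 ^ ((d : ℝ) + 2) * (256 * M)) *
      rescale (fun z => (256 * M)⁻¹ • ψ (zoom d z - q)) (4 * lam) x y := by
    intro y
    rw [rescale_eq, rescale_eq]
    have hz : zoom d (dilate (4 * lam) (y - x)) - q = dilate lam (y - w) := by
      rw [zoom_apply, hq]
      refine Prod.ext ?_ ?_
      · simp only [dilate, Prod.fst_sub]
        field_simp
        ring
      · simp only [dilate, Prod.snd_sub, smul_smul]
        rw [show (4 : ℝ) * (4 * lam)⁻¹ = lam⁻¹ by field_simp, ← smul_sub]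
        congr 1
        abel
    simp only [hz, smul_eq_mul]
    rw [Real.mul_rpow (by norm_num) hl.le, show -(d : ℝ) - 2 = -((d : ℝ) + 2) by ring,
      Real.rpow_neg (by norm_num : (0 : ℝ) ≤ 4)]
    have h4 : (0 : ℝ) < 4 ^ ((d : ℝ) + 2) := by positivity
    generalize lam ^ (-((d : ℝ) + 2)) = r
    generalize (4 : ℝ) ^ ((d : ℝ) + 2) = r' at h4
    field_simp
  have e2 : ∫ k, rescale ψ lam 0 k • iteratedDeriv m (fun b' => P b' x (w + k)) b =
      ∫ y, rescale ψ lam w y • iteratedDeriv m (fun b' => P b' x y) b := by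
    rw [← integral_add_left_eq_self
      (fun y => rescale ψ lam w y • iteratedDeriv m (fun b' => P b' x y) b) w]
    simp only [rescale_add]
  rw [e2]
  simp only [e1]
  simp_rw [mul_smul ((4 : ℝ) ^ ((d : ℝ) + 2) * (256 * M))]
  rw [integral_smul, norm_smul, Real.norm_of_nonneg (by positivity)]
  calc _ ≤ 4 ^ ((d : ℝ) + 2) * (256 * M) * (n * (4 * lam) ^ h * b ^ (-e - m)) := by gcongr
    _ = _ := by rw [Real.mul_rpow (by norm_num) hl.le]; ring

/-! ### Differentiating pairings in the diffusivity -/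

/-- A family of functions of space-time that is, up to a counterterm, differentiable in the
diffusivity with continuous derivative. -/
structure DiffFamily (P : ℝ → SpaceTime d → ℝ) (S S' : ℝ → SpaceTime d → ℝ) (c : ℝ → ℝ → ℝ) :
    Prop where
  eq : ∀ b, 0 < b → ∀ y, P b y = S b y - c b y.1
  hasDerivAt : ∀ b, 0 < b → ∀ y, HasDerivAt (fun b => S b y) (S' b y) b
  continuousOn : ContinuousOn (Function.uncurry S) (Ioi 0 ×ˢ univ)
  continuousOn_deriv : ContinuousOn (Function.uncurry S') (Ioi 0 ×ˢ univ)
  counterterm : CountertermRegular c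

lemma CountertermRegular.hasDerivAt {c : ℝ → ℝ → ℝ} (hc : CountertermRegular c) {b : ℝ}
    (hb : 0 < b) (s : ℝ) : HasDerivAt (fun b => c b s) (deriv (fun b => c b s) b) b :=
  (((hc.contDiffOn s).differentiableOn (by norm_num)).differentiableAt
    (Ioi_mem_nhds hb)).hasDerivAt

lemma CountertermRegular.measurable_deriv {c : ℝ → ℝ → ℝ} (hc : CountertermRegular c) {b : ℝ}
    (hb : 0 < b) : Measurable fun s => deriv (fun b => c b s) b := by
  have hlim : ∀ s, Tendsto (fun n : ℕ => ((1 / ((n : ℝ) + 1)))⁻¹ • (c (b + 1 / ((n : ℝ) + 1)) s - c b s))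
      atTop (𝓝 (deriv (fun b => c b s) b)) := by
    intro s
    have h := hasDerivAt_iff_tendsto_slope_zero.1 (hc.hasDerivAt hb s)
    refine h.comp (tendsto_nhdsWithin_iff.2 ⟨tendsto_one_div_add_atTop_nhds_zero_nat, ?_⟩)
    exact Eventually.of_forall fun n => by
      simp only [mem_compl_iff, mem_singleton_iff]; positivity
  refine measurable_of_tendsto_metrizable (fun n => ?_) (tendsto_pi_nhds.2 hlim)
  exact Measurable.const_smul (((hc.measurable _ (by positivity)).sub (hc.measurable b hb) :
    Measurable fun s => c (b + 1 / ((n : ℝ) + 1)) s - c b s)) (1 / ((n : ℝ) + 1))⁻¹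

lemma countertermRegular_zero : CountertermRegular fun _ _ => 0 where
  measurable _ _ := measurable_const
  contDiffOn _ := contDiffOn_const
  dominated _ _ _ := ⟨fun _ => 0, locallyIntegrable_const 0, fun b _ s => by simp⟩

namespace DiffFamily

variable {P S S' : ℝ → SpaceTime d → ℝ} {c : ℝ → ℝ → ℝ}

lemma hasDerivAt_family (h : DiffFamily P S S' c) {b : ℝ} (hb : 0 < b) (y : SpaceTime d) :
    HasDerivAt (fun b => P b y) (S' b y - deriv (fun b => c b y.1) b) b := by
  refine ((h.hasDerivAt b hb y).sub (h.counterterm.hasDerivAt hb y.1)).congr_of_eventuallyEq ?_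
  filter_upwards [Ioi_mem_nhds hb] with b' hb'
  exact h.eq b' hb' y

lemma continuous_slice (h : DiffFamily P S S' c) {b : ℝ} (hb : 0 < b) : Continuous (S b) :=
  h.continuousOn.comp_continuous (Continuous.prodMk_right b) fun y => ⟨hb, mem_univ y⟩

lemma continuous_slice_deriv (h : DiffFamily P S S' c) {b : ℝ} (hb : 0 < b) : Continuous (S' b) :=
  h.continuousOn_deriv.comp_continuous (Continuous.prodMk_right b) fun y => ⟨hb, mem_univ y⟩

/-- Pairings with a compactly supported function can be differentiated in the diffusivity. -/
lemma hasDerivAt_pairing (h : DiffFamily P S S' c) {ψ : SpaceTime d → ℝ} (hψ : Continuous ψ)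
    (hψ0 : ∀ k, ψ k ≠ 0 → ‖k‖ ≤ 1) (w : SpaceTime d) {b : ℝ} (hb : 0 < b) :
    Integrable (fun k => ψ k * P b (w + k)) ∧
    HasDerivAt (fun b => ∫ k, ψ k * P b (w + k))
      (∫ k, ψ k * iteratedDeriv 1 (fun b' => P b' (w + k)) b) b := by
  have hder : ∀ b' : ℝ, 0 < b' → ∀ k, iteratedDeriv 1 (fun b' => P b' (w + k)) b' =
      S' b' (w + k) - deriv (fun b => c b (w + k).1) b' := fun b' hb' k => by
    rw [iteratedDeriv_one, (h.hasDerivAt_family hb' (w + k)).deriv]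
  set I : Set ℝ := Icc (b / 2) (2 * b)
  have hI : I ⊆ Ioi 0 := fun t ht => lt_of_lt_of_le (by linarith) ht.1
  obtain ⟨B₁, hB₁, hcB⟩ := h.counterterm.dominated I isCompact_Icc hI
  set Q : Set (SpaceTime d) := Metric.closedBall 0 1
  have hQ : IsCompact Q := isCompact_closedBall _ _
  have hcomp : IsCompact (I ×ˢ Q) := isCompact_Icc.prod hQ
  have hmap : MapsTo (fun p : ℝ × SpaceTime d => (p.1, w + p.2)) (I ×ˢ Q) (Ioi 0 ×ˢ univ) :=
    fun p hp => ⟨hI hp.1, mem_univ _⟩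
  have hmc : Continuous fun p : ℝ × SpaceTime d => (p.1, w + p.2) := by fun_prop
  obtain ⟨C₀, hC₀⟩ := hcomp.exists_bound_of_continuousOn
    (h.continuousOn.comp hmc.continuousOn hmap)
  obtain ⟨C₁, hC₁⟩ := hcomp.exists_bound_of_continuousOn
    (h.continuousOn_deriv.comp hmc.continuousOn hmap)
  obtain ⟨C₂, hC₂⟩ := hQ.exists_bound_of_continuousOn hψ.continuousOn
  -- an integrable majorant of `ψ` times `|S|`, `|S'|` and the counterterm
  have hmaj : ∀ C : ℝ, Integrable (fun k : SpaceTime d =>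
      Q.indicator (fun k => |C₂| * (|C| + |B₁ (w.1 + k.1)|)) k) := by
    intro C
    rw [integrable_indicator_iff hQ.measurableSet]
    have hQp : Q = Icc (-1 : ℝ) 1 ×ˢ Metric.closedBall (0 : Space d) 1 := by
      have := closedBall_prod_same (0 : ℝ) (0 : Space d) 1
      rw [Real.closedBall_eq_Icc, zero_sub, zero_add] at this
      exact this.symm
    have h1 : IntegrableOn (fun t => |B₁ (w.1 + t)|) (Icc (-1) 1) := by
      have h2 : IntegrableOn B₁ (Icc (w.1 - 1) (w.1 + 1)) :=
        hB₁.integrableOn_isCompact isCompact_Icc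
      have h3 := (integrableOn_comp_add h2 w.1).abs
      have h4 : (fun t => t + w.1) ⁻¹' Icc (w.1 - 1) (w.1 + 1) = Icc (-1) 1 := by
        ext t; simp only [mem_preimage, mem_Icc]; constructor <;> rintro ⟨h5, h6⟩ <;>
          constructor <;> linarith
      rw [h4] at h3
      simp only [add_comm w.1]
      exact h3
    have h5 : IntegrableOn (fun k : SpaceTime d => |B₁ (w.1 + k.1)|) Q := by
      rw [hQp, IntegrableOn, Measure.volume_eq_prod, ← Measure.prod_restrict]
      have : IsFiniteMeasure ((volume : Measure (Space d)).restrict (Metric.closedBall 0 1)) :=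
        ⟨by rw [Measure.restrict_apply_univ]; exact measure_closedBall_lt_top⟩
      have h6 : Integrable (fun z : SpaceTime d => |B₁ (w.1 + z.1)| * (1 : ℝ))
          ((volume.restrict (Icc (-1) 1)).prod (volume.restrict (Metric.closedBall 0 1))) :=
        Integrable.mul_prod (g := fun _ : Space d => (1 : ℝ)) h1 (integrable_const _)
      simpa using h6
    have hQf : volume Q ≠ ∞ := hQ.measure_lt_top.ne
    exact ((integrableOn_const hQf).add h5).const_mul _
  have hbd : ∀ (f : ℝ) (k : SpaceTime d) (C : ℝ), (k ∈ Q → |f| ≤ |C| + |B₁ (w.1 + k.1)|) →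
      ‖ψ k * f‖ ≤ Q.indicator (fun k => |C₂| * (|C| + |B₁ (w.1 + k.1)|)) k := by
    intro f k C hf
    by_cases hk : k ∈ Q
    · rw [indicator_of_mem hk, norm_mul]
      exact mul_le_mul ((hC₂ k hk).trans (le_abs_self _)) (hf hk) (norm_nonneg _) (abs_nonneg _)
    · have : ψ k = 0 := by
        by_contra hne
        exact hk (mem_closedBall_zero_iff.2 (hψ0 k hne))
      rw [indicator_of_notMem hk, this, zero_mul, norm_zero]
  have hmeas : ∀ b' : ℝ, 0 < b' → AEStronglyMeasurable (fun k => ψ k * P b' (w + k)) volume := by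
    intro b' hb'
    refine hψ.aestronglyMeasurable.mul ?_
    have e : (fun k => P b' (w + k)) = fun k => S b' (w + k) - c b' (w + k).1 :=
      funext fun k => h.eq b' hb' _
    rw [e]
    exact ((h.continuous_slice hb').comp (continuous_const_add w)).aestronglyMeasurable.sub
      ((h.counterterm.measurable b' hb').comp (measurable_fst.comp
        (measurable_const_add w))).aestronglyMeasurable
  have hmeas' : AEStronglyMeasurable
      (fun k => ψ k * iteratedDeriv 1 (fun b' => P b' (w + k)) b) volume := by
    refine hψ.aestronglyMeasurable.mul ?_
    have e : (fun k => iteratedDeriv 1 (fun b' => P b' (w + k)) b) =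
        fun k => S' b (w + k) - deriv (fun b => c b (w + k).1) b := funext (hder b hb)
    rw [e]
    exact ((h.continuous_slice_deriv hb).comp (continuous_const_add w)).aestronglyMeasurable.sub
      ((h.counterterm.measurable_deriv hb).comp (measurable_fst.comp
        (measurable_const_add w))).aestronglyMeasurable
  have hbI : b ∈ I := ⟨by linarith, by linarith⟩
  have hint : Integrable (fun k => ψ k * P b (w + k)) := by
    refine (hmaj C₀).mono' (hmeas b hb) (Eventually.of_forall fun k => hbd _ k C₀ fun hk => ?_)
    rw [h.eq b hb]
    refine (abs_sub _ _).trans (add_le_add ((hC₀ (b, k) ⟨hbI, hk⟩).trans (le_abs_self _)) ?_)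
    exact (hcB b hbI _).1.trans (le_abs_self _)
  refine ⟨hint, (hasDerivAt_integral_of_dominated_loc_of_deriv_le (s := I)
    (F := fun b k => ψ k * P b (w + k))
    (F' := fun b k => ψ k * iteratedDeriv 1 (fun b' => P b' (w + k)) b)
    (Icc_mem_nhds (by linarith) (by linarith)) ?_ hint hmeas' ?_ (hmaj C₁) ?_).2⟩
  · filter_upwards [Ioi_mem_nhds hb] with b' hb' using hmeas b' hb'
  · refine Eventually.of_forall fun k b' hb' => hbd _ k C₁ fun hk => ?_
    rw [hder b' (hI hb')]
    refine (abs_sub _ _).trans (add_le_add ((hC₁ (b', k) ⟨hb', hk⟩).trans (le_abs_self _)) ?_)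
    exact (hcB b' hb' _).2.trans (le_abs_self _)
  · refine Eventually.of_forall fun k b' hb' => ?_
    rw [hder b' (hI hb')]
    exact (h.hasDerivAt_family (hI hb') (w + k)).const_mul (ψ k)

end DiffFamily

/-! ### Lipschitz bounds with respect to the truncation -/

/-- A continuous function with derivative bounded away from the origin is Lipschitz continuous. -/
lemma abs_sub_le_of_deriv_le {H H' : ℝ → ℝ} {K : ℝ} (hc : Continuous H)
    (hd : ∀ v, v ≠ 0 → HasDerivAt H (H' v) v ∧ |H' v| ≤ K) (v w : ℝ) :
    |H v - H w| ≤ K * |v - w| := by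
  have hK : 0 ≤ K := (abs_nonneg _).trans (hd 1 one_ne_zero).2
  -- the mean value theorem on intervals that do not contain the origin
  have key : ∀ v w : ℝ, v ≤ w → (0 ≤ v ∨ w ≤ 0) → |H v - H w| ≤ K * (w - v) := by
    intro v w hvw h0
    rcases hvw.eq_or_lt with rfl | hlt
    · simp
    obtain ⟨c, hcm, hce⟩ := exists_hasDerivAt_eq_slope H H' hlt hc.continuousOn fun x hx =>
      (hd x (by rcases h0 with h | h; exacts [(h.trans_lt hx.1).ne', (hx.2.trans_le h).ne])).1
    have hne : c ≠ 0 := by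
      rcases h0 with h | h; exacts [(h.trans_lt hcm.1).ne', (hcm.2.trans_le h).ne]
    have h1 : H w - H v = H' c * (w - v) := by
      rw [hce, div_mul_cancel₀ _ (sub_pos.2 hlt).ne']
    rw [abs_sub_comm, h1, abs_mul, abs_of_pos (sub_pos.2 hlt)]
    exact mul_le_mul_of_nonneg_right (hd c hne).2 (sub_pos.2 hlt).le
  have key' : ∀ v w : ℝ, v ≤ w → |H v - H w| ≤ K * (w - v) := by
    intro v w hvw
    rcases le_total 0 v with h | h
    · exact key v w hvw (Or.inl h)
    rcases le_total w 0 with h' | h'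
    · exact key v w hvw (Or.inr h')
    calc |H v - H w| ≤ |H v - H 0| + |H 0 - H w| := abs_sub_le _ _ _
      _ ≤ K * (0 - v) + K * (w - 0) :=
        add_le_add (key v 0 h (Or.inr le_rfl)) (key 0 w h' (Or.inl le_rfl))
      _ = _ := by ring
  rcases le_total v w with h | h
  · rw [abs_sub_comm v w, abs_of_nonneg (sub_nonneg.2 h)]; exact key' v w h
  · rw [abs_sub_comm (H v), abs_of_nonneg (sub_nonneg.2 h)]; exact key' w v h

/-- A Lipschitz function that vanishes off a closed set `S` has increments bounded by those of any
monotone function that is the identity on `S`: between two points it only varies between the first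
and the last point of `S`. -/
lemma abs_sub_le_of_eq_id {H Θ : ℝ → ℝ} {S : Set ℝ} {K : ℝ} (hS : IsClosed S)
    (hH0 : ∀ v, v ∉ S → H v = 0) (hK : 0 ≤ K) (hH : ∀ v w, |H v - H w| ≤ K * |v - w|)
    (hΘ : Monotone Θ) (hΘS : ∀ v ∈ S, Θ v = v) (v w : ℝ) :
    |H v - H w| ≤ K * |Θ v - Θ w| := by
  -- `H` vanishes at points of `S` from which an interval outside of `S` starts
  have hz : ∀ s : ℝ, (∀ δ > 0, ∃ t, |s - t| ≤ δ ∧ t ∉ S) → H s = 0 := by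
    intro s hs
    have : ∀ δ > 0, |H s| ≤ 0 + K * δ := fun δ hδ => by
      obtain ⟨t, ht, htS⟩ := hs δ hδ
      have := hH s t
      rw [hH0 t htS, sub_zero] at this
      rw [zero_add]
      exact this.trans (mul_le_mul_of_nonneg_left ht hK)
    have h2 : |H s| ≤ 0 := by
      refine le_of_forall_pos_le_add fun η hη => ?_
      refine (this (η / (K + 1)) (by positivity)).trans ?_
      rw [zero_add, zero_add, mul_div_assoc', div_le_iff₀ (by positivity)]
      nlinarith
    exact abs_nonpos_iff.1 h2
  have key : ∀ v w : ℝ, v ≤ w → |H v - H w| ≤ K * (Θ w - Θ v) := by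
    intro v w hvw
    have hnn : 0 ≤ K * (Θ w - Θ v) := mul_nonneg hK (sub_nonneg.2 (hΘ hvw))
    rcases (S ∩ Icc v w).eq_empty_or_nonempty with he | hne
    · have hv : v ∉ S := fun h => (he ▸ (⟨h, le_rfl, hvw⟩ : v ∈ S ∩ Icc v w) : v ∈ (∅ : Set ℝ))
      have hw : w ∉ S := fun h => (he ▸ (⟨h, hvw, le_rfl⟩ : w ∈ S ∩ Icc v w) : w ∈ (∅ : Set ℝ))
      rw [hH0 v hv, hH0 w hw, sub_zero, abs_zero]
      exact hnn
    have hcomp : IsCompact (S ∩ Icc v w) := isCompact_Icc.inter_left hS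
    obtain ⟨s, hs⟩ := hcomp.exists_isGreatest hne
    obtain ⟨r, hr⟩ := hcomp.exists_isLeast hne
    have hHs : H w = H s := by
      rcases hs.1.2.2.eq_or_lt with h | h
      · rw [h]
      have hw : w ∉ S := fun hw => (hs.2 ⟨hw, hvw, le_rfl⟩).not_gt h
      rw [hH0 w hw, hz s]
      intro δ hδ
      refine ⟨min (s + δ) w, ?_, fun ht => ?_⟩
      · rw [abs_sub_comm, abs_of_nonneg (sub_nonneg.2 (le_min (by linarith) h.le))]
        linarith [min_le_left (s + δ) w]
      · exact (hs.2 ⟨ht, hs.1.2.1.trans (le_min (by linarith) h.le), min_le_right _ _⟩).not_gt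
          (lt_min (by linarith) h)
    have hHr : H v = H r := by
      rcases hr.1.2.1.eq_or_lt with h | h
      · rw [h]
      have hv : v ∉ S := fun hv => (hr.2 ⟨hv, le_rfl, hvw⟩).not_gt h
      rw [hH0 v hv, hz r]
      intro δ hδ
      refine ⟨max (r - δ) v, ?_, fun ht => ?_⟩
      · rw [abs_of_nonneg (sub_nonneg.2 (max_le (by linarith) h.le))]
        linarith [le_max_left (r - δ) v]
      · exact (hr.2 ⟨ht, le_max_right _ _, (max_le (by linarith) h.le).trans hr.1.2.2⟩).not_gt
          (max_lt (by linarith) h)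
    have hrs : r ≤ s := hr.2 hs.1
    rw [hHs, hHr]
    refine (hH r s).trans (mul_le_mul_of_nonneg_left ?_ hK)
    rw [abs_sub_comm, abs_of_nonneg (sub_nonneg.2 hrs), ← hΘS s hs.1.1, ← hΘS r hr.1.1]
    exact sub_le_sub (hΘ hs.1.2.2) (hΘ hr.1.2.1)
  rcases le_total v w with h | h
  · rw [abs_sub_comm (Θ v), abs_of_nonneg (sub_nonneg.2 (hΘ h))]; exact key v w h
  · rw [abs_sub_comm (H v), abs_of_nonneg (sub_nonneg.2 (hΘ h))]; exact key w v h

/-! ### Weights -/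

/-- `q` is a weight for quantities that grow like `b ^ (-e)` in the diffusivity `b`: it vanishes
off the support of `σ`, and `q` times such a quantity at `b = a v` is bounded and Lipschitz
continuous in `v`, with constants proportional to `K`. -/
structure WeightBound (a σ q : ℝ → ℝ) (e K : ℝ) : Prop where
  continuous : Continuous q
  zero_off : ∀ v, v ∉ tsupport σ → q v = 0
  bound : ∀ v ∈ tsupport σ, |q v| * a v ^ (-e) ≤ K
  differentiableAt : ∀ v, v ≠ 0 → DifferentiableAt ℝ q v
  deriv_bound : ∀ v ∈ tsupport σ, v ≠ 0 →
    |deriv q v| * a v ^ (-e) + |q v| * |deriv a v| * a v ^ (-e - 1) ≤ K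

/-- Where a weight does not vanish, `Θ` is locally the identity. -/
lemma WeightBound.deriv_truncation {a σ q : ℝ → ℝ} {e K L : ℝ} {Θ : ℝ → ℝ}
    (hq : WeightBound a σ q e K) (hΘ : IsTruncation L σ Θ) {v : ℝ} (hv : q v ≠ 0) :
    deriv Θ v = 1 := by
  have hopen : ∀ᶠ w in 𝓝 v, q w ≠ 0 := hq.continuous.continuousAt.eventually_ne hv
  have heq : Θ =ᶠ[𝓝 v] id := by
    filter_upwards [hopen] with w hw
    exact hΘ.eq_id w (by by_contra h; exact hw (hq.zero_off w h))
  rw [heq.deriv_eq, deriv_id]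

/-- If `G b` and its derivative are bounded by `n * b ^ (-e)` and `n * b ^ (-e - 1)`, then
`v ↦ q v * G (a v)` is bounded, and Lipschitz continuous with respect to the truncation. -/
lemma WeightBound.mul_comp {a σ q : ℝ → ℝ} {e K L n : ℝ} {Θ G G' : ℝ → ℝ}
    (hq : WeightBound a σ q e K) (hΘ : IsTruncation L σ Θ) (ha : ContDiff ℝ 2 a)
    (ha0 : ∀ v, 0 < a v) (hn : 0 ≤ n) (hG : ∀ b, 0 < b → HasDerivAt G (G' b) b)
    (hGb : ∀ b ∈ (a '' tsupport σ) \ {0}, |G b| ≤ n * b ^ (-e))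
    (hGb' : ∀ b ∈ (a '' tsupport σ) \ {0}, |G' b| ≤ n * b ^ (-e - 1)) (hK : 0 ≤ K) :
    (∀ v, |q v * G (a v)| ≤ K * n) ∧
      ∀ v w, |q v * G (a v) - q w * G (a w)| ≤ K * n * |Θ v - Θ w| := by
  have hab : ∀ v ∈ tsupport σ, a v ∈ (a '' tsupport σ) \ {0} := fun v hv =>
    ⟨mem_image_of_mem a hv, (ha0 v).ne'⟩
  have h0 : ∀ v, v ∉ tsupport σ → q v * G (a v) = 0 := fun v hv => by
    rw [hq.zero_off v hv, zero_mul]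
  have hKn : 0 ≤ K * n := mul_nonneg hK hn
  have hcont : Continuous fun v => q v * G (a v) :=
    hq.continuous.mul (continuous_iff_continuousAt.2 fun v =>
      (hG (a v) (ha0 v)).continuousAt.comp ha.continuous.continuousAt)
  refine ⟨fun v => ?_, ?_⟩
  · by_cases hv : v ∈ tsupport σ
    · rw [abs_mul]
      calc |q v| * |G (a v)| ≤ |q v| * (n * a v ^ (-e)) :=
            mul_le_mul_of_nonneg_left (hGb _ (hab v hv)) (abs_nonneg _)
        _ = (|q v| * a v ^ (-e)) * n := by ring
        _ ≤ K * n := mul_le_mul_of_nonneg_right (hq.bound v hv) hn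
    · rw [h0 v hv, abs_zero]; exact hKn
  · refine abs_sub_le_of_eq_id (isClosed_tsupport σ) h0 hKn ?_ hΘ.monotone hΘ.eq_id
    have hder : ∀ v, v ≠ 0 → ∃ D, HasDerivAt (fun v => q v * G (a v)) D v ∧ |D| ≤ K * n := by
      intro v hv0
      by_cases hv : v ∈ tsupport σ
      · refine ⟨_, (hq.differentiableAt v hv0).hasDerivAt.mul ((hG (a v) (ha0 v)).comp v
          (ha.differentiable (by norm_num) v).hasDerivAt), ?_⟩
        calc |deriv q v * G (a v) + q v * (G' (a v) * deriv a v)|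
            ≤ |deriv q v| * |G (a v)| + |q v| * (|G' (a v)| * |deriv a v|) := by
              rw [← abs_mul, ← abs_mul, ← abs_mul]; exact abs_add_le _ _
          _ ≤ |deriv q v| * (n * a v ^ (-e)) + |q v| * ((n * a v ^ (-e - 1)) * |deriv a v|) := by
              gcongr
              · exact hGb _ (hab v hv)
              · exact hGb' _ (hab v hv)
          _ = (|deriv q v| * a v ^ (-e) + |q v| * |deriv a v| * a v ^ (-e - 1)) * n := by ring
          _ ≤ K * n := mul_le_mul_of_nonneg_right (hq.deriv_bound v hv hv0) hn
      · refine ⟨0, (hasDerivAt_const v (0 : ℝ)).congr_of_eventuallyEq ?_, by simpa using hKn⟩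
        filter_upwards [(isClosed_tsupport σ).isOpen_compl.mem_nhds hv] with w hw using h0 w hw
    choose! D hD using hder
    exact abs_sub_le_of_deriv_le hcont hD

/-- `f` is differentiable off the origin, where it is bounded by a multiple of `|v| ^ r` and its
derivative by a multiple of `|v| ^ (r - 1)`. -/
def PowerBound (f : ℝ → ℝ) (r c : ℝ) : Prop :=
  ∀ v, v ≠ 0 → DifferentiableAt ℝ f v ∧ |f v| ≤ c * |v| ^ r ∧ |deriv f v| ≤ c * |v| ^ (r - 1)

lemma PowerBound.nonneg {f : ℝ → ℝ} {r c : ℝ} (hf : PowerBound f r c) : 0 ≤ c := by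
  have := (abs_nonneg _).trans (hf 1 one_ne_zero).2.1
  simpa using this

lemma PowerBound.mul {f h : ℝ → ℝ} {r s b c : ℝ} (hf : PowerBound f r b) (hh : PowerBound h s c) :
    PowerBound (fun v => f v * h v) (r + s) (2 * (b * c)) := by
  intro v hv
  have hv' : 0 < |v| := abs_pos.2 hv
  obtain ⟨f1, f2, f3⟩ := hf v hv
  obtain ⟨h1, h2, h3⟩ := hh v hv
  have hb := hf.nonneg
  have hc := hh.nonneg
  refine ⟨f1.mul h1, ?_, ?_⟩
  · rw [abs_mul]
    calc |f v| * |h v| ≤ (b * |v| ^ r) * (c * |v| ^ s) := by gcongr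
      _ = (b * c) * |v| ^ (r + s) := by rw [Real.rpow_add hv']; ring
      _ ≤ _ := by
        refine mul_le_mul_of_nonneg_right ?_ (Real.rpow_nonneg hv'.le _)
        linarith [mul_nonneg hb hc]
  · have hd : deriv (fun v => f v * h v) v = _ := (f1.hasDerivAt.mul h1.hasDerivAt).deriv
    rw [hd]
    calc |deriv f v * h v + f v * deriv h v| ≤ |deriv f v| * |h v| + |f v| * |deriv h v| := by
          rw [← abs_mul, ← abs_mul]; exact abs_add_le _ _
      _ ≤ (b * |v| ^ (r - 1)) * (c * |v| ^ s) + (b * |v| ^ r) * (c * |v| ^ (s - 1)) := by gcongr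
      _ = b * c * (|v| ^ (r - 1) * |v| ^ s + |v| ^ r * |v| ^ (s - 1)) := by ring
      _ = 2 * (b * c) * |v| ^ (r + s - 1) := by
        rw [← Real.rpow_add hv', ← Real.rpow_add hv', show r - 1 + s = r + s - 1 by ring,
          show r + (s - 1) = r + s - 1 by ring]
        ring

lemma PowerBound.add {f h : ℝ → ℝ} {r b c : ℝ} (hf : PowerBound f r b) (hh : PowerBound h r c) :
    PowerBound (fun v => f v + h v) r (b + c) := by
  intro v hv
  obtain ⟨f1, f2, f3⟩ := hf v hv
  obtain ⟨h1, h2, h3⟩ := hh v hv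
  refine ⟨f1.add h1, ?_, ?_⟩
  · rw [add_mul]; exact (abs_add_le _ _).trans (add_le_add f2 h2)
  · have hd : deriv (fun v => f v + h v) v = _ := (f1.hasDerivAt.add h1.hasDerivAt).deriv
    rw [hd, add_mul]
    exact (abs_add_le _ _).trans (add_le_add f3 h3)

lemma PowerBound.continuous {f : ℝ → ℝ} {r c : ℝ} (hf : PowerBound f r c) (hr : 0 < r)
    (h0 : f 0 = 0) : Continuous f := by
  rw [continuous_iff_continuousAt]
  intro v
  by_cases hv : v = 0
  · subst hv
    have h1 : Tendsto (fun v : ℝ => c * |v| ^ r) (𝓝 0) (𝓝 0) := by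
      have : Continuous fun v : ℝ => c * |v| ^ r :=
        continuous_const.mul (continuous_abs.rpow_const fun _ => Or.inr hr.le)
      simpa [Real.zero_rpow hr.ne'] using this.tendsto 0
    rw [ContinuousAt, h0]
    refine squeeze_zero_norm (fun v => ?_) h1
    by_cases hv : v = 0
    · rw [hv, h0, norm_zero, abs_zero, Real.zero_rpow hr.ne', mul_zero]
    · exact (hf v hv).2.1
  · exact (hf v hv).1.continuousAt

lemma powerBound_gPrime (p : ℝ) : PowerBound (gPrime p) (p - 2) (1 + |p - 2|) := by
  intro v hv
  have hv' : 0 < |v| := abs_pos.2 hv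
  have hd : HasDerivAt (gPrime p) (SignType.sign v * (p - 2) * |v| ^ (p - 2 - 1)) v :=
    (hasDerivAt_abs hv).rpow_const (Or.inl hv'.ne')
  have hpos : 0 ≤ |p - 2| := abs_nonneg _
  refine ⟨hd.differentiableAt, ?_, ?_⟩
  · rw [gPrime, abs_of_nonneg (by positivity)]
    nlinarith [Real.rpow_nonneg hv'.le (p - 2)]
  · rw [hd.deriv, abs_mul, abs_mul, abs_of_nonneg (Real.rpow_nonneg hv'.le _)]
    refine mul_le_mul_of_nonneg_right ?_ (Real.rpow_nonneg hv'.le _)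
    have : |((SignType.sign v : SignType) : ℝ)| ≤ 1 := by
      rcases hv.lt_or_gt with h | h
      · rw [sign_neg h]; simp
      · rw [sign_pos h]; simp
    nlinarith

lemma powerBound_g {p : ℝ} (hp : 1 < p) : PowerBound (g p) (p - 1) (1 + (p - 1)⁻¹) := by
  intro v hv
  have hv' : 0 < |v| := abs_pos.2 hv
  have hpos : 0 < (p - 1)⁻¹ := inv_pos.2 (by linarith)
  have hd := hasDerivAt_g hp hv
  refine ⟨hd.differentiableAt, ?_, ?_⟩
  · rw [abs_g hp, div_eq_mul_inv]
    nlinarith [Real.rpow_nonneg hv'.le (p - 1)]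
  · rw [hd.deriv, gPrime, abs_of_nonneg (by positivity), show p - 1 - 1 = p - 2 by ring]
    nlinarith [Real.rpow_nonneg hv'.le (p - 2)]

namespace Nonlinearities

variable {M N C : ℝ} {a σ : ℝ → ℝ}

lemma pos (h : Nonlinearities M N C a σ) (v : ℝ) : 0 < a v := by
  obtain ⟨a₀, h0, h1⟩ := h.a_pos
  exact h0.trans_le (h1 v)

lemma sigma_zero (h : Nonlinearities M N C a σ) (hN : 0 < N) : σ 0 = 0 := by
  have := h.sigma_bound 0
  rw [abs_zero, Real.zero_rpow hN.ne', mul_zero] at this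
  exact abs_nonpos_iff.1 this

lemma sigma_deriv_zero (h : Nonlinearities M N C a σ) (hN : 1 < N) : deriv σ 0 = 0 := by
  have := h.sigma_deriv 0
  rw [abs_zero, Real.zero_rpow (sub_pos.2 hN).ne', mul_zero] at this
  exact abs_nonpos_iff.1 this

lemma powerBound_sigma (h : Nonlinearities M N C a σ) : PowerBound σ N C := fun v _ =>
  ⟨h.sigma_contDiff.differentiable (by norm_num) v, h.sigma_bound v, h.sigma_deriv v⟩

lemma powerBound_sigma_deriv (h : Nonlinearities M N C a σ) : PowerBound (deriv σ) (N - 1) C := by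
  intro v _
  refine ⟨(h.sigma_contDiff.differentiable_deriv_two) v, h.sigma_deriv v, ?_⟩
  have := h.sigma_deriv_two v
  rw [iteratedDeriv_succ, iteratedDeriv_one] at this
  rw [show N - 1 - 1 = N - 2 by ring]
  exact this

/-- The lower bound on `a` turns negative powers of `a` into powers of the argument. -/
lemma rpow_neg_le (h : Nonlinearities M N C a σ) (hC : 0 < C) {e : ℝ} (he : 0 ≤ e) {v : ℝ}
    (hv : v ≠ 0) : a v ^ (-e) ≤ C ^ e * |v| ^ (-((M - 1) * e)) := by
  have hv' : 0 < |v| := abs_pos.2 hv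
  have h1 : C⁻¹ * |v| ^ (M - 1) ≤ a v := by
    rw [inv_mul_le_iff₀ hC]; exact h.a_lower v
  calc a v ^ (-e) ≤ (C⁻¹ * |v| ^ (M - 1)) ^ (-e) :=
        Real.rpow_le_rpow_of_nonpos (by positivity) h1 (by linarith)
    _ = _ := by
      rw [Real.mul_rpow (by positivity) (by positivity), ← Real.rpow_mul hv'.le, Real.inv_rpow hC.le,
        Real.rpow_neg hC.le, inv_inv, mul_neg]

/-- Functions with sufficient decay at the origin are weights. The exponent `r - 1 - (M - 1) * e` is
what remains of the decay after one derivative and the loss of `a ^ (-e)`; in the second part of the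
derivative bound, the bound on the derivative of `a` compensates the additional power of `a`. -/
lemma weightBound (h : Nonlinearities M N C a σ) (hC : 0 < C) {q : ℝ → ℝ} {r c e : ℝ}
    (hq : PowerBound q r c) (hq0 : q 0 = 0) (hoff : ∀ v, v ∉ tsupport σ → q v = 0) (he : 0 ≤ e)
    (hs : 0 ≤ r - 1 - (M - 1) * e) (hr : 0 < r) :
    WeightBound a σ q e (c * C ^ e * (1 + C ^ 2) * C ^ (r - 1 - (M - 1) * e) +
      c * C ^ e * C ^ (r - (M - 1) * e)) := by
  have hc := hq.nonneg
  have hvC : ∀ v ∈ tsupport σ, |v| ≤ C := fun v hv => abs_le.2 (h.sigma_support hv)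
  refine ⟨hq.continuous hr hq0, hoff, fun v hv => ?_, fun v hv => (hq v hv).1, fun v hv hv0 => ?_⟩
  · by_cases hv0 : v = 0
    · rw [hv0, hq0, abs_zero, zero_mul]; positivity
    · have hv' : 0 < |v| := abs_pos.2 hv0
      calc |q v| * a v ^ (-e) ≤ (c * |v| ^ r) * (C ^ e * |v| ^ (-((M - 1) * e))) := by
            have := h.pos v
            gcongr
            · exact (hq v hv0).2.1
            · exact h.rpow_neg_le hC he hv0
        _ = c * C ^ e * |v| ^ (r - (M - 1) * e) := by
            rw [sub_eq_add_neg r, Real.rpow_add hv']; ring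
        _ ≤ c * C ^ e * C ^ (r - (M - 1) * e) := by
            gcongr
            · linarith
            · exact hvC v hv
        _ ≤ _ := le_add_of_nonneg_left (by positivity)
  · have hv' : 0 < |v| := abs_pos.2 hv0
    have hav := h.pos v
    have ha1 := h.rpow_neg_le hC he hv0
    have ha2 := h.rpow_neg_le hC (by linarith : 0 ≤ e + 1) hv0
    calc |deriv q v| * a v ^ (-e) + |q v| * |deriv a v| * a v ^ (-e - 1)
        ≤ (c * |v| ^ (r - 1)) * (C ^ e * |v| ^ (-((M - 1) * e))) +
          (c * |v| ^ r) * (C * |v| ^ (M - 2)) *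
            (C ^ (e + 1) * |v| ^ (-((M - 1) * (e + 1)))) := by
          rw [show -e - 1 = -(e + 1) by ring]
          gcongr
          · exact (hq v hv0).2.2
          · exact (hq v hv0).2.1
          · exact h.a_deriv v hv0
      _ = c * C ^ e * (1 + C ^ 2) * |v| ^ (r - 1 - (M - 1) * e) := by
          have e1 : |v| ^ (r - 1 - (M - 1) * e) = |v| ^ (r - 1) * |v| ^ (-((M - 1) * e)) := by
            rw [← Real.rpow_add hv']; rfl
          have e2 : |v| ^ (r - 1 - (M - 1) * e) =
              |v| ^ r * |v| ^ (M - 2) * |v| ^ (-((M - 1) * (e + 1))) := by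
            rw [← Real.rpow_add hv', ← Real.rpow_add hv']; congr 1; ring
          rw [mul_add (c * C ^ e), add_mul, mul_one]
          nth_rw 1 [e1]
          rw [e2, Real.rpow_add hC, Real.rpow_one]
          ring
      _ ≤ c * C ^ e * (1 + C ^ 2) * C ^ (r - 1 - (M - 1) * e) := by
          gcongr
          exact hvC v hv
      _ ≤ _ := le_add_of_nonneg_right (by positivity)

end Nonlinearities

/-- Multiplication with the diffusivity raises the exponent of a weight by one. -/
lemma WeightBound.mul_diffusivity {a σ q : ℝ → ℝ} {e K : ℝ} (hq : WeightBound a σ q e K)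
    (ha : ContDiff ℝ 2 a) (ha0 : ∀ v, 0 < a v) :
    WeightBound a σ (fun v => q v * a v) (e + 1) (2 * K) := by
  have hmul : ∀ (v s : ℝ), a v * a v ^ (s - 1) = a v ^ s := fun v s => by
    rw [Real.rpow_sub_one (ha0 v).ne', mul_div_cancel₀ _ (ha0 v).ne']
  have had := ha.differentiable (by norm_num)
  refine ⟨hq.continuous.mul ha.continuous, fun v hv => by rw [hq.zero_off v hv, zero_mul],
    fun v hv => ?_, fun v hv => (hq.differentiableAt v hv).mul (had v), fun v hv hv0 => ?_⟩
  · have h1 := hq.bound v hv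
    have h0 : 0 ≤ |q v| * a v ^ (-e) := mul_nonneg (abs_nonneg _) (Real.rpow_nonneg (ha0 v).le _)
    rw [abs_mul, abs_of_pos (ha0 v), mul_assoc, show -(e + 1) = -e - 1 by ring, hmul]
    linarith
  · have h1 := hq.deriv_bound v hv hv0
    have h0 : 0 ≤ |deriv q v| * a v ^ (-e) :=
      mul_nonneg (abs_nonneg _) (Real.rpow_nonneg (ha0 v).le _)
    have hd : deriv (fun v => q v * a v) v = _ :=
      ((hq.differentiableAt v hv0).hasDerivAt.mul (had v).hasDerivAt).deriv
    rw [hd]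
    have e1 := hmul v (-e)
    have e2 := hmul v (-e - 1)
    have hp1 : 0 < a v ^ (-e - 1) := Real.rpow_pos_of_pos (ha0 v) _
    calc |deriv q v * a v + q v * deriv a v| * a v ^ (-(e + 1)) +
          |q v * a v| * |deriv a v| * a v ^ (-(e + 1) - 1)
        ≤ (|deriv q v| * a v + |q v| * |deriv a v|) * a v ^ (-e - 1) +
          |q v| * a v * |deriv a v| * a v ^ (-e - 1 - 1) := by
          rw [show -(e + 1) = -e - 1 by ring, abs_mul (q v) (a v), abs_of_pos (ha0 v)]
          have hle : |deriv q v * a v + q v * deriv a v| ≤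
              |deriv q v| * a v + |q v| * |deriv a v| :=
            (abs_add_le _ _).trans (by rw [abs_mul, abs_mul, abs_of_pos (ha0 v)])
          gcongr
      _ = |deriv q v| * (a v * a v ^ (-e - 1)) + |q v| * |deriv a v| * a v ^ (-e - 1) +
          |q v| * |deriv a v| * (a v * a v ^ (-e - 1 - 1)) := by ring
      _ ≤ 2 * K := by rw [e1, e2]; linarith

lemma WeightBound.mono {a σ q : ℝ → ℝ} {e K K' : ℝ} (hq : WeightBound a σ q e K) (hK : K ≤ K') :
    WeightBound a σ q e K' :=
  ⟨hq.continuous, hq.zero_off, fun v hv => (hq.bound v hv).trans hK, hq.differentiableAt,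
    fun v hv h0 => (hq.deriv_bound v hv h0).trans hK⟩

/-! ### The weights of the germ -/

/-- The derivative of `v ↦ g p v * σ v`. -/
noncomputable def gSigmaDeriv (p : ℝ) (σ : ℝ → ℝ) (v : ℝ) : ℝ :=
  gPrime p v * σ v + g p v * deriv σ v

section Weights

variable {M N C : ℝ} {a σ : ℝ → ℝ} {p ε : ℝ}

lemma eq_zero_of_notMem_tsupport {v : ℝ} (hv : v ∉ tsupport σ) : σ v = 0 ∧ deriv σ v = 0 := by
  refine ⟨image_eq_zero_of_notMem_tsupport hv, ?_⟩
  exact image_eq_zero_of_notMem_tsupport fun h => hv (tsupport_deriv_subset h)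

lemma Nonlinearities.powerBound_gSigmaDeriv (h : Nonlinearities M N C a σ) (hp : 1 < p) :
    PowerBound (gSigmaDeriv p σ) (p - 2 + N)
      (2 * ((1 + |p - 2|) * C) + 2 * ((1 + (p - 1)⁻¹) * C)) := by
  have h2 := (powerBound_g hp).mul h.powerBound_sigma_deriv
  rw [show p - 1 + (N - 1) = p - 2 + N by ring] at h2
  exact ((powerBound_gPrime p).mul h.powerBound_sigma).add h2

lemma Nonlinearities.hasDerivAt_gSigma (h : Nonlinearities M N C a σ) (hp : 1 < p) (hN : 1 < N)
    (v : ℝ) : HasDerivAt (fun v => g p v * σ v) (gSigmaDeriv p σ v) v := by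
  by_cases hv : v = 0
  · subst hv
    have hg0 : g p 0 = 0 := g_zero p
    have hσ0 := h.sigma_zero (by linarith)
    have hσd : HasDerivAt σ 0 0 := by
      have := (h.sigma_contDiff.differentiable (by norm_num) 0).hasDerivAt
      rwa [h.sigma_deriv_zero hN] at this
    have e0 : gSigmaDeriv p σ 0 = 0 := by
      rw [gSigmaDeriv, hσ0, h.sigma_deriv_zero hN, mul_zero, mul_zero, add_zero]
    -- at the origin `g` need not be differentiable, but it is bounded and `σ` is of order
    -- `o(v)`
    rw [e0, hasDerivAt_iff_isLittleO_nhds_zero]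
    rw [hasDerivAt_iff_isLittleO_nhds_zero] at hσd
    simp only [zero_add, hσ0, sub_zero, smul_zero, mul_zero] at hσd ⊢
    have hO : (fun t => g p t) =O[𝓝 0] fun _ => (1 : ℝ) :=
      ((continuous_g hp).continuousAt (x := 0)).tendsto.isBigO_one ℝ
    simpa using hO.mul_isLittleO hσd
  · exact (hasDerivAt_g hp hv).mul (h.sigma_contDiff.differentiable (by norm_num) v).hasDerivAt

lemma Nonlinearities.gSigmaDeriv_zero (h : Nonlinearities M N C a σ) (hN : 1 < N) :
    gSigmaDeriv p σ 0 = 0 := by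
  rw [gSigmaDeriv, h.sigma_zero (by linarith), h.sigma_deriv_zero hN, mul_zero, mul_zero, add_zero]

lemma gSigmaDeriv_off {v : ℝ} (hv : v ∉ tsupport σ) : gSigmaDeriv p σ v = 0 := by
  obtain ⟨h1, h2⟩ := eq_zero_of_notMem_tsupport hv
  rw [gSigmaDeriv, h1, h2, mul_zero, mul_zero, add_zero]

/-- The coefficients of the germ are weights, with constants that depend only on the exponents and
on the constant in the assumptions on the nonlinearities. The coefficients that contain `a` are
not products of powers, since `a` does not vanish at the origin; the factor `a` is used instead to
lower the exponent by one. The most restrictive coefficient is then `gPrime p * σ * a`, for which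
`N ≥ M + 1` leaves the decay `p - 2 + N - 1 - (M - 1) * ε ≥ p - 1`. -/
lemma exists_weightBound (hM : 1 < M) (hM2 : M < 2) (hN : M + 1 ≤ N) (hp : 1 < p) (hε : 0 < ε)
    (hε' : ε ≤ 1) (hC : 0 < C) :
    ∃ K : ℝ, 0 < K ∧ ∀ a σ : ℝ → ℝ, Nonlinearities M N C a σ →
      WeightBound a σ (fun v => gSigmaDeriv p σ v * σ v) (1 + ε) K ∧
      WeightBound a σ (fun v => gPrime p v * σ v ^ 2 * a v) (2 + 2 * ε) K ∧
      WeightBound a σ (fun v => gPrime p v * σ v * a v) (1 + ε) K ∧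
      WeightBound a σ (gSigmaDeriv p σ) 0 K := by
  set Kf : ℝ → ℝ → ℝ → ℝ := fun r c e => |c * C ^ e * (1 + C ^ 2) * C ^ (r - 1 - (M - 1) * e) +
      c * C ^ e * C ^ (r - (M - 1) * e)| with hKf
  set cX : ℝ := 2 * ((1 + |p - 2|) * C) + 2 * ((1 + (p - 1)⁻¹) * C)
  set cG : ℝ := 2 * ((1 + |p - 2|) * C)
  refine ⟨1 + Kf (p - 2 + N + N) (2 * (cX * C)) (1 + ε) +
    2 * Kf (p - 2 + N + N) (2 * (cG * C)) (1 + 2 * ε) + 2 * Kf (p - 2 + N) cG ε +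
    Kf (p - 2 + N) cX 0, by positivity, fun a σ h => ?_⟩
  have hnn : ∀ r c e, 0 ≤ Kf r c e := fun r c e => abs_nonneg _
  have n1 := hnn (p - 2 + N + N) (2 * (cX * C)) (1 + ε)
  have n2 := hnn (p - 2 + N + N) (2 * (cG * C)) (1 + 2 * ε)
  have n3 := hnn (p - 2 + N) cG ε
  have n4 := hnn (p - 2 + N) cX 0
  have hσ0 : σ 0 = 0 := h.sigma_zero (by linarith)
  have hoff : ∀ v, v ∉ tsupport σ → σ v = 0 := fun v hv => (eq_zero_of_notMem_tsupport hv).1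
  have hX := h.powerBound_gSigmaDeriv hp
  have hG := (powerBound_gPrime p).mul h.powerBound_sigma
  have hD := hX.mul h.powerBound_sigma
  have hV := hG.mul h.powerBound_sigma
  have hMe : (M - 1) * ε ≤ M - 1 := by nlinarith
  refine ⟨?_, ?_, ?_, ?_⟩
  · refine (h.weightBound hC hD (by rw [hσ0, mul_zero])
      (fun v hv => by rw [hoff v hv, mul_zero]) (e := 1 + ε) (by linarith) (by nlinarith)
      (by linarith)).mono ((le_abs_self _).trans ?_)
    linarith
  · have hw := ((h.weightBound hC hV (by rw [hσ0, mul_zero])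
      (fun v hv => by rw [hoff v hv, mul_zero]) (e := 1 + 2 * ε) (by linarith) (by nlinarith)
      (by linarith)).mono (le_abs_self _)).mul_diffusivity h.a_contDiff h.pos
    have hw' := hw.mono (K' := 1 + Kf (p - 2 + N + N) (2 * (cX * C)) (1 + ε) +
      2 * Kf (p - 2 + N + N) (2 * (cG * C)) (1 + 2 * ε) + 2 * Kf (p - 2 + N) cG ε +
      Kf (p - 2 + N) cX 0) (by linarith)
    have e1 : (fun v => gPrime p v * σ v ^ 2 * a v) = fun v => gPrime p v * σ v * σ v * a v :=
      funext fun v => by ring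
    rw [e1, show 2 + 2 * ε = 1 + 2 * ε + 1 by ring]
    exact hw'
  · have hw := ((h.weightBound hC hG (by rw [hσ0, mul_zero])
      (fun v hv => by rw [hoff v hv, mul_zero]) (e := ε) (by linarith) (by nlinarith)
      (by linarith)).mono (le_abs_self _)).mul_diffusivity h.a_contDiff h.pos
    rw [add_comm ε] at hw
    exact hw.mono (by linarith)
  · exact (h.weightBound hC hX (h.gSigmaDeriv_zero (by linarith)) (fun v => gSigmaDeriv_off)
      (e := 0) le_rfl (by linarith) (by linarith)).mono ((le_abs_self _).trans (by linarith))

end Weights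

/-! ### The germ -/

/-- The local expansion of the reaction term and of the products produced by the energy identity
around the base point `x`, in terms of the model. Here `U` stands for the solution and `n` for its
modelledness derivative. -/
noncomputable def germ (p : ℝ) (a σ : ℝ → ℝ) (ξ : SpaceTime d → ℝ) (cd cc : ℝ → ℝ → ℝ)
    (U : SpaceTime d → ℝ) (n : SpaceTime d → Space d) (x y : SpaceTime d) : ℝ :=
  g p (U x) * σ (U x) * ξ y
    + gSigmaDeriv p σ (U x) * σ (U x) * dumb ξ cd (a (U x)) x y
    + gSigmaDeriv p σ (U x) * ∑ i, n x i * xnoise ξ x y i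
    - gPrime p (U x) * σ (U x) ^ 2 * a (U x) * cherry ξ cc (a (U x)) x y
    - 2 * (gPrime p (U x) * σ (U x) * a (U x)) * ∑ i, n x i * gradPotential ξ (a (U x)) y i

/-- By periodicity it suffices to bound a continuous germ on a compact set. -/
lemma exists_bound_near_diagonal {f : SpaceTime d → SpaceTime d → ℝ}
    (hf : ∀ (k : Fin d → ℤ) x y, f (x + (0, latticeVec k)) (y + (0, latticeVec k)) = f x y)
    (hc : Continuous (Function.uncurry f)) (l u : ℝ) :
    ∃ B : ℝ, 0 ≤ B ∧ ∀ x h : SpaceTime d, x.1 ∈ Icc l u → pnorm h ≤ 1 → |f x (x + h)| ≤ B := by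
  have hc' : Continuous fun q : SpaceTime d × SpaceTime d => f q.1 (q.1 + q.2) :=
    hc.comp (continuous_fst.prodMk (continuous_fst.add continuous_snd))
  obtain ⟨B, hB⟩ := (((isCompact_Icc (a := l) (b := u)).prod
    (isCompact_closedCube (d := d))).prod (isCompact_closedBall (0 : SpaceTime d) 1)
    ).exists_bound_of_continuousOn hc'.continuousOn
  refine ⟨max B 0, le_max_right _ _, fun x h hx hh => ?_⟩
  obtain ⟨k, hk⟩ := exists_add_latticeVec_mem_cube x.2
  rw [← hf k x (x + h), add_right_comm]
  refine (hB (x + (0, latticeVec k), h) ⟨⟨by simpa using hx,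
    cube_subset_closedCube (by simpa using hk)⟩, ?_⟩).trans (le_max_left _ _)
  rw [mem_closedBall_zero_iff]
  exact (norm_le_pnorm hh).trans hh

section Germ

variable {p : ℝ} {a σ : ℝ → ℝ} {ξ : SpaceTime d → ℝ} {cd cc : ℝ → ℝ → ℝ} {U : SpaceTime d → ℝ}
  {n : SpaceTime d → Space d}

lemma dumb_eq (hc : Continuous ξ) (hp : SpacePeriodic ξ) {b : ℝ} (hb : 0 < b)
    (x y : SpaceTime d) :
    dumb ξ cd b x y = (potential ξ b y - potential ξ b x) * ξ y - cd b y.1 := by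
  rw [dumb, lolly_eq hc hp hb]

lemma cherry_eq (hξ : ContDiff ℝ ((⊤ : ℕ∞) : WithTop ℕ∞) ξ) (hp : SpacePeriodic ξ) {b : ℝ}
    (hb : 0 < b) (x y : SpaceTime d) :
    cherry ξ cc b x y = ‖gradPotential ξ b y‖ ^ 2 - cc b y.1 := by
  rw [cherry, gradLolly_eq hξ hp hb]

lemma CountertermRegular.continuous_comp {c : ℝ → ℝ → ℝ} (hc : CountertermRegular c) {X : Type*}
    [TopologicalSpace X] {f : X → ℝ} (hf : Continuous f) (h0 : ∀ x, 0 < f x) (s : ℝ) :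
    Continuous fun x => c (f x) s :=
  (hc.contDiffOn s).continuousOn.comp_continuous hf h0

lemma CountertermRegular.measurable_comp {c : ℝ → ℝ → ℝ} (hc : CountertermRegular c)
    (ha : Continuous a) (ha0 : ∀ v, 0 < a v) (hU : Continuous U) :
    Measurable fun q : SpaceTime d × SpaceTime d => c (a (U q.1)) q.2.1 := by
  have h : Measurable (Function.uncurry fun v s => c (a v) s) :=
    measurable_uncurry_of_continuous_of_measurable
      (fun s => hc.continuous_comp ha ha0 s) (fun v => hc.measurable (a v) (ha0 v))
  exact h.comp ((hU.measurable.comp measurable_fst).prodMk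
    (measurable_fst.comp measurable_snd))

/-- The germ without the counterterms. -/
noncomputable def continuousGerm (p : ℝ) (a σ : ℝ → ℝ) (ξ : SpaceTime d → ℝ)
    (U : SpaceTime d → ℝ) (n : SpaceTime d → Space d) (x y : SpaceTime d) : ℝ :=
  g p (U x) * σ (U x) * ξ y
    + gSigmaDeriv p σ (U x) * σ (U x) *
      ((potential ξ (a (U x)) y - potential ξ (a (U x)) x) * ξ y)
    + gSigmaDeriv p σ (U x) * ∑ i, n x i * xnoise ξ x y i
    - gPrime p (U x) * σ (U x) ^ 2 * a (U x) * ‖gradPotential ξ (a (U x)) y‖ ^ 2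
    - 2 * (gPrime p (U x) * σ (U x) * a (U x)) * ∑ i, n x i * gradPotential ξ (a (U x)) y i

lemma germ_eq (hξ : ContDiff ℝ ((⊤ : ℕ∞) : WithTop ℕ∞) ξ) (hp : SpacePeriodic ξ)
    (ha0 : ∀ v, 0 < a v) (x y : SpaceTime d) :
    germ p a σ ξ cd cc U n x y = continuousGerm p a σ ξ U n x y
      - gSigmaDeriv p σ (U x) * σ (U x) * cd (a (U x)) y.1
      + gPrime p (U x) * σ (U x) ^ 2 * a (U x) * cc (a (U x)) y.1 := by
  rw [germ, continuousGerm, dumb_eq hξ.continuous hp (ha0 _), cherry_eq hξ hp (ha0 _)]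
  ring

/-- On the diagonal the germ consists of the unrenormalized products and of the counterterms. -/
lemma germ_self (hξ : ContDiff ℝ ((⊤ : ℕ∞) : WithTop ℕ∞) ξ) (hp : SpacePeriodic ξ)
    (ha0 : ∀ v, 0 < a v) (x : SpaceTime d) :
    germ p a σ ξ cd cc U n x x = g p (U x) * σ (U x) * ξ x
      - gSigmaDeriv p σ (U x) * σ (U x) * cd (a (U x)) x.1
      - gPrime p (U x) * σ (U x) ^ 2 * a (U x) *
        (‖gradPotential ξ (a (U x)) x‖ ^ 2 - cc (a (U x)) x.1)
      - 2 * (gPrime p (U x) * σ (U x) * a (U x)) *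
        inner ℝ (n x) (gradPotential ξ (a (U x)) x) := by
  have h1 : ∑ i, n x i * xnoise ξ x x i = 0 := by simp [xnoise]
  have h2 : ∑ i, n x i * gradPotential ξ (a (U x)) x i =
      inner ℝ (n x) (gradPotential ξ (a (U x)) x) := by
    rw [PiLp.inner_apply]
    exact Finset.sum_congr rfl fun i _ => by
      rw [mul_comm]; rfl
  rw [germ, dumb_eq hξ.continuous hp (ha0 _), cherry_eq hξ hp (ha0 _), h1, h2]
  ring

lemma continuous_continuousGerm (hp1 : 1 < p) (hξ : ContDiff ℝ ((⊤ : ℕ∞) : WithTop ℕ∞) ξ)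
    (hp : SpacePeriodic ξ) (ha : Continuous a) (hσ : Continuous σ) (hU : Continuous U)
    (hn : Continuous n) (hX : Continuous (gSigmaDeriv p σ))
    (hV : Continuous fun v => gPrime p v * σ v ^ 2 * a v)
    (hG : Continuous fun v => gPrime p v * σ v * a v) :
    Continuous (Function.uncurry (continuousGerm p a σ ξ U n)) := by
  have hU1 : Continuous fun q : SpaceTime d × SpaceTime d => U q.1 := hU.comp continuous_fst
  have hb : Continuous fun q : SpaceTime d × SpaceTime d => a (U q.1) := ha.comp hU1
  have hξ2 : Continuous fun q : SpaceTime d × SpaceTime d => ξ q.2 :=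
    hξ.continuous.comp continuous_snd
  have hΦ := continuous_potential hξ.continuous hp
  have h1 : Continuous fun q : SpaceTime d × SpaceTime d => potential ξ (a (U q.1)) q.2 :=
    hΦ.comp (hb.prodMk continuous_snd)
  have h2 : Continuous fun q : SpaceTime d × SpaceTime d => potential ξ (a (U q.1)) q.1 :=
    hΦ.comp (hb.prodMk continuous_fst)
  have h3 : Continuous fun q : SpaceTime d × SpaceTime d => gradPotential ξ (a (U q.1)) q.2 :=
    (continuous_gradPotential hξ hp).comp (hb.prodMk continuous_snd)
  have happ : ∀ i : Fin d, Continuous fun v : Space d => v i := fun i =>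
    (EuclideanSpace.proj (𝕜 := ℝ) i).continuous
  have h4 : Continuous fun q : SpaceTime d × SpaceTime d => xnoise ξ q.1 q.2 :=
    hξ2.smul ((continuous_snd.comp continuous_snd).sub (continuous_snd.comp continuous_fst))
  have h5 : ∀ f : SpaceTime d × SpaceTime d → Space d, Continuous f →
      Continuous fun q => ∑ i, n q.1 i * f q i := fun f hf =>
    continuous_finsetSum _ fun i _ =>
      ((happ i).comp (hn.comp continuous_fst)).mul ((happ i).comp hf)
  exact (((((((continuous_g hp1).comp hU1).mul (hσ.comp hU1)).mul hξ2).add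
    (((hX.comp hU1).mul (hσ.comp hU1)).mul ((h1.sub h2).mul hξ2))).add
    ((hX.comp hU1).mul (h5 _ h4))).sub ((hV.comp hU1).mul (h3.norm.pow 2))).sub
    ((continuous_const.mul (hG.comp hU1)).mul (h5 _ h3))

lemma continuousGerm_periodic (hp : SpacePeriodic ξ) (hU : SpacePeriodic U)
    (hn : SpacePeriodic n) (k : Fin d → ℤ) (x y : SpaceTime d) :
    continuousGerm p a σ ξ U n (x + (0, latticeVec k)) (y + (0, latticeVec k)) =
      continuousGerm p a σ ξ U n x y := by
  have hx : xnoise ξ (x + (0, latticeVec k)) (y + (0, latticeVec k)) = xnoise ξ x y := by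
    rw [xnoise, xnoise, hp k y]
    simp
  simp only [continuousGerm, hU k x, hn k x, hp k y, potential_add_latticeVec hp _ k,
    gradPotential_periodic hp _ k, hx]

/-- The germ is continuous apart from the counterterms, which are dominated by integrable functions
of time, uniformly over the compact range of diffusivities `a (U x)`. -/
lemma germ_regular (hp1 : 1 < p) (hξ : ContDiff ℝ ((⊤ : ℕ∞) : WithTop ℕ∞) ξ)
    (hp : SpacePeriodic ξ) (ha : Continuous a) (ha0 : ∀ v, 0 < a v) (hσ : Continuous σ)
    (hU : Continuous U) (hUp : SpacePeriodic U) (hn : Continuous n) (hnp : SpacePeriodic n)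
    (hX : Continuous (gSigmaDeriv p σ))
    (hV : Continuous fun v => gPrime p v * σ v ^ 2 * a v)
    (hG : Continuous fun v => gPrime p v * σ v * a v)
    (hcd : CountertermRegular cd) (hcc : CountertermRegular cc) :
    ∃ B, GermRegular (germ p a σ ξ cd cc U n) B := by
  have hfun : germ p a σ ξ cd cc U n = fun x y => continuousGerm p a σ ξ U n x y
      - gSigmaDeriv p σ (U x) * σ (U x) * cd (a (U x)) y.1
      + gPrime p (U x) * σ (U x) ^ 2 * a (U x) * cc (a (U x)) y.1 :=
    funext fun x => funext fun y => germ_eq hξ hp ha0 x y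
  have hcont := continuous_continuousGerm hp1 hξ hp ha hσ hU hn hX hV hG
  have hqD : Continuous fun x => gSigmaDeriv p σ (U x) * σ (U x) :=
    (hX.comp hU).mul (hσ.comp hU)
  have hqV : Continuous fun x => gPrime p (U x) * σ (U x) ^ 2 * a (U x) := hV.comp hU
  obtain ⟨B₀, hB₀, h0⟩ := exists_bound_near_diagonal
    (continuousGerm_periodic (p := p) (a := a) (σ := σ) hp hUp hnp) hcont (-1) 2
  obtain ⟨B₁, hB₁, h1⟩ := SpacePeriodic.exists_bound (f := fun x =>
    gSigmaDeriv p σ (U x) * σ (U x)) (fun k z => by simp only [hUp k z]) hqD (-1) 2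
  obtain ⟨B₂, hB₂, h2⟩ := SpacePeriodic.exists_bound (f := fun x =>
    gPrime p (U x) * σ (U x) ^ 2 * a (U x)) (fun k z => by simp only [hUp k z]) hqV (-1) 2
  obtain ⟨B₃, hB₃, h3⟩ := hUp.exists_bound hU (-1) 2
  have hcomp : IsCompact (a '' Icc (-B₃) B₃) := isCompact_Icc.image ha
  have hpos : a '' Icc (-B₃) B₃ ⊆ Ioi 0 := by
    rintro _ ⟨v, _, rfl⟩; exact ha0 v
  obtain ⟨Bd, hBd, hd⟩ := hcd.dominated _ hcomp hpos
  obtain ⟨Bc, hBc, hc⟩ := hcc.dominated _ hcomp hpos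
  refine ⟨fun s => B₀ + B₁ * Bd s + B₂ * Bc s, ?_⟩
  rw [hfun]
  refine ⟨?_, fun k x y => ?_, ?_, fun x h hx hh => ?_, fun y => ?_⟩
  · exact (hcont.measurable.sub ((hqD.measurable.comp measurable_fst).mul
      (hcd.measurable_comp ha ha0 hU))).add ((hqV.measurable.comp measurable_fst).mul
      (hcc.measurable_comp ha ha0 hU))
  · simp only [hUp k x, continuousGerm_periodic hp hUp hnp k, Prod.fst_add, add_zero]
  · exact ((integrableOn_const measure_Icc_lt_top.ne).add
      ((hBd.integrableOn_isCompact isCompact_Icc).const_mul _)).add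
      ((hBc.integrableOn_isCompact isCompact_Icc).const_mul _)
  · have hmem : a (U x) ∈ a '' Icc (-B₃) B₃ := mem_image_of_mem a (abs_le.1 (h3 x hx))
    have hd' := (hd _ hmem (x + h).1).1
    have hc' := (hc _ hmem (x + h).1).1
    refine (abs_add_le _ _).trans (add_le_add ((abs_sub _ _).trans (add_le_add
      (h0 x h hx hh) ?_)) ?_)
    · rw [abs_mul]
      exact mul_le_mul (h1 x hx) hd' (abs_nonneg _) hB₁
    · rw [abs_mul]
      exact mul_le_mul (h2 x hx) hc' (abs_nonneg _) hB₂
  · exact ((hcont.comp (Continuous.prodMk_left y)).sub (hqD.mul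
      (hcd.continuous_comp (ha.comp hU) (fun x => ha0 _) _))).add (hqV.mul
      (hcc.continuous_comp (ha.comp hU) (fun x => ha0 _) _))

end Germ

/-! ### Pairings of the components of the germ -/

/-- `H` is bounded by `A` and has increments bounded by `A` times those of `Θ`. -/
def TruncLipschitz (Θ H : ℝ → ℝ) (A : ℝ) : Prop :=
  (∀ v, |H v| ≤ A) ∧ ∀ v w, |H v - H w| ≤ A * |Θ v - Θ w|

lemma TruncLipschitz.const_mul {Θ H : ℝ → ℝ} {A : ℝ} (h : TruncLipschitz Θ H A) (c : ℝ) :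
    TruncLipschitz Θ (fun v => c * H v) (|c| * A) := by
  refine ⟨fun v => ?_, fun v w => ?_⟩
  · rw [abs_mul]; exact mul_le_mul_of_nonneg_left (h.1 v) (abs_nonneg c)
  · rw [← mul_sub, abs_mul, mul_assoc]; exact mul_le_mul_of_nonneg_left (h.2 v w) (abs_nonneg c)

lemma IsProfile.continuous {ψ : SpaceTime d → ℝ} (hψ : IsProfile ψ) : Continuous ψ :=
  hψ.contDiff.continuous

lemma IsProfile.norm_le_of_rescale_ne_zero {ψ : SpaceTime d → ℝ} (hψ : IsProfile ψ) {l : ℝ}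
    (hl : 0 < l) (hl1 : l ≤ 1) {k : SpaceTime d} (hk : rescale ψ l 0 k ≠ 0) : ‖k‖ ≤ 1 := by
  have h := (hψ.pnorm_le_of_rescale_ne_zero hl hk).trans hl1
  exact (norm_le_pnorm h).trans h

lemma IsProfile.integrable_rescale_mul {ψ : SpaceTime d → ℝ} (hψ : IsProfile ψ) {l : ℝ}
    (hl : 0 < l) (hl1 : l ≤ 1) {f : SpaceTime d → ℝ} (hf : Continuous f) (w : SpaceTime d) :
    Integrable fun k => rescale ψ l 0 k * f (w + k) := by
  refine Continuous.integrable_of_hasCompactSupport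
    ((continuous_rescale hψ.continuous l 0).mul (hf.comp (continuous_const_add w))) ?_
  refine HasCompactSupport.intro (isCompact_closedBall (0 : SpaceTime d) 1) fun k hk => ?_
  have : rescale ψ l 0 k = 0 := by
    by_contra h
    exact hk (mem_closedBall_zero_iff.2 (hψ.norm_le_of_rescale_ne_zero hl hl1 h))
  rw [this, zero_mul]

/-- Weighted pairings of a scalar component of the model. -/
lemma exists_truncLipschitz {ψ : SpaceTime d → ℝ} (hψ : IsProfile ψ) (h : ℝ) :
    ∃ K : ℝ, 0 < K ∧ ∀ (a σ Θ q : ℝ → ℝ) (P : ℝ → SpaceTime d → SpaceTime d → ℝ)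
      (S S' : SpaceTime d → ℝ → SpaceTime d → ℝ) (c : ℝ → ℝ → ℝ) (e Kq L : ℝ) (n : ℝ≥0),
      ContDiff ℝ 2 a → (∀ v, 0 < a v) → WeightBound a σ q e Kq → 0 ≤ Kq → IsTruncation L σ Θ →
      ModelBound a σ P h e n → (∀ x, DiffFamily (fun b y => P b x y) (S x) (S' x) c) →
      ∀ x ∈ box d, ∀ lam, 0 < lam → 4 * lam < 1 → ∀ w, pnorm (w - x) ≤ 2 * lam →
      TruncLipschitz Θ (fun v => q v * ∫ k, rescale ψ lam 0 k * P (a v) x (w + k))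
        (Kq * (K * n * lam ^ h)) := by
  obtain ⟨K, hK, hb⟩ := exists_pairing_le hψ h
  refine ⟨K, hK, fun a σ Θ q P S S' c e Kq L n ha ha0 hq hKq hΘ hP hS x hx lam hl hl1 w hw => ?_⟩
  have hbd := hb ℝ a σ P e n hP x hx lam hl hl1 w hw
  have hder := fun b (hb : 0 < b) => ((hS x).hasDerivAt_pairing
    (continuous_rescale hψ.continuous lam 0)
    (fun k hk => hψ.norm_le_of_rescale_ne_zero hl (by linarith) hk) w hb).2
  refine hq.mul_comp hΘ ha ha0 (by positivity) hder (fun b hbm => ?_) (fun b hbm => ?_) hKq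
  · have := hbd b hbm 0 zero_le_one
    simpa [iteratedDeriv_zero, smul_eq_mul] using this
  · have := hbd b hbm 1 le_rfl
    simpa [smul_eq_mul] using this

section Families

variable {ξ : SpaceTime d → ℝ} {cd cc : ℝ → ℝ → ℝ}

lemma continuousOn_potentialDeriv (hξ : ContDiff ℝ ((⊤ : ℕ∞) : WithTop ℕ∞) ξ)
    (hp : SpacePeriodic ξ) :
    ContinuousOn (fun q : ℝ × SpaceTime d => potentialDeriv ξ q.1 q.2) (Ioi 0 ×ˢ univ) :=
  fun _ hq => (continuousAt_potentialDeriv hξ hp hq.1).continuousWithinAt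

lemma diffFamily_lolly (hξ : ContDiff ℝ ((⊤ : ℕ∞) : WithTop ℕ∞) ξ) (hp : SpacePeriodic ξ)
    (x : SpaceTime d) :
    DiffFamily (fun b y => lolly ξ b x y) (fun b y => potential ξ b y - potential ξ b x)
      (fun b y => potentialDeriv ξ b y - potentialDeriv ξ b x) (fun _ _ => 0) where
  eq _ hb y := by rw [lolly_eq hξ.continuous hp hb, sub_zero]
  hasDerivAt b hb y := (hasDerivAt_potential hξ hp hb y).sub (hasDerivAt_potential hξ hp hb x)
  continuousOn := by
    have h := continuous_potential hξ.continuous hp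
    exact (h.sub (h.comp (continuous_fst.prodMk continuous_const))).continuousOn
  continuousOn_deriv := by
    have h := continuousOn_potentialDeriv hξ hp
    exact h.sub (h.comp (continuous_fst.prodMk continuous_const).continuousOn
      fun q hq => ⟨hq.1, mem_univ x⟩)
  counterterm := countertermRegular_zero

lemma diffFamily_dumb (hξ : ContDiff ℝ ((⊤ : ℕ∞) : WithTop ℕ∞) ξ) (hp : SpacePeriodic ξ)
    (hcd : CountertermRegular cd) (x : SpaceTime d) :
    DiffFamily (fun b y => dumb ξ cd b x y)
      (fun b y => (potential ξ b y - potential ξ b x) * ξ y)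
      (fun b y => (potentialDeriv ξ b y - potentialDeriv ξ b x) * ξ y) cd where
  eq _ hb y := dumb_eq hξ.continuous hp hb x y
  hasDerivAt b hb y := ((diffFamily_lolly hξ hp x).hasDerivAt b hb y).mul_const (ξ y)
  continuousOn := (diffFamily_lolly hξ hp x).continuousOn.mul
    (hξ.continuous.comp continuous_snd).continuousOn
  continuousOn_deriv := (diffFamily_lolly hξ hp x).continuousOn_deriv.mul
    (hξ.continuous.comp continuous_snd).continuousOn
  counterterm := hcd

lemma diffFamily_cherry (hξ : ContDiff ℝ ((⊤ : ℕ∞) : WithTop ℕ∞) ξ) (hp : SpacePeriodic ξ)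
    (hcc : CountertermRegular cc) (x : SpaceTime d) :
    DiffFamily (fun b y => cherry ξ cc b x y) (fun b y => ‖gradPotential ξ b y‖ ^ 2)
      (fun b y => 2 * inner ℝ (gradPotential ξ b y) (gradPotentialDeriv ξ b y)) cc where
  eq _ hb y := cherry_eq hξ hp hb x y
  hasDerivAt b hb y := (hasDerivAt_gradPotential hξ hp hb y).norm_sq
  continuousOn := ((continuous_gradPotential hξ hp).norm.pow 2).continuousOn
  continuousOn_deriv := by
    have h : ContinuousOn (fun q : ℝ × SpaceTime d => gradPotentialDeriv ξ q.1 q.2)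
        (Ioi 0 ×ˢ univ) :=
      fun q hq => (continuousAt_gradPotentialDeriv hξ hp hq.1).continuousWithinAt
    exact continuousOn_const.mul (ContinuousOn.inner (𝕜 := ℝ)
      (continuous_gradPotential hξ hp).continuousOn h)
  counterterm := hcc

/-- Spatial derivatives of the heat potential, averaged at scale `lam`, are pairings with the
derivative of the bump function at the cost of a factor `lam⁻¹`. -/
lemma integral_mollifier_mul_gradPotential (hξ : ContDiff ℝ ((⊤ : ℕ∞) : WithTop ℕ∞) ξ)
    (hp : SpacePeriodic ξ) {b lam : ℝ} (hb : 0 < b) (hl : 0 < lam) (hl1 : lam ≤ 1) (i : Fin d)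
    (x w : SpaceTime d) :
    ∫ k, mollifier lam k * gradPotential ξ b (w + k) i =
      -lam⁻¹ * ∫ k, rescale (bumpDeriv i) lam 0 k * lolly ξ b x (w + k) := by
  have hlc : Continuous fun y => lolly ξ b x y := by
    have := (diffFamily_lolly hξ hp x).continuous_slice hb
    refine this.congr fun y => ?_
    rw [lolly_eq hξ.continuous hp hb]
  have hgc : Continuous fun y => gradPotential ξ b y i :=
    (EuclideanSpace.proj (𝕜 := ℝ) i).continuous.comp
      ((continuous_gradPotential hξ hp).comp (Continuous.prodMk_right b))
  have hdil : ∀ k : SpaceTime d, ∀ t : ℝ, dilate lam (k + t • ((0, EuclideanSpace.single i 1) :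
      SpaceTime d)) = ((dilate lam k).1, (dilate lam k).2 + (t * lam⁻¹) •
        EuclideanSpace.single i (1 : ℝ)) := by
    intro k t
    refine Prod.ext ?_ ?_
    · simp [dilate]
    · simp only [dilate, Prod.snd_add, Prod.smul_snd, smul_add, smul_smul, mul_comm lam⁻¹]
  have h1 : ∀ k : SpaceTime d, HasLineDerivAt ℝ (mollifier lam)
      (lam⁻¹ * rescale (bumpDeriv i) lam 0 k) k ((0, EuclideanSpace.single i 1) : SpaceTime d) := by
    intro k
    have hd := (hasFDerivAt_sderiv (contDiff_bump.differentiable (by simp))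
      (dilate lam k).1 ((dilate lam k).2)).comp_hasDerivAt_of_eq (0 : ℝ)
      (f := fun t : ℝ => (dilate lam k).2 + (t * lam⁻¹) • EuclideanSpace.single i (1 : ℝ))
      ((((hasDerivAt_id (0 : ℝ)).mul_const lam⁻¹).smul_const
        (EuclideanSpace.single i (1 : ℝ))).const_add (dilate lam k).2) (by simp)
    have hd' := hd.const_mul (lam ^ (-(d : ℝ) - 2))
    unfold HasLineDerivAt
    refine (hd'.congr_of_eventuallyEq (Eventually.of_forall fun t => ?_)).congr_deriv ?_
    · rw [mollifier, rescale_eq, sub_zero, hdil]; rfl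
    · rw [rescale_eq, sub_zero, bumpDeriv, one_mul, map_smul, smul_eq_mul]
      ring
  have h2 : ∀ k : SpaceTime d, HasLineDerivAt ℝ (fun k => lolly ξ b x (w + k))
      (gradPotential ξ b (w + k) i) k ((0, EuclideanSpace.single i 1) : SpaceTime d) := by
    intro k
    have hg := (hasGradientAt_potential hξ hp b (w + k).1 (w + k).2).hasFDerivAt
    have hd := hg.comp_hasDerivAt_of_eq (0 : ℝ)
      (f := fun t : ℝ => (w + k).2 + t • EuclideanSpace.single i (1 : ℝ))
      (((hasDerivAt_id (0 : ℝ)).smul_const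
        (EuclideanSpace.single i (1 : ℝ))).const_add (w + k).2) (by simp)
    unfold HasLineDerivAt
    refine ((hd.sub_const (potential ξ b x)).congr_of_eventuallyEq
      (Eventually.of_forall fun t => ?_)).congr_deriv ?_
    · simp only [Function.comp, lolly_eq hξ.continuous hp hb]
      congr 2
      refine Prod.ext ?_ ?_
      · simp
      · simp [add_assoc]
    · rw [one_smul, InnerProductSpace.toDual_apply_apply, EuclideanSpace.inner_single_right]
      simp only [conj_trivial, one_mul]
  have hB := integral_bilinear_hasLineDerivAt_right_eq_neg_left_of_integrable
    (μ := (volume : Measure (SpaceTime d))) (B := ContinuousLinearMap.mul ℝ ℝ)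
    (f := mollifier lam) (f' := fun k => lam⁻¹ * rescale (bumpDeriv i) lam 0 k)
    (g := fun k => lolly ξ b x (w + k)) (g' := fun k => gradPotential ξ b (w + k) i)
    (v := ((0, EuclideanSpace.single i 1) : SpaceTime d)) ?_ ?_ ?_ (fun k _ => h1 k)
    (fun k _ => h2 k)
  · simp only [ContinuousLinearMap.mul_apply', mul_assoc] at hB
    rw [hB, integral_const_mul, neg_mul]
  · simp only [ContinuousLinearMap.mul_apply', mul_assoc]
    exact ((isProfile_bumpDeriv i).integrable_rescale_mul hl hl1 hlc w).const_mul _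
  · simp only [ContinuousLinearMap.mul_apply']
    exact isProfile_bump.integrable_rescale_mul hl hl1 hgc w
  · simp only [ContinuousLinearMap.mul_apply']
    exact isProfile_bump.integrable_rescale_mul hl hl1 hlc w

end Families

/-- The noise averaged at scale `lam`. -/
lemma exists_average_noise_le (d : ℕ) (h : ℝ) :
    ∃ K : ℝ, 0 < K ∧ ∀ (a σ : ℝ → ℝ) (ξ : SpaceTime d → ℝ) (n : ℝ≥0), (∀ v, 0 < a v) →
      (tsupport σ).Nonempty → ModelBound a σ (fun _ _ y => ξ y) h 0 n →
      ∀ x ∈ box d, ∀ lam, 0 < lam → 4 * lam < 1 → ∀ w, pnorm (w - x) ≤ 2 * lam →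
      |∫ k, mollifier lam k * ξ (w + k)| ≤ K * n * lam ^ h := by
  obtain ⟨K, hK, hb⟩ := exists_pairing_le (isProfile_bump (d := d)) h
  refine ⟨K, hK, fun a σ ξ n ha0 hσ hP x hx lam hl hl1 w hw => ?_⟩
  -- the model is controlled only for diffusivities in the image of the support of `σ`, so
  -- the bound on the noise needs one such diffusivity
  obtain ⟨v, hv⟩ := hσ
  have := hb ℝ a σ _ 0 n hP x hx lam hl hl1 w hw (a v)
    ⟨mem_image_of_mem a hv, (ha0 v).ne'⟩ 0 zero_le_one
  simpa [iteratedDeriv_zero, smul_eq_mul, mollifier] using this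

/-- The components of the products of the noise with the monomials, averaged at scale `lam`. -/
lemma exists_truncLipschitz_xnoise (d : ℕ) (h : ℝ) :
    ∃ K : ℝ, 0 < K ∧ ∀ (a σ Θ q : ℝ → ℝ) (ξ : SpaceTime d → ℝ) (Kq L : ℝ) (n : ℝ≥0),
      Continuous ξ → ContDiff ℝ 2 a → (∀ v, 0 < a v) → WeightBound a σ q 0 Kq → 0 ≤ Kq →
      IsTruncation L σ Θ → ModelBound a σ (fun _ x y => xnoise ξ x y) h 0 n →
      ∀ x ∈ box d, ∀ lam, 0 < lam → 4 * lam < 1 → ∀ w, pnorm (w - x) ≤ 2 * lam → ∀ i,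
      TruncLipschitz Θ (fun v => q v * ∫ k, mollifier lam k * xnoise ξ x (w + k) i)
        (Kq * (K * n * lam ^ h)) := by
  obtain ⟨K, hK, hb⟩ := exists_pairing_le (isProfile_bump (d := d)) h
  refine ⟨K, hK, fun a σ Θ q ξ Kq L n hξ ha ha0 hq hKq hΘ hP x hx lam hl hl1 w hw i => ?_⟩
  have hbd := hb (Space d) a σ _ 0 n hP x hx lam hl hl1 w hw
  have hxc : Continuous fun y => xnoise ξ x y := hξ.smul (continuous_snd.sub continuous_const)
  have hint : Integrable fun k => mollifier lam k • xnoise ξ x (w + k) := by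
    refine Continuous.integrable_of_hasCompactSupport
      ((continuous_mollifier lam).smul (hxc.comp (continuous_const_add w))) ?_
    refine HasCompactSupport.intro (isCompact_closedBall (0 : SpaceTime d) 1) fun k hk => ?_
    have : mollifier lam k = 0 := by
      by_contra h
      exact hk (mem_closedBall_zero_iff.2
        (isProfile_bump.norm_le_of_rescale_ne_zero hl (by linarith) h))
    rw [this, zero_smul]
  have hcomp : ∫ k, mollifier lam k * xnoise ξ x (w + k) i =
      (∫ k, mollifier lam k • xnoise ξ x (w + k)) i :=
    (EuclideanSpace.proj (𝕜 := ℝ) i).integral_comp_comm hint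
  refine hq.mul_comp (G' := fun _ => 0) hΘ ha ha0 (by positivity)
    (fun b _ => hasDerivAt_const b _) (fun b hbm => ?_) (fun b hbm => ?_) hKq
  · have h1 := hbd b hbm 0 zero_le_one
    simp only [iteratedDeriv_zero, Nat.cast_zero, sub_zero, neg_zero, Real.rpow_zero, mul_one]
      at h1 ⊢
    rw [hcomp]
    exact (PiLp.norm_apply_le _ i).trans h1
  · obtain ⟨v, _, rfl⟩ := hbm.1
    rw [abs_zero]
    exact mul_nonneg (by positivity) (Real.rpow_nonneg (ha0 v).le _)

/-! ### Averages of the germ -/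

lemma TruncLipschitz.sub {Θ H G : ℝ → ℝ} {A B : ℝ} (hH : TruncLipschitz Θ H A)
    (hG : TruncLipschitz Θ G B) : TruncLipschitz Θ (fun v => H v - G v) (A + B) := by
  refine ⟨fun v => (abs_sub _ _).trans (add_le_add (hH.1 v) (hG.1 v)), fun v w => ?_⟩
  rw [show H v - G v - (H w - G w) = (H v - H w) - (G v - G w) by ring, add_mul]
  exact (abs_sub _ _).trans (add_le_add (hH.2 v w) (hG.2 v w))

lemma TruncLipschitz.mono {Θ H : ℝ → ℝ} {A B : ℝ} (hH : TruncLipschitz Θ H A) (hAB : A ≤ B) :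
    TruncLipschitz Θ H B :=
  ⟨fun v => (hH.1 v).trans hAB,
    fun v w => (hH.2 v w).trans (mul_le_mul_of_nonneg_right hAB (abs_nonneg _))⟩

section Average

variable {p : ℝ} {a σ : ℝ → ℝ} {ξ : SpaceTime d → ℝ} {cd cc : ℝ → ℝ → ℝ} {U : SpaceTime d → ℝ}
  {n : SpaceTime d → Space d}

/-- Averages of the germ with base point `x`, in terms of the model based at `z`. -/
lemma germAverage_eq (hξ : ContDiff ℝ ((⊤ : ℕ∞) : WithTop ℕ∞) ξ) (hp : SpacePeriodic ξ)
    (ha0 : ∀ v, 0 < a v) (hcd : CountertermRegular cd) (hcc : CountertermRegular cc) {lam : ℝ}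
    (hl : 0 < lam) (hl1 : lam ≤ 1) (x z w : SpaceTime d) :
    germAverage (germ p a σ ξ cd cc U n) lam x w =
      (g p (U x) * σ (U x) + gSigmaDeriv p σ (U x) *
        (σ (U x) * lolly ξ (a (U x)) x z + inner ℝ (n x) (z.2 - x.2))) *
          (∫ k, mollifier lam k * ξ (w + k))
      + (gSigmaDeriv p σ (U x) * σ (U x) * (∫ k, mollifier lam k * dumb ξ cd (a (U x)) z (w + k))
        - gPrime p (U x) * σ (U x) ^ 2 * a (U x) *
          ∫ k, mollifier lam k * cherry ξ cc (a (U x)) z (w + k))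
      + ∑ i, n x i * (gSigmaDeriv p σ (U x) * (∫ k, mollifier lam k * xnoise ξ z (w + k) i)
        - 2 * (gPrime p (U x) * σ (U x) * a (U x) *
          ∫ k, mollifier lam k * gradPotential ξ (a (U x)) (w + k) i)) := by
  have hb := ha0 (U x)
  have hψc := continuous_mollifier (d := d) lam
  have hψ0 : ∀ k : SpaceTime d, mollifier lam k ≠ 0 → ‖k‖ ≤ 1 := fun k hk =>
    isProfile_bump.norm_le_of_rescale_ne_zero hl hl1 hk
  have happ : ∀ i : Fin d, Continuous fun v : Space d => v i := fun i =>
    (EuclideanSpace.proj (𝕜 := ℝ) i).continuous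
  have i1 : Integrable fun k => mollifier lam k * ξ (w + k) :=
    isProfile_bump.integrable_rescale_mul hl hl1 hξ.continuous w
  have i2 := ((diffFamily_dumb hξ hp hcd z).hasDerivAt_pairing hψc hψ0 w hb).1
  have i3 := ((diffFamily_cherry hξ hp hcc z).hasDerivAt_pairing hψc hψ0 w hb).1
  have i4 : ∀ i, Integrable fun k => mollifier lam k * xnoise ξ z (w + k) i := fun i =>
    isProfile_bump.integrable_rescale_mul hl hl1
      (f := fun y => xnoise ξ z y i)
      ((happ i).comp (hξ.continuous.smul (continuous_snd.sub continuous_const))) w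
  have i5 : ∀ i, Integrable fun k => mollifier lam k * gradPotential ξ (a (U x)) (w + k) i :=
    fun i => isProfile_bump.integrable_rescale_mul hl hl1
      (f := fun y => gradPotential ξ (a (U x)) y i) ((happ i).comp
        ((continuous_gradPotential hξ hp).comp (Continuous.prodMk_right _))) w
  -- recentering the model from `x` to `z` changes `Π[I]` by a constant, hence `Π[D]` and
  -- `Π[X]` by multiples of the noise
  have hlx : ∀ y, lolly ξ (a (U x)) x y = lolly ξ (a (U x)) z y + lolly ξ (a (U x)) x z :=
    fun y => by simp only [lolly_eq hξ.continuous hp hb]; ring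
  have e : ∀ k, mollifier lam k * germ p a σ ξ cd cc U n x (w + k) =
      (g p (U x) * σ (U x) + gSigmaDeriv p σ (U x) *
        (σ (U x) * lolly ξ (a (U x)) x z + inner ℝ (n x) (z.2 - x.2))) *
          (mollifier lam k * ξ (w + k))
      + (gSigmaDeriv p σ (U x) * σ (U x) * (mollifier lam k * dumb ξ cd (a (U x)) z (w + k))
        - gPrime p (U x) * σ (U x) ^ 2 * a (U x) *
          (mollifier lam k * cherry ξ cc (a (U x)) z (w + k)))
      + ∑ i, n x i * (gSigmaDeriv p σ (U x) * (mollifier lam k * xnoise ξ z (w + k) i)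
        - 2 * (gPrime p (U x) * σ (U x) * a (U x) *
          (mollifier lam k * gradPotential ξ (a (U x)) (w + k) i))) := by
    intro k
    have h1 : inner ℝ (n x) (z.2 - x.2) = ∑ i, n x i * (z.2 i - x.2 i) := by
      rw [PiLp.inner_apply]
      exact Finset.sum_congr rfl fun i _ => mul_comm _ _
    have h2 : ∀ i, xnoise ξ x (w + k) i = xnoise ξ z (w + k) i + ξ (w + k) * (z.2 i - x.2 i) := by
      intro i
      simp only [xnoise, PiLp.smul_apply, PiLp.sub_apply, smul_eq_mul]
      ring
    have h3 : ∑ i, n x i * (gSigmaDeriv p σ (U x) * (mollifier lam k * xnoise ξ z (w + k) i)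
        - 2 * (gPrime p (U x) * σ (U x) * a (U x) *
          (mollifier lam k * gradPotential ξ (a (U x)) (w + k) i))) =
        mollifier lam k * (gSigmaDeriv p σ (U x) * ∑ i, n x i * xnoise ξ z (w + k) i
          - 2 * (gPrime p (U x) * σ (U x) * a (U x)) *
            ∑ i, n x i * gradPotential ξ (a (U x)) (w + k) i) := by
      simp only [Finset.mul_sum, ← Finset.sum_sub_distrib]
      exact Finset.sum_congr rfl fun i _ => by ring
    have h4 : ∑ i, n x i * xnoise ξ x (w + k) i =
        ∑ i, n x i * xnoise ξ z (w + k) i + ξ (w + k) * ∑ i, n x i * (z.2 i - x.2 i) := by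
      simp only [h2, Finset.mul_sum, ← Finset.sum_add_distrib]
      exact Finset.sum_congr rfl fun i _ => by ring
    rw [h3, h1, germ, h4, cherry_eq hξ hp hb, cherry_eq hξ hp hb, dumb, dumb, hlx (w + k)]
    ring
  have i6 : ∀ i, Integrable fun k => n x i * (gSigmaDeriv p σ (U x) *
      (mollifier lam k * xnoise ξ z (w + k) i) - 2 * (gPrime p (U x) * σ (U x) * a (U x) *
        (mollifier lam k * gradPotential ξ (a (U x)) (w + k) i))) := fun i =>
    (((i4 i).const_mul _).sub (((i5 i).const_mul _).const_mul 2)).const_mul _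
  have hsplit : ∀ f₁ f₂ f₃ f₄ : SpaceTime d → ℝ, Integrable f₁ → Integrable f₂ → Integrable f₃ →
      Integrable f₄ → ∫ k, (f₁ k + (f₂ k - f₃ k) + f₄ k) =
        (∫ k, f₁ k) + ((∫ k, f₂ k) - ∫ k, f₃ k) + ∫ k, f₄ k := by
    intro f₁ f₂ f₃ f₄ h₁ h₂ h₃ h₄
    have h := integral_add (h₁.add (h₂.sub h₃)) h₄
    have h' := integral_add h₁ (h₂.sub h₃)
    rw [integral_sub' h₂ h₃] at h'
    simp only [Pi.add_apply, Pi.sub_apply] at h h'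
    rw [h, h']
  rw [germAverage, integral_congr_ae (Eventually.of_forall e), hsplit _ _ _ _ (i1.const_mul _)
    (i2.const_mul _) (i3.const_mul _) (integrable_finsetSum _ fun i _ => i6 i),
    integral_const_mul, integral_const_mul, integral_const_mul,
    integral_finsetSum _ fun i _ => i6 i]
  congr 1
  refine Finset.sum_congr rfl fun i _ => ?_
  rw [integral_const_mul, integral_sub ((i4 i).const_mul _) (((i5 i).const_mul _).const_mul 2),
    integral_const_mul, integral_const_mul, integral_const_mul]

end Average

/-- Averages of the germ are a multiple of the averaged noise, the coefficient being a local
expansion of `g p U * σ U`, plus terms that depend on the base point only through truncated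
Lipschitz functions of the solution and, linearly, through its modelledness derivative. -/
lemma exists_germAverage_decomposition (d : ℕ) {α M N p ε C : ℝ} (hM : 1 < M) (hM2 : M < 2)
    (hN : M + 1 ≤ N) (hp1 : 1 < p) (hε : 0 < ε) (hε' : ε ≤ 1) (hC : 0 < C) :
    ∃ A : ℝ, 0 < A ∧ ∀ (L : ℝ) (a σ Θ : ℝ → ℝ) (ξ : SpaceTime d → ℝ) (cd cc : ℝ → ℝ → ℝ)
      (m : ModelConstants) (U : SpaceTime d → ℝ) (n : SpaceTime d → Space d),
      Nonlinearities M N C a σ → IsTruncation L σ Θ →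
      ContDiff ℝ ((⊤ : ℕ∞) : WithTop ℕ∞) ξ → SpacePeriodic ξ → CountertermRegular cd →
      CountertermRegular cc → ModelBounds α ε a σ ξ cd cc m →
      ∀ z ∈ box d, ∀ lam, 0 < lam → 4 * lam < 1 → ∀ w, pnorm (w - z) ≤ 2 * lam →
      ∃ (η : ℝ) (S : ℝ → ℝ) (W : Fin d → ℝ → ℝ),
        ((tsupport σ).Nonempty → |η| ≤ A * m.noise * lam ^ (α - 2)) ∧
        TruncLipschitz Θ S (A * (m.dumb + m.cherry) * lam ^ (2 * α - 2)) ∧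
        (∀ i, TruncLipschitz Θ (W i) (A * (m.xnoise + m.lolly) * lam ^ (α - 1))) ∧
        ∀ x, germAverage (germ p a σ ξ cd cc U n) lam x w =
          (g p (U x) * σ (U x) + gSigmaDeriv p σ (U x) *
            (σ (U x) * lolly ξ (a (U x)) x z + inner ℝ (n x) (z.2 - x.2))) * η
          + S (U x) + ∑ i, n x i * W i (U x) := by
  obtain ⟨Kw, hKw, hw⟩ := exists_weightBound hM hM2 hN hp1 hε hε' hC
  obtain ⟨K₁, hK₁, h1⟩ := exists_average_noise_le d (α - 2)
  obtain ⟨K₂, hK₂, h2⟩ := exists_truncLipschitz (isProfile_bump (d := d)) (2 * α - 2)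
  obtain ⟨K₃, hK₃, h3⟩ := exists_truncLipschitz_xnoise d (α - 1)
  choose K₄ hK₄ h4 using fun i : Fin d =>
    exists_truncLipschitz (isProfile_bumpDeriv (d := d) i) α
  have hs4 : 0 ≤ ∑ i, K₄ i := Finset.sum_nonneg fun i _ => (hK₄ i).le
  refine ⟨K₁ + Kw * K₂ + Kw * K₃ + 2 * (Kw * ∑ i, K₄ i), by positivity, ?_⟩
  intro L a σ Θ ξ cd cc m U n hN hΘ hξ hp hcd hcc hm z hz lam hl hl1 w hwz
  set A := K₁ + Kw * K₂ + Kw * K₃ + 2 * (Kw * ∑ i, K₄ i) with hA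
  have ha := hN.a_contDiff
  have ha0 := hN.pos
  obtain ⟨wD, wV, wG, wX⟩ := hw a σ hN
  have p1 : 0 ≤ Kw * K₂ := by positivity
  have p2 : 0 ≤ Kw * K₃ := by positivity
  have p3 : 0 ≤ Kw * ∑ i, K₄ i := by positivity
  have hD := h2 a σ Θ _ _ _ _ cd _ Kw L m.dumb ha ha0 wD hKw.le hΘ hm.dumb
    (diffFamily_dumb hξ hp hcd) z hz lam hl hl1 w hwz
  have hV := h2 a σ Θ _ _ _ _ cc _ Kw L m.cherry ha ha0 wV hKw.le hΘ hm.cherry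
    (diffFamily_cherry hξ hp hcc) z hz lam hl hl1 w hwz
  have hX := h3 a σ Θ _ ξ Kw L m.xnoise hξ.continuous ha ha0 wX hKw.le hΘ hm.xnoise z hz lam hl
    hl1 w hwz
  have hG := fun i => h4 i a σ Θ _ _ _ _ _ _ Kw L m.lolly ha ha0 wG hKw.le hΘ hm.lolly
    (diffFamily_lolly hξ hp) z hz lam hl hl1 w hwz
  have hG' : ∀ i, TruncLipschitz Θ (fun v => 2 * (gPrime p v * σ v * a v *
      ∫ k, mollifier lam k * gradPotential ξ (a v) (w + k) i))
      (2 * (Kw * K₄ i) * m.lolly * lam ^ (α - 1)) := by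
    intro i
    have h := (hG i).const_mul (2 * -lam⁻¹)
    have e1 : (fun v => 2 * (gPrime p v * σ v * a v *
        ∫ k, mollifier lam k * gradPotential ξ (a v) (w + k) i)) = fun v => 2 * -lam⁻¹ *
        (gPrime p v * σ v * a v * ∫ k, rescale (bumpDeriv i) lam 0 k * lolly ξ (a v) z (w + k)) := by
      funext v
      rw [integral_mollifier_mul_gradPotential hξ hp (ha0 v) hl (by linarith) i z w]
      ring
    rw [e1]
    refine h.mono (le_of_eq ?_)
    rw [abs_mul, abs_neg, abs_of_pos (inv_pos.2 hl), abs_of_pos (two_pos : (0 : ℝ) < 2),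
      Real.rpow_sub_one hl.ne']
    field_simp
  refine ⟨_, _, _, fun hne => ?_, (hD.sub hV).mono ?_, fun i => ((hX i).sub (hG' i)).mono ?_,
    fun x => germAverage_eq hξ hp ha0 hcd hcc hl (by linarith) x z w⟩
  · refine (h1 a σ ξ m.noise ha0 hne hm.noise z hz lam hl hl1 w hwz).trans ?_
    gcongr
    linarith
  · have hle : Kw * K₂ ≤ A := by rw [hA]; linarith
    have hx : 0 ≤ (m.dumb + m.cherry : ℝ) * lam ^ (2 * α - 2) := by positivity
    nlinarith [mul_le_mul_of_nonneg_right hle hx]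
  · have hle : Kw * K₃ ≤ A := by rw [hA]; linarith
    have hKi : K₄ i ≤ ∑ i, K₄ i :=
      Finset.single_le_sum (f := K₄) (fun j _ => (hK₄ j).le) (Finset.mem_univ i)
    have hle' : 2 * (Kw * K₄ i) ≤ A := by
      have : Kw * K₄ i ≤ Kw * ∑ i, K₄ i := mul_le_mul_of_nonneg_left hKi hKw.le
      rw [hA]; linarith
    have hx : 0 ≤ (m.xnoise : ℝ) * lam ^ (α - 1) := by positivity
    have hy : 0 ≤ (m.lolly : ℝ) * lam ^ (α - 1) := by positivity
    nlinarith [mul_le_mul_of_nonneg_right hle hx, mul_le_mul_of_nonneg_right hle' hy]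

/-! ### Pointwise bounds on the germ -/

lemma lolly_self (ξ : SpaceTime d → ℝ) (b : ℝ) (x : SpaceTime d) : lolly ξ b x x = 0 := by
  simp [lolly]

lemma abs_sum_mul_le {v : Space d} {W : Fin d → ℝ} {A : ℝ} (hW : ∀ i, |W i| ≤ A) :
    |∑ i, v i * W i| ≤ d * (A * ‖v‖) := by
  calc |∑ i, v i * W i| ≤ ∑ i, |v i * W i| := Finset.abs_sum_le_sum_abs _ _
    _ ≤ ∑ _i : Fin d, A * ‖v‖ := by
        refine Finset.sum_le_sum fun i _ => ?_
        rw [abs_mul, mul_comm]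
        exact mul_le_mul (hW i) (PiLp.norm_apply_le v i) (abs_nonneg _)
          ((abs_nonneg _).trans (hW i))
    _ = _ := by rw [Finset.sum_const, Finset.card_univ, Fintype.card_fin, nsmul_eq_mul]

lemma Nonlinearities.abs_g_mul_sigma_le {M N C p : ℝ} {a σ : ℝ → ℝ}
    (h : Nonlinearities M N C a σ) (hp : 1 < p) (hN : 0 < N) (hC : 0 < C) (v : ℝ) :
    |g p v * σ v| ≤ C ^ (p - 1) / (p - 1) * (C * C ^ N) := by
  have hp' : 0 < p - 1 := by linarith
  by_cases hv : v ∈ tsupport σ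
  · have hvC : |v| ≤ C := abs_le.2 (h.sigma_support hv)
    rw [abs_mul, abs_g hp]
    have h1 := h.sigma_bound v
    gcongr
    exact h1.trans (by gcongr)
  · rw [(eq_zero_of_notMem_tsupport hv).1, mul_zero, abs_zero]
    positivity

/-- The deviation of `g p U * σ U` at `w` from its local expansion at `x`. -/
noncomputable def remainder (p : ℝ) (a σ : ℝ → ℝ) (ξ : SpaceTime d → ℝ) (U : SpaceTime d → ℝ)
    (n : SpaceTime d → Space d) (x w : SpaceTime d) : ℝ :=
  g p (U w) * σ (U w) - g p (U x) * σ (U x) - gSigmaDeriv p σ (U x) *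
    (σ (U x) * lolly ξ (a (U x)) x w + inner ℝ (n x) (w.2 - x.2))

/-- Size and coherence of the germ. -/
lemma exists_germAverage_bounds (d : ℕ) {α M N p ε C : ℝ} (hM : 1 < M) (hM2 : M < 2)
    (hN : M + 1 ≤ N) (hp1 : 1 < p) (hε : 0 < ε) (hε' : ε ≤ 1) (hC : 0 < C) :
    ∃ A : ℝ, 0 < A ∧ ∀ (L : ℝ) (a σ Θ : ℝ → ℝ) (ξ : SpaceTime d → ℝ) (cd cc : ℝ → ℝ → ℝ)
      (m : ModelConstants) (U : SpaceTime d → ℝ) (n : SpaceTime d → Space d),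
      Nonlinearities M N C a σ → IsTruncation L σ Θ →
      ContDiff ℝ ((⊤ : ℕ∞) : WithTop ℕ∞) ξ → SpacePeriodic ξ → CountertermRegular cd →
      CountertermRegular cc → ModelBounds α ε a σ ξ cd cc m →
      ∀ lam, 0 < lam → 4 * lam < 1 →
      (∀ x ∈ box d, ∀ w, pnorm (w - x) ≤ 2 * lam →
        |germAverage (germ p a σ ξ cd cc U n) lam x w| ≤
          A * m.noise * lam ^ (α - 2) + A * (m.dumb + m.cherry) * lam ^ (2 * α - 2)
          + A * (m.xnoise + m.lolly) * lam ^ (α - 1) * ‖n x‖) ∧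
      ∀ x, ∀ w ∈ box d, |germAverage (germ p a σ ξ cd cc U n) lam x w -
          germAverage (germ p a σ ξ cd cc U n) lam w w| ≤
        A * m.noise * lam ^ (α - 2) * |remainder p a σ ξ U n x w|
        + A * (m.dumb + m.cherry) * lam ^ (2 * α - 2) * |Θ (U w) - Θ (U x)|
        + A * (m.xnoise + m.lolly) * lam ^ (α - 1) *
          (‖n w - n x‖ + ‖n x‖ * |Θ (U w) - Θ (U x)|) := by
  obtain ⟨A, hA, h⟩ := exists_germAverage_decomposition d (α := α) hM hM2 hN hp1 hε hε' hC
  set B := C ^ (p - 1) / (p - 1) * (C * C ^ N) with hB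
  have hp' : 0 < p - 1 := by linarith
  have hB0 : 0 ≤ B := by positivity
  refine ⟨A * (1 + B + d), by positivity, ?_⟩
  intro L a σ Θ ξ cd cc m U n hNL hΘ hξ hp hcd hcc hm lam hl hl1
  have hA1 : A ≤ A * (1 + B + d) := le_mul_of_one_le_right hA.le (by
    have : (0 : ℝ) ≤ d := Nat.cast_nonneg d
    linarith)
  have hAB : A * B ≤ A * (1 + B + d) := mul_le_mul_of_nonneg_left (by
    have : (0 : ℝ) ≤ d := Nat.cast_nonneg d
    linarith) hA.le
  have hAd : A * d ≤ A * (1 + B + d) := mul_le_mul_of_nonneg_left (by linarith) hA.le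
  have hx1 : 0 ≤ (m.noise : ℝ) * lam ^ (α - 2) := by positivity
  have hx2 : 0 ≤ (m.dumb + m.cherry : ℝ) * lam ^ (2 * α - 2) := by positivity
  have hx3 : 0 ≤ (m.xnoise + m.lolly : ℝ) * lam ^ (α - 1) := by positivity
  refine ⟨fun x hx w hw => ?_, fun x w hw => ?_⟩
  -- for the size, the model is centered at the base point
  · obtain ⟨η, S, W, hη, hS, hW, hdec⟩ := h L a σ Θ ξ cd cc m U n hNL hΘ hξ hp hcd hcc hm x hx lam
      hl hl1 w hw
    rw [hdec x, lolly_self, sub_self, inner_zero_right, mul_zero, add_zero, mul_zero, add_zero]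
    have t1 : |g p (U x) * σ (U x) * η| ≤ A * B * (m.noise * lam ^ (α - 2)) := by
      by_cases hne : (tsupport σ).Nonempty
      · rw [abs_mul]
        calc |g p (U x) * σ (U x)| * |η| ≤ B * (A * m.noise * lam ^ (α - 2)) :=
              mul_le_mul (hNL.abs_g_mul_sigma_le hp1 (by linarith) hC _) (hη hne) (abs_nonneg _) hB0
          _ = _ := by ring
      · have hσ : σ (U x) = 0 := (eq_zero_of_notMem_tsupport fun hv => hne ⟨_, hv⟩).1
        rw [hσ, mul_zero, zero_mul, abs_zero]
        positivity
    have t2 := hS.1 (U x)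
    have t3 := abs_sum_mul_le (v := n x) fun i => (hW i).1 (U x)
    calc _ ≤ A * B * (m.noise * lam ^ (α - 2)) + A * (m.dumb + m.cherry) * lam ^ (2 * α - 2)
          + d * (A * (m.xnoise + m.lolly) * lam ^ (α - 1) * ‖n x‖) :=
          (abs_add_le _ _).trans (add_le_add ((abs_add_le _ _).trans (add_le_add t1 t2)) t3)
      _ = (A * B) * (m.noise * lam ^ (α - 2)) + A * ((m.dumb + m.cherry) * lam ^ (2 * α - 2))
          + (A * d) * ((m.xnoise + m.lolly) * lam ^ (α - 1) * ‖n x‖) := by ring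
      _ ≤ (A * (1 + B + d)) * (m.noise * lam ^ (α - 2))
          + (A * (1 + B + d)) * ((m.dumb + m.cherry) * lam ^ (2 * α - 2))
          + (A * (1 + B + d)) * ((m.xnoise + m.lolly) * lam ^ (α - 1) * ‖n x‖) := by gcongr
      _ = _ := by ring
  -- for the coherence, both germs are expressed by the model centered at the evaluation
  -- point, and the coefficients of the noise differ by the remainder
  · obtain ⟨η, S, W, hη, hS, hW, hdec⟩ := h L a σ Θ ξ cd cc m U n hNL hΘ hξ hp hcd hcc hm w hw lam
      hl hl1 w (by rw [sub_self, pnorm_zero]; positivity)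
    rw [hdec x, hdec w, lolly_self, sub_self, inner_zero_right, mul_zero, add_zero, mul_zero,
      add_zero]
    have e : (g p (U x) * σ (U x) + gSigmaDeriv p σ (U x) *
          (σ (U x) * lolly ξ (a (U x)) x w + inner ℝ (n x) (w.2 - x.2))) * η + S (U x)
          + ∑ i, n x i * W i (U x) -
        (g p (U w) * σ (U w) * η + S (U w) + ∑ i, n w i * W i (U w)) =
        -(remainder p a σ ξ U n x w * η) + (-(S (U w) - S (U x)))
          + (-(∑ i, (n w - n x) i * W i (U w)) - ∑ i, n x i * (W i (U w) - W i (U x))) := by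
      have e1 : ∑ i, (n w - n x) i * W i (U w) =
          ∑ i, n w i * W i (U w) - ∑ i, n x i * W i (U w) := by
        rw [← Finset.sum_sub_distrib]
        exact Finset.sum_congr rfl fun i _ => by rw [PiLp.sub_apply]; ring
      have e2 : ∑ i, n x i * (W i (U w) - W i (U x)) =
          ∑ i, n x i * W i (U w) - ∑ i, n x i * W i (U x) := by
        rw [← Finset.sum_sub_distrib]
        exact Finset.sum_congr rfl fun i _ => by ring
      rw [e1, e2, remainder]
      ring
    rw [e]
    have t1 : |-(remainder p a σ ξ U n x w * η)| ≤
        A * (m.noise * lam ^ (α - 2) * |remainder p a σ ξ U n x w|) := by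
      rw [abs_neg, abs_mul]
      by_cases hne : (tsupport σ).Nonempty
      · calc _ ≤ |remainder p a σ ξ U n x w| * (A * m.noise * lam ^ (α - 2)) :=
              mul_le_mul_of_nonneg_left (hη hne) (abs_nonneg _)
          _ = _ := by ring
      · have hσ : ∀ v, σ v = 0 := fun v =>
          (eq_zero_of_notMem_tsupport fun hv => hne ⟨_, hv⟩).1
        have hσ' : gSigmaDeriv p σ (U x) = 0 := gSigmaDeriv_off fun hv => hne ⟨_, hv⟩
        rw [remainder, hσ, hσ, hσ', mul_zero, mul_zero, zero_mul, sub_zero, sub_zero, abs_zero,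
          zero_mul, mul_zero, mul_zero]
    have t2 : |-(S (U w) - S (U x))| ≤
        A * ((m.dumb + m.cherry) * lam ^ (2 * α - 2) * |Θ (U w) - Θ (U x)|) := by
      rw [abs_neg]
      exact (hS.2 _ _).trans (le_of_eq (by ring))
    have t3 : |(-(∑ i, (n w - n x) i * W i (U w)) - ∑ i, n x i * (W i (U w) - W i (U x)))| ≤
        (A * d) * ((m.xnoise + m.lolly) * lam ^ (α - 1) *
          (‖n w - n x‖ + ‖n x‖ * |Θ (U w) - Θ (U x)|)) := by
      refine (abs_sub _ _).trans ?_
      rw [abs_neg]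
      refine (add_le_add (abs_sum_mul_le fun i => (hW i).1 (U w))
        (abs_sum_mul_le fun i => (hW i).2 (U w) (U x))).trans (le_of_eq (by ring))
    calc _ ≤ A * (m.noise * lam ^ (α - 2) * |remainder p a σ ξ U n x w|)
          + A * ((m.dumb + m.cherry) * lam ^ (2 * α - 2) * |Θ (U w) - Θ (U x)|)
          + (A * d) * ((m.xnoise + m.lolly) * lam ^ (α - 1) *
            (‖n w - n x‖ + ‖n x‖ * |Θ (U w) - Θ (U x)|)) :=
          (abs_add_le _ _).trans (add_le_add ((abs_add_le _ _).trans (add_le_add t1 t2)) t3)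
      _ ≤ (A * (1 + B + d)) * (m.noise * lam ^ (α - 2) * |remainder p a σ ξ U n x w|)
          + (A * (1 + B + d)) * ((m.dumb + m.cherry) * lam ^ (2 * α - 2) * |Θ (U w) - Θ (U x)|)
          + (A * (1 + B + d)) * ((m.xnoise + m.lolly) * lam ^ (α - 1) *
            (‖n w - n x‖ + ‖n x‖ * |Θ (U w) - Θ (U x)|)) := by gcongr
      _ = _ := by ring

/-! ### Sums over dyadic scales -/

/-- Real powers of a length, as extended nonnegative numbers. -/
noncomputable def lengthPow (l s : ℝ) : ℝ≥0∞ := ENNReal.ofReal (l ^ s)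

lemma lengthPow_mul_lengthPow {l : ℝ} (hl : 0 < l) (s t : ℝ) :
    lengthPow l s * lengthPow l t = lengthPow l (s + t) := by
  rw [lengthPow, lengthPow, ← ENNReal.ofReal_mul (by positivity), ← Real.rpow_add hl, lengthPow]

lemma mul_lengthPow {l k : ℝ} (hl : 0 ≤ l) (hk : 0 ≤ k) (s : ℝ) :
    lengthPow (k * l) s = lengthPow k s * lengthPow l s := by
  rw [lengthPow, lengthPow, lengthPow, ← ENNReal.ofReal_mul (by positivity), Real.mul_rpow hk hl]

lemma lengthPow_mono {l k s : ℝ} (hl : 0 ≤ l) (hlk : l ≤ k) (hs : 0 ≤ s) :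
    lengthPow l s ≤ lengthPow k s :=
  ENNReal.ofReal_le_ofReal (Real.rpow_le_rpow hl hlk hs)

lemma lengthPow_le_one {l s : ℝ} (hl : 0 ≤ l) (hl1 : l ≤ 1) (hs : 0 ≤ s) : lengthPow l s ≤ 1 := by
  rw [lengthPow, ← ENNReal.ofReal_one]
  exact ENNReal.ofReal_le_ofReal (Real.rpow_le_one hl hl1 hs)

lemma lengthPow_rpow {l : ℝ} (hl : 0 < l) (s t : ℝ) : lengthPow l s ^ t = lengthPow l (s * t) := by
  rw [lengthPow, lengthPow, ENNReal.ofReal_rpow_of_pos (by positivity), ← Real.rpow_mul hl.le]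

lemma lengthPow_half {l : ℝ} (hl : 0 ≤ l) (s : ℝ) :
    lengthPow (l / 2) s = lengthPow 2 (-s) * lengthPow l s := by
  rw [div_eq_inv_mul, mul_lengthPow hl (by norm_num)]
  congr 1
  rw [lengthPow, lengthPow, Real.inv_rpow (by norm_num), Real.rpow_neg (by norm_num)]

lemma lengthPow_half_le {l : ℝ} (hl : 0 ≤ l) {s : ℝ} (hs : -2 ≤ s) :
    lengthPow (l / 2) s ≤ 4 * lengthPow l s := by
  rw [lengthPow_half hl]
  gcongr
  rw [lengthPow, ENNReal.ofReal_le_iff_le_toReal (by simp)]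
  calc (2 : ℝ) ^ (-s) ≤ 2 ^ (2 : ℝ) :=
        Real.rpow_le_rpow_of_exponent_le (by norm_num) (by linarith)
    _ = _ := by norm_num

/-- The sum of the geometric series with ratio `2 ^ (-s)`. -/
noncomputable def geomSum (s : ℝ) : ℝ≥0∞ := (1 - lengthPow 2 (-s))⁻¹

lemma geomSum_ne_top {s : ℝ} (hs : 0 < s) : geomSum s ≠ ∞ := by
  have : lengthPow 2 (-s) < 1 := by
    rw [lengthPow, ← ENNReal.ofReal_one, ENNReal.ofReal_lt_ofReal_iff one_pos]
    exact Real.rpow_lt_one_of_one_lt_of_neg (by norm_num) (by linarith)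
  rw [geomSum, Ne, ENNReal.inv_eq_top]
  exact (tsub_pos_of_lt this).ne'

lemma lengthPow_scale {μ : ℝ} (hμ : 0 < μ) (s : ℝ) (k : ℕ) :
    lengthPow (scale μ k) s = lengthPow μ s * lengthPow 2 (-s) ^ k := by
  induction k with
  | zero => simp [scale]
  | succ k ih => rw [scale_succ, lengthPow_half (scale_pos hμ k).le, ih, pow_succ]; ring

lemma tsum_lengthPow_scale {μ : ℝ} (hμ : 0 < μ) (s : ℝ) :
    ∑' k, lengthPow (scale μ k) s = lengthPow μ s * geomSum s := by
  simp_rw [lengthPow_scale hμ]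
  rw [ENNReal.tsum_mul_left, ENNReal.tsum_geometric, geomSum]

/-- Summing a perturbed geometric recursion. No summability is needed in `ℝ≥0∞`. -/
lemma tsum_le_of_contraction {c e : ℕ → ℝ≥0∞} {θ : ℝ≥0∞} (h : ∀ k, c (k + 1) ≤ θ * c k + e k) :
    ∑' k, c k ≤ (1 - θ)⁻¹ * (c 0 + ∑' k, e k) := by
  set X := c 0 + ∑' k, e k
  have hB : (1 - θ)⁻¹ = 1 + θ * (1 - θ)⁻¹ := by
    have h1 := tsum_eq_zero_add' (f := fun k => θ ^ k) ENNReal.summable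
    simp only [pow_zero, pow_succ'] at h1
    rw [ENNReal.tsum_mul_left, ENNReal.tsum_geometric] at h1
    exact h1
  refine ENNReal.tsum_le_of_sum_range_le fun N => ?_
  induction N with
  | zero => simp
  | succ N ih =>
    rw [Finset.sum_range_succ']
    calc ∑ k ∈ Finset.range N, c (k + 1) + c 0
        ≤ ∑ k ∈ Finset.range N, (θ * c k + e k) + c 0 := by gcongr with k; exact h k
      _ = θ * ∑ k ∈ Finset.range N, c k + (c 0 + ∑ k ∈ Finset.range N, e k) := by
        rw [Finset.sum_add_distrib, Finset.mul_sum]; ring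
      _ ≤ θ * ((1 - θ)⁻¹ * X) + X := by
        exact add_le_add (by gcongr) (add_le_add le_rfl (ENNReal.sum_le_tsum _))
      _ = (1 - θ)⁻¹ * X := by
        nth_rw 2 [hB]
        ring

/-! ### Boundary layers in time -/

section Layer

variable {T : ℝ} {n : SpaceTime d → Space d}

/-- The mass of `n` in the layers of width `l ^ 2` at the initial and at the final time. -/
noncomputable def layerMass (T : ℝ) (n : SpaceTime d → Space d) (l : ℝ) : ℝ≥0∞ :=
  (∫⁻ x in Ico 0 (l ^ 2) ×ˢ cube d, ‖n x‖ₑ) + ∫⁻ x in Ioc (T - l ^ 2) T ×ˢ cube d, ‖n x‖ₑ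

lemma layerMass_le {l : ℝ} (hl : l ^ 2 ≤ T) :
    layerMass T n l ≤ 2 * ∫⁻ x in Icc 0 T ×ˢ cube d, ‖n x‖ₑ := by
  rw [two_mul]
  refine add_le_add (lintegral_mono_set (prod_mono_left fun t ht => ?_))
    (lintegral_mono_set (prod_mono_left fun t ht => ?_))
  · exact ⟨ht.1, ht.2.le.trans hl⟩
  · exact ⟨by linarith [ht.1], ht.2⟩

/-- Comparison of the mass of `n` over a time set `A` with that over a disjoint translate `A'` of
it. -/
lemma two_mul_lintegral_layer_le (hn : Continuous n) (hnp : SpacePeriodic n) {A A' A'' : Set ℝ}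
    (hA' : MeasurableSet A') {t : ℝ} (hAt : (fun s => s + t) ⁻¹' A' = A)
    (hdisj : Disjoint A A') (hA : A ∪ A' ⊆ A'') (hAT : A ⊆ Icc 0 T) (hAT' : A' ⊆ Icc 0 T)
    {E : ℝ≥0∞} (hE : ∫⁻ x in shiftDomain T ((t, 0) : SpaceTime d), ‖n (x + (t, 0)) - n x‖ₑ ≤ E) :
    2 * ∫⁻ x in A ×ˢ cube d, ‖n x‖ₑ ≤ (∫⁻ x in A'' ×ˢ cube d, ‖n x‖ₑ) + E := by
  have hper : SpacePeriodic fun x => ‖n x‖ₑ := fun k z => by simp only [hnp k z]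
  have hshift := lintegral_prod_cube_add hper hA' (t, 0)
  rw [hAt] at hshift
  have hsub : A ×ˢ cube d ⊆ shiftDomain T ((t, 0) : SpaceTime d) := fun x hx =>
    ⟨hAT hx.1, hAT' (by have := hx.1; rw [← hAt] at this; exact this), hx.2⟩
  have hn' : Measurable fun x : SpaceTime d => ‖n (x + (t, 0)) - n x‖ₑ :=
    ((hn.comp (continuous_add_const _)).sub hn).enorm.measurable
  calc 2 * ∫⁻ x in A ×ˢ cube d, ‖n x‖ₑ
      = (∫⁻ x in A ×ˢ cube d, ‖n x‖ₑ) + ∫⁻ x in A ×ˢ cube d, ‖n x‖ₑ := two_mul _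
    _ ≤ (∫⁻ x in A ×ˢ cube d, ‖n x‖ₑ) +
        ((∫⁻ x in A ×ˢ cube d, ‖n (x + (t, 0))‖ₑ) +
          ∫⁻ x in A ×ˢ cube d, ‖n (x + (t, 0)) - n x‖ₑ) := by
        gcongr
        rw [← lintegral_add_right _ hn']
        refine lintegral_mono fun x => ?_
        have : n x = n (x + (t, 0)) - (n (x + (t, 0)) - n x) := by abel
        calc ‖n x‖ₑ = ‖n (x + (t, 0)) - (n (x + (t, 0)) - n x)‖ₑ := by rw [← this]
          _ ≤ _ := enorm_sub_le
    _ ≤ (∫⁻ x in A ×ˢ cube d, ‖n x‖ₑ) + ((∫⁻ x in A' ×ˢ cube d, ‖n x‖ₑ) + E) := by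
        exact add_le_add le_rfl (add_le_add hshift.le ((lintegral_mono_set hsub).trans hE))
    _ = (∫⁻ x in (A ∪ A') ×ˢ cube d, ‖n x‖ₑ) + E := by
        rw [union_prod, lintegral_union (hA'.prod measurableSet_cube) (hdisj.set_prod_left _ _),
          add_assoc]
    _ ≤ _ := by gcongr

/-- Comparison of a layer with its translate by its own width halves its mass at the expense of an
increment. -/
lemma two_mul_layerMass_le (hn : Continuous n) (hnp : SpacePeriodic n) {l : ℝ} (hl : 0 ≤ l)
    (hlT : (2 * l) ^ 2 ≤ T) {E : ℝ≥0∞}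
    (hE : ∀ h : SpaceTime d, pnorm h ≤ l → ∫⁻ x in shiftDomain T h, ‖n (x + h) - n x‖ₑ ≤ E) :
    2 * layerMass T n l ≤ layerMass T n (2 * l) + 2 * E := by
  have hl2 : 0 ≤ l ^ 2 := sq_nonneg l
  have hpn : ∀ t : ℝ, |t| = l ^ 2 → pnorm ((t, 0) : SpaceTime d) ≤ l := fun t ht => by
    rw [pnorm, ht]; simp [Real.sqrt_sq hl]
  have h1 := two_mul_lintegral_layer_le hn hnp (T := T) (A := Ico 0 (l ^ 2))
    (A' := Ico (l ^ 2) (2 * l ^ 2)) (A'' := Ico 0 ((2 * l) ^ 2)) measurableSet_Ico (t := l ^ 2)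
    (by ext s; simp only [mem_preimage, mem_Ico]; constructor <;> rintro ⟨h, h'⟩ <;>
      constructor <;> linarith)
    (disjoint_left.2 fun s hs hs' => absurd hs.2 (not_lt.2 hs'.1))
    (by rintro s (hs | hs) <;> exact ⟨by linarith [hs.1], by nlinarith [hs.2]⟩)
    (fun s hs => ⟨hs.1, by nlinarith [hs.2]⟩) (fun s hs => ⟨hl2.trans hs.1, by nlinarith [hs.2]⟩)
    (hE _ (hpn _ (abs_of_nonneg hl2)))
  have h2 := two_mul_lintegral_layer_le hn hnp (T := T) (A := Ioc (T - l ^ 2) T)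
    (A' := Ioc (T - 2 * l ^ 2) (T - l ^ 2)) (A'' := Ioc (T - (2 * l) ^ 2) T) measurableSet_Ioc
    (t := -l ^ 2)
    (by ext s; simp only [mem_preimage, mem_Ioc]; constructor <;> rintro ⟨h, h'⟩ <;>
      constructor <;> linarith)
    (disjoint_left.2 fun s hs hs' => absurd hs.1 (not_lt.2 hs'.2))
    (by rintro s (hs | hs) <;> exact ⟨by nlinarith [hs.1], by linarith [hs.2]⟩)
    (fun s hs => ⟨by nlinarith [hs.1], hs.2⟩) (fun s hs => ⟨by nlinarith [hs.1],
      by linarith [hs.2]⟩)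
    (hE _ (hpn _ (by rw [abs_neg, abs_of_nonneg hl2])))
  calc 2 * layerMass T n l = 2 * (∫⁻ x in Ico 0 (l ^ 2) ×ˢ cube d, ‖n x‖ₑ) +
        2 * ∫⁻ x in Ioc (T - l ^ 2) T ×ˢ cube d, ‖n x‖ₑ := by rw [layerMass, mul_add]
    _ ≤ _ := add_le_add h1 h2
    _ = _ := by rw [layerMass]; ring

/-- Points that a translation by `h` moves out of the time interval lie in the boundary layers. -/
lemma lintegral_diff_shiftDomain_le {l : ℝ} {h : SpaceTime d} (hh : pnorm h ≤ l)
    (f : SpaceTime d → ℝ≥0∞) :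
    ∫⁻ x in (Icc 0 T ×ˢ cube d) \ shiftDomain T h, f x ≤
      (∫⁻ x in Ico 0 (l ^ 2) ×ˢ cube d, f x) + ∫⁻ x in Ioc (T - l ^ 2) T ×ˢ cube d, f x := by
  refine (lintegral_mono_set ?_).trans (lintegral_union_le _ _ _)
  rintro x ⟨hx, hx'⟩
  have h1 := (abs_fst_le_pnorm_sq h).trans (pow_le_pow_left₀ (pnorm_nonneg h) hh 2)
  rw [abs_le] at h1
  by_cases h0 : x.1 < l ^ 2
  · exact Or.inl ⟨⟨hx.1.1, h0⟩, hx.2⟩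
  · refine Or.inr ⟨⟨?_, hx.1.2⟩, hx.2⟩
    by_contra h2
    exact hx' ⟨hx.1, ⟨by linarith [not_lt.1 h0], by linarith [not_lt.1 h2]⟩, hx.2⟩

lemma lintegral_layers_add_le (hn : Continuous n) (c c' : ℝ≥0∞) (l : ℝ) :
    (∫⁻ x in Ico 0 (l ^ 2) ×ˢ cube d, (c + c' * ‖n x‖ₑ)) +
      ∫⁻ x in Ioc (T - l ^ 2) T ×ˢ cube d, (c + c' * ‖n x‖ₑ) ≤
      c * (2 * ENNReal.ofReal (l ^ 2)) + c' * layerMass T n l := by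
  have hm : Measurable fun x => ‖n x‖ₑ := hn.enorm.measurable
  have key : ∀ A : Set ℝ, ∫⁻ x in A ×ˢ cube d, (c + c' * ‖n x‖ₑ) =
      c * volume A + c' * ∫⁻ x in A ×ˢ cube d, ‖n x‖ₑ := fun A => by
    rw [lintegral_add_left measurable_const, lintegral_const, Measure.restrict_apply_univ,
      volume_prod_cube, lintegral_const_mul _ hm]
  rw [key, key, Real.volume_Ico, Real.volume_Ioc, layerMass, sub_zero, sub_sub_cancel]
  exact le_of_eq (by ring)

end Layer

/-! ### Reconstruction bound for coherent germs -/

/-- Quantitative properties of a germ `F` which, averaged at a small scale, is bounded by powers of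
the scale, and changes with the base point like increments of a remainder `r`, of a function `θ`
and of a vector field `n`. The constants `s₁`, `s₂`, `s₃` measure the regularity of `r`, `θ` and
`n`. -/
structure CoherentGerm (T R L α β : ℝ) (F r : SpaceTime d → SpaceTime d → ℝ)
    (θ : SpaceTime d → ℝ) (n : SpaceTime d → Space d) (c₁ c₂ c₃ : ℝ≥0) (s₁ s₂ s₃ : ℝ≥0∞) : Prop where
  size : ∀ lam, 0 < lam → 4 * lam < 1 → ∀ x ∈ Icc 0 T ×ˢ cube d, ∀ w, pnorm (w - x) ≤ 2 * lam →
    ‖germAverage F lam x w‖ₑ ≤ c₁ * lengthPow lam (α - 2) + c₂ * lengthPow lam (2 * α - 2)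
      + c₃ * lengthPow lam (α - 1) * ‖n x‖ₑ
  coherence : ∀ lam, 0 < lam → 4 * lam < 1 → ∀ h, pnorm h ≤ 2 * lam → ∀ x ∈ shiftDomain T h,
    ‖germAverage F lam x (x + h) - germAverage F lam (x + h) (x + h)‖ₑ ≤
      c₁ * lengthPow lam (α - 2) * ‖r x (x + h)‖ₑ
      + (c₂ * lengthPow lam (2 * α - 2) * ‖θ (x + h) - θ x‖ₑ
      + c₃ * lengthPow lam (α - 1) *
        (‖n (x + h) - n x‖ₑ + ‖n x‖ₑ * ‖θ (x + h) - θ x‖ₑ))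
  remainder_le : ∀ l ≤ R, ∀ h, pnorm h ≤ l →
    ∫⁻ x in shiftDomain T h, ‖r x (x + h)‖ₑ ≤ lengthPow l β * s₁
  theta_le : ∀ l ≤ R, ∀ h, pnorm h ≤ l →
    ∫⁻ x in shiftDomain T h, ‖θ (x + h) - θ x‖ₑ ≤ lengthPow l α * s₂
  field_le : ∀ l ≤ R, ∀ h, pnorm h ≤ l →
    ∫⁻ x in shiftDomain T h, ‖n (x + h) - n x‖ₑ ≤ lengthPow l (β - 1) * s₃
  theta_continuous : Continuous θ
  field_continuous : Continuous n
  field_periodic : SpacePeriodic n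
  theta_bound : ∀ x, |θ x| ≤ L

namespace CoherentGerm

variable {T R L α β : ℝ} {F r : SpaceTime d → SpaceTime d → ℝ} {θ : SpaceTime d → ℝ}
  {n : SpaceTime d → Space d} {c₁ c₂ c₃ : ℝ≥0} {s₁ s₂ s₃ : ℝ≥0∞}

/-- The product of the field and of an increment of a bounded function: the increment is controlled
in `L²` by interpolation between `L¹` and `L^∞`. -/
lemma lintegral_field_mul_le (hF : CoherentGerm T R L α β F r θ n c₁ c₂ c₃ s₁ s₂ s₃) {l : ℝ}
    (hl : 0 < l) (hlR : l ≤ R) {h : SpaceTime d} (hh : pnorm h ≤ l) :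
    ∫⁻ x in shiftDomain T h, ‖n x‖ₑ * ‖θ (x + h) - θ x‖ₑ ≤
      (∫⁻ x in Icc 0 T ×ˢ cube d, ‖n x‖ₑ ^ (2 : ℝ)) ^ (1 / 2 : ℝ) *
        (ENNReal.ofReal (2 * L) ^ (1 / 2 : ℝ) * (lengthPow l (α / 2) * s₂ ^ (1 / 2 : ℝ))) := by
  have hm1 : Measurable fun x => ‖n x‖ₑ := hF.field_continuous.enorm.measurable
  have hm2 : Measurable fun x => ‖θ (x + h) - θ x‖ₑ :=
    ((hF.theta_continuous.comp (continuous_add_const _)).sub hF.theta_continuous).enorm.measurable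
  have hH := ENNReal.lintegral_mul_le_Lp_mul_Lq (volume.restrict (shiftDomain T h))
    (p := 2) (q := 2) Real.HolderConjugate.two_two hm1.aemeasurable hm2.aemeasurable
  refine hH.trans (mul_le_mul' ?_ ?_)
  · exact ENNReal.rpow_le_rpow (lintegral_mono_set (shiftDomain_subset T h)) (by norm_num)
  · have hsq : ∀ x, ‖θ (x + h) - θ x‖ₑ ^ (2 : ℝ) ≤
        ENNReal.ofReal (2 * L) * ‖θ (x + h) - θ x‖ₑ := by
      intro x
      have e : ‖θ (x + h) - θ x‖ₑ ^ (2 : ℝ) = ‖θ (x + h) - θ x‖ₑ * ‖θ (x + h) - θ x‖ₑ := by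
        rw [← pow_two, ← ENNReal.rpow_natCast]; norm_num
      rw [e]
      gcongr
      rw [← ofReal_norm, Real.norm_eq_abs]
      refine ENNReal.ofReal_le_ofReal ((abs_sub _ _).trans ?_)
      linarith [hF.theta_bound (x + h), hF.theta_bound x]
    calc (∫⁻ x in shiftDomain T h, ‖θ (x + h) - θ x‖ₑ ^ (2 : ℝ)) ^ (1 / 2 : ℝ)
        ≤ (ENNReal.ofReal (2 * L) * (lengthPow l α * s₂)) ^ (1 / 2 : ℝ) := by
          refine ENNReal.rpow_le_rpow ((lintegral_mono hsq).trans ?_) (by norm_num)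
          rw [lintegral_const_mul _ hm2]
          exact mul_le_mul' le_rfl (hF.theta_le l hlR h hh)
      _ = _ := by
          rw [ENNReal.mul_rpow_of_nonneg _ _ (by norm_num),
            ENNReal.mul_rpow_of_nonneg _ _ (by norm_num), lengthPow_rpow hl, mul_one_div]

/-- The cost of a change of base point, integrated over the torus. -/
lemma lintegral_coherence_le (hF : CoherentGerm T R L α β F r θ n c₁ c₂ c₃ s₁ s₂ s₃) {lam : ℝ}
    (hl : 0 < lam) (hl1 : 4 * lam < 1) (hlR : 2 * lam ≤ R) {h : SpaceTime d}
    (hh : pnorm h ≤ 2 * lam) :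
    ∫⁻ x in shiftDomain T h,
      ‖germAverage F lam x (x + h) - germAverage F lam (x + h) (x + h)‖ₑ ≤
      c₁ * lengthPow lam (α - 2) * (lengthPow (2 * lam) β * s₁)
      + (c₂ * lengthPow lam (2 * α - 2) * (lengthPow (2 * lam) α * s₂)
      + c₃ * lengthPow lam (α - 1) * (lengthPow (2 * lam) (β - 1) * s₃ +
        (∫⁻ x in Icc 0 T ×ˢ cube d, ‖n x‖ₑ ^ (2 : ℝ)) ^ (1 / 2 : ℝ) *
        (ENNReal.ofReal (2 * L) ^ (1 / 2 : ℝ) *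
          (lengthPow (2 * lam) (α / 2) * s₂ ^ (1 / 2 : ℝ))))) := by
  have hm1 : Measurable fun x => ‖n x‖ₑ := hF.field_continuous.enorm.measurable
  have hm2 : Measurable fun x => ‖θ (x + h) - θ x‖ₑ :=
    ((hF.theta_continuous.comp (continuous_add_const _)).sub hF.theta_continuous).enorm.measurable
  have hm3 : Measurable fun x => ‖n (x + h) - n x‖ₑ :=
    ((hF.field_continuous.comp (continuous_add_const _)).sub hF.field_continuous).enorm.measurable
  have hsplit : ∀ (μ : Measure (SpaceTime d)) (k₁ k₂ k₃ : ℝ≥0∞) (f₁ f₂ f₃ f₄ : SpaceTime d → ℝ≥0∞),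
      k₁ ≠ ∞ → Measurable f₂ → Measurable f₃ → Measurable f₄ →
      ∫⁻ x, (k₁ * f₁ x + (k₂ * f₂ x + k₃ * (f₃ x + f₄ x))) ∂μ =
        k₁ * (∫⁻ x, f₁ x ∂μ) + (k₂ * (∫⁻ x, f₂ x ∂μ) +
          k₃ * ((∫⁻ x, f₃ x ∂μ) + ∫⁻ x, f₄ x ∂μ)) := by
    intro μ k₁ k₂ k₃ f₁ f₂ f₃ f₄ hk h₂ h₃ h₄
    have h34 : Measurable fun x => f₃ x + f₄ x := h₃.add h₄
    have h234 : Measurable fun x => k₂ * f₂ x + k₃ * (f₃ x + f₄ x) :=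
      (h₂.const_mul k₂).add (h34.const_mul k₃)
    rw [lintegral_add_right _ h234, lintegral_add_left (h₂.const_mul k₂),
      lintegral_const_mul _ h₂, lintegral_const_mul _ h34, lintegral_add_left h₃,
      lintegral_const_mul' _ _ hk]
  refine (setLIntegral_mono' (measurableSet_shiftDomain T h)
    (hF.coherence lam hl hl1 h hh)).trans ?_
  refine (hsplit _ _ _ _ (fun x => ‖r x (x + h)‖ₑ) _ _ (fun x => ‖n x‖ₑ * ‖θ (x + h) - θ x‖ₑ)
    (ENNReal.mul_ne_top ENNReal.coe_ne_top ENNReal.ofReal_ne_top) hm2 hm3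
    (hm1.mul hm2)).le.trans ?_
  exact add_le_add (mul_le_mul' le_rfl (hF.remainder_le _ hlR h hh))
    (add_le_add (mul_le_mul' le_rfl (hF.theta_le _ hlR h hh)) (mul_le_mul' le_rfl
      (add_le_add (hF.field_le _ hlR h hh) (hF.lintegral_field_mul_le (by positivity) hlR hh))))

/-- The contribution of the boundary layers is estimated by the size of the germ only. The volume of
the layers yields the factor `lengthPow (2 * lam) 2`; the field is left to `layerMass`. -/
lemma lintegral_boundary_le (hF : CoherentGerm T R L α β F r θ n c₁ c₂ c₃ s₁ s₂ s₃) {lam : ℝ}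
    (hl : 0 < lam) (hl1 : 4 * lam < 1) {h k : SpaceTime d} (hh : pnorm h ≤ 2 * lam)
    (hk : pnorm k ≤ 2 * lam) :
    ∫⁻ x in (Icc 0 T ×ˢ cube d) \ shiftDomain T h, ‖germAverage F lam x (x + k)‖ₑ ≤
      (c₁ * lengthPow lam (α - 2) + c₂ * lengthPow lam (2 * α - 2)) *
        (2 * lengthPow (2 * lam) 2) +
      c₃ * lengthPow lam (α - 1) * layerMass T n (2 * lam) := by
  have hD : MeasurableSet ((Icc 0 T ×ˢ cube d) \ shiftDomain T h) :=
    (measurableSet_Icc.prod measurableSet_cube).diff (measurableSet_shiftDomain T h)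
  have e : lengthPow (2 * lam) 2 = ENNReal.ofReal ((2 * lam) ^ 2) := by
    rw [lengthPow]; norm_cast
  rw [e]
  refine ((setLIntegral_mono' hD fun x hx => hF.size lam hl hl1 x hx.1 (x + k)
    (by rw [add_sub_cancel_left]; exact hk)).trans
    (lintegral_diff_shiftDomain_le hh _)).trans ?_
  exact lintegral_layers_add_le hF.field_continuous _ _ _

/-- The contribution of one dyadic scale to the reconstruction bound. -/
lemma increment_le (hF : CoherentGerm T R L α β F r θ n c₁ c₂ c₃ s₁ s₂ s₃) (hα : 0 < α) {l : ℝ}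
    (hl : 0 < l) (hl1 : 2 * l < 1) (hlR : l ≤ R) {h : SpaceTime d} (hh : pnorm h ≤ l) :
    (∫⁻ x in shiftDomain T h,
      ‖germAverage F (l / 2) x (x + h) - germAverage F (l / 2) (x + h) (x + h)‖ₑ) +
    ((∫⁻ x in (Icc 0 T ×ˢ cube d) \ shiftDomain T h, ‖germAverage F (l / 2) x (x + h)‖ₑ) +
      ∫⁻ x in (Icc 0 T ×ˢ cube d) \ shiftDomain T (-h), ‖germAverage F (l / 2) x (x + 0)‖ₑ) ≤
    4 * c₁ * (lengthPow l (α - 2 + β) * s₁ + 4 * lengthPow l α)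
    + 4 * c₂ * (lengthPow l (3 * α - 2) * s₂ + 4 * lengthPow l (2 * α))
    + 4 * c₃ * (lengthPow l (α + β - 2) * s₃ + lengthPow l (3 * α / 2 - 1) *
        (ENNReal.ofReal (2 * L) ^ (1 / 2 : ℝ) * (s₂ ^ (1 / 2 : ℝ) *
          (∫⁻ x in Icc 0 T ×ˢ cube d, ‖n x‖ₑ ^ (2 : ℝ)) ^ (1 / 2 : ℝ)))
      + 2 * (lengthPow l (α - 1) * layerMass T n l)) := by
  have h2 : 2 * (l / 2) = l := by ring
  have hp0 : pnorm (0 : SpaceTime d) ≤ 2 * (l / 2) := by rw [pnorm_zero]; positivity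
  have hh' : pnorm h ≤ 2 * (l / 2) := h2.symm ▸ hh
  have b1 := hF.lintegral_coherence_le (lam := l / 2) (by positivity) (by linarith)
    (h2.symm ▸ hlR) hh'
  have b2 := hF.lintegral_boundary_le (lam := l / 2) (by positivity) (by linarith) hh' hh'
  have b3 := hF.lintegral_boundary_le (lam := l / 2) (h := -h) (by positivity) (by linarith)
    (by rw [pnorm_neg]; exact hh') hp0
  rw [h2] at b1 b2 b3
  set N₂ := (∫⁻ x in Icc 0 T ×ˢ cube d, ‖n x‖ₑ ^ (2 : ℝ)) ^ (1 / 2 : ℝ)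
  set L₂ := ENNReal.ofReal (2 * L) ^ (1 / 2 : ℝ)
  set S₂ := s₂ ^ (1 / 2 : ℝ)
  have e1 := lengthPow_half_le hl.le (s := α - 2) (by linarith)
  have e2 := lengthPow_half_le hl.le (s := 2 * α - 2) (by linarith)
  have e3 := lengthPow_half_le hl.le (s := α - 1) (by linarith)
  have hmul := lengthPow_mul_lengthPow hl
  refine (add_le_add b1 (add_le_add b2 b3)).trans ?_
  calc _ ≤ c₁ * (4 * lengthPow l (α - 2)) * (lengthPow l β * s₁)
      + (c₂ * (4 * lengthPow l (2 * α - 2)) * (lengthPow l α * s₂)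
      + c₃ * (4 * lengthPow l (α - 1)) * (lengthPow l (β - 1) * s₃ +
        N₂ * (L₂ * (lengthPow l (α / 2) * S₂)))) +
      (((c₁ * (4 * lengthPow l (α - 2)) + c₂ * (4 * lengthPow l (2 * α - 2))) *
          (2 * lengthPow l 2) + c₃ * (4 * lengthPow l (α - 1)) * layerMass T n l) +
      ((c₁ * (4 * lengthPow l (α - 2)) + c₂ * (4 * lengthPow l (2 * α - 2))) *
          (2 * lengthPow l 2) + c₃ * (4 * lengthPow l (α - 1)) * layerMass T n l)) := by
        gcongr
    _ = 4 * c₁ * (lengthPow l (α - 2) * lengthPow l β * s₁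
          + 4 * (lengthPow l (α - 2) * lengthPow l 2))
        + 4 * c₂ * (lengthPow l (2 * α - 2) * lengthPow l α * s₂
          + 4 * (lengthPow l (2 * α - 2) * lengthPow l 2))
        + 4 * c₃ * (lengthPow l (α - 1) * lengthPow l (β - 1) * s₃
          + lengthPow l (α - 1) * lengthPow l (α / 2) * (L₂ * (S₂ * N₂))
          + 2 * (lengthPow l (α - 1) * layerMass T n l)) := by ring
    _ = _ := by
        rw [hmul, hmul, hmul, hmul, hmul, hmul]
        congr! 4 <;> ring_nf

/-- The masses of the boundary layers, weighted with powers of the scale, are summable although the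
powers are negative: the mass of a layer halves when its width is divided by four. -/
lemma tsum_layerMass_le (hF : CoherentGerm T R L α β F r θ n c₁ c₂ c₃ s₁ s₂ s₃)
    {μ : ℝ} (hμ : 0 < μ) (hμ1 : μ ≤ 1) (hμT : μ ^ 2 ≤ T) (hμR : μ ≤ R) (hs : 0 ≤ α + β - 2) :
    ∑' k, lengthPow (scale μ k) (α - 1) * layerMass T n (scale μ k) ≤
      geomSum α * (lengthPow μ (α - 1) * layerMass T n μ + geomSum (α + β - 2) * s₃) := by
  have hstep : ∀ k, lengthPow (scale μ (k + 1)) (α - 1) * layerMass T n (scale μ (k + 1)) ≤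
      lengthPow 2 (-α) * (lengthPow (scale μ k) (α - 1) * layerMass T n (scale μ k)) +
        lengthPow (scale μ (k + 1)) (α + β - 2) * s₃ := by
    intro k
    have hl := scale_pos hμ (k + 1)
    have hl' := scale_pos hμ k
    have h2 : 2 * scale μ (k + 1) = scale μ k := by rw [scale_succ]; ring
    have hle := two_mul_layerMass_le hF.field_continuous hF.field_periodic hl.le
      (by rw [h2]; exact (pow_le_pow_left₀ hl'.le (scale_le hμ k) 2).trans hμT)
      (hF.field_le (scale μ (k + 1)) ((scale_le hμ _).trans hμR))
    rw [h2] at hle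
    -- the weight grows by `2 ^ (1 - α)` and the mass halves, which is the ratio `2 ^ (-α)`
    have e1 : lengthPow (scale μ (k + 1)) (α - 1) =
        2 * lengthPow 2 (-α) * lengthPow (scale μ k) (α - 1) := by
      rw [scale_succ, lengthPow_half hl'.le]
      congr 1
      have : (2 : ℝ≥0∞) = lengthPow 2 1 := by simp [lengthPow]
      rw [this, lengthPow_mul_lengthPow two_pos]
      congr 1
      ring
    have e2 : lengthPow (scale μ (k + 1)) (α + β - 2) =
        lengthPow (scale μ (k + 1)) (α - 1) * lengthPow (scale μ (k + 1)) (β - 1) := by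
      rw [lengthPow_mul_lengthPow hl]
      congr 1
      ring
    refine (ENNReal.mul_le_mul_iff_right two_ne_zero ENNReal.ofNat_ne_top).1 ?_
    calc 2 * (lengthPow (scale μ (k + 1)) (α - 1) * layerMass T n (scale μ (k + 1)))
        = lengthPow (scale μ (k + 1)) (α - 1) * (2 * layerMass T n (scale μ (k + 1))) := by ring
      _ ≤ lengthPow (scale μ (k + 1)) (α - 1) * (layerMass T n (scale μ k) +
          2 * (lengthPow (scale μ (k + 1)) (β - 1) * s₃)) := by gcongr
      _ = lengthPow (scale μ (k + 1)) (α - 1) * layerMass T n (scale μ k) +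
          2 * (lengthPow (scale μ (k + 1)) (α + β - 2) * s₃) := by rw [e2]; ring
      _ = _ := by nth_rw 1 [e1]; ring
  refine (tsum_le_of_contraction hstep).trans ?_
  have h0 : scale μ 0 = μ := by simp [scale]
  rw [h0, ENNReal.tsum_mul_right]
  refine mul_le_mul' le_rfl (add_le_add le_rfl (mul_le_mul' ?_ le_rfl))
  calc ∑' k, lengthPow (scale μ (k + 1)) (α + β - 2)
      ≤ ∑' k, lengthPow (scale μ k) (α + β - 2) := by
        rw [tsum_eq_zero_add' (f := fun k => lengthPow (scale μ k) (α + β - 2)) ENNReal.summable]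
        exact le_add_self
    _ = lengthPow μ (α + β - 2) * geomSum (α + β - 2) := tsum_lengthPow_scale hμ _
    _ ≤ 1 * geomSum (α + β - 2) := mul_le_mul' (lengthPow_le_one hμ.le hμ1 hs) le_rfl
    _ = _ := one_mul _

/-- The sum over all dyadic scales of the bounds in `increment_le`. -/
lemma tsum_increment_le (hF : CoherentGerm T R L α β F r θ n c₁ c₂ c₃ s₁ s₂ s₃) {μ : ℝ}
    (hα : 2 / 3 < α) (hβ : 2 - α < β) (hμ : 0 < μ) (hμ1 : μ ≤ 1) (hμT : μ ^ 2 ≤ T)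
    (hμR : μ ≤ R) (N : ℝ≥0∞) :
    ∑' k, (4 * c₁ * (lengthPow (scale μ k) (α - 2 + β) * s₁ + 4 * lengthPow (scale μ k) α)
      + 4 * c₂ * (lengthPow (scale μ k) (3 * α - 2) * s₂ + 4 * lengthPow (scale μ k) (2 * α))
      + 4 * c₃ * (lengthPow (scale μ k) (α + β - 2) * s₃ + lengthPow (scale μ k) (3 * α / 2 - 1) * N
        + 2 * (lengthPow (scale μ k) (α - 1) * layerMass T n (scale μ k)))) ≤
    4 * c₁ * (geomSum (α - 2 + β) * s₁ + 4 * (lengthPow μ α * geomSum α))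
    + 4 * c₂ * (geomSum (3 * α - 2) * s₂ + 4 * (lengthPow μ (2 * α) * geomSum (2 * α)))
    + 4 * c₃ * (geomSum (α + β - 2) * s₃ + geomSum (3 * α / 2 - 1) * N
      + 2 * (geomSum α * (lengthPow μ (α - 1) * layerMass T n μ + geomSum (α + β - 2) * s₃))) := by
  have hsum : ∀ s : ℝ, 0 ≤ s → ∑' k, lengthPow (scale μ k) s ≤ geomSum s := fun s hs => by
    rw [tsum_lengthPow_scale hμ]
    exact (mul_le_mul' (lengthPow_le_one hμ.le hμ1 hs) le_rfl).trans (one_mul _).le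
  simp only [ENNReal.tsum_add, ENNReal.tsum_mul_left, ENNReal.tsum_mul_right]
  rw [tsum_lengthPow_scale hμ α, tsum_lengthPow_scale hμ (2 * α)]
  have hlayer := hF.tsum_layerMass_le hμ hμ1 hμT hμR (by linarith)
  gcongr
  · exact hsum _ (by linarith)
  · exact hsum _ (by linarith)
  · exact hsum _ (by linarith)
  · exact hsum _ (by linarith)

end CoherentGerm

/-- Bound on the integral of a coherent germ along the diagonal. -/
theorem exists_reconstruction_bound {α β κ L : ℝ} (hα : 2 / 3 < α) (hβ : 2 - α < β)
    (hκ : 0 < κ) :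
    ∃ K : ℝ≥0, ∀ T R : ℝ, 0 < T → T ≤ 1 → κ * √T ≤ R →
      ∀ (d : ℕ) (F r : SpaceTime d → SpaceTime d → ℝ) (B : ℝ → ℝ) (θ : SpaceTime d → ℝ)
        (n : SpaceTime d → Space d) (c₁ c₂ c₃ : ℝ≥0) (s₁ s₂ s₃ : ℝ≥0∞),
        GermRegular F B → CoherentGerm T R L α β F r θ n c₁ c₂ c₃ s₁ s₂ s₃ →
        ‖∫ x in Icc 0 T ×ˢ cube d, F x x‖ₑ ≤ K *
          (c₁ * (s₁ + lengthPow (√T) α) + c₂ * (s₂ + lengthPow (√T) (2 * α))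
          + c₃ * (s₃ + s₂ ^ (1 / 2 : ℝ) *
              (∫⁻ x in Icc 0 T ×ˢ cube d, ‖n x‖ₑ ^ (2 : ℝ)) ^ (1 / 2 : ℝ)
            + (∫⁻ x in Icc 0 T ×ˢ cube d, ‖n x‖ₑ) * lengthPow (√T) (α - 1))) := by
  -- the largest scale is a small multiple of `√T`
  set c := min κ 1 / 8 with hc
  have hc0 : 0 < c := by positivity
  have hc1 : c ≤ 1 / 8 := by rw [hc]; linarith [min_le_right κ 1]
  have hcκ : c ≤ κ := by
    rw [hc]; linarith [min_le_left κ 1, show 0 < min κ 1 by positivity]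
  set k₁ := 12 * geomSum (α - 2 + β) with hk₁
  set k₂ := lengthPow (c / 2) (α - 2) + 48 * geomSum α with hk₂
  set k₃ := 12 * geomSum (3 * α - 2) with hk₃
  set k₄ := lengthPow (c / 2) (2 * α - 2) + 48 * geomSum (2 * α) with hk₄
  set k₅ := 12 * geomSum (α + β - 2) + 24 * geomSum α * geomSum (α + β - 2) with hk₅
  set k₆ := 12 * geomSum (3 * α / 2 - 1) * ENNReal.ofReal (2 * L) ^ (1 / 2 : ℝ) with hk₆
  set k₇ := lengthPow (c / 2) (α - 1) + 48 * geomSum α * lengthPow c (α - 1) with hk₇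
  set K := k₁ ⊔ k₂ ⊔ k₃ ⊔ k₄ ⊔ k₅ ⊔ k₆ ⊔ k₇ with hK
  have hKtop : K ≠ ∞ := by
    have g1 := geomSum_ne_top (s := α - 2 + β) (by linarith)
    have g2 := geomSum_ne_top (s := α) (by linarith)
    have g3 := geomSum_ne_top (s := 3 * α - 2) (by linarith)
    have g4 := geomSum_ne_top (s := 2 * α) (by linarith)
    have g5 := geomSum_ne_top (s := α + β - 2) (by linarith)
    have g6 := geomSum_ne_top (s := 3 * α / 2 - 1) (by linarith)
    have hl : ∀ l s : ℝ, lengthPow l s ≠ ∞ := fun _ _ => ENNReal.ofReal_ne_top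
    have hL : ENNReal.ofReal (2 * L) ^ (1 / 2 : ℝ) ≠ ∞ :=
      ENNReal.rpow_ne_top_of_nonneg (by norm_num) ENNReal.ofReal_ne_top
    have n1 : (12 : ℝ≥0∞) ≠ ∞ := ENNReal.ofNat_ne_top
    have n2 : (24 : ℝ≥0∞) ≠ ∞ := ENNReal.ofNat_ne_top
    have n3 : (48 : ℝ≥0∞) ≠ ∞ := ENNReal.ofNat_ne_top
    rw [hK, ← lt_top_iff_ne_top]
    simp only [sup_lt_iff]
    refine ⟨⟨⟨⟨⟨⟨?_, ?_⟩, ?_⟩, ?_⟩, ?_⟩, ?_⟩, ?_⟩ <;>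
      simp only [lt_top_iff_ne_top, hk₁, hk₂, hk₃, hk₄, hk₅, hk₆, hk₇, ne_eq, ENNReal.add_eq_top,
        ENNReal.mul_eq_top, hl, g1, g2, g3, g4, g5, g6, hL, n1, n2, n3,
        and_false, false_and, or_self, not_false_eq_true]
  refine ⟨K.toNNReal, fun T R hT hT1 hR d F r B θ n c₁ c₂ c₃ s₁ s₂ s₃ hreg hF => ?_⟩
  rw [ENNReal.coe_toNNReal hKtop]
  have hτ : 0 < √T := Real.sqrt_pos.2 hT
  have hτ1 : √T ≤ 1 := Real.sqrt_le_one.2 hT1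
  set μ := c * √T with hμdef
  have hμ : 0 < μ := by positivity
  have hμτ : μ ≤ √T := by rw [hμdef]; nlinarith
  have hμ8 : μ ≤ 1 / 8 := by rw [hμdef]; nlinarith
  have hμR : μ ≤ R := (mul_le_mul_of_nonneg_right hcκ hτ.le).trans hR
  have hμT : μ ^ 2 ≤ T := by
    calc μ ^ 2 ≤ (√T) ^ 2 := pow_le_pow_left₀ hμ.le hμτ 2
      _ = T := Real.sq_sqrt hT.le
  set N₂ := (∫⁻ x in Icc 0 T ×ˢ cube d, ‖n x‖ₑ ^ (2 : ℝ)) ^ (1 / 2 : ℝ)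
  set N₁ := ∫⁻ x in Icc 0 T ×ˢ cube d, ‖n x‖ₑ
  set L₂ := ENNReal.ofReal (2 * L) ^ (1 / 2 : ℝ)
  set S₂ := s₂ ^ (1 / 2 : ℝ)
  set P₁ := lengthPow (√T) α
  set P₂ := lengthPow (√T) (2 * α)
  set P₃ := lengthPow (√T) (α - 1)
  -- the average at the largest scale
  have hs1 : scale μ 1 = c / 2 * √T := by rw [scale, pow_one, hμdef]; ring
  have htop : ∫⁻ x in Icc 0 T ×ˢ cube d, ‖germAverage F (scale μ 1) x (x + 0)‖ₑ ≤
      c₁ * (lengthPow (c / 2) (α - 2) * P₁) + c₂ * (lengthPow (c / 2) (2 * α - 2) * P₂)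
        + c₃ * (lengthPow (c / 2) (α - 1) * P₃) * N₁ := by
    have hvol : ∀ s : ℝ, lengthPow (c / 2 * √T) s * ENNReal.ofReal T =
        lengthPow (c / 2) s * lengthPow (√T) (s + 2) := fun s => by
      have : ENNReal.ofReal T = lengthPow (√T) 2 := by
        rw [lengthPow]
        norm_cast
        rw [Real.sq_sqrt hT.le]
      rw [mul_lengthPow hτ.le (by positivity), this, mul_assoc, lengthPow_mul_lengthPow hτ]
    refine (setLIntegral_mono' (measurableSet_Icc.prod measurableSet_cube) fun x hx =>
      hF.size (scale μ 1) (scale_pos hμ 1) (by linarith [scale_le hμ 1]) x hx (x + 0)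
        (by rw [add_zero, sub_self, pnorm_zero]; linarith [scale_pos hμ 1])).trans ?_
    rw [lintegral_add_left measurable_const, lintegral_const, Measure.restrict_apply_univ,
      volume_prod_cube, Real.volume_Icc, sub_zero,
      lintegral_const_mul _ hF.field_continuous.enorm.measurable, hs1, add_mul, mul_assoc, hvol,
      mul_assoc (c₂ : ℝ≥0∞), hvol, sub_add_cancel, sub_add_cancel,
      mul_lengthPow hτ.le (by positivity)]
  -- the increments between consecutive scales
  have hrec := hreg.enorm_integral_diagonal_le hT1 hμ (by linarith) _ fun k h hh => by
    rw [scale_succ]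
    exact hF.increment_le (by linarith) (scale_pos hμ k) (by linarith [scale_le hμ k])
      ((scale_le hμ k).trans hμR) hh
  have hinc := hF.tsum_increment_le hα hβ hμ (by linarith) hμT hμR (L₂ * (S₂ * N₂))
  refine (hrec.trans (add_le_add htop (mul_le_mul' le_rfl hinc))).trans ?_
  have q1 : lengthPow μ α ≤ P₁ := lengthPow_mono hμ.le hμτ (by linarith)
  have q2 : lengthPow μ (2 * α) ≤ P₂ := lengthPow_mono hμ.le hμτ (by linarith)
  have q3 : lengthPow μ (α - 1) = lengthPow c (α - 1) * P₃ := mul_lengthPow hτ.le hc0.le _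
  have q4 : layerMass T n μ ≤ 2 * N₁ := layerMass_le hμT
  have j1 : k₁ ≤ K := by simp only [hK, le_sup_iff, le_refl, true_or]
  have j2 : k₂ ≤ K := by simp only [hK, le_sup_iff, le_refl, true_or, or_true]
  have j3 : k₃ ≤ K := by simp only [hK, le_sup_iff, le_refl, true_or, or_true]
  have j4 : k₄ ≤ K := by simp only [hK, le_sup_iff, le_refl, true_or, or_true]
  have j5 : k₅ ≤ K := by simp only [hK, le_sup_iff, le_refl, true_or, or_true]
  have j6 : k₆ ≤ K := by simp only [hK, le_sup_iff, le_refl, true_or, or_true]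
  have j7 : k₇ ≤ K := by simp only [hK, le_sup_iff, le_refl, or_true]
  calc _ ≤ c₁ * (lengthPow (c / 2) (α - 2) * P₁) + c₂ * (lengthPow (c / 2) (2 * α - 2) * P₂)
        + c₃ * (lengthPow (c / 2) (α - 1) * P₃) * N₁ +
        3 * (4 * c₁ * (geomSum (α - 2 + β) * s₁ + 4 * (P₁ * geomSum α))
        + 4 * c₂ * (geomSum (3 * α - 2) * s₂ + 4 * (P₂ * geomSum (2 * α)))
        + 4 * c₃ * (geomSum (α + β - 2) * s₃ + geomSum (3 * α / 2 - 1) * (L₂ * (S₂ * N₂))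
          + 2 * (geomSum α * (lengthPow c (α - 1) * P₃ * (2 * N₁) +
            geomSum (α + β - 2) * s₃)))) := by
        rw [q3]
        gcongr
    _ = c₁ * (k₁ * s₁ + k₂ * P₁) + c₂ * (k₃ * s₂ + k₄ * P₂)
        + c₃ * (k₅ * s₃ + k₆ * (S₂ * N₂) + k₇ * (N₁ * P₃)) := by
        rw [hk₁, hk₂, hk₃, hk₄, hk₅, hk₆, hk₇]; ring
    _ ≤ c₁ * (K * s₁ + K * P₁) + c₂ * (K * s₂ + K * P₂)
        + c₃ * (K * s₃ + K * (S₂ * N₂) + K * (N₁ * P₃)) := by gcongr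
    _ = _ := by ring

/-! ### The germ of a solution -/

/-- The gradient part `ν` of the solution, cut off outside the support of `σ` by means of the
truncation, and extended to all times. -/
noncomputable def truncatedNu (T : ℝ) (a σ Θ : ℝ → ℝ) (ξ u : SpaceTime d → ℝ) (z : SpaceTime d) :
    Space d :=
  deriv Θ (extend T u z) • extendNu T a σ ξ u z

/-- A seminorm bounds the increments at all distances `l ≤ R`. Vanishing increments, over which the
seminorm does not range, are trivial. -/
lemma lintegral_shiftDomain_le_iSup {Φ : SpaceTime d → SpaceTime d → ℝ≥0∞} (h0 : ∀ x, Φ 0 x = 0)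
    {T R γ l : ℝ} (hγ : 0 ≤ γ) (hlR : l ≤ R) {h : SpaceTime d} (hh : pnorm h ≤ l) :
    ∫⁻ x in shiftDomain T h, Φ h x ≤ lengthPow l γ *
      ⨆ (y : SpaceTime d) (_ : 0 < pnorm y ∧ pnorm y ≤ R),
        ENNReal.ofReal (pnorm y ^ (-γ)) * ∫⁻ x in shiftDomain T y, Φ y x := by
  rcases (pnorm_nonneg h).eq_or_lt with h1 | h1
  · rw [eq_zero_of_pnorm_nonpos h1.symm.le]
    simp [h0]
  · have e : ∫⁻ x in shiftDomain T h, Φ h x = lengthPow (pnorm h) γ *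
        (ENNReal.ofReal (pnorm h ^ (-γ)) * ∫⁻ x in shiftDomain T h, Φ h x) := by
      rw [← mul_assoc]
      change _ = lengthPow (pnorm h) γ * lengthPow (pnorm h) (-γ) * _
      rw [lengthPow_mul_lengthPow h1, add_neg_cancel, lengthPow, Real.rpow_zero,
        ENNReal.ofReal_one, one_mul]
    rw [e]
    exact mul_le_mul' (lengthPow_mono h1.le hh hγ)
      (le_iSup₂_of_le h ⟨h1, hh.trans hlR⟩ le_rfl)

/-- The model bounds on the box apply to all points close to the torus. -/
lemma mem_box_of_norm_le {T : ℝ} (hT : T ≤ 1) {x h : SpaceTime d} (hx : x ∈ Icc 0 T ×ˢ cube d)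
    (hh : pnorm h ≤ 1) : x + h ∈ box d := by
  have h1 := abs_le.1 (GermRegular.abs_fst_le_one hh)
  refine ⟨⟨?_, ?_⟩, fun i => ?_⟩
  · rw [Prod.fst_add]; linarith [hx.1.1]
  · rw [Prod.fst_add]; linarith [hx.1.2]
  · have h2 : |h.2 i| ≤ 1 := by
      rw [← Real.norm_eq_abs]
      exact (PiLp.norm_apply_le h.2 i).trans ((norm_snd_le_pnorm h).trans hh)
    have h3 := hx.2 i
    have h4 := abs_le.1 h2
    rw [Prod.snd_add, PiLp.add_apply]
    exact ⟨by linarith [h3.1], by linarith [h3.2]⟩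

section Solution

variable {α β M N p ε C L T R : ℝ} {a σ Θ : ℝ → ℝ} {ξ : SpaceTime d → ℝ} {Cct : ℝ → ℝ}
  {cd cc : ℝ → ℝ → ℝ} {m : ModelConstants} {u₀ : Space d → ℝ} {u : SpaceTime d → ℝ}

lemma IsClassicalSolution.truncatedNu_eq (hu : IsClassicalSolution T a σ ξ Cct u₀ u)
    (ha : ∀ v, 0 < a v) (hξ : ContDiff ℝ ((⊤ : ℕ∞) : WithTop ℕ∞) ξ) (hp : SpacePeriodic ξ)
    {z : SpaceTime d} (hz : z.1 ∈ Icc 0 T) :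
    truncatedNu T a σ Θ ξ u z = deriv Θ (u z) • nu a σ ξ u z := by
  rw [truncatedNu, hu.nu_eq ha hξ hp hz, extendNu, extend_of_mem hz]

lemma IsClassicalSolution.continuous_truncatedNu (hu : IsClassicalSolution T a σ ξ Cct u₀ u)
    (hT : 0 ≤ T) (hNL : Nonlinearities M N C a σ) (hΘ : IsTruncation L σ Θ)
    (hξ : ContDiff ℝ ((⊤ : ℕ∞) : WithTop ℕ∞) ξ) (hp : SpacePeriodic ξ) :
    Continuous (truncatedNu T a σ Θ ξ u) :=
  ((hΘ.smooth.continuous_deriv (by norm_num)).comp (hu.continuous_extend hT)).smul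
    (hu.continuous_extendNu hT hNL.a_contDiff.continuous hNL.sigma_contDiff.continuous hξ hp)

lemma IsClassicalSolution.truncatedNu_periodic (hu : IsClassicalSolution T a σ ξ Cct u₀ u)
    (hT : 0 ≤ T) (hp : SpacePeriodic ξ) : SpacePeriodic (truncatedNu T a σ Θ ξ u) := fun k z => by
  rw [truncatedNu, hu.extend_periodic hT, hu.extendNu_periodic hT hp, truncatedNu]

end Solution

/-- The germ of a solution is coherent, with regularity measured by the seminorms of the statement.
-/
lemma exists_coherentGerm (d : ℕ) {α β M N p ε C : ℝ} (hα : 0 ≤ α) (hβ : 1 ≤ β) (hM : 1 < M)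
    (hM2 : M < 2) (hN : M + 1 ≤ N) (hp1 : 1 < p) (hε : 0 < ε) (hε' : ε ≤ 1) (hC : 0 < C) :
    ∃ A : ℝ≥0, ∀ (L T R : ℝ) (a σ Θ : ℝ → ℝ) (ξ : SpaceTime d → ℝ) (Cct : ℝ → ℝ)
      (cd cc : ℝ → ℝ → ℝ) (m : ModelConstants) (u₀ : Space d → ℝ) (u : SpaceTime d → ℝ),
      0 < T → T ≤ 1 → Nonlinearities M N C a σ → IsTruncation L σ Θ →
      ContDiff ℝ ((⊤ : ℕ∞) : WithTop ℕ∞) ξ → SpacePeriodic ξ → CountertermRegular cd →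
      CountertermRegular cc → ModelBounds α ε a σ ξ cd cc m →
      IsClassicalSolution T a σ ξ Cct u₀ u →
      CoherentGerm T R L α β
        (germ p a σ ξ cd cc (extend T u) (truncatedNu T a σ Θ ξ u))
        (remainder p a σ ξ (extend T u) (truncatedNu T a σ Θ ξ u))
        (fun z => Θ (extend T u z)) (truncatedNu T a σ Θ ξ u)
        (A * m.noise) (A * (m.dumb + m.cherry)) (A * (m.xnoise + m.lolly))
        (modelled T R β a σ ξ u (fun v => g p v * σ v))
        (besov T R α (fun x => Θ (u x)))
        (besov T R (β - 1) (fun x => deriv Θ (u x) • nu a σ ξ u x)) := by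
  obtain ⟨A, hA, h⟩ := exists_germAverage_bounds d (α := α) hM hM2 hN hp1 hε hε' hC
  obtain ⟨K, -, hw⟩ := exists_weightBound hM hM2 hN hp1 hε hε' hC
  lift A to ℝ≥0 using hA.le
  refine ⟨A, ?_⟩
  intro L T R a σ Θ ξ Cct cd cc m u₀ u hT hT1 hNL hΘ hξ hp hcd hcc hm hu
  set U := extend T u
  set n := truncatedNu T a σ Θ ξ u with hn
  obtain ⟨-, -, -, hw4⟩ := hw a σ hNL
  have hmem : ∀ x h : SpaceTime d, x ∈ shiftDomain T h → x.1 ∈ Icc 0 T ∧ (x + h).1 ∈ Icc 0 T :=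
    fun x h hx => ⟨hx.1, hx.2.1⟩
  have hN1 : 1 < N := by linarith
  refine ⟨?_, ?_, ?_, ?_, ?_, ?_, ?_, ?_, ?_⟩
  · intro lam hl hl1 x hx w hxw
    have hb := (h L a σ Θ ξ cd cc m U n hNL hΘ hξ hp hcd hcc hm lam hl hl1).1 x
      (by simpa using mem_box_of_norm_le hT1 hx (h := 0) (by simp)) w hxw
    rw [← NNReal.coe_mul, ← NNReal.coe_add, ← NNReal.coe_mul, ← NNReal.coe_add,
      ← NNReal.coe_mul] at hb
    rw [← ofReal_norm, Real.norm_eq_abs]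
    refine (ENNReal.ofReal_le_ofReal hb).trans (le_of_eq ?_)
    rw [ENNReal.ofReal_add (by positivity) (by positivity),
      ENNReal.ofReal_add (by positivity) (by positivity), ENNReal.ofReal_mul (by positivity),
      ENNReal.ofReal_mul (by positivity), ENNReal.ofReal_mul (by positivity),
      ENNReal.ofReal_mul (by positivity), ofReal_norm, ENNReal.ofReal_coe_nnreal,
      ENNReal.ofReal_coe_nnreal, ENNReal.ofReal_coe_nnreal]
    rfl
  · intro lam hl hl1 y hy x hx
    have hb := (h L a σ Θ ξ cd cc m U n hNL hΘ hξ hp hcd hcc hm lam hl hl1).2 x (x + y)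
      (mem_box_of_norm_le hT1 (shiftDomain_subset T y hx) (hy.trans (by linarith)))
    rw [← NNReal.coe_mul, ← NNReal.coe_add, ← NNReal.coe_mul, ← NNReal.coe_add,
      ← NNReal.coe_mul] at hb
    rw [← ofReal_norm, Real.norm_eq_abs]
    refine (ENNReal.ofReal_le_ofReal hb).trans (le_of_eq ?_)
    rw [ENNReal.ofReal_add (by positivity) (by positivity),
      ENNReal.ofReal_add (by positivity) (by positivity), ENNReal.ofReal_mul (by positivity),
      ENNReal.ofReal_mul (by positivity), ENNReal.ofReal_mul (by positivity),
      ENNReal.ofReal_mul (by positivity), ENNReal.ofReal_mul (by positivity),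
      ENNReal.ofReal_mul (by positivity), ENNReal.ofReal_add (by positivity) (by positivity),
      ENNReal.ofReal_mul (by positivity), ENNReal.ofReal_coe_nnreal,
      ENNReal.ofReal_coe_nnreal, ENNReal.ofReal_coe_nnreal, ofReal_norm, ofReal_norm,
      ← Real.norm_eq_abs, ← Real.norm_eq_abs, ofReal_norm, ofReal_norm, add_assoc]
    rfl
  · intro l hl y hy
    refine le_trans (le_of_eq ?_) (lintegral_shiftDomain_le_iSup
      (Φ := fun y x => ‖g p (u (x + y)) * σ (u (x + y)) - g p (u x) * σ (u x)
        - deriv (fun v => g p v * σ v) (u x) *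
          (σ (u x) * lolly ξ (a (u x)) x (x + y) + inner ℝ (nu a σ ξ u x) y.2)‖ₑ)
      (fun x => by simp [lolly_self]) (by linarith) hl hy)
    refine setLIntegral_congr_fun (measurableSet_shiftDomain T y) fun x hx => ?_
    obtain ⟨h1, h2⟩ := hmem x y hx
    simp only [remainder, U, extend_of_mem h1, extend_of_mem h2, hn,
      hu.truncatedNu_eq hNL.pos hξ hp h1, (hNL.hasDerivAt_gSigma hp1 hN1 (u x)).deriv,
      Prod.snd_add, add_sub_cancel_left, inner_smul_left, conj_trivial]
    -- on the support of the weight the truncation is the identity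
    by_cases hq : gSigmaDeriv p σ (u x) = 0
    · rw [hq, zero_mul, zero_mul]
    · rw [hw4.deriv_truncation hΘ hq, one_mul]
  · intro l hl y hy
    refine le_trans (le_of_eq ?_) (lintegral_shiftDomain_le_iSup
      (Φ := fun y x => ‖Θ (u (x + y)) - Θ (u x)‖ₑ) (fun x => by simp) hα hl hy)
    refine setLIntegral_congr_fun (measurableSet_shiftDomain T y) fun x hx => ?_
    obtain ⟨h1, h2⟩ := hmem x y hx
    simp only [U, extend_of_mem h1, extend_of_mem h2]
  · intro l hl y hy
    refine le_trans (le_of_eq ?_) (lintegral_shiftDomain_le_iSup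
      (Φ := fun y x => ‖deriv Θ (u (x + y)) • nu a σ ξ u (x + y) - deriv Θ (u x) • nu a σ ξ u x‖ₑ)
      (fun x => by simp) (by linarith) hl hy)
    refine setLIntegral_congr_fun (measurableSet_shiftDomain T y) fun x hx => ?_
    obtain ⟨h1, h2⟩ := hmem x y hx
    simp only [hn, hu.truncatedNu_eq hNL.pos hξ hp h1, hu.truncatedNu_eq hNL.pos hξ hp h2]
  · exact hΘ.smooth.continuous.comp (hu.continuous_extend hT.le)
  · exact hu.continuous_truncatedNu hT.le hNL hΘ hξ hp
  · exact hu.truncatedNu_periodic hT.le hp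
  · exact fun x => hΘ.bounded _

/-! ### Counterterms -/

/-- A bound by a function of time, which need not be measurable: it is applied to suprema over
uncountable sets. -/
lemma lintegral_le_of_le_time {T : ℝ} {f : SpaceTime d → ℝ≥0∞} (hf : Measurable f)
    {S : ℝ → ℝ≥0∞} (h : ∀ z, f z ≤ S z.1) :
    ∫⁻ z in Icc 0 T ×ˢ cube d, f z ≤ ∫⁻ t in Ioo 0 T, S t := by
  rw [Measure.volume_eq_prod, ← Measure.prod_restrict, lintegral_prod _ hf.aemeasurable,
    setLIntegral_congr Ioo_ae_eq_Icc]
  refine lintegral_mono fun t => (lintegral_mono fun x => h (t, x)).trans ?_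
  change ∫⁻ _ in cube d, S t ≤ S t
  rw [lintegral_const, Measure.restrict_apply_univ, volume_cube, mul_one]

section Bounds

variable {M N C p : ℝ} {a σ : ℝ → ℝ}

lemma Nonlinearities.gPrime_mul_sigma_le (h : Nonlinearities M N C a σ) (hN : 1 < N) (hp : 1 < p)
    (hC : 0 < C) (v : ℝ) : gPrime p v * |σ v| ≤ C * C ^ (p - 2 + N) := by
  rcases eq_or_ne v 0 with rfl | hv
  · rw [h.sigma_zero (by linarith), abs_zero, mul_zero]
    positivity
  by_cases hs : v ∈ tsupport σ
  · have hvC : |v| ≤ C := abs_le.2 (h.sigma_support hs)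
    have hv0 : 0 < |v| := abs_pos.2 hv
    calc gPrime p v * |σ v| ≤ |v| ^ (p - 2) * (C * |v| ^ N) :=
          mul_le_mul_of_nonneg_left (h.sigma_bound v) (gPrime_nonneg p v)
      _ = C * |v| ^ (p - 2 + N) := by rw [Real.rpow_add hv0]; ring
      _ ≤ C * C ^ (p - 2 + N) := by gcongr; linarith
  · rw [(eq_zero_of_notMem_tsupport hs).1, abs_zero, mul_zero]
    positivity

lemma Nonlinearities.abs_g_mul_le (h : Nonlinearities M N C a σ) (hp : 1 < p)
    (v w : ℝ) : |g p v * (deriv σ v * σ v * w)| ≤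
      C ^ (p - 1) / (p - 1) * |deriv σ v * σ v * w| := by
  have hp' : 0 < p - 1 := by linarith
  by_cases hs : v ∈ tsupport σ
  · have hvC : |v| ≤ C := abs_le.2 (h.sigma_support hs)
    rw [abs_mul, abs_g hp]
    gcongr
  · simp [(eq_zero_of_notMem_tsupport hs).1]

/-- The quotient `σ v ^ 2 / v` is `0` at the origin, and so is the left hand side, where `σ`
vanishes. -/
lemma Nonlinearities.abs_gPrime_mul_le (h : Nonlinearities M N C a σ) (hN : 0 < N) (hp : 1 < p)
    (v w : ℝ) :
    |gPrime p v * σ v ^ 2 * w| ≤ C ^ (p - 1) * |σ v ^ 2 / v * w| := by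
  have hp' : 0 < p - 1 := by linarith
  rcases eq_or_ne v 0 with rfl | hv
  · simp [h.sigma_zero hN]
  by_cases hs : v ∈ tsupport σ
  · have hvC : |v| ≤ C := abs_le.2 (h.sigma_support hs)
    have hv0 : 0 < |v| := abs_pos.2 hv
    have e : gPrime p v * σ v ^ 2 * w = (gPrime p v * v) * (σ v ^ 2 / v * w) := by
      field_simp
    have e2 : |gPrime p v * v| = |v| ^ (p - 1) := by
      rw [abs_mul, abs_of_nonneg (gPrime_nonneg p v), gPrime, ← Real.rpow_add_one hv0.ne']
      congr 1; ring
    rw [e, abs_mul, e2]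
    gcongr
  · simp [(eq_zero_of_notMem_tsupport hs).1]

end Bounds

section Solution

variable {α β M N p ε C C₂ L T R : ℝ} {a σ Θ : ℝ → ℝ} {ξ : SpaceTime d → ℝ} {Cct : ℝ → ℝ}
  {cd cc : ℝ → ℝ → ℝ} {m : ModelConstants} {u₀ : Space d → ℝ} {u : SpaceTime d → ℝ}

/-- The right hand side of the energy inequality is the diagonal of the germ, up to differences of
counterterms. -/
lemma energy_integrand_eq (hξ : ContDiff ℝ ((⊤ : ℕ∞) : WithTop ℕ∞) ξ) (hp : SpacePeriodic ξ)
    (ha0 : ∀ v, 0 < a v) (hΘ : IsTruncation L σ Θ) {e K : ℝ}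
    (hw : WeightBound a σ (fun v => gPrime p v * σ v * a v) e K) (z : SpaceTime d) :
    g p (extend T u z) * reaction T a σ ξ Cct u z -
        gPrime p (extend T u z) * σ (extend T u z) * crossTerm T a σ ξ u z =
      germ p a σ ξ cd cc (extend T u) (truncatedNu T a σ Θ ξ u) z z +
      (gPrime p (extend T u z) * σ (extend T u z) ^ 2 *
          (cd (a (extend T u z)) z.1 - a (extend T u z) * cc (a (extend T u z)) z.1) -
        g p (extend T u z) * (deriv σ (extend T u z) * σ (extend T u z) *
          (Cct (a (extend T u z)) - cd (a (extend T u z)) z.1))) := by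
  have h : gPrime p (extend T u z) * σ (extend T u z) * a (extend T u z) *
      inner ℝ (truncatedNu T a σ Θ ξ u z) (gradPotential ξ (a (extend T u z)) z) =
      gPrime p (extend T u z) * σ (extend T u z) * a (extend T u z) *
      inner ℝ (extendNu T a σ ξ u z) (gradPotential ξ (a (extend T u z)) z) := by
    rw [truncatedNu, inner_smul_left, conj_trivial]
    -- the truncation of `ν` is invisible on the support of the weight
    by_cases hq : gPrime p (extend T u z) * σ (extend T u z) * a (extend T u z) = 0
    · rw [hq, zero_mul, zero_mul]
    · rw [hw.deriv_truncation hΘ hq, one_mul]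
  rw [germ_self hξ hp ha0, reaction, crossTerm, gSigmaDeriv]
  linear_combination (2 : ℝ) * h

/-- The differences of counterterms that remain besides the diagonal of the germ are those
controlled by the assumptions on the noise. -/
lemma IsClassicalSolution.enorm_integral_energy_le (hu : IsClassicalSolution T a σ ξ Cct u₀ u)
    (hT : 0 < T) (hT1 : T ≤ 1) (hC : 0 < C) (hM : 1 < M) (hM2 : M < 2) (hN : M + 1 ≤ N)
    (hp1 : 1 < p) (hε : 0 < ε) (hε' : ε ≤ 1) (hNL : Nonlinearities M N C a σ)
    (hξp : SpacePeriodic ξ) (hno : NoiseAssumption α ε C₂ T a σ ξ Cct cd cc m)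
    (hΘ : IsTruncation L σ Θ) {B : ℝ → ℝ}
    (hreg : GermRegular (germ p a σ ξ cd cc (extend T u) (truncatedNu T a σ Θ ξ u)) B) :
    ENNReal.ofReal (∫ z in Icc 0 T ×ˢ cube d, (g p (extend T u z) * reaction T a σ ξ Cct u z -
        gPrime p (extend T u z) * σ (extend T u z) * crossTerm T a σ ξ u z)) ≤
      ‖∫ z in Icc 0 T ×ˢ cube d,
        germ p a σ ξ cd cc (extend T u) (truncatedNu T a σ Θ ξ u) z z‖ₑ +
      (ENNReal.ofReal (C ^ (p - 1)) + ENNReal.ofReal (C ^ (p - 1) / (p - 1))) *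
        ENNReal.ofReal C₂ := by
  have hp' : 0 < p - 1 := by linarith
  obtain ⟨K, -, hw⟩ := exists_weightBound hM hM2 hN hp1 hε hε' hC
  obtain ⟨-, -, hw3, -⟩ := hw a σ hNL
  have ha0 := hNL.pos
  have haC := hNL.a_contDiff.continuous
  have hσC := hNL.sigma_contDiff.continuous
  have hσ' : Continuous (deriv σ) := hNL.sigma_contDiff.continuous_deriv (by norm_num)
  set U := extend T u with hUdef
  have hU : Continuous U := hu.continuous_extend hT.le
  set D : Set (SpaceTime d) := Icc 0 T ×ˢ cube d with hD
  set F := germ p a σ ξ cd cc U (truncatedNu T a σ Θ ξ u)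
  set E₁ : SpaceTime d → ℝ := fun z => gPrime p (U z) * σ (U z) ^ 2 *
    (cd (a (U z)) z.1 - a (U z) * cc (a (U z)) z.1)
  set E₂ : SpaceTime d → ℝ := fun z => g p (U z) * (deriv σ (U z) * σ (U z) *
    (Cct (a (U z)) - cd (a (U z)) z.1))
  set I : SpaceTime d → ℝ := fun z => g p (U z) * reaction T a σ ξ Cct u z -
    gPrime p (U z) * σ (U z) * crossTerm T a σ ξ u z with hI
  have hIF : ∀ z, I z = F z z + (E₁ z - E₂ z) := fun z =>
    energy_integrand_eq hno.smooth hξp ha0 hΘ hw3 z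
  -- integrability
  have hgP : Measurable (gPrime p) := by unfold gPrime; fun_prop
  have hFi : IntegrableOn (fun z => F z z) D := by
    simpa using hreg.integrableOn_shift hT1 (h := 0) (by simp)
  have hIi : IntegrableOn I D := by
    have hq : Continuous fun v => gPrime p v * σ v := by
      refine (hw3.continuous.div haC fun v => (ha0 v).ne').congr fun v => ?_
      exact mul_div_cancel_right₀ _ (ha0 v).ne'
    exact integrableOn_prod_cube ((((continuous_g hp1).comp hU).mul (hu.continuous_reaction hT.le
      hNL.a_contDiff ha0 hNL.sigma_contDiff hno.smooth.continuous hno.Cct_continuousOn)).sub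
      ((hq.comp hU).mul (hu.continuous_crossTerm hT.le haC hσC hno.smooth hξp))) 0 T
  have hEi : IntegrableOn (fun z => E₁ z - E₂ z) D := by
    refine (hIi.sub hFi).congr (Eventually.of_forall fun z => ?_)
    simp only [Pi.sub_apply, hIF z, add_sub_cancel_left]
  -- measurability of the counterterms
  have hdiag : Measurable fun z : SpaceTime d => (z, z) := measurable_id.prodMk measurable_id
  have hcd : Measurable fun z : SpaceTime d => cd (a (U z)) z.1 :=
    (hno.cd_regular.measurable_comp haC ha0 hU).comp hdiag
  have hcc : Measurable fun z : SpaceTime d => cc (a (U z)) z.1 :=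
    (hno.cc_regular.measurable_comp haC ha0 hU).comp hdiag
  have hCt : Measurable fun z : SpaceTime d => Cct (a (U z)) :=
    (hno.Cct_continuousOn.comp_continuous (haC.comp hU) fun z => ha0 _).measurable
  have hE₁m : Measurable E₁ := ((hgP.comp hU.measurable).mul
    ((hσC.comp hU).measurable.pow_const 2)).mul (hcd.sub ((haC.comp hU).measurable.mul hcc))
  have hE₂m : Measurable E₂ := ((continuous_g hp1).comp hU).measurable.mul
    (((hσ'.comp hU).mul (hσC.comp hU)).measurable.mul (hCt.sub hcd))
  have b₁ : ∫⁻ z in D, ‖E₁ z‖ₑ ≤ ENNReal.ofReal (C ^ (p - 1)) * ENNReal.ofReal C₂ := by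
    refine (lintegral_le_of_le_time hE₁m.enorm (S := fun t => ENNReal.ofReal (C ^ (p - 1)) *
      ⨆ v : ℝ, ENNReal.ofReal |σ v ^ 2 / v * (cd (a v) t - a v * cc (a v) t)|) fun z => ?_).trans ?_
    · rw [← ofReal_norm, Real.norm_eq_abs]
      refine (ENNReal.ofReal_le_ofReal (hNL.abs_gPrime_mul_le (by linarith) hp1 _ _)).trans ?_
      rw [ENNReal.ofReal_mul (by positivity)]
      exact mul_le_mul' le_rfl (le_iSup (fun v : ℝ => ENNReal.ofReal
        |σ v ^ 2 / v * (cd (a v) z.1 - a v * cc (a v) z.1)|) (U z))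
    · rw [lintegral_const_mul' _ _ ENNReal.ofReal_ne_top]
      exact mul_le_mul' le_rfl hno.counterterm_dumb_cherry
  have b₂ : ∫⁻ z in D, ‖E₂ z‖ₑ ≤ ENNReal.ofReal (C ^ (p - 1) / (p - 1)) * ENNReal.ofReal C₂ := by
    refine (lintegral_le_of_le_time hE₂m.enorm
      (S := fun t => ENNReal.ofReal (C ^ (p - 1) / (p - 1)) *
      ⨆ v : ℝ, ENNReal.ofReal |deriv σ v * σ v * (Cct (a v) - cd (a v) t)|) fun z => ?_).trans ?_
    · rw [← ofReal_norm, Real.norm_eq_abs]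
      refine (ENNReal.ofReal_le_ofReal (hNL.abs_g_mul_le hp1 _ _)).trans ?_
      rw [ENNReal.ofReal_mul (by positivity)]
      exact mul_le_mul' le_rfl (le_iSup (fun v : ℝ => ENNReal.ofReal
        |deriv σ v * σ v * (Cct (a v) - cd (a v) z.1)|) (U z))
    · rw [lintegral_const_mul' _ _ ENNReal.ofReal_ne_top]
      exact mul_le_mul' le_rfl hno.counterterm_time_independent
  have e : ∫ z in D, I z = (∫ z in D, F z z) + ∫ z in D, (E₁ z - E₂ z) := by
    rw [← integral_add hFi hEi]
    exact integral_congr_ae (Eventually.of_forall hIF)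
  rw [e]
  refine (Real.ofReal_le_enorm _).trans ((enorm_add_le _ _).trans (add_le_add le_rfl ?_))
  calc ‖∫ z in D, (E₁ z - E₂ z)‖ₑ ≤ ∫⁻ z in D, ‖E₁ z - E₂ z‖ₑ := enorm_integral_le_lintegral_enorm _
    _ ≤ ∫⁻ z in D, (‖E₁ z‖ₑ + ‖E₂ z‖ₑ) := lintegral_mono fun z => enorm_sub_le
    _ = (∫⁻ z in D, ‖E₁ z‖ₑ) + ∫⁻ z in D, ‖E₂ z‖ₑ := lintegral_add_left hE₁m.enorm _
    _ ≤ _ := by rw [add_mul]; exact add_le_add b₁ b₂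

end Solution

end SPM

theorem mainTheorem3 (d : ℕ) (hd : 1 ≤ d)
    (α β M N p ε C₁ C₂ L κ : ℝ)
    (hα : 2 / 3 < α) (hα' : α < 1)
    (hβ : 2 - α < β) (hβ' : β ≤ 2 * α)
    (hM : 1 < M) (hM' : M < 1 + (3 * α - 2) / (α * (2 - α)))
    (hN : M + 1 ≤ N) (hp : 1 < p) (hε : 0 < ε) (hε' : ε ≤ 1)
    (hC₁ : 0 < C₁) (hC₂ : 0 < C₂) (hκ : 0 < κ) :
    ∃ K : ℝ≥0, ∀ T R : ℝ, 0 < T → T ≤ 1 → κ * √T ≤ R →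
      ∀ (a σ Θ : ℝ → ℝ) (ξ : SPM.SpaceTime d → ℝ) (Cct : ℝ → ℝ) (cd cc : ℝ → ℝ → ℝ)
        (n : SPM.ModelConstants) (u₀ : SPM.Space d → ℝ) (u : SPM.SpaceTime d → ℝ),
        SPM.Nonlinearities M N C₁ a σ →
        SPM.NoiseAssumption α ε C₂ T a σ ξ Cct cd cc n →
        SPM.IsTruncation L σ Θ →
        ContDiff ℝ (((⊤ : ℕ∞) : WithTop ℕ∞)) u₀ →
        SPM.IsPeriodic u₀ →
        SPM.IsClassicalSolution T a σ ξ Cct u₀ u →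
        ∫⁻ z in Ioo 0 T ×ˢ SPM.cube d,
            ENNReal.ofReal (|SPM.gPrime p (u z)| * a (u z) * ‖SPM.nu a σ ξ u z‖ ^ 2)
          ≤ K * (eLpNorm u₀ (ENNReal.ofReal p) (volume.restrict (SPM.cube d)) ^ p
              + SPM.energyConstant T R α β p a σ Θ ξ u n + 1) := by
  have hM2 : M < 2 := by
    refine hM'.trans ?_
    -- equivalent to `(α - 1) * (α + 2) < 0`
    have h : (3 * α - 2) / (α * (2 - α)) < 1 := by
      rw [div_lt_one (mul_pos (by linarith) (by linarith))]
      nlinarith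
    linarith
  obtain ⟨A, hA⟩ := SPM.exists_coherentGerm d (α := α) (β := β) (by linarith) (by linarith) hM hM2
    hN hp hε hε' hC₁
  obtain ⟨Kr, hKr⟩ := SPM.exists_reconstruction_bound (L := L) hα hβ hκ
  obtain ⟨Kw, -, hw⟩ := SPM.exists_weightBound hM hM2 hN hp hε hε' hC₁
  set k : ℝ≥0 := Real.toNNReal (2 * SPM.growthConst p) with hk
  set k' : ℝ≥0 := (Real.toNNReal (C₁ ^ (p - 1)) + Real.toNNReal (C₁ ^ (p - 1) / (p - 1))) *
    Real.toNNReal C₂ with hk'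
  refine ⟨k + Kr * A + k', ?_⟩
  intro T R hT hT1 hTR a σ Θ ξ Cct cd cc n u₀ u hNL hno hΘ _ _ hu
  have hξp : SPM.SpacePeriodic ξ := fun j z => by
    rw [show z + (0, SPM.latticeVec j) = (z.1, z.2 + SPM.latticeVec j) from
      Prod.ext (add_zero z.1) rfl]
    exact hno.periodic z.1 j z.2
  have hN1 : 1 < N := by linarith
  have hcoh := hA L T R a σ Θ ξ Cct cd cc n u₀ u hT hT1 hNL hΘ hno.smooth hξp hno.cd_regular
    hno.cc_regular hno.model hu
  obtain ⟨-, hw2, hw3, hw4⟩ := hw a σ hNL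
  obtain ⟨B, hB⟩ := SPM.germ_regular (cd := cd) (cc := cc) hp hno.smooth hξp
    hNL.a_contDiff.continuous hNL.pos hNL.sigma_contDiff.continuous (hu.continuous_extend hT.le)
    (hu.extend_periodic hT.le) (hu.continuous_truncatedNu hT.le hNL hΘ hno.smooth hξp)
    (hu.truncatedNu_periodic hT.le hξp) hw4.continuous hw2.continuous hw3.continuous
    hno.cd_regular hno.cc_regular
  have hrec := hKr T R hT hT1 hTR d _ _ B _ _ _ _ _ _ _ _ hB hcoh
  have hen := hu.energy_inequality hp hT hNL.a_contDiff hNL.pos hNL.sigma_contDiff hno.smooth hξp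
    hno.Cct_continuousOn (hNL.sigma_zero (by linarith)) (hNL.gPrime_mul_sigma_le hN1 hp hC₁)
  have hint := hu.enorm_integral_energy_le hT hT1 hC₁ hM hM2 hN hp hε hε' hNL hξp hno hΘ hB
  -- the norms in the conclusion
  have hmeas : MeasurableSet (Icc (0 : ℝ) T ×ˢ SPM.cube d) :=
    measurableSet_Icc.prod SPM.measurableSet_cube
  have hp0 : ENNReal.ofReal p ≠ 0 := by simpa using by linarith
  have hpn : eLpNorm u₀ (ENNReal.ofReal p) (volume.restrict (SPM.cube d)) ^ p =
      ∫⁻ x in SPM.cube d, ‖u₀ x‖ₑ ^ p := by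
    rw [eLpNorm_eq_lintegral_rpow_enorm_toReal hp0 ENNReal.ofReal_ne_top,
      ENNReal.toReal_ofReal (by linarith), ← ENNReal.rpow_mul, one_div,
      inv_mul_cancel₀ (by linarith), ENNReal.rpow_one]
  have hn1 : eLpNorm (fun x => deriv Θ (u x) • SPM.nu a σ ξ u x) 1 (SPM.torusMeasure d T) =
      ∫⁻ x in Icc 0 T ×ˢ SPM.cube d, ‖SPM.truncatedNu T a σ Θ ξ u x‖ₑ := by
    rw [eLpNorm_one_eq_lintegral_enorm, SPM.torusMeasure]
    refine setLIntegral_congr_fun hmeas fun x hx => ?_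
    simp only [hu.truncatedNu_eq hNL.pos hno.smooth hξp hx.1]
  have hn2 : eLpNorm (fun x => deriv Θ (u x) • SPM.nu a σ ξ u x) 2 (SPM.torusMeasure d T) =
      (∫⁻ x in Icc 0 T ×ˢ SPM.cube d, ‖SPM.truncatedNu T a σ Θ ξ u x‖ₑ ^ (2 : ℝ)) ^
        (1 / 2 : ℝ) := by
    rw [eLpNorm_eq_lintegral_rpow_enorm_toReal (by norm_num) (by norm_num), SPM.torusMeasure,
      ENNReal.toReal_ofNat]
    congr 1
    refine setLIntegral_congr_fun hmeas fun x hx => ?_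
    simp only [hu.truncatedNu_eq hNL.pos hno.smooth hξp hx.1]
  rw [← hn1, ← hn2] at hrec
  rw [hpn]
  set P := ∫⁻ x in SPM.cube d, ‖u₀ x‖ₑ ^ p
  set E := SPM.energyConstant T R α β p a σ Θ ξ u n with hE
  have hrec' : ‖∫ z in Icc 0 T ×ˢ SPM.cube d, SPM.germ p a σ ξ cd cc (SPM.extend T u)
      (SPM.truncatedNu T a σ Θ ξ u) z z‖ₑ ≤ Kr * (A * E) := by
    refine hrec.trans (mul_le_mul' le_rfl ?_)
    rw [hE, SPM.energyConstant, mul_add (A : ℝ≥0∞), mul_add (A : ℝ≥0∞)]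
    refine add_le_add (add_le_add ?_ ?_) ?_
    · rw [ENNReal.coe_mul, mul_assoc]
      rfl
    · rw [ENNReal.coe_mul, ENNReal.coe_add, mul_assoc]
      refine mul_le_mul' le_rfl (mul_le_mul' ?_ le_rfl)
      exact add_le_add (le_self_add) le_rfl
    · rw [ENNReal.coe_mul, ENNReal.coe_add, mul_assoc]
      rfl
  -- the counterterms and the initial datum are absorbed by the summands `1` and `P`
  calc _ ≤ k * (P + 1) + (Kr * (A * E) + k') :=
        hen.trans (add_le_add le_rfl (hint.trans (add_le_add hrec' (le_of_eq (by
          rw [hk']; push_cast; rfl)))))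
    _ ≤ k * (P + E + 1) + (Kr * A * (P + E + 1) + k' * (P + E + 1)) := by
        refine add_le_add (mul_le_mul' le_rfl (add_le_add le_self_add le_rfl))
          (add_le_add ?_ ?_)
        · rw [← mul_assoc]
          exact mul_le_mul' le_rfl (le_add_self.trans le_self_add)
        · exact le_mul_of_one_le_right' le_add_self
    _ = _ := by push_cast; ring
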